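/- **Proposition (Stability of the mean-field process).** Let $A\in\mathbb R^{d\times d}$, $H\in\mathbb R^{m\times d}$, $\sigma_B\in\mathbb R^{d\times d_B}$ with $(A,H)$ detectable, $(A,\sigma_B)$ stabilizable and $\Sigma_B:=\sigma_B\sigma_B^\top\succ0$, and let $m_0\in\mathbb R^d$, $\Sigma_0\succeq0$. Let $\|\cdot\|_2$ be the spectral norm, and let $$\mathrm{Ricc}(Q)=AQ+QA^\top+\Sigma_B-QH^\top HQ .$$ Consider $dX_t=AX_t\,dt+\sigma_B\,dB_t$, $dZ_t=HX_t\,dt+dW_t$, $Z_0=0$, where $X_0\sim\mathcal N(m_0,\Sigma_0)$ and the standard Wiener processes $B,W$ are mutually independent, and $\mathcal Z_t=\sigma(Z_s;\,s\in[0,t])$. For a probability measure $\pi$ on $\mathbb R^d$ with finite second moment, a mean-field process with initial law $\pi$ is a square-integrable continuous solution $Y$ of the McKean–Vlasov equation $$dY_t=AY_t\,dt+\sigma_B\,d\bar B_t+\bar\Sigma_tH^\top\Big(dZ_t-\tfrac{HY_t+H\bar m_t}{2}\,dt\Big),\qquad \bar m_t=\mathsf E[Y_t|\mathcal Z_t],\quad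 \bar\Sigma_t=\mathrm{var}(Y_t|\mathcal Z_t)$$ ($\bar m,\bar\Sigma$ taken with continuous paths), where $Y_0\sim\pi$, $\bar B$ is a standard Wiener process, and $Y_0$, $\bar B$, $(X_0,B,W)$ are independent. The algebraic Riccati equation $\mathrm{Ricc}(\Sigma)=0$ has a unique positive definite solution $\Sigma_\infty$. Put $\mathrm{cond}(\Sigma_\infty)=\lambda_{\max}(\Sigma_\infty)/\lambda_{\min}(\Sigma_\infty)$, $$\beta=\frac{\lambda_{\min}(\Sigma_B)}{2\lambda_{\max}(\Sigma_\infty)},\qquad \alpha=e^{\frac{\sqrt{\mathrm{cond}(\Sigma_\infty)}\,M_1\|H^\top H\|_2}{2\beta}}\sqrt{\mathrm{cond}(\Sigma_\infty)} .$$ Let $\pi_0=\mathcal N(m_0,\Sigma_0)$, let $\tilde\pi_0$ be a probability measure with finite second moment, mean $\tilde m_0$ and covariance $\tilde\Sigma_0$, and let $(m_t,\Sigma_t)$, $(\tilde m_t,\tilde\Sigma_t)$ solve the Kalman–Bucy equations $dm_t=Am_t\,dt+\Sigma_tH^\top(dZ_t-Hm_t\,dt)$, $\frac{d}{dt}\Sigma_t=\mathrm{Ricc}(\Sigma_t)$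 from $(m_0,\Sigma_0)$ and $(\tilde m_0,\tilde\Sigma_0)$ respectively. Call $M_1,M_2>0$ *stability constants with rate $\lambda$* if for all $t\ge0$ $$\|\Sigma_t-\Sigma_\infty\|_2\le M_1e^{-2\lambda t},\qquad \|\tilde\Sigma_t-\Sigma_\infty\|_2\le M_1e^{-2\lambda t},\qquad \mathsf E\big[|\tilde m_t-m_t|^2\big]\le M_2e^{-2\lambda t}.$$ 1. Stability constants with rate $\beta$ exist, and they can be chosen depending only on $A,H,\sigma_B$ and on $m_0,\Sigma_0,\tilde m_0,\tilde\Sigma_0$. 2. Let $M_1,M_2$ be any stability constants with some rate $\lambda\ge\beta$. Let $\bar X$, $\tilde X$ be mean-field processes with initial laws $\pi_0$ and $\tilde\pi_0$, and let $\bar\pi_t,\tilde\pi_t$ be the conditional laws of $\bar X_t,\tilde X_t$ given $\mathcal Z_t$. Then for all $t>0$ $$\Big(\mathsf E\big[W_2(\bar\pi_t,\tilde\pi_t)^2\big]\Big)^{1/2}\le e^{-\beta t}\Big(\alpha\,W_2(\pi_0,\tilde\pi_0)+\sqrt{M_2}+\alpha M_1\|H^\top H\|_2\int_0^t\sqrt{\mathrm{tr}(\Sigma_s)}\,ds\Big),$$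 where $W_2$ is the $L^2$-Wasserstein distance. In particular, enlarging $M_2$ so that $M_2\ge1$, the bound holds with $M_2$ in place of $\sqrt{M_2}$. -/

import Mathlib

open MeasureTheory ProbabilityTheory Filter
open scoped NNReal ENNReal Matrix Topology Matrix.Norms.L2Operator

namespace LinearFPF

noncomputable section

/-! ### Linear systems and Riccati equations -/

/-- All complex eigenvalues of the real matrix `M` have strictly negative real part. -/
def IsHurwitz {d : ℕ} (M : Matrix (Fin d) (Fin d) ℝ) : Prop :=
  ∀ z ∈ spectrum ℂ (M.map (algebraMap ℝ ℂ)), z.re < 0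

/-- The pair `(A, H)` is detectable. -/
def IsDetectable {d m : ℕ} (A : Matrix (Fin d) (Fin d) ℝ) (H : Matrix (Fin m) (Fin d) ℝ) : Prop :=
  ∃ L : Matrix (Fin d) (Fin m) ℝ, IsHurwitz (A - L * H)

/-- The pair `(A, σB)` is stabilizable. -/
def IsStabilizable {d b : ℕ} (A : Matrix (Fin d) (Fin d) ℝ) (σB : Matrix (Fin d) (Fin b) ℝ) :
    Prop :=
  ∃ K : Matrix (Fin b) (Fin d) ℝ, IsHurwitz (A - σB * K)

/-- `Ricc(Q) = A Q + Q Aᵀ + σB σBᵀ - Q Hᵀ H Q`. -/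
def ricc {d m b : ℕ} (A : Matrix (Fin d) (Fin d) ℝ) (H : Matrix (Fin m) (Fin d) ℝ)
    (σB : Matrix (Fin d) (Fin b) ℝ) (Q : Matrix (Fin d) (Fin d) ℝ) : Matrix (Fin d) (Fin d) ℝ :=
  A * Q + Q * Aᵀ + σB * σBᵀ - Q * Hᵀ * H * Q

/-- `Q` is a positive definite solution of the algebraic Riccati equation `Ricc(Q) = 0`. -/
def IsARESolution {d m b : ℕ} (A : Matrix (Fin d) (Fin d) ℝ) (H : Matrix (Fin m) (Fin d) ℝ)
    (σB : Matrix (Fin d) (Fin b) ℝ) (Q : Matrix (Fin d) (Fin d) ℝ) : Prop :=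
  Q.PosDef ∧ ricc A H σB Q = 0

/-- `S` solves `dS/dt = Ricc(S)` on `[0, ∞)` with `S 0 = S₀`. -/
def IsDRESolution {d m b : ℕ} (A : Matrix (Fin d) (Fin d) ℝ) (H : Matrix (Fin m) (Fin d) ℝ)
    (σB : Matrix (Fin d) (Fin b) ℝ) (S₀ : Matrix (Fin d) (Fin d) ℝ)
    (S : ℝ → Matrix (Fin d) (Fin d) ℝ) : Prop :=
  S 0 = S₀ ∧ ∀ t : ℝ, 0 ≤ t → HasDerivWithinAt S (ricc A H σB (S t)) (Set.Ici 0) t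

/-- Largest eigenvalue of a symmetric matrix. -/
def lamMax {d : ℕ} (M : Matrix (Fin d) (Fin d) ℝ) : ℝ := sSup (spectrum ℝ M)

/-- Smallest eigenvalue of a symmetric matrix. -/
def lamMin {d : ℕ} (M : Matrix (Fin d) (Fin d) ℝ) : ℝ := sInf (spectrum ℝ M)

/-- Condition number of a positive definite matrix. -/
def condNum {d : ℕ} (M : Matrix (Fin d) (Fin d) ℝ) : ℝ := lamMax M / lamMin M

/-- `β = λ_min(σB σBᵀ) / (2 λ_max(Σ∞))`. -/
def rateβ {d b : ℕ} (σB : Matrix (Fin d) (Fin b) ℝ) (Sinf : Matrix (Fin d) (Fin d) ℝ) : ℝ :=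
  lamMin (σB * σBᵀ) / (2 * lamMax Sinf)

/-- `α = exp(√cond(Σ∞) M₁ ‖Hᵀ H‖₂ / (2β)) √cond(Σ∞)`. -/
def constα {d m b : ℕ} (H : Matrix (Fin m) (Fin d) ℝ) (σB : Matrix (Fin d) (Fin b) ℝ)
    (Sinf : Matrix (Fin d) (Fin d) ℝ) (M₁ : ℝ) : ℝ :=
  Real.exp (√(condNum Sinf) * M₁ * ‖Hᵀ * H‖ / (2 * rateβ σB Sinf)) * √(condNum Sinf)

/-! ### Probability measures on `ℝᵈ` -/

/-- Covariance matrix of a law on `ℝᵈ`. -/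
def covMat {d : ℕ} (ν : Measure (EuclideanSpace ℝ (Fin d))) : Matrix (Fin d) (Fin d) ℝ :=
  Matrix.of fun i j => cov[fun x : EuclideanSpace ℝ (Fin d) => x i, fun x => x j; ν]

/-- The `L²`-Wasserstein distance: infimum over all couplings of the root mean square distance. -/
def W2 {E : Type*} [MeasurableSpace E] [EDist E] (μ ν : Measure E) : ℝ≥0∞ :=
  (⨅ (γ : Measure (E × E)) (_ : γ.map Prod.fst = μ) (_ : γ.map Prod.snd = ν),
    ∫⁻ p, edist p.1 p.2 ^ 2 ∂γ) ^ (1 / 2 : ℝ)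

/-! ### Processes -/

/-- A standard Wiener process in `ℝᵏ`: the coordinates are independent real Brownian motions. -/
structure IsWiener {Ω : Type*} [MeasurableSpace Ω] {k : ℕ} (P : Measure Ω)
    (B : ℝ≥0 → Ω → EuclideanSpace ℝ (Fin k)) : Prop where
  measurable : ∀ t, Measurable (B t)
  brownian : ∀ i, IsBrownianReal (fun t ω => B t ω i) P
  indep : iIndepFun (fun i ω (t : ℝ≥0) => B t ω i) P

/-- `I t = ∫₀ᵗ K dZ` is the Itô integral of a matrix-valued adapted integrand `K` with continuous
paths against the continuous semimartingale `Z`: the continuous process whose value at each `t` is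
the limit in probability of the left-point Riemann sums over the uniform partitions of `[0, t]`. -/
def IsItoIntegral {Ω : Type*} [MeasurableSpace Ω] {p q : ℕ} (P : Measure Ω)
    (K : ℝ≥0 → Ω → Matrix (Fin p) (Fin q) ℝ) (Z : ℝ≥0 → Ω → EuclideanSpace ℝ (Fin q))
    (I : ℝ≥0 → Ω → EuclideanSpace ℝ (Fin p)) : Prop :=
  (∀ᵐ ω ∂P, Continuous fun t => I t ω) ∧
  ∀ t : ℝ≥0, TendstoInMeasure P
    (fun (n : ℕ) ω => ∑ k ∈ Finset.range n,
      (K ((k : ℝ≥0) / n * t) ω).toEuclideanLin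
        (Z (((k : ℝ≥0) + 1) / n * t) ω - Z ((k : ℝ≥0) / n * t) ω))
    atTop (I t)

/-- The path of `Z` on `[0, t]`. -/
def pathUpTo {Ω F : Type*} (Z : ℝ≥0 → Ω → F) (t : ℝ≥0) (ω : Ω) : Set.Iic t → F :=
  fun s => Z s ω

/-- `𝒵_t = σ(Z_s ; s ∈ [0, t])`. -/
abbrev obsSigma {Ω F : Type*} [MeasurableSpace F] (Z : ℝ≥0 → Ω → F) (t : ℝ≥0) : MeasurableSpace Ω :=
  MeasurableSpace.comap (pathUpTo Z t) MeasurableSpace.pi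

/-- The (regular) conditional law of `Y` given `𝒵_t`, as a random measure. -/
def condLaw {Ω : Type*} [MeasurableSpace Ω] {d m : ℕ} (P : Measure Ω) [IsFiniteMeasure P]
    (Z : ℝ≥0 → Ω → EuclideanSpace ℝ (Fin m)) (t : ℝ≥0) (Y : Ω → EuclideanSpace ℝ (Fin d)) (ω : Ω) :
    Measure (EuclideanSpace ℝ (Fin d)) :=
  condDistrib Y (pathUpTo Z t) P (pathUpTo Z t ω)

/-- The signal-observation pair `dX = A X dt + σB dB`, `dZ = H X dt + dW`, `Z₀ = 0`, with
`X₀ ∼ N(m₀, S₀)` and `X₀`, `B`, `W` mutually independent. -/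
structure IsFilteringModel {Ω : Type*} [MeasurableSpace Ω] {d m b : ℕ}
    (A : Matrix (Fin d) (Fin d) ℝ) (H : Matrix (Fin m) (Fin d) ℝ) (σB : Matrix (Fin d) (Fin b) ℝ)
    (m₀ : EuclideanSpace ℝ (Fin d)) (S₀ : Matrix (Fin d) (Fin d) ℝ) (P : Measure Ω)
    (X : ℝ≥0 → Ω → EuclideanSpace ℝ (Fin d)) (Z : ℝ≥0 → Ω → EuclideanSpace ℝ (Fin m))
    (B : ℝ≥0 → Ω → EuclideanSpace ℝ (Fin b)) (W : ℝ≥0 → Ω → EuclideanSpace ℝ (Fin m)) : Prop where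
  wiener_B : IsWiener P B
  wiener_W : IsWiener P W
  measurable_X : ∀ t, Measurable (X t)
  measurable_Z : ∀ t, Measurable (Z t)
  law_zero : HasLaw (X 0) (multivariateGaussian m₀ S₀) P
  indep_BW : IndepFun (fun ω (t : ℝ≥0) => B t ω) (fun ω (t : ℝ≥0) => W t ω) P
  indep_zero : IndepFun (X 0) (fun ω => ((fun t : ℝ≥0 => B t ω), (fun t : ℝ≥0 => W t ω))) P
  continuous_X : ∀ᵐ ω ∂P, Continuous fun t => X t ω
  sde_X : ∀ᵐ ω ∂P, ∀ t : ℝ≥0,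
    X t ω = X 0 ω + (∫ s in (0 : ℝ)..t, A.toEuclideanLin (X s.toNNReal ω)) +
      σB.toEuclideanLin (B t ω)
  sde_Z : ∀ᵐ ω ∂P, ∀ t : ℝ≥0,
    Z t ω = (∫ s in (0 : ℝ)..t, H.toEuclideanLin (X s.toNNReal ω)) + W t ω

/-- `(M, S)` solves the Kalman-Bucy filter equations
`dM = A M dt + S Hᵀ (dZ - H M dt)`, `dS/dt = Ricc(S)`, initialized at `(m₀, S₀)`. -/
structure IsKalmanFilter {Ω : Type*} [MeasurableSpace Ω] {d m b : ℕ}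
    (A : Matrix (Fin d) (Fin d) ℝ) (H : Matrix (Fin m) (Fin d) ℝ) (σB : Matrix (Fin d) (Fin b) ℝ)
    (m₀ : EuclideanSpace ℝ (Fin d)) (S₀ : Matrix (Fin d) (Fin d) ℝ) (P : Measure Ω)
    (Z : ℝ≥0 → Ω → EuclideanSpace ℝ (Fin m))
    (M : ℝ≥0 → Ω → EuclideanSpace ℝ (Fin d)) (S : ℝ → Matrix (Fin d) (Fin d) ℝ) : Prop where
  dre : IsDRESolution A H σB S₀ S
  aemeasurable : ∀ t, AEMeasurable (M t) P
  continuous : ∀ᵐ ω ∂P, Continuous fun t => M t ω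
  sde : ∃ I : ℝ≥0 → Ω → EuclideanSpace ℝ (Fin d),
    IsItoIntegral P (fun t _ => S t * Hᵀ) Z I ∧
    ∀ᵐ ω ∂P, ∀ t : ℝ≥0,
      M t ω = m₀ + (∫ s in (0 : ℝ)..t, A.toEuclideanLin (M s.toNNReal ω)) + I t ω -
        ∫ s in (0 : ℝ)..t, (S s * Hᵀ).toEuclideanLin (H.toEuclideanLin (M s.toNNReal ω))

/-- The noise `Bbar` and the initial value `Y₀` of a mean-field process: `Bbar` is an independent
copy of the process noise, and `Y₀`, `Bbar`, `(X₀, B, W)` are mutually independent. -/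
structure IsIndependentCopy {Ω : Type*} [MeasurableSpace Ω] {d m b : ℕ} (P : Measure Ω)
    (X₀ : Ω → EuclideanSpace ℝ (Fin d)) (B : ℝ≥0 → Ω → EuclideanSpace ℝ (Fin b))
    (W : ℝ≥0 → Ω → EuclideanSpace ℝ (Fin m))
    (Y₀ : Ω → EuclideanSpace ℝ (Fin d)) (Bbar : ℝ≥0 → Ω → EuclideanSpace ℝ (Fin b)) : Prop where
  wiener : IsWiener P Bbar
  indep_zero : IndepFun Y₀ (fun ω (t : ℝ≥0) => Bbar t ω) P
  indep_signal : IndepFun (fun ω => (Y₀ ω, (fun t : ℝ≥0 => Bbar t ω)))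
    (fun ω => (X₀ ω, (fun t : ℝ≥0 => B t ω), (fun t : ℝ≥0 => W t ω))) P

/-- `Y` solves the McKean-Vlasov equation
`dY = A Y dt + σB dBbar + Sbar Hᵀ (dZ - (H Y + H mbar) / 2 dt)` with `Y₀ ∼ π₀`, where
`mbar t = E[Y t | 𝒵_t]` and `Sbar t = var(Y t | 𝒵_t)` (taken with continuous paths). -/
structure IsMeanFieldSolution {Ω : Type*} [MeasurableSpace Ω] {d m b : ℕ}
    (A : Matrix (Fin d) (Fin d) ℝ) (H : Matrix (Fin m) (Fin d) ℝ) (σB : Matrix (Fin d) (Fin b) ℝ)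
    (π₀ : Measure (EuclideanSpace ℝ (Fin d))) (P : Measure Ω)
    (Z : ℝ≥0 → Ω → EuclideanSpace ℝ (Fin m)) (Bbar : ℝ≥0 → Ω → EuclideanSpace ℝ (Fin b))
    (Y : ℝ≥0 → Ω → EuclideanSpace ℝ (Fin d)) : Prop where
  measurable : ∀ t, Measurable (Y t)
  memLp : ∀ t, MemLp (Y t) 2 P
  continuous : ∀ᵐ ω ∂P, Continuous fun t => Y t ω
  law_zero : HasLaw (Y 0) π₀ P
  sde : ∃ (mbar : ℝ≥0 → Ω → EuclideanSpace ℝ (Fin d)) (Sbar : ℝ≥0 → Ω → Matrix (Fin d) (Fin d) ℝ)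
      (I : ℝ≥0 → Ω → EuclideanSpace ℝ (Fin d)),
    (∀ᵐ ω ∂P, Continuous fun t => mbar t ω) ∧
    (∀ᵐ ω ∂P, Continuous fun t => Sbar t ω) ∧
    (∀ t, mbar t =ᵐ[P] P[Y t | obsSigma Z t]) ∧
    (∀ t i j, (fun ω => Sbar t ω i j) =ᵐ[P]
      P[fun ω => (Y t ω i - mbar t ω i) * (Y t ω j - mbar t ω j) | obsSigma Z t]) ∧
    IsItoIntegral P (fun t ω => Sbar t ω * Hᵀ) Z I ∧
    ∀ᵐ ω ∂P, ∀ t : ℝ≥0,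
      Y t ω = Y 0 ω + (∫ s in (0 : ℝ)..t, A.toEuclideanLin (Y s.toNNReal ω)) +
        σB.toEuclideanLin (Bbar t ω) + I t ω -
        ∫ s in (0 : ℝ)..t, (Sbar s.toNNReal ω * Hᵀ).toEuclideanLin
          ((1 / 2 : ℝ) • (H.toEuclideanLin (Y s.toNNReal ω) + H.toEuclideanLin (mbar s.toNNReal ω)))

/-- `M₁, M₂ > 0` are constants of exponential stability, with rate `lam`, for the two Kalman filters
`(M, S)` and `(M', S')`. -/
structure IsKalmanConst {Ω : Type*} [MeasurableSpace Ω] {d : ℕ} (P : Measure Ω)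
    (Sinf : Matrix (Fin d) (Fin d) ℝ)
    (M : ℝ≥0 → Ω → EuclideanSpace ℝ (Fin d)) (S : ℝ → Matrix (Fin d) (Fin d) ℝ)
    (M' : ℝ≥0 → Ω → EuclideanSpace ℝ (Fin d)) (S' : ℝ → Matrix (Fin d) (Fin d) ℝ)
    (lam M₁ M₂ : ℝ) : Prop where
  pos₁ : 0 < M₁
  pos₂ : 0 < M₂
  cov : ∀ t : ℝ, 0 ≤ t → ‖S t - Sinf‖ ≤ M₁ * Real.exp (-2 * lam * t)
  cov' : ∀ t : ℝ, 0 ≤ t → ‖S' t - Sinf‖ ≤ M₁ * Real.exp (-2 * lam * t)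
  mean : ∀ t : ℝ≥0,
    ∫⁻ ω, ‖M' t ω - M t ω‖ₑ ^ 2 ∂P ≤ ENNReal.ofReal (M₂ * Real.exp (-2 * lam * t))

end

end LinearFPF

/-! Given the observations, the McKean–Vlasov equation is linear in `Y`: its drift `A - S̄ Hᵀ H / 2`
and its forcing are observable, and what remains is the noise `(Y₀, B̄)`, independent of the
observations. Freezing the observable part shows that the conditional mean solves the equation
without noise and that the conditional covariance solves `q' = a q + q aᵀ + σB σBᵀ` with `a = A - q
Hᵀ H / 2`, which is the Riccati equation. By uniqueness the covariance is deterministic; then the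
mean is the Kalman–Bucy mean, and `Y_t = m_t + U_t` with `U` a linear functional of the centred
initial value and of `B̄` (`IsMeanFieldSolution.ae_eq`). So the conditional law is the law of `U_t`
translated by `m_t` (`condLaw_ae_eq_map`).

For the estimate, two fluctuations are driven by a common noise path and by coupled initial values.
The limiting drift satisfies `a Σ∞ + Σ∞ aᵀ = -σB σBᵀ`, so it contracts at rate `β` in the norm given
by `Σ∞⁻¹` (`exists_lyapunov_coordinates`), and changing norms costs `√cond(Σ∞)`. The time-dependent
part of the drift decays exponentially, so it costs a constant factor and no rate
(`norm_le_of_dissipative`); the difference of the two drifts acts on `U`, whose `L²` norm is `√tr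
Σ_s`. An infimum over couplings produces `W₂(π₀, π̃₀)`, and the difference of the means produces
`√M₂`.

The constants come from the Riccati flow. The function `riccDist` decays at rate `2β`, then at rate
`4β` by bootstrapping; being quadratic in the distance, it gives `‖Σ_t - Σ∞‖ = O(exp(-2βt))`
(`exists_dre_decay`). Two filters then differ by a contracting equation forced by their gain
difference (`exists_filter_diff_bound`). The matrix `Σ∞` is a trace-minimal supersolution of the
algebraic equation, on which a Newton step cannot improve (`exists_isARESolution`).

Little stochastic calculus is needed: the gains turn out to be deterministic and differentiable, so
Itô integrals are integrals by parts along each path, and second moments follow from Fubini's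
theorem. -/

namespace LinearFPF

noncomputable section

/-! ### Linear Volterra equations -/

section Volterra

variable {F : Type*} [NormedAddCommGroup F] [NormedSpace ℝ F]

/-- Terms of the Picard series of `u t = n t + ∫₀ᵗ a u`. -/
def picTerm (a : ℝ → F →L[ℝ] F) (n : ℝ → F) : ℕ → ℝ → F
  | 0 => n
  | k + 1 => fun t => ∫ s in (0 : ℝ)..t, a s (picTerm a n k s)

/-- The solution of `u t = n t + ∫₀ᵗ a u` for `0 ≤ t`, extended as a constant to negative times. -/
def linSol (a : ℝ → F →L[ℝ] F) (n : ℝ → F) (t : ℝ) : F := ∑' k, picTerm a n k (max t 0)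

lemma continuous_picTerm {a : ℝ → F →L[ℝ] F} {n : ℝ → F} (ha : Continuous a) (hn : Continuous n)
    (k : ℕ) : Continuous (picTerm a n k) := by
  induction k with
  | zero => exact hn
  | succ k ih =>
    exact intervalIntegral.continuous_primitive
      (fun _ _ => (ha.clm_apply ih).intervalIntegrable _ _) 0

/-- Each integration turns `s ^ k / k!` into `t ^ (k + 1) / (k + 1)!`, so the series converges like
an exponential series on every bounded interval, with no smallness condition on `T`. -/
lemma norm_picTerm_le {a : ℝ → F →L[ℝ] F} {n : ℝ → F}
    {T K C : ℝ} (hK : ∀ s ∈ Set.Icc 0 T, ‖a s‖ ≤ K) (hC : ∀ s ∈ Set.Icc 0 T, ‖n s‖ ≤ C) (k : ℕ) :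
    ∀ t ∈ Set.Icc 0 T, ‖picTerm a n k t‖ ≤ C * ((K * t) ^ k / k.factorial) := by
  induction k with
  | zero => intro t ht; simpa [picTerm] using hC t ht
  | succ k ih =>
    intro t ht
    have hK0 : 0 ≤ K := (norm_nonneg _).trans (hK t ht)
    have hb : ∀ s ∈ Set.Ioc 0 t, ‖a s (picTerm a n k s)‖ ≤
        K * (C * ((K * s) ^ k / k.factorial)) := by
      intro s hs
      have hs' : s ∈ Set.Icc 0 T := ⟨hs.1.le, hs.2.trans ht.2⟩
      exact ((a s).le_opNorm _).trans
        (mul_le_mul (hK s hs') (ih s hs') (norm_nonneg _) hK0)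
    have := intervalIntegral.norm_integral_le_of_norm_le (μ := volume) ht.1
      (ae_of_all _ hb) (Continuous.intervalIntegrable (by fun_prop) _ _)
    refine this.trans (le_of_eq ?_)
    have h1 : ∀ s : ℝ, K * (C * ((K * s) ^ k / k.factorial)) =
        (K ^ (k + 1) * C / k.factorial) * s ^ k := by intro s; rw [mul_pow]; ring
    simp_rw [h1]
    rw [intervalIntegral.integral_const_mul, integral_pow, Nat.factorial_succ]
    have : (k.factorial : ℝ) ≠ 0 := by positivity
    have : (k : ℝ) + 1 ≠ 0 := by positivity
    push_cast
    field_simp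
    ring

lemma exists_norm_le_Icc {V : Type*} [SeminormedAddCommGroup V] {f : ℝ → V} (hf : Continuous f)
    (T : ℝ) : ∃ C, 0 ≤ C ∧ ∀ s ∈ Set.Icc 0 T, ‖f s‖ ≤ C := by
  obtain ⟨C, hC⟩ := (isCompact_Icc (a := (0 : ℝ)) (b := T)).exists_bound_of_continuousOn
    hf.continuousOn
  exact ⟨max C 0, le_max_right _ _, fun s hs => (hC s hs).trans (le_max_left _ _)⟩

lemma summable_picBound (C x : ℝ) : Summable fun k : ℕ => C * (x ^ k / k.factorial) :=
  (Real.summable_pow_div_factorial x).mul_left C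

lemma norm_picTerm_le_const {a : ℝ → F →L[ℝ] F} {n : ℝ → F} (ha : Continuous a)
    (hn : Continuous n) (T : ℝ) : ∃ C x : ℝ, ∀ k, ∀ t ∈ Set.Icc 0 T,
      ‖picTerm a n k t‖ ≤ C * (x ^ k / k.factorial) := by
  obtain ⟨K, hK0, hK⟩ := exists_norm_le_Icc ha T
  obtain ⟨C, hC0, hC⟩ := exists_norm_le_Icc hn T
  refine ⟨C, K * T, fun k t ht => (norm_picTerm_le hK hC k t ht).trans ?_⟩
  have := mul_nonneg hK0 ht.1
  gcongr
  exact ht.2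

lemma summable_picTerm [CompleteSpace F] {a : ℝ → F →L[ℝ] F} {n : ℝ → F} (ha : Continuous a) (hn : Continuous n)
    {t : ℝ} (ht : 0 ≤ t) : Summable fun k => picTerm a n k t := by
  obtain ⟨C, x, h⟩ := norm_picTerm_le_const ha hn t
  exact Summable.of_norm_bounded (summable_picBound C x) fun k => h k t ⟨ht, le_rfl⟩

lemma continuous_linSol [CompleteSpace F] {a : ℝ → F →L[ℝ] F} {n : ℝ → F} (ha : Continuous a) (hn : Continuous n) :
    Continuous (linSol a n) := by
  have h : ContinuousOn (fun t => ∑' k, picTerm a n k t) (Set.Ici 0) := by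
    intro t ht
    obtain ⟨C, x, h⟩ := norm_picTerm_le_const ha hn (t + 1)
    have h1 : ContinuousOn (fun t => ∑' k, picTerm a n k t) (Set.Icc 0 (t + 1)) :=
      continuousOn_tsum (fun k => (continuous_picTerm ha hn k).continuousOn)
        (summable_picBound C x) (fun k s hs => h k s hs)
    -- The uniform bound holds on bounded intervals only; `[0, t + 1]` is a neighbourhood of `t`
    -- within `[0, ∞)`, which is enough.
    have h2 : Set.Icc 0 (t + 1) ∈ 𝓝[Set.Ici 0] t := by
      have : Set.Ici (0 : ℝ) ∩ Set.Iic (t + 1) ∈ 𝓝[Set.Ici 0] t :=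
        inter_mem_nhdsWithin _ (Iic_mem_nhds (by linarith))
      simpa [Set.Ici_inter_Iic] using this
    exact (h1 t ⟨ht, by linarith⟩).mono_of_mem_nhdsWithin h2
  exact h.comp_continuous (by fun_prop) (fun t => le_max_right t 0)

lemma linSol_eq [CompleteSpace F] {a : ℝ → F →L[ℝ] F} {n : ℝ → F} (ha : Continuous a) (hn : Continuous n)
    {t : ℝ} (ht : 0 ≤ t) : linSol a n t = n t + ∫ s in (0 : ℝ)..t, a s (linSol a n s) := by
  have h1 : linSol a n t = n t + ∑' k, picTerm a n (k + 1) t := by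
    simp only [linSol, max_eq_left ht]
    rw [(summable_picTerm ha hn ht).tsum_eq_zero_add]
    rfl
  rw [h1]
  congr 1
  obtain ⟨C, x, h⟩ := norm_picTerm_le_const ha hn t
  obtain ⟨K, hK0, hK⟩ := exists_norm_le_Icc ha t
  have h2 := intervalIntegral.hasSum_integral_of_dominated_convergence (μ := volume)
    (a := 0) (b := t) (F := fun k s => a s (picTerm a n k s))
    (f := fun s => a s (linSol a n s)) (fun k _ => K * (C * (x ^ k / k.factorial)))
    (fun k => (ha.clm_apply (continuous_picTerm ha hn k)).aestronglyMeasurable)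
    (fun k => ae_of_all _ fun s hs => by
      rw [Set.uIoc_of_le ht] at hs
      have hs' : s ∈ Set.Icc 0 t := ⟨hs.1.le, hs.2⟩
      exact ((a s).le_opNorm _).trans
        (mul_le_mul (hK s hs') (h k s hs') (norm_nonneg _) hK0))
    (ae_of_all _ fun s hs => (summable_picBound C x).mul_left K)
    (by simp)
    (ae_of_all _ fun s hs => by
      rw [Set.uIoc_of_le ht] at hs
      have : HasSum (fun k => picTerm a n k s) (linSol a n s) := by
        simp only [linSol, max_eq_left hs.1.le]
        exact (summable_picTerm ha hn hs.1.le).hasSum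
      exact this.mapL (a s))
  exact h2.tsum_eq

/-- The function `exp (-(K t)) ∫ u - ∫ v` is nonincreasing. The bound is on the integral of `u`
rather than on `u`, so `v` need not be monotone and `u` may have any sign. -/
lemma integral_gronwall {u v : ℝ → ℝ} (hu : Continuous u) (hv : Continuous v) {T K : ℝ}
    (hT : 0 ≤ T) (hK : 0 ≤ K) (hv0 : ∀ t ∈ Set.Icc 0 T, 0 ≤ v t)
    (h : ∀ t ∈ Set.Icc 0 T, u t ≤ v t + K * ∫ s in (0 : ℝ)..t, u s) :
    ∫ s in (0 : ℝ)..T, u s ≤ Real.exp (K * T) * ∫ s in (0 : ℝ)..T, v s := by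
  have hd : ∀ f : ℝ → ℝ, Continuous f → ∀ t, HasDerivAt (fun t => ∫ s in (0 : ℝ)..t, f s) (f t) t :=
    fun f hf t => intervalIntegral.integral_hasDerivAt_right (hf.intervalIntegrable _ _)
      (hf.stronglyMeasurableAtFilter _ _) hf.continuousAt
  have hφ : ∀ t, HasDerivAt (fun t => Real.exp (-(K * t)) * (∫ s in (0 : ℝ)..t, u s) -
      ∫ s in (0 : ℝ)..t, v s)
      (Real.exp (-(K * t)) * (-(K * 1)) * (∫ s in (0 : ℝ)..t, u s) +
        Real.exp (-(K * t)) * u t - v t) t := fun t =>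
    ((((hasDerivAt_id t).const_mul K).neg.exp).mul (hd u hu t)).sub (hd v hv t)
  have hanti : AntitoneOn (fun t => Real.exp (-(K * t)) * (∫ s in (0 : ℝ)..t, u s) -
      ∫ s in (0 : ℝ)..t, v s) (Set.Icc 0 T) := by
    refine antitoneOn_of_deriv_nonpos (convex_Icc _ _)
      (fun t _ => (hφ t).continuousAt.continuousWithinAt)
      (fun t _ => (hφ t).differentiableAt.differentiableWithinAt) fun t ht => ?_
    rw [interior_Icc] at ht
    have ht' : t ∈ Set.Icc 0 T := ⟨ht.1.le, ht.2.le⟩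
    rw [(hφ t).deriv]
    have h1 := h t ht'
    have h2 : Real.exp (-(K * t)) ≤ 1 :=
      Real.exp_le_one_iff.2 (by have := mul_nonneg hK ht.1.le; linarith)
    have h3 := Real.exp_pos (-(K * t))
    have h4 := hv0 t ht'
    nlinarith [mul_le_mul_of_nonneg_left h1 h3.le, mul_le_mul_of_nonneg_right h2 h4]
  have := hanti ⟨le_rfl, hT⟩ ⟨hT, le_rfl⟩ hT
  simp only [intervalIntegral.integral_same, mul_zero, sub_zero] at this
  have h5 : Real.exp (-(K * T)) * (∫ s in (0 : ℝ)..T, u s) ≤ ∫ s in (0 : ℝ)..T, v s := by linarith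
  have h6 := mul_le_mul_of_nonneg_left h5 (Real.exp_pos (K * T)).le
  rwa [← mul_assoc, ← Real.exp_add, add_neg_cancel, Real.exp_zero, one_mul] at h6

/-- The bound is linear in `n`: with `n = 0` it gives uniqueness, and taken in `L²` it shows that
solutions of a linear equation are square integrable when the forcing is. -/
lemma norm_le_of_volterra {a : ℝ → F →L[ℝ] F} {n u : ℝ → F}
    (hn : Continuous n) (hu : Continuous u) {T K : ℝ} (hK0 : 0 ≤ K)
    (hK : ∀ s ∈ Set.Icc 0 T, ‖a s‖ ≤ K)
    (h : ∀ t ∈ Set.Icc 0 T, u t = n t + ∫ s in (0 : ℝ)..t, a s (u s)) :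
    ∀ t ∈ Set.Icc 0 T, ‖u t‖ ≤ ‖n t‖ + K * (Real.exp (K * t) * ∫ s in (0 : ℝ)..t, ‖n s‖) := by
  have h1 : ∀ t ∈ Set.Icc 0 T, ‖u t‖ ≤ ‖n t‖ + K * ∫ s in (0 : ℝ)..t, ‖u s‖ := by
    intro t ht
    rw [h t ht]
    refine (norm_add_le _ _).trans (add_le_add le_rfl ?_)
    rw [← intervalIntegral.integral_const_mul]
    refine intervalIntegral.norm_integral_le_of_norm_le ht.1 (ae_of_all _ fun s hs => ?_)
      ((hu.norm.const_mul K).intervalIntegrable _ _)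
    exact ((a s).le_opNorm _).trans
      (mul_le_mul_of_nonneg_right (hK s ⟨hs.1.le, hs.2.trans ht.2⟩) (norm_nonneg _))
  intro t ht
  refine (h1 t ht).trans ?_
  gcongr
  exact integral_gronwall hu.norm hn.norm ht.1 hK0 (fun _ _ => norm_nonneg _)
    fun s hs => h1 s ⟨hs.1, hs.2.trans ht.2⟩

lemma volterra_unique {a : ℝ → F →L[ℝ] F} {n u v : ℝ → F} (ha : Continuous a)
    (hu : Continuous u) (hv : Continuous v) {T : ℝ}
    (h : ∀ t ∈ Set.Icc 0 T, u t = n t + ∫ s in (0 : ℝ)..t, a s (u s))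
    (h' : ∀ t ∈ Set.Icc 0 T, v t = n t + ∫ s in (0 : ℝ)..t, a s (v s)) :
    ∀ t ∈ Set.Icc 0 T, u t = v t := by
  intro t ht
  obtain ⟨K, hK0, hK⟩ := exists_norm_le_Icc ha T
  have := norm_le_of_volterra (n := fun _ => (0 : F)) continuous_const (hu.sub hv) hK0 hK
    (fun s hs => by
      simp only [Pi.sub_apply]
      rw [h s hs, h' s hs, zero_add, add_sub_add_left_eq_sub, ← intervalIntegral.integral_sub
        ((ha.clm_apply hu).intervalIntegrable _ _) ((ha.clm_apply hv).intervalIntegrable _ _)]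
      simp only [map_sub]) t ht
  simpa [sub_eq_zero] using this

/-- Agreement of the coefficients on `[0, T]` suffices. Processes defined for nonnegative times only
can thus be identified with `linSol`, and `linSol` at time `T` depends on the data up to `T` only.
-/
lemma eq_linSol [CompleteSpace F] {a b : ℝ → F →L[ℝ] F} {n n' u : ℝ → F} (ha : Continuous a)
    (hn : Continuous n) (hu : Continuous u) {T : ℝ} (hab : ∀ t ∈ Set.Icc 0 T, b t = a t)
    (hnn : ∀ t ∈ Set.Icc 0 T, n' t = n t)
    (h : ∀ t ∈ Set.Icc 0 T, u t = n' t + ∫ s in (0 : ℝ)..t, b s (u s)) :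
    ∀ t ∈ Set.Icc 0 T, u t = linSol a n t := by
  refine volterra_unique ha hu (continuous_linSol ha hn) (fun t ht => ?_)
    (fun t ht => linSol_eq ha hn ht.1)
  rw [h t ht, hnn t ht]
  congr 1
  refine intervalIntegral.integral_congr fun s hs => ?_
  rw [Set.uIcc_of_le ht.1] at hs
  simp only [hab s ⟨hs.1, hs.2.trans ht.2⟩]

lemma linSol_congr [CompleteSpace F] {a b : ℝ → F →L[ℝ] F} {n n' : ℝ → F} (ha : Continuous a) (hb : Continuous b)
    (hn : Continuous n) (hn' : Continuous n') {T : ℝ} (hab : ∀ t ∈ Set.Icc 0 T, b t = a t)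
    (hnn : ∀ t ∈ Set.Icc 0 T, n' t = n t) :
    ∀ t ∈ Set.Icc 0 T, linSol b n' t = linSol a n t :=
  eq_linSol ha hn (continuous_linSol hb hn') hab hnn fun _ ht => linSol_eq hb hn' ht.1

lemma linSol_sub [CompleteSpace F] {a : ℝ → F →L[ℝ] F} {n n' : ℝ → F} (ha : Continuous a)
    (hn : Continuous n) (hn' : Continuous n') {t : ℝ} (ht : 0 ≤ t) :
    linSol a n t - linSol a n' t = linSol a (fun s => n s - n' s) t := by
  refine eq_linSol (u := fun t => linSol a n t - linSol a n' t) (n' := fun s => n s - n' s) ha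
    (hn.sub hn') ((continuous_linSol ha hn).sub (continuous_linSol ha hn')) (fun _ _ => rfl)
    (fun _ _ => rfl) (fun s hs => ?_) t ⟨ht, le_rfl⟩
  simp only [map_sub]
  rw [intervalIntegral.integral_sub ((ha.clm_apply (continuous_linSol ha hn)).intervalIntegrable _ _)
    ((ha.clm_apply (continuous_linSol ha hn')).intervalIntegrable _ _), linSol_eq ha hn hs.1,
    linSol_eq ha hn' hs.1]
  abel

/-- The explicit Picard series pays off here: its terms are iterated integrals, hence measurable in
the parameter, and so is the limit of the partial sums. -/
lemma stronglyMeasurable_linSol [CompleteSpace F] {α : Type*} [MeasurableSpace α] {a : α → ℝ → F →L[ℝ] F}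
    {n : α → ℝ → F} (ha : ∀ x, Continuous (a x)) (hn : ∀ x, Continuous (n x))
    (ham : ∀ t, StronglyMeasurable fun x => a x t) (hnm : ∀ t, StronglyMeasurable fun x => n x t)
    (t : ℝ) : StronglyMeasurable fun x => linSol (a x) (n x) t := by
  have h1 : ∀ k t, StronglyMeasurable fun x => picTerm (a x) (n x) k t := by
    intro k
    induction k with
    | zero => exact hnm
    | succ k ih =>
      intro t
      have h2 : StronglyMeasurable (Function.uncurry fun s x => a x s (picTerm (a x) (n x) k s)) :=
        stronglyMeasurable_uncurry_of_continuous_of_stronglyMeasurable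
          (fun x => (ha x).clm_apply (continuous_picTerm (ha x) (hn x) k)) (fun s =>
            (isBoundedBilinearMap_apply (𝕜 := ℝ) (E := F) (F := F)).continuous.comp_stronglyMeasurable
              ((ham s).prodMk (ih s)))
      have h3 : StronglyMeasurable (fun p : α × ℝ =>
          a p.1 p.2 (picTerm (a p.1) (n p.1) k p.2)) := h2.comp_measurable measurable_swap
      simp only [picTerm, intervalIntegral]
      exact (h3.integral_prod_right' (ν := volume.restrict (Set.Ioc 0 t))).sub
        (h3.integral_prod_right' (ν := volume.restrict (Set.Ioc t 0)))
  refine stronglyMeasurable_of_tendsto atTop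
    (f := fun (N : ℕ) x => ∑ k ∈ Finset.range N, picTerm (a x) (n x) k (max t 0))
    (fun N => Finset.stronglyMeasurable_fun_sum _ fun k _ => h1 k _) ?_
  rw [tendsto_pi_nhds]
  exact fun x => (summable_picTerm (ha x) (hn x) (le_max_right t 0)).hasSum.tendsto_sum_nat

lemma hasDerivAt_integral_of_continuous [CompleteSpace F] {f : ℝ → F} (hf : Continuous f) (t : ℝ) :
    HasDerivAt (fun t => ∫ s in (0 : ℝ)..t, f s) (f t) t :=
  intervalIntegral.integral_hasDerivAt_right (hf.intervalIntegrable _ _)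
    (hf.stronglyMeasurableAtFilter _ _) hf.continuousAt

end Volterra

/-! ### Quadratic forms, Lyapunov equations and the algebraic Riccati equation -/

section Forms

variable {d m b : ℕ}

lemma posSemidef_real_iff {M : Matrix (Fin d) (Fin d) ℝ} :
    M.PosSemidef ↔ Mᵀ = M ∧ ∀ x : Fin d → ℝ, 0 ≤ x ⬝ᵥ M *ᵥ x := by
  rw [Matrix.posSemidef_iff_dotProduct_mulVec]
  simp [Matrix.IsHermitian, Matrix.conjTranspose_eq_transpose_of_trivial]

lemma posDef_real_iff {M : Matrix (Fin d) (Fin d) ℝ} :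
    M.PosDef ↔ Mᵀ = M ∧ ∀ x : Fin d → ℝ, x ≠ 0 → 0 < x ⬝ᵥ M *ᵥ x := by
  rw [Matrix.posDef_iff_dotProduct_mulVec]
  simp [Matrix.IsHermitian, Matrix.conjTranspose_eq_transpose_of_trivial]

lemma dotProduct_mulVec_comm (M : Matrix (Fin d) (Fin d) ℝ) (x y : Fin d → ℝ) :
    x ⬝ᵥ M *ᵥ y = y ⬝ᵥ Mᵀ *ᵥ x := by
  rw [Matrix.dotProduct_mulVec, ← Matrix.mulVec_transpose, dotProduct_comm]

lemma eq_zero_of_posSemidef_neg {M : Matrix (Fin d) (Fin d) ℝ} (h : M.PosSemidef)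
    (h' : (-M).PosSemidef) : M = 0 := by
  rw [← h.trace_eq_zero_iff]
  have h1 := h.trace_nonneg
  have h2 := h'.trace_nonneg
  rw [Matrix.trace_neg] at h2
  linarith

/-- At a null vector `x` the form is minimal; if `M x` were nonzero, moving from `x` in the
direction `-M x` would make the form negative to first order. -/
lemma mulVec_eq_zero_of_posSemidef {M : Matrix (Fin d) (Fin d) ℝ} (h : M.PosSemidef)
    {x : Fin d → ℝ} (hx : x ⬝ᵥ M *ᵥ x = 0) : M *ᵥ x = 0 := by
  rw [posSemidef_real_iff] at h
  by_contra hne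
  set y := M *ᵥ x with hy
  have hyy : 0 < y ⬝ᵥ y := by
    rw [← star_trivial y]
    exact Matrix.dotProduct_star_self_pos_iff.2 (by simpa using hne)
  have hxy : x ⬝ᵥ M *ᵥ y = y ⬝ᵥ y := by rw [dotProduct_mulVec_comm, h.1]
  have key : ∀ s : ℝ, 0 ≤ 2 * s * (y ⬝ᵥ y) + s ^ 2 * (y ⬝ᵥ M *ᵥ y) := by
    intro s
    have := h.2 (x + s • y)
    simp only [Matrix.mulVec_add, Matrix.mulVec_smul, dotProduct_add, add_dotProduct,
      dotProduct_smul, smul_dotProduct, smul_eq_mul, hx, hxy, ← hy] at this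
    nlinarith
  have hyMy := h.2 y
  -- The exact minimizer has denominator `y ⬝ᵥ M *ᵥ y`, which may vanish; adding `1` keeps it
  -- positive and the value is still negative.
  have h1 := key (-(y ⬝ᵥ y) / (1 + y ⬝ᵥ M *ᵥ y))
  have h2 : 0 < 1 + y ⬝ᵥ M *ᵥ y := by linarith
  have h3 : 2 * (-(y ⬝ᵥ y) / (1 + y ⬝ᵥ M *ᵥ y)) * (y ⬝ᵥ y) +
      (-(y ⬝ᵥ y) / (1 + y ⬝ᵥ M *ᵥ y)) ^ 2 * (y ⬝ᵥ M *ᵥ y) =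
      -((y ⬝ᵥ y) ^ 2 * (2 + y ⬝ᵥ M *ᵥ y)) / (1 + y ⬝ᵥ M *ᵥ y) ^ 2 := by
    field_simp
    ring
  rw [h3] at h1
  have h4 : 0 < (y ⬝ᵥ y) ^ 2 * (2 + y ⬝ᵥ M *ᵥ y) / (1 + y ⬝ᵥ M *ᵥ y) ^ 2 := by
    have : 0 < 2 + y ⬝ᵥ M *ᵥ y := by linarith
    positivity
  rw [neg_div] at h1
  linarith

/-- If `F` has a strict Lyapunov matrix `R`, the solution of `F P + P Fᵀ = -Q` with `Q ⪰ 0` is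
positive semidefinite. -/
lemma posSemidef_of_lyapunov {F R P : Matrix (Fin d) (Fin d) ℝ} (hR : R.PosDef)
    (hFR : (-(F * R + R * Fᵀ)).PosDef) (hP : Pᵀ = P) (hFP : (-(F * P + P * Fᵀ)).PosSemidef) :
    P.PosSemidef := by
  rw [posSemidef_real_iff]
  refine ⟨hP, ?_⟩
  by_contra! hneg
  obtain ⟨z, hz⟩ := hneg
  rw [posDef_real_iff] at hR
  have hz0 : z ≠ 0 := by rintro rfl; simp at hz
  -- Generalized Rayleigh quotient of `P` against `R`. If its minimum `-s` is negative, then `P + s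
  -- R` is semidefinite and singular at the minimizer.
  let q : (Fin d → ℝ) → ℝ := fun x => (x ⬝ᵥ P *ᵥ x) / (x ⬝ᵥ R *ᵥ x)
  have hcP : ∀ M : Matrix (Fin d) (Fin d) ℝ, Continuous fun x : Fin d → ℝ => x ⬝ᵥ M *ᵥ x := by
    intro M; fun_prop
  have hsph : IsCompact (Metric.sphere (0 : Fin d → ℝ) 1) := isCompact_sphere _ _
  have hne : ∀ x ∈ Metric.sphere (0 : Fin d → ℝ) 1, x ≠ 0 := by
    rintro x hx rfl; simp at hx
  have hscale : ∀ (M : Matrix (Fin d) (Fin d) ℝ) (x : Fin d → ℝ) (c : ℝ),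
      (c • x) ⬝ᵥ M *ᵥ (c • x) = c ^ 2 * (x ⬝ᵥ M *ᵥ x) := by
    intro M x c
    simp only [Matrix.mulVec_smul, dotProduct_smul, smul_dotProduct, smul_eq_mul]; ring
  have hunit : ∀ x : Fin d → ℝ, x ≠ 0 → ‖x‖⁻¹ • x ∈ Metric.sphere (0 : Fin d → ℝ) 1 := by
    intro x hx
    have : ‖x‖ ≠ 0 := norm_ne_zero_iff.2 hx
    simp [norm_smul, this]
  obtain ⟨x, hxS, hxmin⟩ := hsph.exists_isMinOn (f := q) ⟨_, hunit z hz0⟩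
    ((hcP P).continuousOn.div (hcP R).continuousOn fun x hx => (hR.2 x (hne x hx)).ne')
  have hx0 := hne x hxS
  have hRx := hR.2 x hx0
  set s := -q x with hs
  have hall : ∀ y : Fin d → ℝ, 0 ≤ y ⬝ᵥ (P + s • R) *ᵥ y := by
    intro y
    rcases eq_or_ne y 0 with rfl | hy
    · simp
    have h1 : q x ≤ q (‖y‖⁻¹ • y) := hxmin (hunit y hy)
    have h2 : q (‖y‖⁻¹ • y) = q y := by
      simp only [q, hscale]
      have : (‖y‖⁻¹) ^ 2 ≠ 0 := by
        have : ‖y‖ ≠ 0 := norm_ne_zero_iff.2 hy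
        positivity
      rw [mul_div_mul_left _ _ this]
    rw [h2] at h1
    have h3 := hR.2 y hy
    rw [le_div_iff₀ h3] at h1
    simp only [Matrix.add_mulVec, Matrix.smul_mulVec, dotProduct_add, dotProduct_smul, smul_eq_mul]
    linarith
  have hxeq : x ⬝ᵥ (P + s • R) *ᵥ x = 0 := by
    simp only [Matrix.add_mulVec, Matrix.smul_mulVec, dotProduct_add, dotProduct_smul, smul_eq_mul,
      hs, q]
    field_simp
    ring
  have hspos : 0 < s := by
    have h1 : q x ≤ q (‖z‖⁻¹ • z) := hxmin (hunit z hz0)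
    have h2 : q (‖z‖⁻¹ • z) < 0 := by
      simp only [q, hscale]
      have : 0 < (‖z‖⁻¹) ^ 2 := by
        have : 0 < ‖z‖ := norm_pos_iff.2 hz0
        positivity
      exact div_neg_of_neg_of_pos (by nlinarith) (mul_pos this (hR.2 z hz0))
    linarith
  have hPR : (P + s • R).PosSemidef :=
    posSemidef_real_iff.2 ⟨by rw [Matrix.transpose_add, Matrix.transpose_smul, hP, hR.1], hall⟩
  have hker := mulVec_eq_zero_of_posSemidef hPR hxeq
  have hT := (posSemidef_real_iff.1 hPR).1
  -- The minimizer lies in the kernel of `P + s R`, so this form vanishes there, whereas the two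
  -- Lyapunov hypotheses make it strictly negative.
  have h5 : x ⬝ᵥ (F * (P + s • R) + (P + s • R) * Fᵀ) *ᵥ x = 0 := by
    rw [Matrix.add_mulVec, dotProduct_add, ← Matrix.mulVec_mulVec, hker, ← Matrix.mulVec_mulVec,
      dotProduct_mulVec_comm (P + s • R), hT, hker]
    simp
  have h6 : F * (P + s • R) + (P + s • R) * Fᵀ =
      -(-(F * P + P * Fᵀ)) - s • (-(F * R + R * Fᵀ)) := by
    simp only [Matrix.mul_add, Matrix.add_mul, Matrix.mul_smul, Matrix.smul_mul, smul_neg, smul_add]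
    abel
  rw [h6, Matrix.sub_mulVec, Matrix.neg_mulVec, Matrix.smul_mulVec, dotProduct_sub, dotProduct_neg,
    dotProduct_smul, smul_eq_mul] at h5
  have h7 := (posSemidef_real_iff.1 hFP).2 x
  have h8 := (posDef_real_iff.1 hFR).2 x hx0
  nlinarith

/-- Solvability of the Lyapunov equation. -/
lemma exists_lyapunov {F R Q : Matrix (Fin d) (Fin d) ℝ} (hR : R.PosDef)
    (hFR : (-(F * R + R * Fᵀ)).PosDef) (hQ : Q.PosSemidef) :
    ∃ P : Matrix (Fin d) (Fin d) ℝ, P.PosSemidef ∧ F * P + P * Fᵀ = -Q := by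
  -- On the finite-dimensional space of symmetric matrices the Lyapunov operator is injective, since
  -- an element `P` of its kernel satisfies both `P ⪰ 0` and `-P ⪰ 0`. Hence it is onto.
  let V : Submodule ℝ (Matrix (Fin d) (Fin d) ℝ) :=
    { carrier := {P | Pᵀ = P}
      add_mem' := by intro a b ha hb; simp only [Set.mem_ofPred_eq] at *; rw [Matrix.transpose_add, ha, hb]
      zero_mem' := Matrix.transpose_zero
      smul_mem' := by intro c a ha; simp only [Set.mem_ofPred_eq] at *; rw [Matrix.transpose_smul, ha] }
  let L : V →ₗ[ℝ] V :=
    { toFun := fun P => ⟨F * P.1 + P.1 * Fᵀ, by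
        have := P.2
        change (_ : Matrix _ _ ℝ)ᵀ = _
        change (P.1)ᵀ = P.1 at this
        rw [Matrix.transpose_add, Matrix.transpose_mul, Matrix.transpose_mul, this,
          Matrix.transpose_transpose, add_comm]⟩
      map_add' := by
        intro P P'
        ext1
        simp only [Submodule.coe_add, Matrix.mul_add, Matrix.add_mul]
        abel
      map_smul' := by
        intro c P
        ext1
        simp [smul_add] }
  have hinj : Function.Injective L := by
    rw [injective_iff_map_eq_zero]
    intro P hP
    have hP' : F * P.1 + P.1 * Fᵀ = 0 := congrArg Subtype.val hP
    have h1 : P.1.PosSemidef := posSemidef_of_lyapunov hR hFR P.2 (by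
      rw [hP', neg_zero]; exact Matrix.PosSemidef.zero)
    have h2 : (-P.1).PosSemidef := posSemidef_of_lyapunov hR hFR
      (by rw [Matrix.transpose_neg]; exact congrArg _ P.2) (by
      rw [Matrix.mul_neg, Matrix.neg_mul, ← neg_add, hP', neg_zero, neg_zero]
      exact Matrix.PosSemidef.zero)
    exact Subtype.ext (eq_zero_of_posSemidef_neg h1 h2)
  have hsurj := LinearMap.injective_iff_surjective.1 hinj
  obtain ⟨P, hP⟩ := hsurj ⟨-Q, by
    change (_ : Matrix _ _ ℝ)ᵀ = _
    rw [Matrix.transpose_neg, (posSemidef_real_iff.1 hQ).1]⟩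
  have hP' : F * P.1 + P.1 * Fᵀ = -Q := congrArg Subtype.val hP
  exact ⟨P.1, posSemidef_of_lyapunov hR hFR P.2 (by rwa [hP', neg_neg]), hP'⟩

lemma posSemidef_transpose_mul (M : Matrix (Fin m) (Fin d) ℝ) : (Mᵀ * M).PosSemidef := by
  rw [← Matrix.conjTranspose_eq_transpose_of_trivial]
  exact Matrix.posSemidef_conjTranspose_mul_self M

lemma posSemidef_mul_transpose (M : Matrix (Fin d) (Fin m) ℝ) : (M * Mᵀ).PosSemidef := by
  rw [← Matrix.conjTranspose_eq_transpose_of_trivial]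
  exact Matrix.posSemidef_self_mul_conjTranspose M

lemma posSemidef_conj {P : Matrix (Fin m) (Fin m) ℝ} (hP : P.PosSemidef)
    (M : Matrix (Fin d) (Fin m) ℝ) : (M * P * Mᵀ).PosSemidef := by
  rw [← Matrix.conjTranspose_eq_transpose_of_trivial]
  exact hP.mul_mul_conjTranspose_same M

lemma ricc_eq (A : Matrix (Fin d) (Fin d) ℝ) (H : Matrix (Fin m) (Fin d) ℝ)
    (σB : Matrix (Fin d) (Fin b) ℝ) {Q : Matrix (Fin d) (Fin d) ℝ} (hQ : Qᵀ = Q) :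
    (A - Q * Hᵀ * H) * Q + Q * (A - Q * Hᵀ * H)ᵀ =
      ricc A H σB Q - σB * σBᵀ - Q * (Hᵀ * H) * Qᵀ := by
  simp only [ricc, Matrix.transpose_sub, Matrix.transpose_mul, Matrix.transpose_transpose, hQ,
    Matrix.sub_mul, Matrix.mul_sub, Matrix.mul_assoc]
  abel

/-- On the kernel of `Q` the quadratic form of `ricc` reduces to that of `σB σBᵀ`, so a
supersolution has no kernel. -/
lemma ricc_le_posDef {A : Matrix (Fin d) (Fin d) ℝ} {H : Matrix (Fin m) (Fin d) ℝ}
    {σB : Matrix (Fin d) (Fin b) ℝ} (hσB : (σB * σBᵀ).PosDef) {Q : Matrix (Fin d) (Fin d) ℝ}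
    (hQ : Q.PosSemidef) (hR : (-ricc A H σB Q).PosSemidef) : Q.PosDef := by
  rw [posDef_real_iff]
  have hQ' := posSemidef_real_iff.1 hQ
  refine ⟨hQ'.1, fun x hx => lt_of_le_of_ne (hQ'.2 x) fun h => ?_⟩
  have hker := mulVec_eq_zero_of_posSemidef hQ h.symm
  have h1 := (posSemidef_real_iff.1 hR).2 x
  have h2 := (posDef_real_iff.1 hσB).2 x hx
  have h3 : x ⬝ᵥ (ricc A H σB Q) *ᵥ x = x ⬝ᵥ (σB * σBᵀ) *ᵥ x := by
    simp only [ricc, Matrix.sub_mulVec, Matrix.add_mulVec, dotProduct_sub, dotProduct_add]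
    rw [← Matrix.mulVec_mulVec x A, ← Matrix.mulVec_mulVec x (Q * Hᵀ * H) Q, hker,
      ← Matrix.mulVec_mulVec x Q, dotProduct_mulVec_comm Q, hQ'.1, hker]
    simp
  rw [Matrix.neg_mulVec, dotProduct_neg, h3] at h1
  linarith

/-- A supersolution is a strict Lyapunov matrix of its own closed loop, so stability is available
without eigenvalues. -/
lemma stable_of_ricc_le {A : Matrix (Fin d) (Fin d) ℝ} {H : Matrix (Fin m) (Fin d) ℝ}
    {σB : Matrix (Fin d) (Fin b) ℝ} (hσB : (σB * σBᵀ).PosDef) {Q : Matrix (Fin d) (Fin d) ℝ}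
    (hQ : Q.PosSemidef) (hR : (-ricc A H σB Q).PosSemidef) :
    (-((A - Q * Hᵀ * H) * Q + Q * (A - Q * Hᵀ * H)ᵀ)).PosDef := by
  rw [ricc_eq A H σB (posSemidef_real_iff.1 hQ).1]
  have : -(ricc A H σB Q - σB * σBᵀ - Q * (Hᵀ * H) * Qᵀ) =
      σB * σBᵀ + (-ricc A H σB Q + Q * (Hᵀ * H) * Qᵀ) := by abel
  rw [this]
  exact hσB.add_posSemidef (hR.add (posSemidef_conj (posSemidef_transpose_mul H) Q))

/-- The difference of two solutions satisfies a Lyapunov equation, with semidefinite right side, for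
the closed loop of the first solution, of which that solution is a strict Lyapunov matrix. Hence
each solution dominates the other. -/
lemma isARESolution_unique {A : Matrix (Fin d) (Fin d) ℝ} {H : Matrix (Fin m) (Fin d) ℝ}
    {σB : Matrix (Fin d) (Fin b) ℝ} (hσB : (σB * σBᵀ).PosDef) {Q Q' : Matrix (Fin d) (Fin d) ℝ}
    (hQ : IsARESolution A H σB Q) (hQ' : IsARESolution A H σB Q') : Q = Q' := by
  have key : ∀ Q Q' : Matrix (Fin d) (Fin d) ℝ, IsARESolution A H σB Q →
      IsARESolution A H σB Q' → (Q - Q').PosSemidef := by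
    intro Q Q' hQ hQ'
    have hT := (posDef_real_iff.1 hQ.1).1
    have hT' := (posDef_real_iff.1 hQ'.1).1
    have hz : (-ricc A H σB Q).PosSemidef := by
      rw [hQ.2, neg_zero]; exact Matrix.PosSemidef.zero
    refine posSemidef_of_lyapunov hQ.1 (stable_of_ricc_le hσB hQ.1.posSemidef hz)
      (by rw [Matrix.transpose_sub, hT, hT']) ?_
    have h1 : -((A - Q * Hᵀ * H) * (Q - Q') + (Q - Q') * (A - Q * Hᵀ * H)ᵀ) =
        (Q - Q') * (Hᵀ * H) * (Q - Q')ᵀ + ricc A H σB Q' - ricc A H σB Q := by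
      simp only [ricc, Matrix.transpose_sub, Matrix.transpose_mul, Matrix.transpose_transpose,
        hT, hT', Matrix.sub_mul, Matrix.mul_sub, Matrix.mul_assoc]
      abel
    rw [h1, hQ.2, hQ'.2, add_zero, sub_zero]
    exact posSemidef_conj (posSemidef_transpose_mul H) _
  have h1 := key Q Q' hQ hQ'
  have h2 := key Q' Q hQ' hQ
  rw [← neg_sub] at h2
  exact sub_eq_zero.1 (eq_zero_of_posSemidef_neg h1 h2)

/-- Test the form on `e_i + e_j` and `e_i - e_j`. A bound on the trace thus makes a set of
semidefinite matrices bounded. -/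
lemma abs_apply_le_trace {P : Matrix (Fin d) (Fin d) ℝ} (hP : P.PosSemidef) (i j : Fin d) :
    |P i j| ≤ P.trace := by
  have hd : ∀ i, P i i ≤ P.trace := fun i =>
    Finset.single_le_sum (f := fun i => P i i) (fun i _ => hP.diag_nonneg) (Finset.mem_univ i)
  have hT := (posSemidef_real_iff.1 hP).1
  have hji : P j i = P i j := congrFun (congrFun hT i) j
  have h := (posSemidef_real_iff.1 hP).2
  have h1 := h (Pi.single i 1 + Pi.single j 1)
  have h2 := h (Pi.single i 1 - Pi.single j 1)
  simp only [Matrix.mulVec_add, Matrix.mulVec_sub, dotProduct_add, dotProduct_sub, add_dotProduct,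
    sub_dotProduct, Matrix.mulVec_single_one, single_one_dotProduct, Matrix.col_apply, hji] at h1 h2
  have := hd i
  have := hd j
  rw [abs_le]
  constructor <;> linarith

lemma isClosed_posSemidef : IsClosed {P : Matrix (Fin d) (Fin d) ℝ | P.PosSemidef} := by
  simp only [posSemidef_real_iff, Set.ofPred_and, Set.ofPred_forall]
  refine IsClosed.inter (isClosed_eq (by fun_prop) continuous_id) (isClosed_iInter fun x => ?_)
  exact isClosed_le continuous_const (by fun_prop)

/-- Existence of a positive definite solution of the algebraic Riccati equation, as the
trace-minimal positive semidefinite supersolution. -/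
lemma exists_isARESolution {A : Matrix (Fin d) (Fin d) ℝ} {H : Matrix (Fin m) (Fin d) ℝ}
    {σB : Matrix (Fin d) (Fin b) ℝ} (hσB : (σB * σBᵀ).PosDef) {L : Matrix (Fin d) (Fin m) ℝ}
    {R : Matrix (Fin d) (Fin d) ℝ} (hR : R.PosDef)
    (hLR : (-((A - L * H) * R + R * (A - L * H)ᵀ)).PosDef) :
    ∃ Q, IsARESolution A H σB Q := by
  -- Stationary error covariance of the observer with gain `L`. Completing the square, `-ricc P₁ =
  -- (L - P₁ Hᵀ)(L - P₁ Hᵀ)ᵀ`, so it is a supersolution.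
  obtain ⟨P₁, hP₁, hP₁e⟩ := exists_lyapunov hR hLR
    (hσB.posSemidef.add (posSemidef_mul_transpose L))
  have hT₁ := (posSemidef_real_iff.1 hP₁).1
  have hP₁r : (-ricc A H σB P₁).PosSemidef := by
    have : -ricc A H σB P₁ = (L - P₁ * Hᵀ) * (L - P₁ * Hᵀ)ᵀ := by
      have h1 : ricc A H σB P₁ = ((A - L * H) * P₁ + P₁ * (A - L * H)ᵀ) + (σB * σBᵀ + L * Lᵀ)
          - (L - P₁ * Hᵀ) * (L - P₁ * Hᵀ)ᵀ := by
        simp only [ricc, Matrix.transpose_sub, Matrix.transpose_mul, Matrix.transpose_transpose,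
          hT₁, Matrix.sub_mul, Matrix.mul_sub, Matrix.mul_assoc]
        abel
      rw [h1, hP₁e]
      abel
    rw [this]
    exact posSemidef_mul_transpose _
  let K : Set (Matrix (Fin d) (Fin d) ℝ) :=
    {P | P.PosSemidef ∧ (-ricc A H σB P).PosSemidef ∧ P.trace ≤ P₁.trace}
  have hclosed : IsClosed K := by
    refine isClosed_posSemidef.inter (IsClosed.inter ?_ (isClosed_le continuous_id.matrix_trace continuous_const))
    exact isClosed_posSemidef.preimage (f := fun P => -ricc A H σB P)
      (by unfold ricc; fun_prop)
  have hcomp : IsCompact K := by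
    have hbox : IsCompact (Set.pi Set.univ fun _ : Fin d => Set.pi Set.univ fun _ : Fin d =>
        Set.Icc (-P₁.trace) P₁.trace) :=
      isCompact_univ_pi fun _ => isCompact_univ_pi fun _ => isCompact_Icc
    refine IsCompact.of_isClosed_subset hbox hclosed fun P hP i _ j _ => ?_
    exact abs_le.1 ((abs_apply_le_trace hP.1 i j).trans hP.2.2)
  obtain ⟨P, hP, hmin⟩ := hcomp.exists_isMinOn (f := Matrix.trace) ⟨P₁, hP₁, hP₁r, le_rfl⟩
    continuous_id.matrix_trace.continuousOn
  have hPpos := ricc_le_posDef hσB hP.1 hP.2.1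
  have hst := stable_of_ricc_le hσB hP.1 hP.2.1
  have hT := (posSemidef_real_iff.1 hP.1).1
  -- One Newton step at the minimizer. It yields a supersolution `P' ⪯ P`, so minimality of the
  -- trace forces `P' = P`, and the Newton equation at a fixed point is `ricc P = 0`.
  obtain ⟨P', hP', hP'e⟩ := exists_lyapunov hPpos hst
    (hσB.posSemidef.add (posSemidef_conj (posSemidef_transpose_mul H) P))
  have hT' := (posSemidef_real_iff.1 hP').1
  have hle : (P - P').PosSemidef := by
    refine posSemidef_of_lyapunov hPpos hst (by rw [Matrix.transpose_sub, hT, hT']) ?_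
    have : -((A - P * Hᵀ * H) * (P - P') + (P - P') * (A - P * Hᵀ * H)ᵀ) =
        ((A - P * Hᵀ * H) * P' + P' * (A - P * Hᵀ * H)ᵀ) -
        ((A - P * Hᵀ * H) * P + P * (A - P * Hᵀ * H)ᵀ) := by
      noncomm_ring
    rw [this, hP'e, ricc_eq A H σB hT]
    have : -(σB * σBᵀ + P * (Hᵀ * H) * Pᵀ) -
        (ricc A H σB P - σB * σBᵀ - P * (Hᵀ * H) * Pᵀ) = -ricc A H σB P := by abel
    rw [this]
    exact hP.2.1
  have hr' : (-ricc A H σB P').PosSemidef := by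
    have : -ricc A H σB P' = (P - P') * (Hᵀ * H) * (P - P')ᵀ := by
      have h1 : ricc A H σB P' = ((A - P * Hᵀ * H) * P' + P' * (A - P * Hᵀ * H)ᵀ) +
          (σB * σBᵀ + P * (Hᵀ * H) * Pᵀ) - (P - P') * (Hᵀ * H) * (P - P')ᵀ := by
        simp only [ricc, Matrix.transpose_sub, Matrix.transpose_mul, Matrix.transpose_transpose,
          hT, hT', Matrix.sub_mul, Matrix.mul_sub, Matrix.mul_assoc]
        abel
      rw [h1, hP'e]
      abel
    rw [this]
    exact posSemidef_conj (posSemidef_transpose_mul H) _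
  have htr : P'.trace ≤ P.trace := by
    have := hle.trace_nonneg
    rw [Matrix.trace_sub] at this
    linarith
  have hmin' : P.trace ≤ P'.trace := hmin ⟨hP', hr', htr.trans hP.2.2⟩
  have hPP' : P - P' = 0 := by
    rw [← hle.trace_eq_zero_iff, Matrix.trace_sub]
    linarith
  have hPeq : P' = P := (sub_eq_zero.1 hPP').symm
  rw [hPeq, ricc_eq A H σB hT] at hP'e
  refine ⟨P, hPpos, ?_⟩
  have := eq_neg_iff_add_eq_zero.1 hP'e
  rw [← this]
  abel

end Forms

/-! ### Lyapunov matrices of Hurwitz matrices -/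

section Hurwitz

variable {d m b : ℕ}

/-- The powers of a complex matrix with spectrum in the open unit disc decay geometrically. -/
lemma exists_norm_pow_le {n : ℕ} [NeZero n] (C : Matrix (Fin n) (Fin n) ℂ)
    (hC : ∀ μ ∈ spectrum ℂ C, ‖μ‖ < 1) :
    ∃ r : ℝ, 0 ≤ r ∧ r < 1 ∧ ∀ᶠ k : ℕ in atTop, ‖C ^ k‖ ≤ r ^ k := by
  have hne : (spectrum ℂ C).Nonempty := spectrum.nonempty C
  have h1 : spectralRadius ℂ C < (1 : ℝ≥0) :=
    spectrum.spectralRadius_lt_of_forall_lt_of_nonempty hne fun k hk => hC k hk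
  obtain ⟨r, hr1, hr2⟩ := ENNReal.lt_iff_exists_nnreal_btwn.1 h1
  -- Gelfand's formula: the norms of the powers are eventually below `r ^ k` as soon as `r` exceeds
  -- the spectral radius.
  have hlim := spectrum.pow_nnnorm_pow_one_div_tendsto_nhds_spectralRadius C
  refine ⟨r, r.2, by exact_mod_cast hr2, ?_⟩
  filter_upwards [hlim.eventually (gt_mem_nhds hr1), eventually_gt_atTop 0] with k hk hk0
  have hk0' : (k : ℝ) ≠ 0 := by positivity
  have h2 := ENNReal.rpow_le_rpow hk.le (Nat.cast_nonneg (α := ℝ) k)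
  rw [← ENNReal.rpow_mul, one_div, inv_mul_cancel₀ hk0', ENNReal.rpow_one,
    ENNReal.rpow_natCast] at h2
  exact_mod_cast h2

/-- `Re ((μ + 1) / (μ - 1)) = (|μ|² - 1) / |μ - 1|²`: the Cayley transform exchanges the left half
plane and the unit disc. -/
lemma norm_lt_one_of_cayley {μ l : ℂ} (hμ : μ ≠ 1) (hl : l = (μ + 1) / (μ - 1)) (h : l.re < 0) :
    ‖μ‖ < 1 := by
  have h0 : 0 < Complex.normSq (μ - 1) := Complex.normSq_pos.2 (sub_ne_zero.2 hμ)
  rw [hl, Complex.div_re, ← add_div, div_lt_iff₀ h0, zero_mul] at h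
  simp only [Complex.add_re, Complex.one_re, Complex.sub_re, Complex.add_im, Complex.one_im,
    Complex.sub_im, add_zero, sub_zero] at h
  have h1 : ‖μ‖ ^ 2 < 1 := by
    rw [← Complex.normSq_eq_norm_sq, Complex.normSq_apply]
    nlinarith
  exact (sq_lt_one_iff₀ (norm_nonneg _)).1 h1

/-- The Cayley transform `C = (F - 1)⁻¹ (F + 1)` has its spectrum in the unit disc, so `R = ∑ C ^ k
(C ^ k)ᵀ` converges and `R - C R Cᵀ = 1`. Multiplied by `F - 1` on the left and by its transpose on
the right, this reads `-(F R + R Fᵀ) = (F - 1)(F - 1)ᵀ / 2`. A discrete series thus replaces the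
usual integral of matrix exponentials. -/
lemma exists_lyapunov_of_isHurwitz {F : Matrix (Fin d) (Fin d) ℝ} (hF : IsHurwitz F) :
    ∃ R : Matrix (Fin d) (Fin d) ℝ, R.PosDef ∧ (-(F * R + R * Fᵀ)).PosDef := by
  rcases Nat.eq_zero_or_pos d with rfl | hd
  · refine ⟨0, ?_, ?_⟩ <;>
    exact posDef_real_iff.2 ⟨Subsingleton.elim _ _, fun x hx => (hx (Subsingleton.elim _ _)).elim⟩
  have : NeZero d := ⟨hd.ne'⟩
  let φ := (algebraMap ℝ ℂ).mapMatrix (m := Fin d)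
  have hspec : ∀ (l : ℂ) (v : Fin d → ℂ), v ≠ 0 → φ F *ᵥ v = l • v → l.re < 0 := by
    intro l v hv h
    refine hF l ?_
    rw [spectrum.mem_iff]
    intro hu
    have h1 : (algebraMap ℂ (Matrix (Fin d) (Fin d) ℂ) l - φ F) *ᵥ v = 0 := by
      rw [Matrix.sub_mulVec, h, Algebra.algebraMap_eq_smul_one, Matrix.smul_mulVec,
        Matrix.one_mulVec, sub_self]
    rw [Matrix.isUnit_iff_isUnit_det] at hu
    exact hu.ne_zero (Matrix.exists_mulVec_eq_zero_iff.1 ⟨v, hv, h1⟩)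
  have hunit : IsUnit (F - 1).det := by
    rw [isUnit_iff_ne_zero]
    intro h0
    have h1 : (φ (F - 1)).det = 0 := by
      rw [← RingHom.map_det, h0, map_zero]
    obtain ⟨v, hv, hv0⟩ := Matrix.exists_mulVec_eq_zero_iff.2 h1
    rw [map_sub, map_one, Matrix.sub_mulVec, Matrix.one_mulVec, sub_eq_zero] at hv0
    have := hspec 1 v hv (by rw [hv0, one_smul])
    norm_num at this
  set C := (F - 1)⁻¹ * (F + 1) with hC
  have hFC : (F - 1) * C = F + 1 := by
    rw [hC, ← Matrix.mul_assoc, Matrix.mul_nonsing_inv _ hunit, Matrix.one_mul]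
  have hCspec : ∀ μ ∈ spectrum ℂ (φ C), ‖μ‖ < 1 := by
    intro μ hμ
    rw [spectrum.mem_iff, Matrix.isUnit_iff_isUnit_det, isUnit_iff_ne_zero, not_not] at hμ
    obtain ⟨v, hv, hv0⟩ := Matrix.exists_mulVec_eq_zero_iff.2 hμ
    rw [Matrix.sub_mulVec, Algebra.algebraMap_eq_smul_one, Matrix.smul_mulVec,
        Matrix.one_mulVec, sub_eq_zero] at hv0
    have h1 : φ F *ᵥ v + v = μ • (φ F *ᵥ v - v) := by
      have h2 := congrArg (fun M => φ M *ᵥ v) hFC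
      simp only [map_mul, map_sub, map_add, map_one, ← Matrix.mulVec_mulVec, ← hv0,
        Matrix.mulVec_smul, Matrix.sub_mulVec, Matrix.add_mulVec, Matrix.one_mulVec] at h2
      exact h2.symm
    have hμ1 : μ ≠ 1 := by
      rintro rfl
      rw [one_smul] at h1
      have h3 : (2 : ℂ) • v = 0 := by
        have := sub_eq_zero.2 h1
        rw [two_smul]
        rw [← this]
        abel
      exact hv ((smul_eq_zero.1 h3).resolve_left two_ne_zero)
    refine norm_lt_one_of_cayley hμ1 rfl (hspec _ v hv ?_)
    have hμ2 : μ - 1 ≠ 0 := sub_ne_zero.2 hμ1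
    have h4 : (μ - 1) • (φ F *ᵥ v) = (μ + 1) • v := by
      rw [smul_sub] at h1
      rw [sub_smul, add_smul, one_smul, one_smul, sub_eq_iff_eq_add, add_assoc, add_comm v, h1]
      abel
    rw [div_eq_inv_mul, mul_smul, ← h4, smul_smul, inv_mul_cancel₀ hμ2, one_smul]
  clear_value C
  obtain ⟨r, hr0, hr1, hr⟩ := exists_norm_pow_le (φ C) hCspec
  have hsumC : Summable fun k : ℕ => φ (C ^ k * (C ^ k)ᵀ) := by
    refine Summable.of_norm_bounded_eventually_nat (g := fun k => r ^ k)
      (summable_geometric_of_lt_one hr0 hr1) ?_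
    filter_upwards [hr] with k hk
    have h1 : φ ((C ^ k)ᵀ) = (φ C ^ k)ᴴ := by
      rw [← map_pow]
      ext i j
      simp [φ, -Matrix.transpose_pow]
    rw [map_mul, map_pow, h1]
    refine (Matrix.l2_opNorm_mul _ _).trans ?_
    rw [Matrix.l2_opNorm_conjTranspose]
    have h2 : r ^ k ≤ 1 := pow_le_one₀ hr0 hr1.le
    nlinarith [norm_nonneg (φ C ^ k), pow_nonneg hr0 k]
  -- Norms of powers are controlled for complex matrices, where the spectral radius formula holds;
  -- the real series is recovered entry by entry.
  have hsum : Summable fun k : ℕ => C ^ k * (C ^ k)ᵀ := by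
    refine Pi.summable.2 fun i => Pi.summable.2 fun j => ?_
    have := Pi.summable.1 (Pi.summable.1 hsumC i) j
    exact Complex.summable_ofReal.1 this
  set R := ∑' k : ℕ, C ^ k * (C ^ k)ᵀ with hRdef
  have hR : R - C * R * Cᵀ = 1 := by
    have h1 : R = 1 + ∑' k : ℕ, C ^ (k + 1) * (C ^ (k + 1))ᵀ := by
      rw [hRdef, hsum.tsum_eq_zero_add]
      simp
    have h2 : ∑' k : ℕ, C ^ (k + 1) * (C ^ (k + 1))ᵀ = C * R * Cᵀ := by
      rw [hRdef, ← hsum.tsum_mul_left, ← (hsum.mul_left C).tsum_mul_right]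
      refine tsum_congr fun k => ?_
      rw [pow_succ', Matrix.transpose_mul]
      simp only [Matrix.mul_assoc]
    rw [h2] at h1
    exact sub_eq_iff_eq_add.2 h1
  have hRpsd : R.PosSemidef :=
    isClosed_posSemidef.mem_of_tendsto hsum.hasSum.tendsto_sum_nat
      (Eventually.of_forall fun N => Matrix.posSemidef_sum _ fun k _ => posSemidef_mul_transpose _)
  have hRpd : R.PosDef := by
    rw [sub_eq_iff_eq_add.1 hR]
    exact Matrix.PosDef.one.add_posSemidef (posSemidef_conj hRpsd C)
  refine ⟨R, hRpd, ?_⟩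
  have hkey : -(F * R + R * Fᵀ) = (1 / 2 : ℝ) • ((F - 1) * (F - 1)ᵀ) := by
    have h1 : (F - 1) * (F - 1)ᵀ = (F - 1) * R * (F - 1)ᵀ - (F + 1) * R * (F + 1)ᵀ := by
      calc (F - 1) * (F - 1)ᵀ = (F - 1) * (R - C * R * Cᵀ) * (F - 1)ᵀ := by
            rw [hR, Matrix.mul_one]
        _ = (F - 1) * R * (F - 1)ᵀ - ((F - 1) * C) * R * ((F - 1) * C)ᵀ := by
            rw [Matrix.transpose_mul, Matrix.mul_sub, Matrix.sub_mul]
            simp only [Matrix.mul_assoc]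
        _ = _ := by rw [hFC]
    have h2 : (F - 1) * R * (F - 1)ᵀ - (F + 1) * R * (F + 1)ᵀ = (-2 : ℝ) • (F * R + R * Fᵀ) := by
      rw [neg_smul, two_smul]
      simp only [Matrix.transpose_sub, Matrix.transpose_add, Matrix.transpose_one]
      noncomm_ring
    rw [h1, h2, smul_smul]
    norm_num
    abel
  rw [hkey]
  refine Matrix.PosDef.smul ?_ (by norm_num)
  rw [← Matrix.conjTranspose_eq_transpose_of_trivial]
  refine Matrix.PosDef.mul_conjTranspose_self _ ?_
  exact Matrix.vecMul_injective_of_isUnit ((Matrix.isUnit_iff_isUnit_det _).2 hunit)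

end Hurwitz

/-! ### Matrices as operators between Euclidean spaces -/

section Operators

variable {d m b p q r : ℕ}

/-- A matrix as a continuous linear map between Euclidean spaces. -/
def clm (M : Matrix (Fin p) (Fin q) ℝ) : EuclideanSpace ℝ (Fin q) →L[ℝ] EuclideanSpace ℝ (Fin p) :=
  LinearMap.toContinuousLinearMap M.toEuclideanLin

lemma ofLp_clm (M : Matrix (Fin p) (Fin q) ℝ) (x : EuclideanSpace ℝ (Fin q)) :
    (clm M x).ofLp = M *ᵥ x.ofLp := rfl

/-- Definitional, because the matrix norm in scope is the Euclidean operator norm. -/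
lemma norm_clm (M : Matrix (Fin p) (Fin q) ℝ) : ‖clm M‖ = ‖M‖ := rfl

lemma norm_clm_le (M : Matrix (Fin p) (Fin q) ℝ) (x : EuclideanSpace ℝ (Fin q)) :
    ‖clm M x‖ ≤ ‖M‖ * ‖x‖ := (clm M).le_opNorm x

lemma clm_add (M N : Matrix (Fin p) (Fin q) ℝ) : clm (M + N) = clm M + clm N := by
  simp [clm]

lemma clm_sub (M N : Matrix (Fin p) (Fin q) ℝ) : clm (M - N) = clm M - clm N := by
  simp [clm]

lemma clm_neg (M : Matrix (Fin p) (Fin q) ℝ) : clm (-M) = -clm M := by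
  simp [clm]

lemma clm_smul (c : ℝ) (M : Matrix (Fin p) (Fin q) ℝ) : clm (c • M) = c • clm M := by
  simp [clm]

lemma clm_mul (M : Matrix (Fin p) (Fin q) ℝ) (N : Matrix (Fin q) (Fin r) ℝ)
    (x : EuclideanSpace ℝ (Fin r)) : clm (M * N) x = clm M (clm N x) := by
  ext i
  simp only [ofLp_clm, Matrix.mulVec_mulVec]

lemma continuous_clm : Continuous (clm : Matrix (Fin p) (Fin q) ℝ → _) :=
  (LinearMap.mk (AddHom.mk clm clm_add) (clm_smul (p := p) (q := q))).continuous_of_finiteDimensional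

/-- `clm` as a continuous linear map. -/
def clmL : Matrix (Fin p) (Fin q) ℝ →L[ℝ]
    (EuclideanSpace ℝ (Fin q) →L[ℝ] EuclideanSpace ℝ (Fin p)) :=
  ⟨⟨⟨clm, clm_add⟩, clm_smul⟩, continuous_clm⟩

lemma clmL_apply (M : Matrix (Fin p) (Fin q) ℝ) : clmL M = clm M := rfl

lemma inner_clm (M : Matrix (Fin p) (Fin q) ℝ) (x : EuclideanSpace ℝ (Fin p))
    (y : EuclideanSpace ℝ (Fin q)) : inner ℝ x (clm M y) = x.ofLp ⬝ᵥ M *ᵥ y.ofLp := by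
  rw [EuclideanSpace.inner_eq_star_dotProduct, ofLp_clm, dotProduct_comm]
  simp

lemma inner_clm_transpose (M : Matrix (Fin p) (Fin q) ℝ) (x : EuclideanSpace ℝ (Fin p))
    (y : EuclideanSpace ℝ (Fin q)) : inner ℝ x (clm M y) = inner ℝ (clm Mᵀ x) y := by
  rw [inner_clm, real_inner_comm, EuclideanSpace.inner_eq_star_dotProduct, ofLp_clm,
    Matrix.dotProduct_mulVec, ← Matrix.mulVec_transpose]
  simp

lemma norm_transpose (M : Matrix (Fin p) (Fin q) ℝ) : ‖Mᵀ‖ = ‖M‖ := by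
  rw [← Matrix.conjTranspose_eq_transpose_of_trivial, Matrix.l2_opNorm_conjTranspose]

end Operators

/-! ### Extreme eigenvalues and coordinates adapted to a Lyapunov matrix -/

section Eigenvalues

variable {d m b : ℕ}

lemma spectrum_real_finite {M : Matrix (Fin d) (Fin d) ℝ} (hM : Mᵀ = M) :
    (spectrum ℝ M).Finite := by
  have hH : M.IsHermitian := by
    rw [Matrix.IsHermitian, Matrix.conjTranspose_eq_transpose_of_trivial, hM]
  rw [hH.spectrum_real_eq_range_eigenvalues]
  exact Set.finite_range _

lemma posSemidef_lamMax_sub {M : Matrix (Fin d) (Fin d) ℝ} (hM : Mᵀ = M) :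
    (lamMax M • (1 : Matrix (Fin d) (Fin d) ℝ) - M).PosSemidef := by
  have hH : (lamMax M • (1 : Matrix (Fin d) (Fin d) ℝ) - M).IsHermitian := by
    rw [Matrix.IsHermitian, Matrix.conjTranspose_eq_transpose_of_trivial, Matrix.transpose_sub,
      Matrix.transpose_smul, Matrix.transpose_one, hM]
  rw [Matrix.posSemidef_iff_isHermitian_and_spectrum_nonneg]
  refine ⟨hH, ?_⟩
  intro x hx
  rw [← Algebra.algebraMap_eq_smul_one, ← spectrum.singleton_sub_eq] at hx
  obtain ⟨a, rfl, y, hy, rfl⟩ := hx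
  exact sub_nonneg.2 (le_csSup (spectrum_real_finite hM).bddAbove hy)

lemma posSemidef_sub_lamMin {M : Matrix (Fin d) (Fin d) ℝ} (hM : Mᵀ = M) :
    (M - lamMin M • (1 : Matrix (Fin d) (Fin d) ℝ)).PosSemidef := by
  have hH : (M - lamMin M • (1 : Matrix (Fin d) (Fin d) ℝ)).IsHermitian := by
    rw [Matrix.IsHermitian, Matrix.conjTranspose_eq_transpose_of_trivial, Matrix.transpose_sub,
      Matrix.transpose_smul, Matrix.transpose_one, hM]
  rw [Matrix.posSemidef_iff_isHermitian_and_spectrum_nonneg]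
  refine ⟨hH, ?_⟩
  intro x hx
  rw [← Algebra.algebraMap_eq_smul_one, ← spectrum.sub_singleton_eq] at hx
  obtain ⟨y, hy, a, rfl, rfl⟩ := hx
  exact sub_nonneg.2 (csInf_le (spectrum_real_finite hM).bddBelow hy)

lemma ofLp_dotProduct_self (x : EuclideanSpace ℝ (Fin d)) : x.ofLp ⬝ᵥ x.ofLp = ‖x‖ ^ 2 := by
  rw [← real_inner_self_eq_norm_sq, EuclideanSpace.inner_eq_star_dotProduct]
  simp

lemma inner_clm_self_le {M : Matrix (Fin d) (Fin d) ℝ} (hM : Mᵀ = M)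
    (x : EuclideanSpace ℝ (Fin d)) : inner ℝ x (clm M x) ≤ lamMax M * ‖x‖ ^ 2 := by
  have := (posSemidef_real_iff.1 (posSemidef_lamMax_sub hM)).2 x.ofLp
  rw [Matrix.sub_mulVec, Matrix.smul_mulVec, Matrix.one_mulVec, dotProduct_sub, dotProduct_smul,
    ofLp_dotProduct_self, smul_eq_mul] at this
  rw [inner_clm]
  linarith

lemma le_inner_clm_self {M : Matrix (Fin d) (Fin d) ℝ} (hM : Mᵀ = M)
    (x : EuclideanSpace ℝ (Fin d)) : lamMin M * ‖x‖ ^ 2 ≤ inner ℝ x (clm M x) := by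
  have := (posSemidef_real_iff.1 (posSemidef_sub_lamMin hM)).2 x.ofLp
  rw [Matrix.sub_mulVec, Matrix.smul_mulVec, Matrix.one_mulVec, dotProduct_sub, dotProduct_smul,
    ofLp_dotProduct_self, smul_eq_mul] at this
  rw [inner_clm]
  linarith

lemma spectrum_real_pos {M : Matrix (Fin d) (Fin d) ℝ} (hM : M.PosDef) :
    ∀ x ∈ spectrum ℝ M, 0 < x := by
  intro x hx
  rw [hM.isHermitian.spectrum_real_eq_range_eigenvalues] at hx
  obtain ⟨i, rfl⟩ := hx
  exact hM.eigenvalues_pos i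

lemma spectrum_real_nonempty [NeZero d] {M : Matrix (Fin d) (Fin d) ℝ} (hM : Mᵀ = M) :
    (spectrum ℝ M).Nonempty := by
  have hH : M.IsHermitian := by
    rw [Matrix.IsHermitian, Matrix.conjTranspose_eq_transpose_of_trivial, hM]
  rw [hH.spectrum_real_eq_range_eigenvalues]
  exact Set.range_nonempty _

/-- In dimension zero the spectrum is empty and its infimum is `0` by convention, whence `NeZero d`.
-/
lemma lamMin_pos [NeZero d] {M : Matrix (Fin d) (Fin d) ℝ} (hM : M.PosDef) : 0 < lamMin M := by
  have hT := (posDef_real_iff.1 hM).1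
  exact spectrum_real_pos hM _
    ((spectrum_real_nonempty hT).csInf_mem (spectrum_real_finite hT))

lemma lamMax_pos [NeZero d] {M : Matrix (Fin d) (Fin d) ℝ} (hM : M.PosDef) : 0 < lamMax M := by
  have hT := (posDef_real_iff.1 hM).1
  exact spectrum_real_pos hM _
    ((spectrum_real_nonempty hT).csSup_mem (spectrum_real_finite hT))

lemma rateβ_pos [NeZero d] {σB : Matrix (Fin d) (Fin b) ℝ} {Q : Matrix (Fin d) (Fin d) ℝ}
    (hσB : (σB * σBᵀ).PosDef) (hQ : Q.PosDef) : 0 < rateβ σB Q :=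
  div_pos (lamMin_pos hσB) (mul_pos two_pos (lamMax_pos hQ))

open scoped MatrixOrder in
/-- A change of coordinates `N` with `Nᵀ N = Q⁻¹`, in which `F` is dissipative with rate `β` as soon
as `F Q + Q Fᵀ ⪯ -σB σBᵀ`. -/
lemma exists_lyapunov_coordinates [NeZero d] {σB : Matrix (Fin d) (Fin b) ℝ}
    {Q : Matrix (Fin d) (Fin d) ℝ} (hσB : (σB * σBᵀ).PosDef) (hQ : Q.PosDef) :
    ∃ (N : EuclideanSpace ℝ (Fin d) →L[ℝ] EuclideanSpace ℝ (Fin d)) (k₁ k₂ : ℝ),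
      0 ≤ k₁ ∧ 0 ≤ k₂ ∧ k₁ * k₂ = √(condNum Q) ∧
      (∀ x, ‖N x‖ ≤ k₁ * ‖x‖) ∧ (∀ x, ‖x‖ ≤ k₂ * ‖N x‖) ∧
      ∀ F : Matrix (Fin d) (Fin d) ℝ, (-(F * Q + Q * Fᵀ) - σB * σBᵀ).PosSemidef →
        ∀ x, inner ℝ (N x) (N (clm F x)) ≤ -rateβ σB Q * ‖N x‖ ^ 2 := by
  have hQT := (posDef_real_iff.1 hQ).1
  have hdet : IsUnit Q.det := (Matrix.isUnit_iff_isUnit_det Q).1 hQ.isUnit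
  -- Any factor of `Q⁻¹ = Bᵀ B` serves; a square root of `Q` is not needed.
  obtain ⟨B, hB⟩ := (CStarAlgebra.nonneg_iff_eq_star_mul_self
    (a := Q⁻¹)).1 (Matrix.nonneg_iff_posSemidef.2 hQ.inv.posSemidef)
  rw [Matrix.star_eq_conjTranspose, Matrix.conjTranspose_eq_transpose_of_trivial] at hB
  have hl := lamMin_pos hQ
  have hL := lamMax_pos hQ
  have hQB : ∀ x, clm Q (clm Bᵀ (clm B x)) = x := by
    intro x
    rw [← clm_mul, ← clm_mul, Matrix.mul_assoc, ← hB, Matrix.mul_nonsing_inv _ hdet]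
    ext i
    simp [ofLp_clm]
  have hBB : ∀ x, ‖clm B x‖ ^ 2 = inner ℝ x (clm Bᵀ (clm B x)) := by
    intro x
    rw [inner_clm_transpose, Matrix.transpose_transpose, real_inner_self_eq_norm_sq]
  have hyQy : ∀ x, inner ℝ (clm Bᵀ (clm B x)) (clm Q (clm Bᵀ (clm B x))) = ‖clm B x‖ ^ 2 := by
    intro x
    rw [hQB, hBB, real_inner_comm]
  refine ⟨clm B, (√(lamMin Q))⁻¹, √(lamMax Q), by positivity, by positivity, ?_, ?_, ?_, ?_⟩
  · rw [condNum, Real.sqrt_div' _ hl.le, div_eq_inv_mul]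
  · intro x
    -- With `y = Q⁻¹ x`: `lamMin Q |y|² ≤ ⟨y, Q y⟩ = |B x|² = ⟨x, y⟩ ≤ |x| |y|`.
    have h1 : lamMin Q * ‖clm Bᵀ (clm B x)‖ ^ 2 ≤ ‖clm B x‖ ^ 2 := by
      rw [← hyQy]; exact le_inner_clm_self hQT _
    have h2 : ‖clm B x‖ ^ 2 ≤ ‖x‖ * ‖clm Bᵀ (clm B x)‖ := by
      rw [hBB]; exact real_inner_le_norm _ _
    have h3 : (√(lamMin Q) * ‖clm Bᵀ (clm B x)‖) ^ 2 ≤ ‖clm B x‖ ^ 2 := by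
      rw [mul_pow, Real.sq_sqrt hl.le]; exact h1
    have h4 := (sq_le_sq₀ (by positivity) (norm_nonneg _)).1 h3
    have h5 : 0 < √(lamMin Q) := Real.sqrt_pos.2 hl
    rw [inv_mul_eq_div, le_div_iff₀ h5]
    rcases (norm_nonneg (clm B x)).eq_or_lt with h0 | h0
    · rw [← h0]; simp
    · refine le_of_mul_le_mul_right ?_ h0
      calc ‖clm B x‖ * √(lamMin Q) * ‖clm B x‖ = √(lamMin Q) * ‖clm B x‖ ^ 2 := by ring
        _ ≤ √(lamMin Q) * (‖x‖ * ‖clm Bᵀ (clm B x)‖) := by gcongr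
        _ = ‖x‖ * (√(lamMin Q) * ‖clm Bᵀ (clm B x)‖) := by ring
        _ ≤ ‖x‖ * ‖clm B x‖ := by gcongr
  · intro x
    -- Cauchy–Schwarz for `|x|² = ⟨B x, B Q x⟩`, together with `|B Q x|² = ⟨x, Q x⟩ ≤ lamMax Q
    -- |x|²`.
    have hQ2 : ‖x‖ ^ 2 ≤ lamMax Q * ‖clm B x‖ ^ 2 := by
      set y := clm Bᵀ (clm B x) with hy
      have h7 : ‖x‖ ^ 2 = inner ℝ (clm Q y) x := by rw [hQB, real_inner_self_eq_norm_sq]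
      have h8 : inner ℝ (clm Q y) x = inner ℝ y (clm Q x) := by
        rw [inner_clm_transpose, hQT]
      have h9 : inner ℝ y (clm Q x) = inner ℝ (clm B x) (clm B (clm Q x)) := by
        rw [hy, real_inner_comm, inner_clm_transpose, Matrix.transpose_transpose, real_inner_comm]
      have h10 : ‖clm B (clm Q x)‖ ^ 2 = inner ℝ x (clm Q x) := by
        rw [hBB, ← clm_mul, ← hB, ← clm_mul, Matrix.nonsing_inv_mul _ hdet, real_inner_comm]
        congr 1
        ext i
        simp [ofLp_clm]
      have h11 := inner_clm_self_le hQT x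
      have h12 : ‖x‖ ^ 2 ≤ ‖clm B x‖ * ‖clm B (clm Q x)‖ := by
        rw [h7, h8, h9]; exact real_inner_le_norm _ _
      have h13 : (‖x‖ ^ 2) ^ 2 ≤ ‖clm B x‖ ^ 2 * (lamMax Q * ‖x‖ ^ 2) := by
        calc (‖x‖ ^ 2) ^ 2 ≤ (‖clm B x‖ * ‖clm B (clm Q x)‖) ^ 2 := by gcongr
          _ = ‖clm B x‖ ^ 2 * inner ℝ x (clm Q x) := by rw [mul_pow, h10]
          _ ≤ _ := by gcongr
      rcases (sq_nonneg ‖x‖).eq_or_lt with h0 | h0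
      · rw [← h0]; positivity
      · exact le_of_mul_le_mul_right (by nlinarith) h0
    have := Real.sqrt_le_sqrt hQ2
    rwa [Real.sqrt_sq (norm_nonneg _), Real.sqrt_mul hL.le, Real.sqrt_sq (norm_nonneg _)] at this
  · intro F hF x
    set y := clm Bᵀ (clm B x) with hy
    -- With `y = Q⁻¹ x` the inner product is `⟨y, F Q y⟩`, half the form of `F Q + Q Fᵀ`, hence at
    -- most `-⟨y, σB σBᵀ y⟩ / 2`. The number `rateβ` is the ratio that compares this with `|B x|² =
    -- ⟨y, Q y⟩`.
    have h1 : inner ℝ (clm B x) (clm B (clm F x)) = inner ℝ y (clm (F * Q) y) := by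
      rw [clm_mul, hQB, inner_clm_transpose]
    have h2 := (posSemidef_real_iff.1 hF).2 y.ofLp
    rw [Matrix.sub_mulVec, Matrix.neg_mulVec, Matrix.add_mulVec, dotProduct_sub, dotProduct_neg,
      dotProduct_add, dotProduct_mulVec_comm (Q * Fᵀ), Matrix.transpose_mul,
      Matrix.transpose_transpose, hQT, ← inner_clm, ← inner_clm] at h2
    have h3 := le_inner_clm_self (posDef_real_iff.1 hσB).1 y
    have h4 : ‖clm B x‖ ^ 2 ≤ lamMax Q * ‖y‖ ^ 2 := by
      rw [← hyQy]; exact inner_clm_self_le hQT _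
    have hs := lamMin_pos hσB
    have h5 : 2 * rateβ σB Q * ‖clm B x‖ ^ 2 ≤ lamMin (σB * σBᵀ) * ‖y‖ ^ 2 := by
      rw [rateβ]
      calc 2 * (lamMin (σB * σBᵀ) / (2 * lamMax Q)) * ‖clm B x‖ ^ 2
          ≤ 2 * (lamMin (σB * σBᵀ) / (2 * lamMax Q)) * (lamMax Q * ‖y‖ ^ 2) := by gcongr
        _ = _ := by field_simp
    rw [h1]
    linarith

end Eigenvalues

/-! ### Exponential stability under exponentially decaying perturbations -/

section Stability

variable {E G : Type*} [NormedAddCommGroup E] [NormedSpace ℝ E] [CompleteSpace E]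
  [NormedAddCommGroup G] [InnerProductSpace ℝ G]

lemma hasDerivAt_of_integral_eq {u f : ℝ → E} {u₀ : E} (hf : Continuous f) {T : ℝ}
    (h : ∀ t ∈ Set.Icc 0 T, u t = u₀ + ∫ s in (0 : ℝ)..t, f s) {t : ℝ} (ht : t ∈ Set.Ioo 0 T) :
    HasDerivAt u (f t) t := by
  refine ((hasDerivAt_integral_of_continuous hf t).const_add u₀).congr_of_eventuallyEq ?_
  filter_upwards [Ioo_mem_nhds ht.1 ht.2] with s hs using h s ⟨hs.1.le, hs.2.le⟩

/-- In the norm `‖N ·‖` the drift `F₀` contracts at rate `β`, and `p` adds at most `C exp (-2 lam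
t)` to the growth rate, with total integral at most `C / (2 lam)`. So the perturbation costs a
constant factor and no rate; `k₁ k₂` is the price of passing to `‖N ·‖` and back. -/
lemma norm_le_of_dissipative {N : E →L[ℝ] G} {k₁ k₂ β c lam : ℝ} (hk₁ : 0 ≤ k₁) (hk₂ : 0 ≤ k₂)
    (hβ : 0 ≤ β) (hc : 0 ≤ c) (hlam : 0 < lam) (hN₁ : ∀ x, ‖N x‖ ≤ k₁ * ‖x‖)
    (hN₂ : ∀ x, ‖x‖ ≤ k₂ * ‖N x‖) {F₀ : E →L[ℝ] E}
    (hF₀ : ∀ x, inner ℝ (N x) (N (F₀ x)) ≤ -β * ‖N x‖ ^ 2) {p : ℝ → E →L[ℝ] E} {g u : ℝ → E}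
    (hp : Continuous p) (hg : Continuous g) (hu : Continuous u) {T : ℝ} (hT : 0 ≤ T)
    (hpc : ∀ t ∈ Set.Icc 0 T, ‖p t‖ ≤ c * Real.exp (-2 * lam * t))
    (h : ∀ t ∈ Set.Icc 0 T, u t = u 0 + ∫ s in (0 : ℝ)..t, (F₀ (u s) + p s (u s) + g s)) :
    ‖u T‖ ≤ Real.exp (-β * T) * (Real.exp (k₁ * k₂ * c / (2 * lam)) * (k₁ * k₂) *
      (‖u 0‖ + ∫ s in (0 : ℝ)..T, Real.exp (β * s) * ‖g s‖)) := by
  set C := k₁ * k₂ * c with hC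
  have hC0 : 0 ≤ C := by positivity
  -- Integrating factor: its logarithmic derivative `β - C exp (-2 lam t)` is opposite to the growth
  -- rate of `‖N u‖`.
  let q : ℝ → ℝ := fun t => Real.exp (β * t - C * (1 - Real.exp (-2 * lam * t)) / (2 * lam))
  have hq0 : q 0 = 1 := by simp [q]
  have hq : ∀ t, HasDerivAt q (q t * (β - C * Real.exp (-2 * lam * t))) t := by
    intro t
    have h1 : HasDerivAt (fun t : ℝ => Real.exp (-2 * lam * t))
        (Real.exp (-2 * lam * t) * (-2 * lam * 1)) t :=
      ((hasDerivAt_id t).const_mul (-2 * lam)).exp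
    have h2 : HasDerivAt q (q t * (β * 1 - C * -(Real.exp (-2 * lam * t) * (-2 * lam * 1)) /
        (2 * lam))) t :=
      (((hasDerivAt_id t).const_mul β).sub (((h1.const_sub 1).const_mul C).div_const (2 * lam))).exp
    have h3 : β * 1 - C * -(Real.exp (-2 * lam * t) * (-2 * lam * 1)) / (2 * lam) =
        β - C * Real.exp (-2 * lam * t) := by
      generalize Real.exp (-2 * lam * t) = e
      field_simp
    rwa [h3] at h2
  have hqle : ∀ t, 0 ≤ t → q t ≤ Real.exp (β * t) := by
    intro t ht
    apply Real.exp_le_exp.2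
    have h1 : Real.exp (-2 * lam * t) ≤ 1 := Real.exp_le_one_iff.2 (by nlinarith)
    have : 0 ≤ C * (1 - Real.exp (-2 * lam * t)) / (2 * lam) :=
      div_nonneg (mul_nonneg hC0 (by linarith)) (by linarith)
    linarith
  have hcontF : Continuous fun s => F₀ (u s) + p s (u s) + g s := by fun_prop
  have hder : ∀ t ∈ Set.Ioo 0 T, HasDerivAt u (F₀ (u t) + p t (u t) + g t) t :=
    fun t ht => hasDerivAt_of_integral_eq hcontF h ht
  have key : ∀ ε > 0, ‖N (u T)‖ * q T ≤ (k₁ * ‖u 0‖ +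
      k₁ * ∫ s in (0 : ℝ)..T, Real.exp (β * s) * ‖g s‖) +
      ε * (1 + ∫ s in (0 : ℝ)..T, Real.exp (β * s) * β) := by
    intro ε hε
    -- Smoothed norm, differentiable also where `N (u t)` vanishes; `ε` tends to zero afterwards.
    let w : ℝ → ℝ := fun t => √(‖N (u t)‖ ^ 2 + ε ^ 2)
    have hwpos : ∀ t, 0 < ‖N (u t)‖ ^ 2 + ε ^ 2 := fun t => by positivity
    have hw0 : ∀ t, 0 < w t := fun t => Real.sqrt_pos.2 (hwpos t)
    have hwsq : ∀ t, w t ^ 2 = ‖N (u t)‖ ^ 2 + ε ^ 2 := fun t => Real.sq_sqrt (hwpos t).le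
    have hεw : ∀ t, ε ≤ w t := fun t => Real.le_sqrt_of_sq_le (by nlinarith [sq_nonneg ‖N (u t)‖])
    have hNw : ∀ t, ‖N (u t)‖ ≤ w t := fun t => Real.le_sqrt_of_sq_le (by nlinarith [sq_nonneg ε])
    have hwcont : Continuous w := by fun_prop
    let φ : ℝ → ℝ := fun t => w t * q t -
      ∫ s in (0 : ℝ)..t, (Real.exp (β * s) * β * ε + k₁ * (Real.exp (β * s) * ‖g s‖))
    have hic : Continuous fun s => Real.exp (β * s) * β * ε + k₁ * (Real.exp (β * s) * ‖g s‖) := by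
      fun_prop
    have hw' : ∀ t ∈ Set.Ioo 0 T, HasDerivAt w
        (2 * inner ℝ (N (u t)) (N (F₀ (u t) + p t (u t) + g t)) / (2 * w t)) t := by
      intro t ht
      have h1 := ((N.hasFDerivAt.comp_hasDerivAt t (hder t ht)).norm_sq).add_const (ε ^ 2)
      exact h1.sqrt (hwpos t).ne'
    have hφ' : ∀ t ∈ Set.Ioo 0 T, HasDerivAt φ
        (2 * inner ℝ (N (u t)) (N (F₀ (u t) + p t (u t) + g t)) / (2 * w t) * q t +
          w t * (q t * (β - C * Real.exp (-2 * lam * t))) -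
          (Real.exp (β * t) * β * ε + k₁ * (Real.exp (β * t) * ‖g t‖))) t := fun t ht =>
      ((hw' t ht).mul (hq t)).sub (hasDerivAt_integral_of_continuous hic t)
    have hqcont : Continuous q := continuous_iff_continuousAt.2 fun t => (hq t).continuousAt
    have hanti : AntitoneOn φ (Set.Icc 0 T) := by
      refine antitoneOn_of_deriv_nonpos (convex_Icc _ _)
        ((hwcont.mul hqcont).sub (intervalIntegral.continuous_primitive
          (fun _ _ => hic.intervalIntegrable _ _) 0)).continuousOn
        (fun t ht => ?_) fun t ht => ?_
      · rw [interior_Icc] at ht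
        exact (hφ' t ht).differentiableAt.differentiableWithinAt
      rw [interior_Icc] at ht
      rw [(hφ' t ht).deriv]
      have htI : t ∈ Set.Icc 0 T := ⟨ht.1.le, ht.2.le⟩
      set z := ‖N (u t)‖ with hz
      have hz0 : 0 ≤ z := norm_nonneg _
      have i1 := hF₀ (u t)
      have i2 : inner ℝ (N (u t)) (N (p t (u t))) ≤ z * (C * Real.exp (-2 * lam * t) * z) := by
        refine (real_inner_le_norm _ _).trans (mul_le_mul_of_nonneg_left ?_ hz0)
        calc ‖N (p t (u t))‖ ≤ k₁ * ‖p t (u t)‖ := hN₁ _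
          _ ≤ k₁ * (c * Real.exp (-2 * lam * t) * (k₂ * z)) := by
            gcongr
            exact ((p t).le_opNorm _).trans
              (mul_le_mul (hpc t htI) (hN₂ _) (norm_nonneg _) (by positivity))
          _ = _ := by rw [hC]; ring
      have i3 : inner ℝ (N (u t)) (N (g t)) ≤ z * (k₁ * ‖g t‖) :=
        (real_inner_le_norm _ _).trans (mul_le_mul_of_nonneg_left (hN₁ _) hz0)
      have hinner : inner ℝ (N (u t)) (N (F₀ (u t) + p t (u t) + g t)) ≤
          -β * z ^ 2 + z * (C * Real.exp (-2 * lam * t) * z) + z * (k₁ * ‖g t‖) := by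
        rw [map_add, map_add, inner_add_right, inner_add_right]
        linarith
      have hwt := hw0 t
      have hzw := hNw t
      have hb : 2 * inner ℝ (N (u t)) (N (F₀ (u t) + p t (u t) + g t)) / (2 * w t) ≤
          (-β + C * Real.exp (-2 * lam * t)) * w t + β * ε + k₁ * ‖g t‖ := by
        rw [div_le_iff₀ (by positivity)]
        have j1 : z * (C * Real.exp (-2 * lam * t) * z) ≤
            C * Real.exp (-2 * lam * t) * w t ^ 2 := by
          have : z ^ 2 ≤ w t ^ 2 := by gcongr
          calc z * (C * Real.exp (-2 * lam * t) * z) = C * Real.exp (-2 * lam * t) * z ^ 2 := by ring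
            _ ≤ _ := by gcongr
        have j2 : z * (k₁ * ‖g t‖) ≤ w t * (k₁ * ‖g t‖) := by gcongr
        -- Since `z² = w² - ε²` and `ε ≤ w`, smoothing costs only `β ε w`.
        have j3 : -β * z ^ 2 ≤ -β * w t ^ 2 + β * ε * w t := by
          have : z ^ 2 = w t ^ 2 - ε ^ 2 := by rw [hwsq]; ring
          rw [this]
          have := hεw t
          have := mul_le_mul_of_nonneg_left (mul_le_mul_of_nonneg_left this hε.le) hβ
          nlinarith
        nlinarith
      have hqt : 0 < q t := Real.exp_pos _
      have hql := hqle t ht.1.le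
      have hpos : 0 ≤ β * ε + k₁ * ‖g t‖ := by positivity
      calc _ ≤ ((-β + C * Real.exp (-2 * lam * t)) * w t + β * ε + k₁ * ‖g t‖) * q t +
          w t * (q t * (β - C * Real.exp (-2 * lam * t))) -
          (Real.exp (β * t) * β * ε + k₁ * (Real.exp (β * t) * ‖g t‖)) := by gcongr
        _ = (β * ε + k₁ * ‖g t‖) * (q t - Real.exp (β * t)) := by ring
        _ ≤ 0 := mul_nonpos_of_nonneg_of_nonpos hpos (by linarith)
    have h1 := hanti ⟨le_rfl, hT⟩ ⟨hT, le_rfl⟩ hT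
    simp only [φ, hq0, intervalIntegral.integral_same, mul_one, sub_zero] at h1
    rw [intervalIntegral.integral_add (Continuous.intervalIntegrable (by fun_prop) _ _)
      (Continuous.intervalIntegrable (by fun_prop) _ _), intervalIntegral.integral_const_mul,
      intervalIntegral.integral_mul_const] at h1
    have h2 : w 0 ≤ k₁ * ‖u 0‖ + ε := by
      refine (Real.sqrt_le_sqrt (y := (‖N (u 0)‖ + ε) ^ 2) ?_).trans ?_
      · nlinarith [norm_nonneg (N (u 0))]
      · rw [Real.sqrt_sq (by positivity)]
        linarith [hN₁ (u 0)]
    have h3 : ‖N (u T)‖ * q T ≤ w T * q T :=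
      mul_le_mul_of_nonneg_right (hNw T) (Real.exp_pos _).le
    linarith
  have hI0 : 0 ≤ ∫ s in (0 : ℝ)..T, Real.exp (β * s) * β :=
    intervalIntegral.integral_nonneg hT fun s _ => by positivity
  have hI1 : 0 ≤ ∫ s in (0 : ℝ)..T, Real.exp (β * s) * ‖g s‖ :=
    intervalIntegral.integral_nonneg hT fun s _ => by positivity
  have hlim : ‖N (u T)‖ * q T ≤ k₁ * ‖u 0‖ +
      k₁ * ∫ s in (0 : ℝ)..T, Real.exp (β * s) * ‖g s‖ := by
    refine le_of_forall_pos_le_add fun δ hδ => ?_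
    have h1 := key (δ / (1 + ∫ s in (0 : ℝ)..T, Real.exp (β * s) * β)) (by positivity)
    rwa [div_mul_cancel₀ _ (by positivity)] at h1
  have hqinv : Real.exp (-β * T) * Real.exp (C / (2 * lam)) * q T ≥ 1 := by
    rw [← Real.exp_add, ← Real.exp_add]
    apply Real.one_le_exp
    have h1 : 0 ≤ C * Real.exp (-2 * lam * T) / (2 * lam) := by positivity
    have h2 : C * (1 - Real.exp (-2 * lam * T)) / (2 * lam) =
      C / (2 * lam) - C * Real.exp (-2 * lam * T) / (2 * lam) := by ring
    rw [h2]
    linarith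
  have hNu : ‖N (u T)‖ ≤ Real.exp (-β * T) * Real.exp (C / (2 * lam)) *
      (k₁ * ‖u 0‖ + k₁ * ∫ s in (0 : ℝ)..T, Real.exp (β * s) * ‖g s‖) := by
    calc ‖N (u T)‖ = ‖N (u T)‖ * 1 := (mul_one _).symm
      _ ≤ ‖N (u T)‖ * (Real.exp (-β * T) * Real.exp (C / (2 * lam)) * q T) := by gcongr
      _ = Real.exp (-β * T) * Real.exp (C / (2 * lam)) * (‖N (u T)‖ * q T) := by ring
      _ ≤ _ := by gcongr
  calc ‖u T‖ ≤ k₂ * ‖N (u T)‖ := hN₂ _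
    _ ≤ k₂ * (Real.exp (-β * T) * Real.exp (C / (2 * lam)) *
      (k₁ * ‖u 0‖ + k₁ * ∫ s in (0 : ℝ)..T, Real.exp (β * s) * ‖g s‖)) := by gcongr
    _ = _ := by ring

end Stability

/-! ### The differential Riccati equation -/

section Riccati

variable {d m b : ℕ} {A : Matrix (Fin d) (Fin d) ℝ} {H : Matrix (Fin m) (Fin d) ℝ}
  {σB : Matrix (Fin d) (Fin b) ℝ} {S₀ : Matrix (Fin d) (Fin d) ℝ}
  {S S' : ℝ → Matrix (Fin d) (Fin d) ℝ}

/-- Composing with `max t 0` extends the flow continuously to all of `ℝ`, so that later integrals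
and linear equations involve globally continuous coefficients. -/
lemma IsDRESolution.continuous_max (hS : IsDRESolution A H σB S₀ S) :
    Continuous fun t => S (max t 0) := by
  have : ContinuousOn S (Set.Ici 0) := fun t ht => (hS.2 t ht).continuousWithinAt
  exact this.comp_continuous (by fun_prop) fun t => le_max_right t 0

lemma IsDRESolution.hasDerivAt (hS : IsDRESolution A H σB S₀ S) {t : ℝ} (ht : 0 < t) :
    HasDerivAt S (ricc A H σB (S t)) t :=
  (hS.2 t ht.le).hasDerivAt (Ici_mem_nhds ht)

lemma IsDRESolution.hasDerivAt_max (hS : IsDRESolution A H σB S₀ S) {t : ℝ} (ht : 0 < t) :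
    HasDerivAt (fun t => S (max t 0)) (ricc A H σB (S t)) t := by
  refine (hS.hasDerivAt ht).congr_of_eventuallyEq ?_
  filter_upwards [Ioi_mem_nhds ht] with s hs using by rw [max_eq_left (le_of_lt hs)]

lemma continuous_ricc : Continuous (ricc A H σB) := by
  unfold ricc; fun_prop

lemma integral_eq_sub_of_hasDerivAt_Ioi {V : Type*} [NormedAddCommGroup V] [NormedSpace ℝ V]
    [CompleteSpace V] {f f' : ℝ → V} (hf : Continuous f) (hf' : Continuous f')
    (h : ∀ t, 0 < t → HasDerivAt f (f' t) t) {s t : ℝ} (hs : 0 ≤ s) (hst : s ≤ t) :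
    f t = f s + ∫ r in s..t, f' r := by
  rw [intervalIntegral.integral_eq_sub_of_hasDerivAt_of_le hst hf.continuousOn
    (fun r hr => h r (hs.trans_lt hr.1)) (hf'.intervalIntegrable _ _)]
  abel

lemma IsDRESolution.eq_integral (hS : IsDRESolution A H σB S₀ S) {t : ℝ} (ht : 0 ≤ t) :
    S (max t 0) = S₀ + ∫ s in (0 : ℝ)..t, ricc A H σB (S (max s 0)) := by
  have h := integral_eq_sub_of_hasDerivAt_Ioi (f' := fun s => ricc A H σB (S (max s 0)))
    hS.continuous_max (continuous_ricc.comp hS.continuous_max)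
    (fun t ht => by simpa only [max_eq_left ht.le] using hS.hasDerivAt_max ht) le_rfl ht
  rw [h, max_self, hS.1]

/-- The operator `X ↦ M X + X N` on matrices. -/
def sylv (M N : Matrix (Fin d) (Fin d) ℝ) :
    Matrix (Fin d) (Fin d) ℝ →L[ℝ] Matrix (Fin d) (Fin d) ℝ :=
  ContinuousLinearMap.mul ℝ _ M + (ContinuousLinearMap.mul ℝ _).flip N

lemma sylv_apply (M N X : Matrix (Fin d) (Fin d) ℝ) : sylv M N X = M * X + X * N := rfl

lemma continuous_sylv {M N : ℝ → Matrix (Fin d) (Fin d) ℝ} (hM : Continuous M)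
    (hN : Continuous N) : Continuous fun t => sylv (M t) (N t) := by
  unfold sylv; fun_prop

/-- For `D = S - S'` one has `ricc S - ricc S' = (A - S Hᵀ H) D + D (Aᵀ - Hᵀ H S')`, so `D` solves a
homogeneous linear equation. Symmetry is not assumed, which allows the use for transposes. -/
lemma IsDRESolution.unique (hS : IsDRESolution A H σB S₀ S) (hS' : IsDRESolution A H σB S₀ S')
    {t : ℝ} (ht : 0 ≤ t) : S t = S' t := by
  have hc := hS.continuous_max
  have hc' := hS'.continuous_max
  have hr : Continuous fun s => ricc A H σB (S (max s 0)) := continuous_ricc.comp hc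
  have hr' : Continuous fun s => ricc A H σB (S' (max s 0)) := continuous_ricc.comp hc'
  have h := volterra_unique (F := Matrix (Fin d) (Fin d) ℝ) (T := t) (n := fun _ => 0)
    (a := fun t => sylv (A - S (max t 0) * (Hᵀ * H)) (Aᵀ - (Hᵀ * H) * S' (max t 0)))
    (u := fun t => S (max t 0) - S' (max t 0)) (v := fun _ => 0)
    (continuous_sylv (continuous_const.sub (hc.mul continuous_const))
      (continuous_const.sub (continuous_const.mul hc'))) (hc.sub hc')
    continuous_const (fun s hs => by
      rw [hS.eq_integral hs.1, hS'.eq_integral hs.1, add_sub_add_left_eq_sub,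
        ← intervalIntegral.integral_sub (hr.intervalIntegrable _ _)
        (hr'.intervalIntegrable _ _), zero_add]
      congr 1
      ext1 r
      simp only [sylv_apply, ricc, Matrix.mul_sub, Matrix.sub_mul, Matrix.mul_assoc]
      abel)
    (fun s hs => by simp) t ⟨ht, le_rfl⟩
  simpa [max_eq_left ht, sub_eq_zero] using h

lemma ricc_transpose (Q : Matrix (Fin d) (Fin d) ℝ) : (ricc A H σB Q)ᵀ = ricc A H σB Qᵀ := by
  simp only [ricc, Matrix.transpose_add, Matrix.transpose_sub, Matrix.transpose_mul,
    Matrix.transpose_transpose, Matrix.mul_assoc]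
  abel

lemma IsDRESolution.transpose_eq (hS : IsDRESolution A H σB S₀ S) (hS₀ : S₀ᵀ = S₀) {t : ℝ}
    (ht : 0 ≤ t) : (S t)ᵀ = S t := by
  have : IsDRESolution A H σB S₀ fun t => (S t)ᵀ := by
    refine ⟨by simp [hS.1, hS₀], fun t ht => ?_⟩
    rw [← ricc_transpose]
    let T : Matrix (Fin d) (Fin d) ℝ →L[ℝ] Matrix (Fin d) (Fin d) ℝ :=
      ⟨(Matrix.transposeLinearEquiv (Fin d) (Fin d) ℝ ℝ).toLinearMap, by
        change Continuous fun M : Matrix (Fin d) (Fin d) ℝ => Mᵀ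
        fun_prop⟩
    exact T.hasFDerivAt.comp_hasDerivWithinAt t (hS.2 t ht)
  exact this.unique hS ht

/-- The linear drift for which the Riccati equation reads `S' = a S + S aᵀ + σB σBᵀ`. -/
def halfDrift (A : Matrix (Fin d) (Fin d) ℝ) (H : Matrix (Fin m) (Fin d) ℝ)
    (Q : Matrix (Fin d) (Fin d) ℝ) : Matrix (Fin d) (Fin d) ℝ :=
  A - (1 / 2 : ℝ) • (Q * Hᵀ * H)

lemma continuous_halfDrift (A : Matrix (Fin d) (Fin d) ℝ) (H : Matrix (Fin m) (Fin d) ℝ) :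
    Continuous (halfDrift A H) := by
  unfold halfDrift; fun_prop

lemma ricc_eq_halfDrift {Q : Matrix (Fin d) (Fin d) ℝ} (hQ : Qᵀ = Q) :
    ricc A H σB Q = halfDrift A H Q * Q + Q * (halfDrift A H Q)ᵀ + σB * σBᵀ := by
  have h : Q * Hᵀ * H * Q = (1 / 2 : ℝ) • (Q * Hᵀ * H * Q) + (1 / 2 : ℝ) • (Q * Hᵀ * H * Q) := by
    rw [← add_smul]; norm_num
  rw [ricc, h]
  simp only [halfDrift, Matrix.transpose_sub, Matrix.transpose_smul, Matrix.transpose_mul,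
    Matrix.transpose_transpose, hQ, Matrix.sub_mul, Matrix.mul_sub, Matrix.smul_mul,
    Matrix.mul_smul, Matrix.mul_assoc]
  abel

/-- Duality. Along the adjoint flow started at `x` and run backwards from `T`, the form `⟨y, S (T -
r) y⟩` has derivative `-⟨y, σB σBᵀ y⟩ ≤ 0`; it starts at `⟨x, S T x⟩` and ends at a value of the
form of `S₀`. -/
lemma IsDRESolution.posSemidef (hS : IsDRESolution A H σB S₀ S) (hS₀ : S₀.PosSemidef)
    {T : ℝ} (hT : 0 ≤ T) : (S T).PosSemidef := by
  have hsym : ∀ t, 0 ≤ t → (S t)ᵀ = S t := fun t =>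
    hS.transpose_eq (posSemidef_real_iff.1 hS₀).1
  rw [posSemidef_real_iff]
  refine ⟨hsym T hT, fun x => ?_⟩
  let a : ℝ → EuclideanSpace ℝ (Fin d) →L[ℝ] EuclideanSpace ℝ (Fin d) := fun r =>
    clm (halfDrift A H (S (max (T - r) 0)))ᵀ
  have hSc := hS.continuous_max
  have hSc' : Continuous fun r => S (max (T - r) 0) :=
    hSc.comp (continuous_const.sub continuous_id)
  have ha : Continuous a :=
    continuous_clm.comp (((continuous_halfDrift A H).comp hSc').matrix_transpose)
  let y := linSol a fun _ => WithLp.toLp 2 x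
  have hy : Continuous y := continuous_linSol ha continuous_const
  have hy0 : y 0 = WithLp.toLp 2 x := by
    simp only [y]
    rw [linSol_eq ha continuous_const le_rfl, intervalIntegral.integral_same, add_zero]
  have hyd : ∀ t ∈ Set.Ioo 0 T, HasDerivAt y (a t (y t)) t := fun t ht =>
    hasDerivAt_of_integral_eq (u₀ := WithLp.toLp 2 x) (f := fun t => a t (y t))
      (ha.clm_apply hy) (fun t ht => linSol_eq ha continuous_const ht.1) ht
  let g : ℝ → ℝ := fun r => inner ℝ (y r) (clm (S (max (T - r) 0)) (y r))
  have hgd : ∀ t ∈ Set.Ioo 0 T, HasDerivAt g (-inner ℝ (y t) (clm (σB * σBᵀ) (y t))) t := by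
    intro t ht
    have hTt : 0 < T - t := sub_pos.2 ht.2
    have h1 : HasDerivAt (fun r => S (max (T - r) 0)) (-ricc A H σB (S (T - t))) t := by
      have := (hS.hasDerivAt_max hTt).scomp t ((hasDerivAt_id t).const_sub T)
      rw [neg_one_smul] at this
      exact this
    have h2 := (hyd t ht).inner ℝ
      ((clmL.hasFDerivAt.comp_hasDerivAt t h1).clm_apply (hyd t ht))
    refine h2.congr_deriv ?_
    simp only [Function.comp_apply, clmL_apply, max_eq_left hTt.le, a]
    rw [ricc_eq_halfDrift (hsym _ hTt.le), clm_neg, clm_add, clm_add]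
    set y' := y t
    set Q := S (T - t)
    simp only [neg_apply, add_apply, inner_add_right,
      inner_neg_right, clm_mul]
    rw [← inner_clm_transpose]
    ring
  have hgc : Continuous g := hy.inner ((continuous_clm.comp hSc').clm_apply hy)
  have hanti : AntitoneOn g (Set.Icc 0 T) := by
    refine antitoneOn_of_deriv_nonpos (convex_Icc _ _) hgc.continuousOn (fun t ht => ?_)
      fun t ht => ?_
    · rw [interior_Icc] at ht
      exact (hgd t ht).differentiableAt.differentiableWithinAt
    · rw [interior_Icc] at ht
      rw [(hgd t ht).deriv, inner_clm]
      exact neg_nonpos.2 ((posSemidef_real_iff.1 (posSemidef_mul_transpose σB)).2 _)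
  have h := hanti ⟨le_rfl, hT⟩ ⟨hT, le_rfl⟩ hT
  simp only [g, hy0, sub_self, max_self, sub_zero, max_eq_left hT, inner_clm, hS.1] at h
  exact ((posSemidef_real_iff.1 hS₀).2 _).trans h

/-- If `S T x = 0`, then `⟨x, S t x⟩` has an interior minimum at `T`, yet its derivative there is
`⟨x, σB σBᵀ x⟩ > 0`. -/
lemma IsDRESolution.posDef (hS : IsDRESolution A H σB S₀ S) (hσB : (σB * σBᵀ).PosDef)
    (hS₀ : S₀.PosSemidef) {T : ℝ} (hT : 0 < T) : (S T).PosDef := by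
  have hpsd := hS.posSemidef hS₀ hT.le
  have hpsd' := posSemidef_real_iff.1 hpsd
  rw [posDef_real_iff]
  refine ⟨hpsd'.1, fun x hx => lt_of_le_of_ne (hpsd'.2 x) fun h => ?_⟩
  have hker := mulVec_eq_zero_of_posSemidef hpsd h.symm
  have hmin : IsLocalMin (fun t => x ⬝ᵥ S t *ᵥ x) T := by
    filter_upwards [Ioi_mem_nhds hT] with t ht
    rw [← h]
    exact (posSemidef_real_iff.1 (hS.posSemidef hS₀ (le_of_lt ht))).2 x
  let L : Matrix (Fin d) (Fin d) ℝ →L[ℝ] ℝ :=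
    ⟨{ toFun := fun M => x ⬝ᵥ M *ᵥ x
       map_add' := by intro M N; rw [Matrix.add_mulVec, dotProduct_add]
       map_smul' := by intro c M; rw [Matrix.smul_mulVec, dotProduct_smul]; rfl }, by
      change Continuous fun M : Matrix (Fin d) (Fin d) ℝ => x ⬝ᵥ M *ᵥ x
      fun_prop⟩
  have hd : HasDerivAt (fun t => x ⬝ᵥ S t *ᵥ x) (x ⬝ᵥ (ricc A H σB (S T)) *ᵥ x) T :=
    L.hasFDerivAt.comp_hasDerivAt T (hS.hasDerivAt hT)
  have h0 := hmin.hasDerivAt_eq_zero hd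
  have h3 : x ⬝ᵥ (ricc A H σB (S T)) *ᵥ x = x ⬝ᵥ (σB * σBᵀ) *ᵥ x := by
    simp only [ricc, Matrix.sub_mulVec, Matrix.add_mulVec, dotProduct_sub, dotProduct_add]
    rw [← Matrix.mulVec_mulVec x A, ← Matrix.mulVec_mulVec x (S T * Hᵀ * H) (S T), hker,
      ← Matrix.mulVec_mulVec x (S T), dotProduct_mulVec_comm (S T), hpsd'.1, hker]
    simp
  have := (posDef_real_iff.1 hσB).2 x hx
  linarith

end Riccati

/-! ### Exponential convergence of the Riccati flow -/

section RiccatiDecay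

variable {d m b : ℕ} {A : Matrix (Fin d) (Fin d) ℝ} {H : Matrix (Fin m) (Fin d) ℝ}
  {σB : Matrix (Fin d) (Fin b) ℝ} {S₀ : Matrix (Fin d) (Fin d) ℝ}
  {S : ℝ → Matrix (Fin d) (Fin d) ℝ}

open scoped MatrixOrder in
lemma trace_mul_nonneg {M N : Matrix (Fin d) (Fin d) ℝ} (hM : M.PosSemidef) (hN : N.PosSemidef) :
    0 ≤ (M * N).trace := by
  obtain ⟨B, hB⟩ := (CStarAlgebra.nonneg_iff_eq_star_mul_self
    (a := N)).1 (Matrix.nonneg_iff_posSemidef.2 hN)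
  rw [Matrix.star_eq_conjTranspose, Matrix.conjTranspose_eq_transpose_of_trivial] at hB
  rw [hB, ← Matrix.mul_assoc, Matrix.trace_mul_comm, ← Matrix.mul_assoc]
  exact (posSemidef_conj hM B).trace_nonneg

/-- The distance-like function `tr(S⁻¹ (S - Q) Q⁻¹ (S - Q))`. -/
def riccDist (Q S : Matrix (Fin d) (Fin d) ℝ) : ℝ := (S⁻¹ * (S - Q) * Q⁻¹ * (S - Q)).trace

/-- In this form the function is linear in `S` and in `S⁻¹`, which makes its derivative along the
flow immediate. -/
lemma riccDist_eq {Q S : Matrix (Fin d) (Fin d) ℝ} (hQ : Q.PosDef) (hS : S.PosDef) :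
    riccDist Q S = (Q⁻¹ * S).trace + (S⁻¹ * Q).trace - 2 * d := by
  have hq : Q⁻¹ * Q = 1 := Matrix.nonsing_inv_mul _ ((Matrix.isUnit_iff_isUnit_det _).1 hQ.isUnit)
  have hs : S⁻¹ * S = 1 := Matrix.nonsing_inv_mul _ ((Matrix.isUnit_iff_isUnit_det _).1 hS.isUnit)
  have hq' : Q * Q⁻¹ = 1 := Matrix.mul_nonsing_inv _ ((Matrix.isUnit_iff_isUnit_det _).1 hQ.isUnit)
  have : S⁻¹ * (S - Q) * Q⁻¹ * (S - Q) = Q⁻¹ * S + S⁻¹ * Q - 1 - 1 := by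
    simp only [Matrix.mul_sub, Matrix.sub_mul, hs, Matrix.one_mul]
    rw [hq, Matrix.mul_assoc S⁻¹ Q, hq', Matrix.mul_one, hs]
    abel
  rw [riccDist, this, Matrix.trace_sub, Matrix.trace_sub, Matrix.trace_add, Matrix.trace_one]
  simp
  ring

lemma hasDerivAt_inv_matrix {f : ℝ → Matrix (Fin d) (Fin d) ℝ} {f' : Matrix (Fin d) (Fin d) ℝ}
    {t : ℝ} (hf : HasDerivAt f f' t) (hu : IsUnit (f t)) :
    HasDerivAt (fun t => (f t)⁻¹) (-((f t)⁻¹ * f' * (f t)⁻¹)) t := by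
  obtain ⟨u, hu⟩ := hu
  have h1 := (hasFDerivAt_ringInverse (𝕜 := ℝ) u)
  rw [hu] at h1
  have h2 := h1.comp_hasDerivAt t hf
  have h3 : (↑u⁻¹ : Matrix (Fin d) (Fin d) ℝ) = (f t)⁻¹ := by
    rw [← hu, Matrix.coe_units_inv]
  rw [h3] at h2
  have h4 : (fun t => (f t)⁻¹) = Ring.inverse ∘ f := by
    funext t; simp [Matrix.nonsing_inv_eq_ringInverse]
  rw [h4]
  exact h2

/-- The trace as a continuous linear map. -/
def traceL : Matrix (Fin d) (Fin d) ℝ →L[ℝ] ℝ :=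
  ⟨Matrix.traceLinearMap (Fin d) ℝ ℝ, continuous_id.matrix_trace⟩

/-- The derivative of `riccDist Q` along the Riccati flow. -/
lemma riccDist_deriv_le {Q S : Matrix (Fin d) (Fin d) ℝ}
    (hQ : IsARESolution A H σB Q) (hS : S.PosDef) {μ ν : ℝ}
    (hμ : (σB * σBᵀ - μ • Q).PosSemidef) (hν : (σB * σBᵀ - ν • S).PosSemidef) :
    (Q⁻¹ * ricc A H σB S).trace + (-(S⁻¹ * ricc A H σB S * S⁻¹) * Q).trace ≤
      -(μ + ν) * riccDist Q S := by
  have hQT := (posDef_real_iff.1 hQ.1).1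
  have hST := (posDef_real_iff.1 hS).1
  have hdQ := (Matrix.isUnit_iff_isUnit_det _).1 hQ.1.isUnit
  have hdS := (Matrix.isUnit_iff_isUnit_det _).1 hS.isUnit
  have hare := hQ.2
  have hQpd := hQ.1
  clear hQ
  set Y := Q⁻¹ with hY
  set X := S⁻¹ with hX
  have hYT : Yᵀ = Y := by rw [hY, Matrix.transpose_nonsing_inv, hQT]
  have hXT : Xᵀ = X := by rw [hX, Matrix.transpose_nonsing_inv, hST]
  have hYQ : Y * Q = 1 := Matrix.nonsing_inv_mul _ hdQ
  have hQY : Q * Y = 1 := Matrix.mul_nonsing_inv _ hdQ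
  have hXS : X * S = 1 := Matrix.nonsing_inv_mul _ hdS
  have hSX : S * X = 1 := Matrix.mul_nonsing_inv _ hdS
  set K := Hᵀ * H with hK
  set Θ := σB * σBᵀ with hΘ
  have hKp : K.PosSemidef := posSemidef_transpose_mul H
  have hricc : ∀ R, ricc A H σB R = A * R + R * Aᵀ + Θ - R * K * R := by
    intro R; simp only [ricc, hK, hΘ, Matrix.mul_assoc]
  rw [hricc] at hare ⊢
  have cancel : ∀ {U V : Matrix (Fin d) (Fin d) ℝ}, U * V = 1 → ∀ R, U * (V * R) = R :=
    fun h R => by rw [← Matrix.mul_assoc, h, Matrix.one_mul]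
  -- the Riccati equation for the inverse
  have hare' : Y * A + Aᵀ * Y = K - Y * Θ * Y := by
    have h1 : Y * (A * Q + Q * Aᵀ + Θ - Q * K * Q) * Y = Y * A + Aᵀ * Y + Y * Θ * Y - K := by
      simp only [Matrix.mul_add, Matrix.mul_sub, Matrix.add_mul, Matrix.sub_mul, Matrix.mul_assoc,
        hQY, cancel hYQ, Matrix.mul_one]
    rw [hare, Matrix.mul_zero, Matrix.zero_mul] at h1
    rw [eq_comm, ← sub_eq_zero, ← neg_eq_zero, h1]
    abel
  have hare'' : A * Q + Q * Aᵀ = Q * K * Q - Θ := by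
    rw [eq_comm, ← sub_eq_zero, ← neg_eq_zero, ← hare]
    abel
  -- Goal: the derivative equals `-tr(Θ G (S + Q) G) - tr(K D (X + Y) D)` with `G = Q⁻¹ - S⁻¹` and
  -- `D = S - Q`. The matrix `A` is eliminated by the Riccati equation for `Q` and its counterpart
  -- for `Q⁻¹`.
  set G := Y - X with hG
  have hGT : Gᵀ = G := by rw [hG, Matrix.transpose_sub, hYT, hXT]
  set D := S - Q with hD
  have hDT : Dᵀ = D := by rw [hD, Matrix.transpose_sub, hST, hQT]
  have trT : ∀ M : Matrix (Fin d) (Fin d) ℝ, Mᵀ.trace = M.trace := Matrix.trace_transpose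
  have e1 : (Y * (A * S)).trace * 2 = (K * S).trace - (Y * Θ * Y * S).trace := by
    have h1 : (Aᵀ * Y * S).trace = (Y * (A * S)).trace := by
      rw [← trT (Aᵀ * Y * S)]
      simp only [Matrix.transpose_mul, hST, hYT, Matrix.transpose_transpose]
      rw [Matrix.trace_mul_comm, Matrix.mul_assoc]
    have h2 := congrArg (fun M => (M * S).trace) hare'
    simp only [Matrix.add_mul, Matrix.sub_mul, Matrix.trace_add, Matrix.trace_sub, h1] at h2
    rw [Matrix.mul_assoc Y A S] at h2
    linarith
  have e2 : (X * (A * Q)).trace * 2 = (X * (Q * K * Q)).trace - (X * Θ).trace := by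
    have h1 : (X * (Q * Aᵀ)).trace = (X * (A * Q)).trace := by
      rw [← trT (X * (Q * Aᵀ))]
      simp only [Matrix.transpose_mul, hQT, hXT, Matrix.transpose_transpose]
      rw [Matrix.trace_mul_comm]
    have h2 := congrArg (fun M => (X * M).trace) hare''
    simp only [Matrix.mul_add, Matrix.mul_sub, Matrix.trace_add, Matrix.trace_sub, h1] at h2
    linarith
  have e3 : (Y * (S * Aᵀ)).trace = (Y * (A * S)).trace := by
    rw [← trT (Y * (S * Aᵀ))]
    simp only [Matrix.transpose_mul, hYT, hST, Matrix.transpose_transpose]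
    rw [Matrix.trace_mul_comm]
  have e4 : (X * (A * S + S * Aᵀ + Θ - S * K * S) * X * Q).trace =
      (X * (A * Q)).trace * 2 + (X * Θ * X * Q).trace - (K * Q).trace := by
    have h1 : (Aᵀ * X * Q).trace = (X * (A * Q)).trace := by
      rw [← trT (Aᵀ * X * Q)]
      simp only [Matrix.transpose_mul, hQT, hXT, Matrix.transpose_transpose]
      rw [Matrix.trace_mul_comm, Matrix.mul_assoc]
    have h2 : X * (A * S + S * Aᵀ + Θ - S * K * S) * X * Q =
        X * (A * Q) + Aᵀ * X * Q + X * Θ * X * Q - K * Q := by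
      simp only [Matrix.mul_add, Matrix.mul_sub, Matrix.add_mul, Matrix.sub_mul, Matrix.mul_assoc,
        cancel hSX, cancel hXS]
    rw [h2, Matrix.trace_sub, Matrix.trace_add, Matrix.trace_add, h1]
    ring
  -- the dissipation terms
  have f1 : (Θ * (G * (S + Q) * G)).trace = (Y * Θ * Y * S).trace - (Y * Θ).trace -
      (X * Θ).trace + (X * Θ * X * Q).trace := by
    have h1 : G * (S + Q) * G = Y * S * Y - Y - X + X * Q * X := by
      simp only [hG, Matrix.sub_mul, Matrix.mul_sub, Matrix.mul_add, Matrix.add_mul,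
        Matrix.mul_assoc, hSX, hQY, hXS, cancel hYQ, Matrix.mul_one, Matrix.one_mul]
      abel
    rw [h1, Matrix.mul_add, Matrix.mul_sub, Matrix.mul_sub, Matrix.trace_add, Matrix.trace_sub,
      Matrix.trace_sub, Matrix.trace_mul_comm Θ Y, Matrix.trace_mul_comm Θ X]
    have h2 : (Θ * (Y * S * Y)).trace = (Y * Θ * Y * S).trace := by
      rw [← Matrix.mul_assoc, Matrix.trace_mul_comm]
      simp only [Matrix.mul_assoc]
    have h3 : (Θ * (X * Q * X)).trace = (X * Θ * X * Q).trace := by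
      rw [← Matrix.mul_assoc, Matrix.trace_mul_comm]
      simp only [Matrix.mul_assoc]
    rw [h2, h3]
  have f2 : (K * (D * (X + Y) * D)).trace = (Y * (S * K * S)).trace - (K * S).trace -
      (K * Q).trace + (X * (Q * K * Q)).trace := by
    have h1 : D * (X + Y) * D = S * Y * S - S - Q + Q * X * Q := by
      simp only [hD, Matrix.sub_mul, Matrix.mul_sub, Matrix.mul_add, Matrix.add_mul,
        Matrix.mul_assoc, hXS, hYQ, cancel hSX, cancel hQY, Matrix.mul_one]
      abel
    rw [h1, Matrix.mul_add, Matrix.mul_sub, Matrix.mul_sub, Matrix.trace_add, Matrix.trace_sub,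
      Matrix.trace_sub]
    have h2 : (K * (S * Y * S)).trace = (Y * (S * K * S)).trace := by
      rw [← Matrix.mul_assoc, Matrix.trace_mul_comm, Matrix.trace_mul_comm Y]
      simp only [Matrix.mul_assoc]
    have h3 : (K * (Q * X * Q)).trace = (X * (Q * K * Q)).trace := by
      rw [← Matrix.mul_assoc, Matrix.trace_mul_comm, Matrix.trace_mul_comm X]
      simp only [Matrix.mul_assoc]
    rw [h2, h3]
  have f2' : 0 ≤ (K * (D * (X + Y) * D)).trace := by
    refine trace_mul_nonneg hKp ?_
    have := posSemidef_conj (hS.inv.posSemidef.add hQpd.inv.posSemidef) D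
    rwa [hDT] at this
  -- These identities give `tr(Q G S G) = tr(S G Q G) = riccDist Q S`, so `Θ ⪰ μ Q` and `Θ ⪰ ν S`
  -- each turn one half of the `Θ` term into a multiple of the distance.
  have hSG : S * G = D * Y := by
    rw [hG, hD, Matrix.mul_sub, Matrix.sub_mul, hSX, hQY]
  have hQG : Q * G = D * X := by
    rw [hG, hD, Matrix.mul_sub, Matrix.sub_mul, hQY, hSX]
  have hv : riccDist Q S = (X * D * Y * D).trace := rfl
  have g1 : μ * riccDist Q S ≤ (Θ * (G * S * G)).trace := by
    have h1 := trace_mul_nonneg hμ (by simpa [hGT] using posSemidef_conj hS.posSemidef G)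
    rw [Matrix.sub_mul, Matrix.trace_sub, Matrix.smul_mul, Matrix.trace_smul, smul_eq_mul] at h1
    have h2 : (Q * (G * S * G)).trace = riccDist Q S := by
      rw [hv, Matrix.mul_assoc G, hSG, ← Matrix.mul_assoc, hQG, Matrix.mul_assoc D,
        Matrix.trace_mul_comm D]
      simp only [Matrix.mul_assoc]
    rw [h2] at h1
    linarith
  have g2 : ν * riccDist Q S ≤ (Θ * (G * Q * G)).trace := by
    have h1 := trace_mul_nonneg hν (by simpa [hGT] using posSemidef_conj hQpd.posSemidef G)
    rw [Matrix.sub_mul, Matrix.trace_sub, Matrix.smul_mul, Matrix.trace_smul, smul_eq_mul] at h1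
    have h2 : (S * (G * Q * G)).trace = riccDist Q S := by
      rw [hv, Matrix.mul_assoc G, hQG, ← Matrix.mul_assoc, hSG, Matrix.trace_mul_comm, Matrix.mul_assoc D,
        Matrix.trace_mul_comm D]
      simp only [Matrix.mul_assoc]
    rw [h2] at h1
    linarith
  have f3 : (Θ * (G * (S + Q) * G)).trace = (Θ * (G * S * G)).trace +
      (Θ * (G * Q * G)).trace := by
    rw [Matrix.mul_add, Matrix.add_mul, Matrix.mul_add, Matrix.trace_add]
  have lhs : (Y * (A * S + S * Aᵀ + Θ - S * K * S)).trace +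
      (-(X * (A * S + S * Aᵀ + Θ - S * K * S) * X) * Q).trace =
      -(Θ * (G * (S + Q) * G)).trace - (K * (D * (X + Y) * D)).trace := by
    rw [Matrix.neg_mul, Matrix.trace_neg, e4, f1, f2]
    rw [Matrix.mul_sub, Matrix.mul_add, Matrix.mul_add, Matrix.trace_sub, Matrix.trace_add,
      Matrix.trace_add, e3]
    linarith
  rw [lhs]
  linarith

lemma posSemidef_norm_sub {M : Matrix (Fin d) (Fin d) ℝ} (hM : Mᵀ = M) :
    (‖M‖ • (1 : Matrix (Fin d) (Fin d) ℝ) - M).PosSemidef := by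
  rw [posSemidef_real_iff]
  refine ⟨by rw [Matrix.transpose_sub, Matrix.transpose_smul, Matrix.transpose_one, hM],
    fun x => ?_⟩
  have h1 := (real_inner_le_norm (WithLp.toLp 2 x) (clm M (WithLp.toLp 2 x))).trans
    (mul_le_mul_of_nonneg_left (norm_clm_le M (WithLp.toLp 2 x)) (norm_nonneg _))
  rw [inner_clm] at h1
  have h2 := ofLp_dotProduct_self (WithLp.toLp 2 x)
  rw [Matrix.sub_mulVec, Matrix.smul_mulVec, Matrix.one_mulVec, dotProduct_sub, dotProduct_smul,
    smul_eq_mul]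
  simp only at h1 h2
  rw [h2]
  nlinarith

/-- For `d = 0` there are no entries and the hypothesis does not fix the sign of `t`; hence the
alternative. -/
lemma exists_norm_le_of_abs_apply_le (d : ℕ) : ∃ C : ℝ, 0 < C ∧
    ∀ (M : Matrix (Fin d) (Fin d) ℝ) (t : ℝ), (∀ i j, |M i j| ≤ t) → ‖M‖ ≤ C * t ∨ d = 0 := by
  refine ⟨∑ i : Fin d, ∑ j : Fin d, ‖Matrix.single i j (1 : ℝ)‖ + 1, by positivity,
    fun M t h => ?_⟩
  rcases Nat.eq_zero_or_pos d with hd | hd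
  · exact Or.inr hd
  left
  have ht : 0 ≤ t := (abs_nonneg _).trans (h ⟨0, hd⟩ ⟨0, hd⟩)
  calc ‖M‖ = ‖∑ i : Fin d, ∑ j : Fin d, M i j • Matrix.single i j (1 : ℝ)‖ := by
        conv_lhs => rw [Matrix.matrix_eq_sum_single M]
        simp [Matrix.smul_single]
    _ ≤ ∑ i : Fin d, ∑ j : Fin d, ‖Matrix.single i j (1 : ℝ)‖ * t := by
        refine (norm_sum_le _ _).trans (Finset.sum_le_sum fun i _ =>
          (norm_sum_le _ _).trans (Finset.sum_le_sum fun j _ => ?_))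
        rw [norm_smul, mul_comm, Real.norm_eq_abs]
        exact mul_le_mul_of_nonneg_left (h i j) (norm_nonneg _)
    _ = (∑ i : Fin d, ∑ j : Fin d, ‖Matrix.single i j (1 : ℝ)‖) * t := by
        simp only [Finset.sum_mul]
    _ ≤ _ := by nlinarith

/-- `S⁻¹ - s⁻¹ = (S⁻¹ - s⁻¹) S (S⁻¹ - s⁻¹) + s⁻² (s - S)`, a sum of two semidefinite matrices. -/
lemma posSemidef_inv_sub {S : Matrix (Fin d) (Fin d) ℝ} (hS : S.PosDef) {s : ℝ} (hs : 0 < s)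
    (h : (s • (1 : Matrix (Fin d) (Fin d) ℝ) - S).PosSemidef) :
    (S⁻¹ - s⁻¹ • (1 : Matrix (Fin d) (Fin d) ℝ)).PosSemidef := by
  have hd := (Matrix.isUnit_iff_isUnit_det _).1 hS.isUnit
  have hST := (posDef_real_iff.1 hS).1
  have hX : S⁻¹ * S = 1 := Matrix.nonsing_inv_mul _ hd
  have hX' : S * S⁻¹ = 1 := Matrix.mul_nonsing_inv _ hd
  have h1 : S⁻¹ - s⁻¹ • (1 : Matrix (Fin d) (Fin d) ℝ) =
      (S⁻¹ - s⁻¹ • (1 : Matrix (Fin d) (Fin d) ℝ)) * S *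
        (S⁻¹ - s⁻¹ • (1 : Matrix (Fin d) (Fin d) ℝ))ᵀ +
      (s⁻¹ * s⁻¹) • (s • (1 : Matrix (Fin d) (Fin d) ℝ) - S) := by
    rw [Matrix.transpose_sub, Matrix.transpose_nonsing_inv, hST, Matrix.transpose_smul,
      Matrix.transpose_one, Matrix.sub_mul, hX, Matrix.smul_mul, Matrix.one_mul, Matrix.mul_sub,
      Matrix.sub_mul, Matrix.one_mul, Matrix.smul_mul, hX', Matrix.mul_smul, Matrix.mul_one,
      smul_sub, smul_sub, smul_smul, smul_smul]
    rw [mul_assoc s⁻¹ s⁻¹ s, inv_mul_cancel₀ hs.ne', mul_one]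
    abel
  rw [h1]
  exact (posSemidef_conj hS.posSemidef _).add (h.smul (by positivity))

lemma trace_smul_sub_le {M N : Matrix (Fin d) (Fin d) ℝ} {c : ℝ}
    (hM : (M - c • (1 : Matrix (Fin d) (Fin d) ℝ)).PosSemidef) (hN : N.PosSemidef) :
    c * N.trace ≤ (M * N).trace := by
  have := trace_mul_nonneg hM hN
  rw [Matrix.sub_mul, Matrix.smul_mul, Matrix.one_mul, Matrix.trace_sub, Matrix.trace_smul,
    smul_eq_mul] at this
  linarith

/-- The defect `c exp (-γ t)` in the rate is integrable, so it affects the constant only. Times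
start at `1` because the initial covariance may be singular, whereas `riccDist` contains its
inverse. -/
lemma le_exp_of_deriv_le {v : ℝ → ℝ} {κ c γ : ℝ} (hγ : 0 < γ) (hc : 0 ≤ c)
    (hv0 : ∀ t, 1 ≤ t → 0 ≤ v t)
    (hv : ∀ t, 0 < t → ∃ v', HasDerivAt v v' t ∧ v' ≤ -(κ - c * Real.exp (-γ * t)) * v t) :
    ∃ C, 0 ≤ C ∧ ∀ t, 1 ≤ t → v t ≤ C * Real.exp (-κ * t) := by
  have hE : ∀ t, HasDerivAt (fun t => Real.exp (κ * t + c / γ * Real.exp (-γ * t)))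
      (Real.exp (κ * t + c / γ * Real.exp (-γ * t)) * (κ - c * Real.exp (-γ * t))) t := by
    intro t
    have h1 : HasDerivAt (fun t : ℝ => Real.exp (-γ * t)) (Real.exp (-γ * t) * (-γ * 1)) t :=
      ((hasDerivAt_id t).const_mul (-γ)).exp
    have h2 := (((hasDerivAt_id t).const_mul κ).add (h1.const_mul (c / γ))).exp
    refine h2.congr_deriv ?_
    have : κ * 1 + c / γ * (Real.exp (-γ * t) * (-γ * 1)) = κ - c * Real.exp (-γ * t) := by
      field_simp
      ring
    rw [this]
    rfl
  choose! v' hv' hvle using hv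
  have hanti : AntitoneOn (fun t => v t * Real.exp (κ * t + c / γ * Real.exp (-γ * t)))
      (Set.Ici 1) := by
    refine antitoneOn_of_deriv_nonpos (convex_Ici _) (fun t ht => ?_) (fun t ht => ?_)
      fun t ht => ?_
    · exact ((hv' t (zero_lt_one.trans_le ht)).mul (hE t)).continuousAt.continuousWithinAt
    · rw [interior_Ici] at ht
      exact ((hv' t (zero_lt_one.trans (Set.mem_Ioi.1 ht))).mul
        (hE t)).differentiableAt.differentiableWithinAt
    · rw [interior_Ici] at ht
      have ht0 := zero_lt_one.trans (Set.mem_Ioi.1 ht)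
      refine (HasDerivAt.deriv ((hv' t ht0).mul (hE t))).trans_le ?_
      have h1 := mul_le_mul_of_nonneg_right (hvle t ht0)
        (Real.exp_pos (κ * t + c / γ * Real.exp (-γ * t))).le
      linarith
  refine ⟨v 1 * Real.exp (κ * 1 + c / γ * Real.exp (-γ * 1)),
    mul_nonneg (hv0 1 le_rfl) (Real.exp_pos _).le, fun t ht => ?_⟩
  have h1 := hanti (Set.mem_Ici.2 le_rfl) ht ht
  simp only at h1
  have h2 : v t * Real.exp (κ * t) ≤ v t * Real.exp (κ * t + c / γ * Real.exp (-γ * t)) := by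
    refine mul_le_mul_of_nonneg_left (Real.exp_le_exp.2 ?_) (hv0 t ht)
    have : 0 ≤ c / γ * Real.exp (-γ * t) := by positivity
    linarith
  calc v t = v t * Real.exp (κ * t) * Real.exp (-κ * t) := by
        rw [mul_assoc, ← Real.exp_add]; simp
    _ ≤ _ := mul_le_mul_of_nonneg_right (h2.trans h1) (Real.exp_pos _).le

lemma trace_sq_ge {D : Matrix (Fin d) (Fin d) ℝ} (hD : Dᵀ = D) (i j : Fin d) :
    (D i j) ^ 2 ≤ (D * D).trace := by
  have h1 : (D * D).trace = ∑ i, ∑ j, (D i j) ^ 2 := by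
    simp only [Matrix.trace, Matrix.diag, Matrix.mul_apply]
    refine Finset.sum_congr rfl fun i _ => Finset.sum_congr rfl fun j _ => ?_
    have : D j i = D i j := congrFun (congrFun hD i) j
    rw [this, sq]
  rw [h1]
  exact (Finset.single_le_sum (f := fun j => (D i j) ^ 2) (fun _ _ => sq_nonneg _)
    (Finset.mem_univ j)).trans (Finset.single_le_sum (f := fun i => ∑ j, (D i j) ^ 2)
    (fun _ _ => Finset.sum_nonneg fun _ _ => sq_nonneg _) (Finset.mem_univ i))

/-- Exponential convergence of the Riccati flow at rate `2β`. -/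
lemma exists_dre_decay [NeZero d] {Q : Matrix (Fin d) (Fin d) ℝ} (hσB : (σB * σBᵀ).PosDef)
    (hQ : IsARESolution A H σB Q) (hS₀ : S₀.PosSemidef) (hS : IsDRESolution A H σB S₀ S) :
    ∃ C, 0 < C ∧ ∀ t, 0 ≤ t → ‖S t - Q‖ ≤ C * Real.exp (-2 * rateβ σB Q * t) := by
  have hQT := (posDef_real_iff.1 hQ.1).1
  have hΘT := (posDef_real_iff.1 hσB).1
  have hL := lamMax_pos hQ.1
  have hl := lamMin_pos hσB
  have hβ := rateβ_pos hσB hQ.1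
  set β := rateβ σB Q with hβdef
  have hβL : 2 * β * lamMax Q = lamMin (σB * σBᵀ) := by
    rw [hβdef, rateβ]; field_simp
  -- `σB σBᵀ ⪰ λ_min(σB σBᵀ) = 2 β λ_max(Q) ⪰ 2 β Q`, by the definition of `β`.
  have hμ : (σB * σBᵀ - (2 * β) • Q).PosSemidef := by
    have h1 := (posSemidef_sub_lamMin hΘT).add ((posSemidef_lamMax_sub hQT).smul
      (show (0 : ℝ) ≤ 2 * β by positivity))
    rwa [smul_sub, smul_smul, hβL, sub_add_sub_cancel] at h1
  set v : ℝ → ℝ := fun t => riccDist Q (S t) with hvdef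
  have hpd : ∀ t, 0 < t → (S t).PosDef := fun t ht => hS.posDef hσB hS₀ ht
  have hsymS : ∀ t, 0 < t → (S t)ᵀ = S t := fun t ht => (posDef_real_iff.1 (hpd t ht)).1
  have hsymD : ∀ t, 0 < t → (S t - Q)ᵀ = S t - Q := fun t ht => by
    rw [Matrix.transpose_sub, hsymS t ht, hQT]
  have hYpd := hQ.1.inv
  have hy := lamMin_pos hYpd
  set y := lamMin Q⁻¹ with hydef
  have hYsub := posSemidef_sub_lamMin (posDef_real_iff.1 hYpd).1
  have hDYD : ∀ t, 0 < t → ((S t - Q) * Q⁻¹ * (S t - Q)).PosSemidef := fun t ht => by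
    have := posSemidef_conj hYpd.posSemidef (S t - Q)
    rwa [hsymD t ht] at this
  have hv_eq : ∀ t, v t = ((S t)⁻¹ * ((S t - Q) * Q⁻¹ * (S t - Q))).trace := fun t => by
    simp only [hvdef, riccDist, Matrix.mul_assoc]
  have hv0 : ∀ t, 0 < t → 0 ≤ v t := fun t ht => by
    rw [hv_eq]
    exact trace_mul_nonneg (hpd t ht).inv.posSemidef (hDYD t ht)
  have hder : ∀ t, 0 < t → HasDerivAt v ((Q⁻¹ * ricc A H σB (S t)).trace +
      (-((S t)⁻¹ * ricc A H σB (S t) * (S t)⁻¹) * Q).trace) t := by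
    intro t ht
    have h1 := (traceL.hasFDerivAt.comp_hasDerivAt t ((hS.hasDerivAt ht).const_mul Q⁻¹)).add
      (traceL.hasFDerivAt.comp_hasDerivAt t
        ((hasDerivAt_inv_matrix (hS.hasDerivAt ht) (hpd t ht).isUnit).mul_const Q))
    have h2 := h1.sub_const (2 * (d : ℝ))
    refine h2.congr_of_eventuallyEq ?_
    filter_upwards [Ioi_mem_nhds ht] with s hs
    exact riccDist_eq hQ.1 (hpd s hs)
  obtain ⟨C₀, hC₀, hnorm⟩ := exists_norm_le_of_abs_apply_le d
  have hnorm' : ∀ (M : Matrix (Fin d) (Fin d) ℝ) (t : ℝ), (∀ i j, |M i j| ≤ t) → ‖M‖ ≤ C₀ * t :=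
    fun M t h => (hnorm M t h).resolve_right (NeZero.ne d)
  -- convergence at half the rate
  obtain ⟨C₁, hC₁, hv₁⟩ := le_exp_of_deriv_le (v := v) (κ := 2 * β) (c := 0) (γ := 1) one_pos le_rfl
    (fun t ht => hv0 t (zero_lt_one.trans_le ht)) fun t ht => ⟨_, hder t ht, by
      refine (riccDist_deriv_le hQ (hpd t ht) hμ (ν := 0)
        (by rw [zero_smul, sub_zero]; exact hσB.posSemidef)).trans (le_of_eq ?_)
      simp only [hvdef]
      ring⟩
  -- A bound on `v` bounds `tr(Q⁻¹ S)`, hence the trace of `S`.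
  have hSbound : ∃ s, 0 < s ∧ ∀ t, 1 ≤ t → ‖S t‖ ≤ s := by
    refine ⟨C₀ * ((C₁ + 2 * d) / y) + 1, by positivity, fun t ht => ?_⟩
    have ht0 := zero_lt_one.trans_le ht
    have h1 : v t ≤ C₁ := (hv₁ t ht).trans (mul_le_of_le_one_right hC₁
      (Real.exp_le_one_iff.2 (by nlinarith)))
    have h2 := riccDist_eq hQ.1 (hpd t ht0)
    have h3 := trace_mul_nonneg (hpd t ht0).inv.posSemidef hQ.1.posSemidef
    have h4 := trace_smul_sub_le hYsub (hpd t ht0).posSemidef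
    have h5 : (S t).trace ≤ (C₁ + 2 * d) / y := by
      rw [le_div_iff₀ hy, mul_comm]
      have : v t = riccDist Q (S t) := rfl
      linarith
    have h6 := hnorm' (S t) _ (fun i j => abs_apply_le_trace (hpd t ht0).posSemidef i j)
    nlinarith
  obtain ⟨s, hs, hSs⟩ := hSbound
  -- `v = tr(S⁻¹ D Q⁻¹ D) ≥ (y / s) tr(D²)` for `D = S - Q`: the function `v` is quadratic in the
  -- distance, so its decay rate is halved for `‖S - Q‖`.
  have hDv : ∀ t, 1 ≤ t → ‖S t - Q‖ ≤ C₀ * √(s / y * v t) := by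
    intro t ht
    have ht0 := zero_lt_one.trans_le ht
    refine hnorm' _ _ fun i j => ?_
    rw [← Real.sqrt_sq_eq_abs]
    refine Real.sqrt_le_sqrt ((trace_sq_ge (hsymD t ht0) i j).trans ?_)
    have h1 : (s • (1 : Matrix (Fin d) (Fin d) ℝ) - S t).PosSemidef := by
      have := (posSemidef_norm_sub (hsymS t ht0)).add
        (Matrix.PosSemidef.one.smul (sub_nonneg.2 (hSs t ht)))
      rw [sub_smul] at this
      convert this using 1
      abel
    have h2 := trace_smul_sub_le (posSemidef_inv_sub (hpd t ht0) hs h1) (hDYD t ht0)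
    rw [← hv_eq, Matrix.trace_mul_comm, ← Matrix.mul_assoc, Matrix.trace_mul_comm] at h2
    have h3 : ((S t - Q) * (S t - Q)).PosSemidef := by
      have := posSemidef_mul_transpose (S t - Q)
      rwa [hsymD t ht0] at this
    have h4 := trace_smul_sub_le hYsub h3
    rw [div_mul_eq_mul_div, le_div_iff₀ hy]
    rw [inv_mul_le_iff₀ hs] at h2
    linarith
  have hD₁ : ∀ t, 1 ≤ t → ‖S t - Q‖ ≤ C₀ * √(s / y * C₁) * Real.exp (-β * t) := by
    intro t ht
    refine (hDv t ht).trans ?_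
    rw [mul_assoc]
    refine mul_le_mul_of_nonneg_left ?_ hC₀.le
    rw [Real.sqrt_le_left (by positivity), mul_pow, Real.sq_sqrt (by positivity), ← Real.exp_nat_mul]
    have h1 := hv₁ t ht
    calc s / y * v t ≤ s / y * (C₁ * Real.exp (-(2 * β) * t)) := by gcongr
      _ = _ := by
        rw [mul_assoc]
        congr 3
        push_cast
        ring
  -- the full rate, by bootstrapping
  set c := C₀ * √(s / y * C₁) with hc
  have hc0 : 0 ≤ c := by positivity
  have hcompact : ∃ K, 0 ≤ K ∧ ∀ t ∈ Set.Icc (0 : ℝ) 1, ‖S (max t 0) - Q‖ ≤ K :=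
    exists_norm_le_Icc (hS.continuous_max.sub continuous_const) 1
  obtain ⟨K, hK0, hK⟩ := hcompact
  have hDall : ∀ t, 0 < t → ‖S t - Q‖ ≤ (c + K * Real.exp β) * Real.exp (-β * t) := by
    intro t ht
    rcases le_total 1 t with h | h
    · refine (hD₁ t h).trans ?_
      gcongr
      have : 0 ≤ K * Real.exp β := by positivity
      linarith
    · have h1 := hK t ⟨ht.le, h⟩
      rw [max_eq_left ht.le] at h1
      refine h1.trans ?_
      have h2 : 1 ≤ Real.exp β * Real.exp (-β * t) := by
        rw [← Real.exp_add]; exact Real.one_le_exp (by nlinarith)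
      have h3 := mul_le_mul_of_nonneg_left h2 hK0
      have h4 : 0 ≤ c * Real.exp (-β * t) := by positivity
      linarith
  set c' := c + K * Real.exp β with hc'
  have hc'0 : 0 ≤ c' := by positivity
  obtain ⟨C₂, hC₂, hv₂⟩ := le_exp_of_deriv_le (v := v) (κ := 4 * β) (c := 2 * β * c' / lamMax Q)
    (γ := β) hβ (by positivity) (fun t ht => hv0 t (zero_lt_one.trans_le ht))
    fun t ht => ⟨_, hder t ht, by
      have hLD : 0 < lamMax Q + ‖S t - Q‖ := by positivity
      -- From `S ⪯ lamMax Q + ‖S - Q‖` one gets `σB σBᵀ ⪰ ν S` with `ν` exponentially close to `2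
      -- β`. Together with `μ = 2 β` the rate of `v` is `4 β` up to an integrable defect.
      have hν : (σB * σBᵀ - (2 * β * lamMax Q / (lamMax Q + ‖S t - Q‖)) • S t).PosSemidef := by
        have h1 := ((posSemidef_lamMax_sub hQT).add (posSemidef_norm_sub (hsymD t ht))).smul
          (show (0 : ℝ) ≤ 2 * β * lamMax Q / (lamMax Q + ‖S t - Q‖) by positivity)
        have h2 := (posSemidef_sub_lamMin hΘT).add h1
        rw [← hβL] at h2
        convert h2 using 1
        have h3 : lamMax Q • (1 : Matrix (Fin d) (Fin d) ℝ) - Q +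
            (‖S t - Q‖ • 1 - (S t - Q)) = (lamMax Q + ‖S t - Q‖) • 1 - S t := by
          rw [add_smul]; abel
        rw [h3, smul_sub, smul_smul, div_mul_cancel₀ _ hLD.ne']
        abel
      refine (riccDist_deriv_le hQ (hpd t ht) hμ hν).trans ?_
      refine mul_le_mul_of_nonneg_right (neg_le_neg ?_) (hv0 t ht)
      have h1 := hDall t ht
      have h2 : 2 * β - 2 * β * ‖S t - Q‖ / lamMax Q ≤
          2 * β * lamMax Q / (lamMax Q + ‖S t - Q‖) := by
        rw [le_div_iff₀ hLD]
        have h4 : 2 * β * ‖S t - Q‖ / lamMax Q * lamMax Q = 2 * β * ‖S t - Q‖ := by field_simp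
        have h3 : 0 ≤ 2 * β * ‖S t - Q‖ / lamMax Q * ‖S t - Q‖ := by positivity
        linear_combination h3 - h4
      have h3 : 2 * β * ‖S t - Q‖ / lamMax Q ≤
          2 * β * c' / lamMax Q * Real.exp (-β * t) := by
        calc 2 * β * ‖S t - Q‖ / lamMax Q
            ≤ 2 * β * (c' * Real.exp (-β * t)) / lamMax Q := by gcongr
          _ = _ := by ring
      linarith⟩
  refine ⟨C₀ * √(s / y * C₂) + K * Real.exp (2 * β) + 1, by positivity, fun t ht => ?_⟩
  rcases le_total 1 t with h | h
  · refine (hDv t h).trans ?_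
    have h5 : C₀ * √(s / y * v t) ≤ C₀ * √(s / y * C₂) * Real.exp (-2 * β * t) := by
      rw [mul_assoc]
      refine mul_le_mul_of_nonneg_left ?_ hC₀.le
      rw [Real.sqrt_le_left (by positivity), mul_pow, Real.sq_sqrt (by positivity),
        ← Real.exp_nat_mul]
      have h1 := hv₂ t h
      calc s / y * v t ≤ s / y * (C₂ * Real.exp (-(4 * β) * t)) := by gcongr
        _ = _ := by
          rw [mul_assoc]
          congr 3
          push_cast
          ring
    refine h5.trans ?_
    gcongr
    have : 0 ≤ K * Real.exp (2 * β) := by positivity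
    linarith
  · have h1 := hK t ⟨ht, h⟩
    rw [max_eq_left ht] at h1
    refine h1.trans ?_
    have h2 : 1 ≤ Real.exp (2 * β) * Real.exp (-2 * β * t) := by
      rw [← Real.exp_add]; exact Real.one_le_exp (by nlinarith)
    have h3 := mul_le_mul_of_nonneg_left h2 hK0
    have h4 : 0 ≤ (C₀ * √(s / y * C₂) + 1) * Real.exp (-2 * β * t) := by positivity
    linarith

end RiccatiDecay

/-! ### Augmented σ-algebras, continuous versions and conditioning on an independent input -/

section Augmentation

variable {Ω : Type*} {m m' : MeasurableSpace Ω} {mΩ : MeasurableSpace Ω} {P : Measure Ω}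

/-- The measurable sets that agree almost surely with a set of `m`. -/
@[reducible] def nullAug {mΩ : MeasurableSpace Ω} (P : Measure Ω) (m : MeasurableSpace Ω) : MeasurableSpace Ω :=
  eventuallyMeasurableSpace m (ae P) ⊓ mΩ

lemma nullAug_le (m : MeasurableSpace Ω) : nullAug P m ≤ mΩ := inf_le_right

lemma measurableSet_nullAug {s : Set Ω} :
    MeasurableSet[nullAug P m] s ↔
      (∃ t, MeasurableSet[m] t ∧ s =ᵐ[P] t) ∧ MeasurableSet s := by
  exact MeasurableSpace.measurableSet_inf

lemma le_nullAug (hm : m ≤ mΩ) : m ≤ nullAug P m := fun s hs =>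
  measurableSet_nullAug.2 ⟨⟨s, hs, ae_eq_refl _⟩, hm s hs⟩

lemma nullAug_mono (h : m ≤ m') : nullAug P m ≤ nullAug P m' := by
  intro s hs
  obtain ⟨⟨t, ht, hst⟩, hs⟩ := measurableSet_nullAug.1 hs
  exact measurableSet_nullAug.2 ⟨⟨t, h t ht, hst⟩, hs⟩

lemma measurableSet_nullAug_of_null {s : Set Ω} (hs : MeasurableSet s)
    (h : P s = 0) : MeasurableSet[nullAug P m] s :=
  measurableSet_nullAug.2 ⟨⟨∅, @MeasurableSet.empty _ m, ae_eq_empty.2 h⟩, hs⟩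

lemma measurableSet_nullAug_congr {s t : Set Ω} (hs : MeasurableSet s)
    (ht : MeasurableSet[nullAug P m] t) (h : s =ᵐ[P] t) : MeasurableSet[nullAug P m] s := by
  obtain ⟨⟨u, hu, htu⟩, -⟩ := measurableSet_nullAug.1 ht
  exact measurableSet_nullAug.2 ⟨⟨u, hu, h.trans htu⟩, hs⟩

lemma measurable_nullAug_congr {β : Type*} [MeasurableSpace β] {f g : Ω → β}
    (hf : Measurable f) (hg : Measurable[nullAug P m] g) (h : f =ᵐ[P] g) :
    Measurable[nullAug P m] f := fun s hs =>
  measurableSet_nullAug_congr (hf hs) (hg hs) (by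
    filter_upwards [h] with ω hω
    exact propext (by change f ω ∈ s ↔ g ω ∈ s; rw [hω]))

/-- Independence does not see null sets, so processes may be altered on them to make all paths
continuous. -/
lemma nullAug_indep (h : Indep m m' P) :
    Indep (nullAug P m) (nullAug P m') P := by
  rw [Indep_iff] at h ⊢
  intro s t hs ht
  obtain ⟨⟨s', hs', hss⟩, -⟩ := measurableSet_nullAug.1 hs
  obtain ⟨⟨t', ht', htt⟩, -⟩ := measurableSet_nullAug.1 ht
  rw [measure_congr (hss.inter htt), measure_congr hss, measure_congr htt]
  exact h s' t' hs' ht'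

/-- Continuous versions are adapted to the augmented σ-algebras only, while the conditional moments
refer to the original ones. -/
lemma condExp_nullAug [IsFiniteMeasure P] {F : Type*} [NormedAddCommGroup F] [NormedSpace ℝ F]
    [CompleteSpace F] (hm : m ≤ mΩ) (f : Ω → F) (hf : Integrable f P) :
    P[f | nullAug P m] =ᵐ[P] P[f | m] := by
  symm
  refine ae_eq_condExp_of_forall_setIntegral_eq (nullAug_le m) hf
    (fun _ _ _ => integrable_condExp.integrableOn) (fun s hs _ => ?_)
    (stronglyMeasurable_condExp.mono (le_nullAug hm)).aestronglyMeasurable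
  obtain ⟨⟨t, ht, hst⟩, -⟩ := measurableSet_nullAug.1 hs
  rw [setIntegral_congr_set hst, setIntegral_congr_set hst, setIntegral_condExp hm hf ht]

/-- Outside a null set the paths are continuous and agree with adapted variables at all times `k /
n`; on the null set they are put equal to zero. The value at `t` is the limit along `⌊t n⌋ / n ≤ t`,
so it depends on the past only. -/
lemma exists_adapted_version {F : Type*} [NormedAddCommGroup F] {m : ℝ≥0 → MeasurableSpace Ω}
    (hmono : Monotone m) {f : ℝ≥0 → Ω → F}
    (hf : ∀ t, ∃ g, StronglyMeasurable[nullAug P (m t)] g ∧ f t =ᵐ[P] g)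
    (hc : ∀ᵐ ω ∂P, Continuous fun t => f t ω) :
    ∃ f' : ℝ → Ω → F, (∀ ω, Continuous fun t => f' t ω) ∧
      (∀ t : ℝ, StronglyMeasurable[nullAug P (m t.toNNReal)] (f' t)) ∧
      ∀ᵐ ω ∂P, ∀ t : ℝ, f' t ω = f t.toNNReal ω := by
  choose g hg hfg using hf
  have hN : ∀ᵐ ω ∂P, Continuous (fun t => f t ω) ∧
      ∀ k n : ℕ, f ((k : ℝ≥0) / n) ω = g ((k : ℝ≥0) / n) ω := by
    refine hc.and ?_
    rw [ae_all_iff]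
    exact fun k => ae_all_iff.2 fun n => hfg _
  set N := toMeasurable P {ω | ¬ (Continuous (fun t => f t ω) ∧
      ∀ k n : ℕ, f ((k : ℝ≥0) / n) ω = g ((k : ℝ≥0) / n) ω)} with hNdef
  have hN0 : P N = 0 := by rw [hNdef, measure_toMeasurable]; exact hN
  have hNm : MeasurableSet N := measurableSet_toMeasurable _ _
  have hNc : ∀ ω, ω ∉ N → Continuous (fun t => f t ω) ∧
      ∀ k n : ℕ, f ((k : ℝ≥0) / n) ω = g ((k : ℝ≥0) / n) ω := by
    intro ω hω
    by_contra h
    exact hω (subset_toMeasurable _ _ h)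
  classical
  refine ⟨fun t => Nᶜ.indicator (f t.toNNReal), fun ω => ?_, fun t => ?_, ?_⟩
  · by_cases hω : ω ∈ N
    · simp only [Set.indicator_of_notMem (Set.notMem_compl_iff.2 hω)]
      exact continuous_const
    · simp only [Set.indicator_of_mem (Set.mem_compl hω)]
      exact (hNc ω hω).1.comp continuous_real_toNNReal
  · have hle : ∀ n : ℕ, ((⌊(t.toNNReal : ℝ) * n⌋₊ : ℝ≥0) / n) ≤ t.toNNReal := by
      intro n
      rcases Nat.eq_zero_or_pos n with rfl | hn
      · simp
      · rw [div_le_iff₀ (by exact_mod_cast hn)]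
        rw [← NNReal.coe_le_coe]
        exact_mod_cast Nat.floor_le (by positivity : (0 : ℝ) ≤ (t.toNNReal : ℝ) * n)
    refine stronglyMeasurable_of_tendsto (u := atTop)
      (f := fun (n : ℕ) => Nᶜ.indicator (g ((⌊(t.toNNReal : ℝ) * n⌋₊ : ℝ≥0) / n)))
      (fun n => ?_) ?_
    · exact ((hg _).mono (nullAug_mono (hmono (hle n)))).indicator
        (measurableSet_nullAug_of_null hNm hN0).compl
    · rw [tendsto_pi_nhds]
      intro ω
      by_cases hω : ω ∈ N
      · simp only [Set.indicator_of_notMem (Set.notMem_compl_iff.2 hω)]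
        exact tendsto_const_nhds
      · simp only [Set.indicator_of_mem (Set.mem_compl hω)]
        simp only [← (hNc ω hω).2]
        refine ((hNc ω hω).1.tendsto _).comp ?_
        rw [← NNReal.tendsto_coe]
        simp only [NNReal.coe_div, NNReal.coe_natCast]
        exact (tendsto_nat_floor_mul_div_atTop (R := ℝ) t.toNNReal.2).comp
          tendsto_natCast_atTop_atTop
  · filter_upwards [measure_eq_zero_iff_ae_notMem.1 hN0] with ω hω t
    exact Set.indicator_of_mem (Set.mem_compl hω) _

lemma stronglyMeasurable_limUnder_nat {F : Type*} [NormedAddCommGroup F] [CompleteSpace F]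
    {α : Type*} (m : MeasurableSpace α) {h : ℕ → α → F} (hh : ∀ k, StronglyMeasurable (h k)) :
    StronglyMeasurable fun x => limUnder atTop fun k => h k x :=
  StronglyMeasurable.limUnder hh

/-- A subsequence converges almost surely, and its `limUnder` is measurable everywhere. This makes
an Itô integral, a limit in probability, adapted. -/
lemma exists_ae_eq_of_tendstoInMeasure {F : Type*} [NormedAddCommGroup F] [CompleteSpace F]
    {f : ℕ → Ω → F} {g : Ω → F} (hf : ∀ n, StronglyMeasurable[m] (f n))
    (h : TendstoInMeasure P f atTop g) : ∃ g', StronglyMeasurable[m] g' ∧ g =ᵐ[P] g' := by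
  obtain ⟨ns, -, hns⟩ := h.exists_seq_tendsto_ae
  refine ⟨fun ω => limUnder atTop fun k => f (ns k) ω,
    stronglyMeasurable_limUnder_nat _ fun k => hf (ns k), ?_⟩
  filter_upwards [hns] with ω hω
  exact hω.limUnder_eq.symm

/-- The joint law is a product, so integrals over events `{ξ ∈ s}` are evaluated by Fubini's theorem
with `ξ` frozen. -/
lemma condExp_freeze {Ω : Type*} [MeasurableSpace Ω] {P : Measure Ω} [IsProbabilityMeasure P] {α β F : Type*} [mα : MeasurableSpace α]
    [MeasurableSpace β]
    [NormedAddCommGroup F] [NormedSpace ℝ F] [CompleteSpace F] {ξ : Ω → α} {η : Ω → β}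
    (hξ : Measurable ξ) (hη : Measurable η) (h : IndepFun ξ η P) {f : α × β → F}
    (hf : StronglyMeasurable f) (hint : Integrable (fun ω => f (ξ ω, η ω)) P) :
    P[fun ω => f (ξ ω, η ω) | mα.comap ξ] =ᵐ[P] (fun ω => ∫ ω', f (ξ ω, η ω') ∂P) ∧
      ∀ᵐ ω ∂P, Integrable (fun ω' => f (ξ ω, η ω')) P := by
  have hlaw : P.map (fun ω => (ξ ω, η ω)) = (P.map ξ).prod (P.map η) :=
    (indepFun_iff_map_prod_eq_prod_map_map hξ.aemeasurable hη.aemeasurable).1 h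
  have := Measure.isProbabilityMeasure_map (μ := P) hξ.aemeasurable
  have := Measure.isProbabilityMeasure_map (μ := P) hη.aemeasurable
  have hI : Integrable f ((P.map ξ).prod (P.map η)) := by
    rw [← hlaw, integrable_map_measure hf.aestronglyMeasurable (hξ.prodMk hη).aemeasurable]
    exact hint
  have hfx : ∀ x, StronglyMeasurable fun y => f (x, y) := fun x =>
    hf.comp_measurable measurable_prodMk_left
  have hmap : ∀ x, ∫ y, f (x, y) ∂(P.map η) = ∫ ω', f (x, η ω') ∂P := fun x =>
    integral_map hη.aemeasurable (hfx x).aestronglyMeasurable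
  have hG : StronglyMeasurable fun x => ∫ ω', f (x, η ω') ∂P := by
    simp only [← hmap]
    exact hf.integral_prod_right'
  have hGint : Integrable (fun ω => ∫ ω', f (ξ ω, η ω') ∂P) P := by
    have := hI.integral_prod_left
    simp only [hmap] at this
    exact (integrable_map_measure hG.aestronglyMeasurable hξ.aemeasurable).1 this
  constructor
  · symm
    refine ae_eq_condExp_of_forall_setIntegral_eq hξ.comap_le hint
      (fun _ _ _ => hGint.integrableOn) ?_
      (hG.comp_measurable (comap_measurable ξ)).aestronglyMeasurable
    rintro _ ⟨s, hs, rfl⟩ -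
    have h1 : ∫ ω in ξ ⁻¹' s, f (ξ ω, η ω) ∂P =
        ∫ z in s ×ˢ Set.univ, f z ∂((P.map ξ).prod (P.map η)) := by
      rw [← hlaw, setIntegral_map (hs.prod MeasurableSet.univ) hf.aestronglyMeasurable
        (hξ.prodMk hη).aemeasurable]
      congr 2
      ext ω
      simp
    rw [h1, setIntegral_prod _ hI.integrableOn]
    simp only [Measure.restrict_univ, hmap]
    exact (setIntegral_map hs hG.aestronglyMeasurable hξ.aemeasurable).symm
  · have := hI.prod_right_ae
    have h2 := ae_of_ae_map hξ.aemeasurable this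
    filter_upwards [h2] with ω hω
    exact (integrable_map_measure (hfx _).aestronglyMeasurable hη.aemeasurable).1 hω

/-- Conditioning on `m` a function of two inputs, one `m`-measurable and one independent of `m`. -/
lemma condExp_of_indep [IsProbabilityMeasure P] {F : Type*}
    [NormedAddCommGroup F] [NormedSpace ℝ F] [CompleteSpace F]
    (hm : m ≤ mΩ) (hm' : m' ≤ mΩ) (h : Indep m m' P) {f : Ω → Ω → F}
    (hf : StronglyMeasurable[m.prod m'] (fun z : Ω × Ω => f z.1 z.2))
    (hint : Integrable (fun ω => f ω ω) P) :
    P[fun ω => f ω ω | m] =ᵐ[P] (fun ω => ∫ ω', f ω ω' ∂P) ∧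
      ∀ᵐ ω ∂P, Integrable (f ω) P := by
  -- Both inputs are the identity of `Ω`, seen with the σ-algebras `m` and `m'` on the target.
  have h1 : @IndepFun Ω Ω Ω mΩ m m' id id P := by
    refine (@IndepFun_iff_Indep _ _ _ mΩ m m' _ _ _).2 ?_
    rw [MeasurableSpace.comap_id, MeasurableSpace.comap_id]
    exact h
  have := @condExp_freeze Ω mΩ P _ Ω Ω F m m' _ _ _ id id hm hm' h1 (fun z : Ω × Ω => f z.1 z.2)
    hf hint
  rwa [MeasurableSpace.comap_id] at this

end Augmentation

/-! ### Minkowski's integral inequality and processes bounded in `Lᵖ` -/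

section LpProcess

set_option linter.unusedSectionVars false

variable {Ω : Type*} {mΩ : MeasurableSpace Ω} {P : Measure Ω}
variable {F G : Type*} [NormedAddCommGroup F] [NormedSpace ℝ F]
  [NormedAddCommGroup G] [NormedSpace ℝ G]

lemma eLpNorm_two (f : Ω → F) : eLpNorm f 2 P = (∫⁻ ω, ‖f ω‖ₑ ^ (2 : ℝ) ∂P) ^ (1 / 2 : ℝ) := by
  rw [eLpNorm_eq_lintegral_rpow_enorm_toReal two_ne_zero ENNReal.ofNat_ne_top]
  simp

lemma lintegral_enorm_sq (f : Ω → F) : ∫⁻ ω, ‖f ω‖ₑ ^ 2 ∂P = eLpNorm f 2 P ^ 2 := by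
  rw [eLpNorm_two, ← ENNReal.rpow_natCast, ← ENNReal.rpow_mul]
  simp

lemma lintegral_mul_le_sqrt {f g : Ω → ℝ≥0∞} (hf : AEMeasurable f P) (hg : AEMeasurable g P) :
    ∫⁻ ω, f ω * g ω ∂P ≤
      (∫⁻ ω, f ω ^ (2 : ℝ) ∂P) ^ (1 / 2 : ℝ) * (∫⁻ ω, g ω ^ (2 : ℝ) ∂P) ^ (1 / 2 : ℝ) :=
  ENNReal.lintegral_mul_le_Lp_mul_Lq P Real.HolderConjugate.two_two hf hg

/-- Minkowski's integral inequality in `L²`. -/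
lemma lintegral_minkowski [SFinite P] {α : Type*} [MeasurableSpace α] {ν : Measure α} [SFinite ν]
    {f : α → Ω → ℝ≥0∞} (hf : Measurable (Function.uncurry f)) :
    (∫⁻ ω, (∫⁻ s, f s ω ∂ν) ^ (2 : ℝ) ∂P) ^ (1 / 2 : ℝ) ≤
      ∫⁻ s, (∫⁻ ω, f s ω ^ (2 : ℝ) ∂P) ^ (1 / 2 : ℝ) ∂ν := by
  have hfs : ∀ s, Measurable (f s) := fun s => hf.comp measurable_prodMk_left
  have hfω : ∀ ω, Measurable fun s => f s ω := fun ω => hf.comp measurable_prodMk_right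
  have hN : Measurable fun s => (∫⁻ ω, f s ω ^ (2 : ℝ) ∂P) ^ (1 / 2 : ℝ) :=
    ((hf.pow_const (2 : ℝ)).lintegral_prod_right').pow_const _
  have hI : Measurable fun ω => ∫⁻ s, f s ω ∂ν := hf.lintegral_prod_left'
  -- The square of the inner integral is a double integral; after exchanging the integrals,
  -- Cauchy–Schwarz in `ω` bounds each product.
  have h1 : ∫⁻ ω, (∫⁻ s, f s ω ∂ν) ^ (2 : ℝ) ∂P ≤
      (∫⁻ s, (∫⁻ ω, f s ω ^ (2 : ℝ) ∂P) ^ (1 / 2 : ℝ) ∂ν) ^ (2 : ℝ) := by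
    calc ∫⁻ ω, (∫⁻ s, f s ω ∂ν) ^ (2 : ℝ) ∂P
        = ∫⁻ ω, ∫⁻ s, f s ω * ∫⁻ r, f r ω ∂ν ∂ν ∂P := by
          refine lintegral_congr fun ω => ?_
          rw [lintegral_mul_const _ (hfω ω), ENNReal.rpow_ofNat, sq]
      _ = ∫⁻ s, ∫⁻ ω, f s ω * ∫⁻ r, f r ω ∂ν ∂P ∂ν := by
          rw [lintegral_lintegral_swap]
          exact ((hf.comp measurable_swap).mul (hI.comp measurable_fst)).aemeasurable
      _ = ∫⁻ s, ∫⁻ r, ∫⁻ ω, f s ω * f r ω ∂P ∂ν ∂ν := by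
          refine lintegral_congr fun s => ?_
          rw [lintegral_lintegral_swap]
          · exact lintegral_congr fun ω => (lintegral_const_mul _ (hfω ω)).symm
          · exact (((hfs s).comp measurable_snd).mul hf).aemeasurable
      _ ≤ ∫⁻ s, ∫⁻ r, (∫⁻ ω, f s ω ^ (2 : ℝ) ∂P) ^ (1 / 2 : ℝ) *
            (∫⁻ ω, f r ω ^ (2 : ℝ) ∂P) ^ (1 / 2 : ℝ) ∂ν ∂ν :=
          lintegral_mono fun s => lintegral_mono fun r =>
            lintegral_mul_le_sqrt (hfs s).aemeasurable (hfs r).aemeasurable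
      _ = _ := by
          simp only [lintegral_const_mul _ hN]
          rw [lintegral_mul_const _ hN, ENNReal.rpow_ofNat, sq]
  calc _ ≤ ((∫⁻ s, (∫⁻ ω, f s ω ^ (2 : ℝ) ∂P) ^ (1 / 2 : ℝ) ∂ν) ^ (2 : ℝ)) ^ (1 / 2 : ℝ) :=
        ENNReal.rpow_le_rpow h1 (by norm_num)
    _ = _ := by rw [← ENNReal.rpow_mul]; norm_num

/-- A process with continuous paths that is locally bounded in `Lᵖ` on `[0, ∞)`. -/
structure IsLpProcess (p : ℝ≥0∞) (P : Measure Ω) (u : ℝ → Ω → F) : Prop where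
  continuous : ∀ ω, Continuous fun t => u t ω
  stronglyMeasurable : ∀ t, StronglyMeasurable (u t)
  bound : ∀ T : ℝ, ∃ C : ℝ≥0, ∀ t ∈ Set.Icc 0 T, eLpNorm (u t) p P ≤ C

namespace IsLpProcess

variable {p : ℝ≥0∞} {u v : ℝ → Ω → F}

lemma uncurry (hu : IsLpProcess p P u) : StronglyMeasurable (Function.uncurry u) :=
  stronglyMeasurable_uncurry_of_continuous_of_stronglyMeasurable hu.continuous hu.stronglyMeasurable

lemma memLp (hu : IsLpProcess p P u) {t : ℝ} (ht : 0 ≤ t) : MemLp (u t) p P := by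
  obtain ⟨C, hC⟩ := hu.bound t
  exact ⟨(hu.stronglyMeasurable t).aestronglyMeasurable,
    (hC t ⟨ht, le_rfl⟩).trans_lt ENNReal.coe_lt_top⟩

lemma of_memLp {x : Ω → F} (hx : MemLp x p P) (hm : StronglyMeasurable x) :
    IsLpProcess p P fun _ => x where
  continuous _ := continuous_const
  stronglyMeasurable _ := hm
  bound _ := ⟨(eLpNorm x p P).toNNReal, fun _ _ => (ENNReal.coe_toNNReal hx.2.ne).ge⟩

lemma add (hp : 1 ≤ p) (hu : IsLpProcess p P u) (hv : IsLpProcess p P v) :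
    IsLpProcess p P fun t ω => u t ω + v t ω where
  continuous ω := (hu.continuous ω).add (hv.continuous ω)
  stronglyMeasurable t := (hu.stronglyMeasurable t).add (hv.stronglyMeasurable t)
  bound T := by
    obtain ⟨C, hC⟩ := hu.bound T
    obtain ⟨C', hC'⟩ := hv.bound T
    exact ⟨C + C', fun t ht => (eLpNorm_add_le (hu.stronglyMeasurable t).aestronglyMeasurable
      (hv.stronglyMeasurable t).aestronglyMeasurable hp).trans
      (by push_cast; exact add_le_add (hC t ht) (hC' t ht))⟩

lemma clm_apply (hu : IsLpProcess p P u) {a : ℝ → F →L[ℝ] G} (ha : Continuous a) :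
    IsLpProcess p P fun t ω => a t (u t ω) where
  continuous ω := ha.clm_apply (hu.continuous ω)
  stronglyMeasurable t := (a t).continuous.comp_stronglyMeasurable (hu.stronglyMeasurable t)
  bound T := by
    obtain ⟨C, hC⟩ := hu.bound T
    obtain ⟨K, hK0, hK⟩ := exists_norm_le_Icc ha T
    refine ⟨K.toNNReal * C, fun t ht => ?_⟩
    have := eLpNorm_le_nnreal_smul_eLpNorm_of_ae_le_mul (f := fun ω => a t (u t ω)) (g := u t)
      (c := K.toNNReal) (μ := P)
      (ae_of_all _ fun ω => by
        rw [← NNReal.coe_le_coe]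
        simp only [NNReal.coe_mul, coe_nnnorm, Real.coe_toNNReal _ hK0]
        exact ((a t).le_opNorm _).trans (mul_le_mul_of_nonneg_right (hK t ht) (norm_nonneg _))) p
    refine this.trans ?_
    rw [ENNReal.smul_def, smul_eq_mul, ENNReal.coe_mul]
    exact mul_le_mul_right (hC t ht) _

lemma norm (hu : IsLpProcess p P u) : IsLpProcess p P fun t ω => ‖u t ω‖ where
  continuous ω := (hu.continuous ω).norm
  stronglyMeasurable t := (hu.stronglyMeasurable t).norm
  bound T := by
    obtain ⟨C, hC⟩ := hu.bound T
    exact ⟨C, fun t ht => by rw [eLpNorm_norm]; exact hC t ht⟩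

end IsLpProcess

lemma enorm_intervalIntegral_le (f : ℝ → F) {t : ℝ} (ht : 0 ≤ t) :
    ‖∫ s in (0 : ℝ)..t, f s‖ₑ ≤ ∫⁻ s in Set.Ioc 0 t, ‖f s‖ₑ := by
  rw [intervalIntegral.integral_of_le ht]
  exact enorm_integral_le_lintegral_enorm _

lemma eLpNorm_integral_le [SFinite P] {u : ℝ → Ω → F}
    (hu : StronglyMeasurable (Function.uncurry u)) {t : ℝ} (ht : 0 ≤ t) :
    eLpNorm (fun ω => ∫ s in (0 : ℝ)..t, u s ω) 2 P ≤
      ∫⁻ s in Set.Ioc 0 t, eLpNorm (u s) 2 P := by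
  simp only [eLpNorm_two]
  refine le_trans ?_ (lintegral_minkowski (f := fun s ω => ‖u s ω‖ₑ) hu.enorm)
  refine ENNReal.rpow_le_rpow (lintegral_mono fun ω => ENNReal.rpow_le_rpow
    (enorm_intervalIntegral_le _ ht) (by norm_num)) (by norm_num)

lemma lintegral_Ioc_ofReal_le {φ : ℝ → ℝ} (hφ : Continuous φ) {t : ℝ} (ht : 0 ≤ t)
    (h0 : ∀ s ∈ Set.Icc 0 t, 0 ≤ φ s) {f : ℝ → ℝ≥0∞}
    (hf : ∀ s ∈ Set.Icc 0 t, f s ≤ ENNReal.ofReal (φ s)) :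
    ∫⁻ s in Set.Ioc 0 t, f s ≤ ENNReal.ofReal (∫ s in (0 : ℝ)..t, φ s) := by
  rw [intervalIntegral.integral_of_le ht, ofReal_integral_eq_lintegral_ofReal]
  · exact setLIntegral_mono' measurableSet_Ioc fun s hs => hf s (Set.Ioc_subset_Icc_self hs)
  · exact hφ.integrableOn_Ioc
  · filter_upwards [ae_restrict_mem measurableSet_Ioc] with s hs
    exact h0 s (Set.Ioc_subset_Icc_self hs)

lemma eLpNorm_integral_le_ofReal [SFinite P] {u : ℝ → Ω → F}
    (hu : StronglyMeasurable (Function.uncurry u)) {t : ℝ} (ht : 0 ≤ t) {φ : ℝ → ℝ}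
    (hφ : Continuous φ) (h0 : ∀ s ∈ Set.Icc 0 t, 0 ≤ φ s)
    (h : ∀ s ∈ Set.Icc 0 t, eLpNorm (u s) 2 P ≤ ENNReal.ofReal (φ s)) :
    eLpNorm (fun ω => ∫ s in (0 : ℝ)..t, u s ω) 2 P ≤
      ENNReal.ofReal (∫ s in (0 : ℝ)..t, φ s) :=
  (eLpNorm_integral_le hu ht).trans (lintegral_Ioc_ofReal_le hφ ht h0 h)

namespace IsLpProcess

variable [CompleteSpace F]

lemma integral [SFinite P] {u : ℝ → Ω → F} (hu : IsLpProcess 2 P u) :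
    IsLpProcess 2 P fun t ω => ∫ s in (0 : ℝ)..t, u s ω where
  continuous ω := intervalIntegral.continuous_primitive
    (fun _ _ => (hu.continuous ω).intervalIntegrable _ _) 0
  stronglyMeasurable t := by
    simp only [intervalIntegral]
    exact (StronglyMeasurable.integral_prod_left hu.uncurry).sub
      (StronglyMeasurable.integral_prod_left hu.uncurry)
  bound T := by
    obtain ⟨C, hC⟩ := hu.bound T
    refine ⟨C * T.toNNReal, fun t ht => ?_⟩
    refine (eLpNorm_integral_le hu.uncurry ht.1).trans ?_
    calc ∫⁻ s in Set.Ioc 0 t, eLpNorm (u s) 2 P ≤ ∫⁻ _ in Set.Ioc 0 t, (C : ℝ≥0∞) :=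
          setLIntegral_mono' measurableSet_Ioc fun s hs => hC s ⟨hs.1.le, hs.2.trans ht.2⟩
      _ = C * ENNReal.ofReal t := by simp
      _ ≤ _ := by
          rw [ENNReal.coe_mul]
          exact mul_le_mul_right (ENNReal.ofReal_le_ofReal ht.2) _

lemma linSol [SFinite P] {n : ℝ → Ω → F} (hn : IsLpProcess 2 P n) {a : ℝ → F →L[ℝ] F}
    (ha : Continuous a) : IsLpProcess 2 P fun t ω => linSol a (fun s => n s ω) t where
  continuous ω := continuous_linSol ha (hn.continuous ω)
  stronglyMeasurable t := stronglyMeasurable_linSol (fun _ => ha) hn.continuous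
    (fun _ => stronglyMeasurable_const) hn.stronglyMeasurable t
  bound T := by
    obtain ⟨K, hK0, hK⟩ := exists_norm_le_Icc ha T
    have h1 : IsLpProcess 2 P fun t ω => ‖n t ω‖ +
        (K * Real.exp (K * t)) • ∫ s in (0 : ℝ)..t, ‖n s ω‖ :=
      hn.norm.add one_le_two (hn.norm.integral.clm_apply
        (a := fun t => (K * Real.exp (K * t)) • ContinuousLinearMap.id ℝ ℝ) (by fun_prop))
    obtain ⟨C, hC⟩ := h1.bound T
    refine ⟨C, fun t ht => (eLpNorm_mono_ae (ae_of_all _ fun ω => ?_)).trans (hC t ht)⟩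
    have := norm_le_of_volterra (hn.continuous ω) (continuous_linSol ha (hn.continuous ω)) hK0 hK
      (fun s hs => linSol_eq ha (hn.continuous ω) hs.1) t ht
    refine this.trans (le_trans (le_of_eq ?_) (le_abs_self _))
    rw [smul_eq_mul, mul_assoc]

lemma integrable_prod [IsFiniteMeasure P] {w : ℝ → Ω → F} (hw : IsLpProcess 1 P w) (t : ℝ) :
    Integrable (Function.uncurry w) ((volume.restrict (Set.Ioc 0 t)).prod P) := by
  refine ⟨hw.uncurry.aestronglyMeasurable, ?_⟩
  obtain ⟨C, hC⟩ := hw.bound t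
  rw [hasFiniteIntegral_iff_enorm, lintegral_prod _ hw.uncurry.enorm.aemeasurable]
  calc ∫⁻ s in Set.Ioc 0 t, ∫⁻ ω, ‖w s ω‖ₑ ∂P ≤ ∫⁻ _ in Set.Ioc 0 t, (C : ℝ≥0∞) :=
        setLIntegral_mono' measurableSet_Ioc fun s hs => by
          rw [← eLpNorm_one_eq_lintegral_enorm]
          exact hC s ⟨hs.1.le, hs.2⟩
    _ < ⊤ := by simp [ENNReal.mul_lt_top]

lemma integral_integral_swap [IsFiniteMeasure P] {w : ℝ → Ω → F} (hw : IsLpProcess 1 P w) {t : ℝ}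
    (ht : 0 ≤ t) : ∫ ω, (∫ s in (0 : ℝ)..t, w s ω) ∂P = ∫ s in (0 : ℝ)..t, (∫ ω, w s ω ∂P) := by
  refine (intervalIntegral_integral_swap ?_).symm
  rw [Set.uIoc_of_le ht]
  exact hw.integrable_prod t

lemma intervalIntegrable [IsFiniteMeasure P] {w : ℝ → Ω → F} (hw : IsLpProcess 1 P w) {t : ℝ}
    (ht : 0 ≤ t) : IntervalIntegrable (fun s => ∫ ω, w s ω ∂P) volume 0 t := by
  rw [intervalIntegrable_iff_integrableOn_Ioc_of_le ht]
  exact (hw.integrable_prod t).integral_prod_left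

end IsLpProcess

/-- For moments `s ↦ E[...]` Fubini's theorem gives integrability, but continuity is not known
beforehand; the equation itself supplies it. The indicator makes the primitive continuous on all of
`ℝ`. -/
lemma eq_linSol_of_intervalIntegrable [CompleteSpace F] {a : ℝ → F →L[ℝ] F} {n u : ℝ → F}
    (ha : Continuous a) (hn : Continuous n) {T : ℝ}
    (hi : IntervalIntegrable (fun s => a s (u s)) volume 0 T)
    (h : ∀ t ∈ Set.Icc 0 T, u t = n t + ∫ s in (0 : ℝ)..t, a s (u s)) :
    ∀ t ∈ Set.Icc 0 T, u t = linSol a n t := by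
  intro t ht
  have hT : 0 ≤ T := ht.1.trans ht.2
  rw [intervalIntegrable_iff_integrableOn_Ioc_of_le hT] at hi
  set g : ℝ → F := (Set.Ioc 0 T).indicator fun s => a s (u s) with hg
  have hgi : Integrable g := (integrable_indicator_iff measurableSet_Ioc).2 hi
  have hgc : Continuous fun t => ∫ s in (0 : ℝ)..t, g s :=
    intervalIntegral.continuous_primitive (fun _ _ => hgi.intervalIntegrable) 0
  have h1 : ∀ t ∈ Set.Icc 0 T, ∫ s in (0 : ℝ)..t, g s = ∫ s in (0 : ℝ)..t, a s (u s) := by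
    intro t ht
    rw [intervalIntegral.integral_of_le ht.1, intervalIntegral.integral_of_le ht.1]
    refine setIntegral_congr_fun measurableSet_Ioc fun s hs => ?_
    exact Set.indicator_of_mem (show s ∈ Set.Ioc 0 T from ⟨hs.1, hs.2.trans ht.2⟩) _
  have h2 := eq_linSol (u := fun t => n t + ∫ s in (0 : ℝ)..t, g s) (n' := n) ha hn (hn.add hgc)
    (T := T) (fun _ _ => rfl) (fun _ _ => rfl) (fun t ht => ?_) t ht
  · rw [← h2, h t ht, h1 t ht]
  · simp only [h1 t ht]
    congr 1
    refine intervalIntegral.integral_congr fun s hs => ?_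
    rw [Set.uIcc_of_le ht.1] at hs
    rw [h s ⟨hs.1, hs.2.trans ht.2⟩, h1 s ⟨hs.1, hs.2.trans ht.2⟩]

end LpProcess

/-! ### Second moments of linear equations driven by a process with independent increments -/

section SecondMoments

variable {Ω : Type*} {mΩ : MeasurableSpace Ω} {P : Measure Ω} {p q r d : ℕ}

/-- The outer product `x yᵀ`. -/
def outer (x : EuclideanSpace ℝ (Fin p)) (y : EuclideanSpace ℝ (Fin q)) :
    Matrix (Fin p) (Fin q) ℝ := Matrix.vecMulVec x.ofLp y.ofLp

lemma outer_apply (x : EuclideanSpace ℝ (Fin p)) (y : EuclideanSpace ℝ (Fin q)) (i : Fin p)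
    (j : Fin q) : outer x y i j = x i * y j := rfl

lemma outer_add_left (x x' : EuclideanSpace ℝ (Fin p)) (y : EuclideanSpace ℝ (Fin q)) :
    outer (x + x') y = outer x y + outer x' y := by
  ext i j; simp [outer_apply, add_mul]

lemma outer_add_right (x : EuclideanSpace ℝ (Fin p)) (y y' : EuclideanSpace ℝ (Fin q)) :
    outer x (y + y') = outer x y + outer x y' := by
  ext i j; simp [outer_apply, mul_add]

lemma outer_smul_left (c : ℝ) (x : EuclideanSpace ℝ (Fin p)) (y : EuclideanSpace ℝ (Fin q)) :
    outer (c • x) y = c • outer x y := by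
  ext i j; simp [outer_apply, mul_assoc]

lemma outer_smul_right (c : ℝ) (x : EuclideanSpace ℝ (Fin p)) (y : EuclideanSpace ℝ (Fin q)) :
    outer x (c • y) = c • outer x y := by
  ext i j; simp [outer_apply, mul_left_comm]

lemma outer_clm_left (M : Matrix (Fin r) (Fin p) ℝ) (x : EuclideanSpace ℝ (Fin p))
    (y : EuclideanSpace ℝ (Fin q)) : outer (clm M x) y = M * outer x y := by
  rw [outer, ofLp_clm, outer, Matrix.mul_vecMulVec]

lemma clm_outer (x : EuclideanSpace ℝ (Fin p)) (y z : EuclideanSpace ℝ (Fin q)) :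
    clm (outer x y) z = inner ℝ y z • x := by
  ext i
  rw [ofLp_clm, outer, Matrix.vecMulVec_mulVec]
  simp [PiLp.inner_apply, dotProduct, mul_comm]

lemma norm_outer_le (x : EuclideanSpace ℝ (Fin p)) (y : EuclideanSpace ℝ (Fin q)) :
    ‖outer x y‖ ≤ ‖x‖ * ‖y‖ := by
  rw [← norm_clm]
  refine ContinuousLinearMap.opNorm_le_bound _ (by positivity) fun z => ?_
  rw [clm_outer, norm_smul, mul_comm, mul_assoc]
  exact mul_le_mul_of_nonneg_left (norm_inner_le_norm _ _) (norm_nonneg _)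

/-- The outer product as a continuous bilinear map. -/
def outerL : EuclideanSpace ℝ (Fin p) →L[ℝ] EuclideanSpace ℝ (Fin q) →L[ℝ]
    Matrix (Fin p) (Fin q) ℝ :=
  LinearMap.mkContinuous₂
    (LinearMap.mk₂ ℝ outer outer_add_left outer_smul_left outer_add_right outer_smul_right) 1
    fun x y => by simpa using norm_outer_le x y

lemma outerL_apply (x : EuclideanSpace ℝ (Fin p)) (y : EuclideanSpace ℝ (Fin q)) :
    outerL x y = outer x y := rfl

lemma IsLpProcess.outer {u : ℝ → Ω → EuclideanSpace ℝ (Fin p)}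
    {v : ℝ → Ω → EuclideanSpace ℝ (Fin q)} (hu : IsLpProcess 2 P u) (hv : IsLpProcess 2 P v) :
    IsLpProcess 1 P fun t ω => outer (u t ω) (v t ω) where
  continuous ω := (outerL.continuous.comp (hu.continuous ω)).clm_apply (hv.continuous ω)
  stronglyMeasurable t :=
    (outerL (p := p) (q := q)).continuous₂.comp_stronglyMeasurable (f := fun ω => (u t ω, v t ω))
      ((hu.stronglyMeasurable t).prodMk (hv.stronglyMeasurable t))
  bound T := by
    obtain ⟨C, hC⟩ := hu.bound T
    obtain ⟨C', hC'⟩ := hv.bound T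
    refine ⟨C * C', fun t ht => ?_⟩
    rw [eLpNorm_one_eq_lintegral_enorm]
    calc ∫⁻ ω, ‖LinearFPF.outer (u t ω) (v t ω)‖ₑ ∂P ≤ ∫⁻ ω, ‖u t ω‖ₑ * ‖v t ω‖ₑ ∂P :=
          lintegral_mono fun ω => by
            rw [← enorm_norm (u t ω), ← enorm_norm (v t ω), ← enorm_mul]
            exact enorm_le_iff_norm_le.2 (by simpa using norm_outer_le _ _)
      _ ≤ eLpNorm (u t) 2 P * eLpNorm (v t) 2 P := by
          rw [eLpNorm_two, eLpNorm_two]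
          exact lintegral_mul_le_sqrt (hu.stronglyMeasurable t).enorm.aemeasurable
            (hv.stronglyMeasurable t).enorm.aemeasurable
      _ ≤ _ := by
          rw [ENNReal.coe_mul]
          exact mul_le_mul' (hC t ht) (hC' t ht)

/-- The matrix of cross moments `E[u vᵀ]`. -/
def cross (P : Measure Ω) (u : Ω → EuclideanSpace ℝ (Fin p)) (v : Ω → EuclideanSpace ℝ (Fin q)) :
    Matrix (Fin p) (Fin q) ℝ := ∫ ω, outer (u ω) (v ω) ∂P

lemma integrable_outer {u : Ω → EuclideanSpace ℝ (Fin p)} {v : Ω → EuclideanSpace ℝ (Fin q)}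
    (hu : MemLp u 2 P) (hv : MemLp v 2 P) : Integrable (fun ω => outer (u ω) (v ω)) P := by
  have h1 : Integrable (fun ω => ‖u ω‖ * ‖v ω‖) P := hu.norm.integrable_mul hv.norm
  refine h1.mono' ((outerL (p := p) (q := q)).continuous₂.comp_aestronglyMeasurable
    (f := fun ω => (u ω, v ω)) (hu.1.prodMk hv.1))
    (ae_of_all _ fun ω => norm_outer_le _ _)

lemma cross_apply {u : Ω → EuclideanSpace ℝ (Fin p)} {v : Ω → EuclideanSpace ℝ (Fin q)}
    (hu : MemLp u 2 P) (hv : MemLp v 2 P) (i : Fin p) (j : Fin q) :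
    cross P u v i j = ∫ ω, u ω i * v ω j ∂P :=
  ((LinearMap.toContinuousLinearMap (Matrix.entryLinearMap ℝ ℝ i j)).integral_comp_comm
    (integrable_outer hu hv)).symm

lemma cross_transpose {u : Ω → EuclideanSpace ℝ (Fin p)} {v : Ω → EuclideanSpace ℝ (Fin q)}
    (hu : MemLp u 2 P) (hv : MemLp v 2 P) : (cross P u v)ᵀ = cross P v u := by
  ext i j
  rw [Matrix.transpose_apply, cross_apply hu hv, cross_apply hv hu]
  simp only [mul_comm]

lemma cross_clm_left {u : Ω → EuclideanSpace ℝ (Fin p)} {v : Ω → EuclideanSpace ℝ (Fin q)}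
    (hu : MemLp u 2 P) (hv : MemLp v 2 P) (M : Matrix (Fin r) (Fin p) ℝ) :
    cross P (fun ω => clm M (u ω)) v = M * cross P u v := by
  simp only [cross, outer_clm_left]
  exact (LinearMap.toContinuousLinearMap (mulLeftLinearMap (Fin q) ℝ M)).integral_comp_comm
    (integrable_outer hu hv)

lemma cross_add_left {u u' : Ω → EuclideanSpace ℝ (Fin p)} {v : Ω → EuclideanSpace ℝ (Fin q)}
    (hu : MemLp u 2 P) (hu' : MemLp u' 2 P) (hv : MemLp v 2 P) :
    cross P (fun ω => u ω + u' ω) v = cross P u v + cross P u' v := by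
  simp only [cross, outer_add_left]
  exact integral_add (integrable_outer hu hv) (integrable_outer hu' hv)

lemma cross_add_right {u : Ω → EuclideanSpace ℝ (Fin p)} {v v' : Ω → EuclideanSpace ℝ (Fin q)}
    (hu : MemLp u 2 P) (hv : MemLp v 2 P) (hv' : MemLp v' 2 P) :
    cross P u (fun ω => v ω + v' ω) = cross P u v + cross P u v' := by
  simp only [cross, outer_add_right]
  exact integral_add (integrable_outer hu hv) (integrable_outer hu hv')

lemma trace_cross_self {u : Ω → EuclideanSpace ℝ (Fin d)} (hu : MemLp u 2 P) :
    (cross P u u).trace = ∫ ω, ‖u ω‖ ^ 2 ∂P := by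
  have h : ∀ M : Matrix (Fin d) (Fin d) ℝ,
      LinearMap.toContinuousLinearMap (Matrix.traceLinearMap (Fin d) ℝ ℝ) M = M.trace :=
    fun _ => rfl
  rw [cross, ← h, ← ContinuousLinearMap.integral_comp_comm _ (integrable_outer hu hu)]
  refine integral_congr_ae (ae_of_all _ fun ω => ?_)
  beta_reduce
  rw [EuclideanSpace.real_norm_sq_eq]
  simp only [h, Matrix.trace, Matrix.diag_apply, outer_apply, sq]

/-- The linear matrix equation `q' = a q + q aᵀ + Θ`, `q 0 = Γ`. -/
def lyapSol (a : ℝ → Matrix (Fin d) (Fin d) ℝ) (Γ Θ : Matrix (Fin d) (Fin d) ℝ) (t : ℝ) :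
    Matrix (Fin d) (Fin d) ℝ :=
  linSol (fun s => sylv (a s) (a s)ᵀ) (fun s => Γ + s • Θ) t

variable [IsProbabilityMeasure P]

lemma cross_integral_left {v : ℝ → Ω → EuclideanSpace ℝ (Fin p)} {y : Ω → EuclideanSpace ℝ (Fin q)}
    (hv : IsLpProcess 2 P v) (hy : IsLpProcess 2 P fun _ => y) {t : ℝ} (ht : 0 ≤ t) :
    cross P (fun ω => ∫ s in (0 : ℝ)..t, v s ω) y = ∫ s in (0 : ℝ)..t, cross P (v s) y := by
  have h := (hv.outer hy).integral_integral_swap ht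
  rw [cross]
  simp only [cross]
  rw [← h]
  refine integral_congr_ae (ae_of_all _ fun ω => ?_)
  exact (((outerL (p := p) (q := q)).flip (y ω)).intervalIntegral_comp_comm
    ((hv.continuous ω).intervalIntegrable 0 t)).symm

/-- The process is a time integral, so its outer square is differentiable along each path and no Itô
correction appears. -/
lemma cross_integral_self {v : ℝ → Ω → EuclideanSpace ℝ (Fin p)}
    (hv : IsLpProcess 2 P v) {t : ℝ} (ht : 0 ≤ t) :
    cross P (fun ω => ∫ s in (0 : ℝ)..t, v s ω) (fun ω => ∫ s in (0 : ℝ)..t, v s ω) =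
      ∫ s in (0 : ℝ)..t, (cross P (v s) (fun ω => ∫ r in (0 : ℝ)..s, v r ω) +
        cross P (fun ω => ∫ r in (0 : ℝ)..s, v r ω) (v s)) := by
  have h1 := hv.outer hv.integral
  have h2 := hv.integral.outer hv
  have h := (h1.add le_rfl h2).integral_integral_swap ht
  have h3 : ∀ ω, outer (∫ s in (0 : ℝ)..t, v s ω) (∫ s in (0 : ℝ)..t, v s ω) =
      ∫ s in (0 : ℝ)..t, (outer (v s ω) (∫ r in (0 : ℝ)..s, v r ω) +
        outer (∫ r in (0 : ℝ)..s, v r ω) (v s ω)) := by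
    intro ω
    have hd : ∀ s, HasDerivAt (fun s => ∫ r in (0 : ℝ)..s, v r ω) (v s ω) s :=
      fun s => hasDerivAt_integral_of_continuous (hv.continuous ω) s
    have hd2 : ∀ s, HasDerivAt (fun s => outer (∫ r in (0 : ℝ)..s, v r ω) (∫ r in (0 : ℝ)..s, v r ω))
        (outer (v s ω) (∫ r in (0 : ℝ)..s, v r ω) + outer (∫ r in (0 : ℝ)..s, v r ω) (v s ω)) s := by
      intro s
      have := outerL.hasFDerivAt_of_bilinear (hd s).hasFDerivAt (hd s).hasFDerivAt
      have h4 := this.hasDerivAt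
      refine h4.congr_deriv ?_
      simp [outerL_apply, add_comm]
    rw [intervalIntegral.integral_eq_sub_of_hasDerivAt (fun s _ => hd2 s)
      ((((h1.add le_rfl h2).continuous ω)).intervalIntegrable _ _)]
    simp [← outerL_apply]
  rw [cross, integral_congr_ae (ae_of_all _ h3), h]
  refine intervalIntegral.integral_congr fun s hs => ?_
  rw [Set.uIcc_of_le ht] at hs
  exact integral_add
    (integrable_outer (hv.memLp hs.1) (hv.integral.memLp hs.1))
    (integrable_outer (hv.integral.memLp hs.1) (hv.memLp hs.1))

end SecondMoments

/-! ### First and second moments of linear equations -/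

section LinearMoments

variable {Ω : Type*} {mΩ : MeasurableSpace Ω} {P : Measure Ω} [IsProbabilityMeasure P] {d : ℕ}

lemma IsLpProcess.one_of_two {F : Type*} [NormedAddCommGroup F] {u : ℝ → Ω → F}
    (hu : IsLpProcess 2 P u) : IsLpProcess 1 P u where
  continuous := hu.continuous
  stronglyMeasurable := hu.stronglyMeasurable
  bound T := by
    obtain ⟨C, hC⟩ := hu.bound T
    exact ⟨C, fun t ht => (eLpNorm_le_eLpNorm_of_exponent_le one_le_two
      (hu.stronglyMeasurable t).aestronglyMeasurable).trans (hC t ht)⟩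

lemma linSol_zero {F : Type*} [NormedAddCommGroup F] [NormedSpace ℝ F] [CompleteSpace F]
    {a : ℝ → F →L[ℝ] F} (ha : Continuous a) {t : ℝ} (ht : 0 ≤ t) :
    linSol a (fun _ => 0) t = 0 :=
  (eq_linSol (u := fun _ => 0) (n' := fun _ => 0) ha continuous_const continuous_const
    (fun _ _ => rfl) (fun _ _ => rfl) (fun s _ => by simp) t ⟨ht, le_rfl⟩).symm

lemma linSol_add {F : Type*} [NormedAddCommGroup F] [NormedSpace ℝ F] [CompleteSpace F]
    {a : ℝ → F →L[ℝ] F} {n n' : ℝ → F} (ha : Continuous a) (hn : Continuous n)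
    (hn' : Continuous n') {t : ℝ} (ht : 0 ≤ t) :
    linSol a (fun s => n s + n' s) t = linSol a n t + linSol a n' t := by
  have := linSol_sub (n := fun s => n s + n' s) ha (hn.add hn') hn' ht
  simp only [add_sub_cancel_right] at this
  rw [← this]; abel

/-- The expectation solves the same linear equation with zero forcing. -/
lemma integral_linSol {a : ℝ → Matrix (Fin d) (Fin d) ℝ} (ha : Continuous a)
    {n : ℝ → Ω → EuclideanSpace ℝ (Fin d)} (hn : IsLpProcess 2 P n)
    (hn0 : ∀ t, 0 ≤ t → ∫ ω, n t ω ∂P = 0) {t : ℝ} (ht : 0 ≤ t) :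
    ∫ ω, linSol (fun s => clm (a s)) (fun s => n s ω) t ∂P = 0 := by
  have hac : Continuous fun s => clm (a s) := continuous_clm.comp ha
  have hU := hn.linSol hac
  have hv := hU.clm_apply hac
  have hcomm : ∀ s, 0 ≤ s → ∫ ω, clm (a s) (linSol (fun s => clm (a s)) (fun s => n s ω) s) ∂P =
      clm (a s) (∫ ω, linSol (fun s => clm (a s)) (fun s => n s ω) s ∂P) := fun s hs =>
    ContinuousLinearMap.integral_comp_comm _ ((hU.memLp hs).integrable one_le_two)
  rw [eq_linSol_of_intervalIntegrable (n := fun _ => 0)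
    (u := fun t => ∫ ω, linSol (fun s => clm (a s)) (fun s => n s ω) t ∂P) hac continuous_const ?_
    ?_ t ⟨ht, le_rfl⟩, linSol_zero hac ht]
  · refine (hv.one_of_two.intervalIntegrable ht).congr fun s hs => ?_
    rw [Set.uIoc_of_le ht] at hs
    exact hcomm s hs.1.le
  · intro s hs
    rw [zero_add]
    calc ∫ ω, linSol (fun s => clm (a s)) (fun s => n s ω) s ∂P
        = ∫ ω, (n s ω + ∫ r in (0 : ℝ)..s,
            clm (a r) (linSol (fun s => clm (a s)) (fun s => n s ω) r)) ∂P :=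
          integral_congr_ae (ae_of_all _ fun ω => linSol_eq hac (hn.continuous ω) hs.1)
      _ = ∫ r in (0 : ℝ)..s,
            (∫ ω, clm (a r) (linSol (fun s => clm (a s)) (fun s => n s ω) r) ∂P) := by
          rw [integral_add ((hn.memLp hs.1).integrable one_le_two)
            ((hv.integral.memLp hs.1).integrable one_le_two), hn0 s hs.1, zero_add,
            hv.one_of_two.integral_integral_swap hs.1]
      _ = _ := by
          refine intervalIntegral.integral_congr fun r hr => ?_
          rw [Set.uIcc_of_le hs.1] at hr
          exact hcomm r hr.1

lemma intervalIntegrable_cross {p q : ℕ} {u : ℝ → Ω → EuclideanSpace ℝ (Fin p)}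
    {v : ℝ → Ω → EuclideanSpace ℝ (Fin q)} (hu : IsLpProcess 2 P u) (hv : IsLpProcess 2 P v) {t : ℝ}
    (ht : 0 ≤ t) : IntervalIntegrable (fun s => cross P (u s) (v s)) volume 0 t :=
  (hu.outer hv).intervalIntegrable ht

/-- The covariance of the solution of a linear equation driven by a process with covariance
`E[n_s n_tᵀ] = Γ + s Θ` for `s ≤ t`. -/
theorem cross_linSol_self {a : ℝ → Matrix (Fin d) (Fin d) ℝ} (ha : Continuous a)
    {n : ℝ → Ω → EuclideanSpace ℝ (Fin d)} (hn : IsLpProcess 2 P n)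
    {Γ Θ : Matrix (Fin d) (Fin d) ℝ}
    (hΓ : ∀ s t, 0 ≤ s → s ≤ t → cross P (n s) (n t) = Γ + s • Θ) {t : ℝ} (ht : 0 ≤ t) :
    cross P (fun ω => linSol (fun s => clm (a s)) (fun s => n s ω) t)
      (fun ω => linSol (fun s => clm (a s)) (fun s => n s ω) t) = lyapSol a Γ Θ t := by
  have hac : Continuous fun s => clm (a s) := continuous_clm.comp ha
  set U : ℝ → Ω → EuclideanSpace ℝ (Fin d) :=
    fun t ω => linSol (fun s => clm (a s)) (fun s => n s ω) t with hUdef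
  have hU : IsLpProcess 2 P U := hn.linSol hac
  set v : ℝ → Ω → EuclideanSpace ℝ (Fin d) := fun t ω => clm (a t) (U t ω) with hvdef
  have hv : IsLpProcess 2 P v := hU.clm_apply hac
  -- `U = V + n`, where `V = ∫ a U` is differentiable in time. All irregularity sits in `n`, whose
  -- moments are prescribed, so Fubini's theorem replaces Itô's formula.
  set V : ℝ → Ω → EuclideanSpace ℝ (Fin d) := fun t ω => ∫ s in (0 : ℝ)..t, v s ω with hVdef
  have hV : IsLpProcess 2 P V := hv.integral
  have hUV : ∀ t, 0 ≤ t → U t = fun ω => V t ω + n t ω := fun t ht => by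
    funext ω
    rw [add_comm]
    exact linSol_eq hac (hn.continuous ω) ht
  have hΓT : ∀ s : ℝ, 0 ≤ s → (Γ + s • Θ)ᵀ = Γ + s • Θ := fun s hs => by
    rw [← hΓ s s hs le_rfl, cross_transpose (hn.memLp hs) (hn.memLp hs)]
  -- the cross moments of `V` and `n`
  set L : ℝ → Matrix (Fin d) (Fin d) ℝ →L[ℝ] Matrix (Fin d) (Fin d) ℝ :=
    fun s => sylv (a s) 0 with hLdef
  have hL : Continuous L := continuous_sylv ha continuous_const
  have hg : Continuous fun s => a s * (Γ + s • Θ) := by fun_prop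
  set k : ℝ → Matrix (Fin d) (Fin d) ℝ :=
    linSol L (fun t => ∫ s in (0 : ℝ)..t, a s * (Γ + s • Θ)) with hkdef
  have hnc : Continuous fun t => ∫ s in (0 : ℝ)..t, a s * (Γ + s • Θ) :=
    intervalIntegral.continuous_primitive (fun _ _ => hg.intervalIntegrable _ _) 0
  have hkc : Continuous k := continuous_linSol hL hnc
  -- For `s ≤ t` the cross moment of `V s` and `n t` is independent of `t`, because `E[n_r n_tᵀ] = Γ
  -- + r Θ` is so for `r ≤ t`. It therefore solves a linear equation in `s` alone.
  have hVn : ∀ t, 0 ≤ t → ∀ s ∈ Set.Icc 0 t, cross P (V s) (n t) = k s := by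
    intro t ht
    have hy : IsLpProcess 2 P fun _ => n t :=
      IsLpProcess.of_memLp (hn.memLp ht) (hn.stronglyMeasurable t)
    have hi := intervalIntegrable_cross hv hy ht
    have hvy : ∀ r ∈ Set.Icc 0 t, cross P (v r) (n t) =
        L r (cross P (V r) (n t)) + a r * (Γ + r • Θ) := by
      intro r hr
      rw [hvdef]
      simp only
      rw [cross_clm_left (hU.memLp hr.1) (hn.memLp ht), hUV r hr.1,
        cross_add_left (hV.memLp hr.1) (hn.memLp hr.1) (hn.memLp ht), hΓ r t hr.1 hr.2, mul_add,
        hLdef, sylv_apply, mul_zero, add_zero]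
    have hi' : IntervalIntegrable (fun r => L r (cross P (V r) (n t))) volume 0 t := by
      refine (hi.sub (hg.intervalIntegrable 0 t)).congr fun r hr => ?_
      rw [Set.uIoc_of_le ht] at hr
      simp only [hvy r ⟨hr.1.le, hr.2⟩, add_sub_cancel_right]
    refine eq_linSol_of_intervalIntegrable hL hnc hi' fun s hs => ?_
    have hss : Set.uIcc 0 s ⊆ Set.uIcc 0 t := by
      rw [Set.uIcc_of_le hs.1, Set.uIcc_of_le ht]; exact Set.Icc_subset_Icc_right hs.2
    rw [add_comm, ← intervalIntegral.integral_add (hi'.mono_set hss) (hg.intervalIntegrable 0 s),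
      cross_integral_left hv hy hs.1]
    refine intervalIntegral.integral_congr fun r hr => ?_
    rw [Set.uIcc_of_le hs.1] at hr
    exact hvy r ⟨hr.1, hr.2.trans hs.2⟩
  have hkeq : ∀ t, 0 ≤ t → k t = ∫ s in (0 : ℝ)..t, a s * (k s + (Γ + s • Θ)) := fun t ht => by
    rw [hkdef, linSol_eq hL hnc ht, ← hkdef,
      ← intervalIntegral.integral_add (hg.intervalIntegrable 0 t)
        ((hL.clm_apply hkc).intervalIntegrable 0 t)]
    refine intervalIntegral.integral_congr fun r hr => ?_
    simp only [hLdef, sylv_apply, mul_zero, add_zero, mul_add]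
    abel
  have hkT : ∀ t, 0 ≤ t → (k t)ᵀ = ∫ s in (0 : ℝ)..t, ((k s)ᵀ + (Γ + s • Θ)) * (a s)ᵀ := by
    intro t ht
    have h := (LinearMap.toContinuousLinearMap
      (Matrix.transposeLinearEquiv (Fin d) (Fin d) ℝ ℝ).toLinearMap).intervalIntegral_comp_comm
      (μ := volume) (a := 0) (b := t) (f := fun s => a s * (k s + (Γ + s • Θ)))
      ((ha.mul (hkc.add (by fun_prop))).intervalIntegrable _ _)
    rw [← hkeq t ht] at h
    refine Eq.trans (Eq.symm h) (intervalIntegral.integral_congr fun r hr => ?_)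
    rw [Set.uIcc_of_le ht] at hr
    change (a r * (k r + (Γ + r • Θ)))ᵀ = _
    rw [Matrix.transpose_mul, Matrix.transpose_add, hΓT r hr.1]
  -- the second moments
  set c : ℝ → Matrix (Fin d) (Fin d) ℝ := fun t => cross P (V t) (V t) with hcdef
  have hq : ∀ t, 0 ≤ t → cross P (U t) (U t) = c t + k t + (k t)ᵀ + (Γ + t • Θ) := by
    intro t ht
    have h1 := hVn t ht t ⟨ht, le_rfl⟩
    have h2 : cross P (n t) (V t) = (k t)ᵀ := by
      rw [← h1, cross_transpose (hV.memLp ht) (hn.memLp ht)]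
    rw [hUV t ht, cross_add_left (hV.memLp ht) (hn.memLp ht)
        (show MemLp (fun ω => V t ω + n t ω) 2 P from (hV.memLp ht).add (hn.memLp ht)),
      cross_add_right (hV.memLp ht) (hV.memLp ht) (hn.memLp ht),
      cross_add_right (hn.memLp ht) (hV.memLp ht) (hn.memLp ht), h1, h2, hΓ t t ht le_rfl]
    abel
  have hcv : ∀ s, 0 ≤ s → cross P (v s) (V s) = a s * (c s + (k s)ᵀ) ∧
      cross P (V s) (v s) = (c s + k s) * (a s)ᵀ := by
    intro s hs
    have h1 := hVn s hs s ⟨hs, le_rfl⟩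
    have h3 : cross P (v s) (V s) = a s * (c s + (k s)ᵀ) := by
      rw [hvdef]
      simp only
      rw [cross_clm_left (hU.memLp hs) (hV.memLp hs), hUV s hs,
        cross_add_left (hV.memLp hs) (hn.memLp hs) (hV.memLp hs),
        ← cross_transpose (hV.memLp hs) (hn.memLp hs), h1]
    refine ⟨h3, ?_⟩
    rw [← cross_transpose (hv.memLp hs) (hV.memLp hs), h3, Matrix.transpose_mul,
      Matrix.transpose_add, Matrix.transpose_transpose, hcdef]
    simp only
    rw [cross_transpose (hV.memLp hs) (hV.memLp hs)]
  have hsum : ∀ s, 0 ≤ s → sylv (a s) (a s)ᵀ (cross P (U s) (U s)) =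
      (cross P (v s) (V s) + cross P (V s) (v s)) + (a s * (k s + (Γ + s • Θ)) +
        ((k s)ᵀ + (Γ + s • Θ)) * (a s)ᵀ) := by
    intro s hs
    rw [(hcv s hs).1, (hcv s hs).2, sylv_apply, hq s hs]
    noncomm_ring
  have hi1 := (intervalIntegrable_cross hv hV ht).add (intervalIntegrable_cross hV hv ht)
  have hi2 : Continuous fun s => a s * (k s + (Γ + s • Θ)) := ha.mul (hkc.add (by fun_prop))
  have hi3 : Continuous fun s => ((k s)ᵀ + (Γ + s • Θ)) * (a s)ᵀ :=
    (hkc.matrix_transpose.add (by fun_prop)).mul ha.matrix_transpose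
  have hi23 : Continuous fun s => a s * (k s + (Γ + s • Θ)) + ((k s)ᵀ + (Γ + s • Θ)) * (a s)ᵀ :=
    hi2.add hi3
  refine eq_linSol_of_intervalIntegrable (u := fun t => cross P (U t) (U t))
    (n := fun s => Γ + s • Θ) (continuous_sylv ha ha.matrix_transpose) (by fun_prop)
    ?_ (fun s hs => ?_) t ⟨ht, le_rfl⟩
  · refine (hi1.add (hi23.intervalIntegrable 0 t)).congr fun s hs => ?_
    rw [Set.uIoc_of_le ht] at hs
    exact (hsum s hs.1.le).symm
  · have hss : Set.uIcc 0 s ⊆ Set.uIcc 0 t := by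
      rw [Set.uIcc_of_le hs.1, Set.uIcc_of_le ht]; exact Set.Icc_subset_Icc_right hs.2
    have h1 : ∫ r in (0 : ℝ)..s, sylv (a r) (a r)ᵀ (cross P (U r) (U r)) =
        c s + (k s + (k s)ᵀ) := by
      rw [hkT s hs.1, hkeq s hs.1, ← intervalIntegral.integral_add (hi2.intervalIntegrable 0 s)
        (hi3.intervalIntegrable 0 s), show c s = ∫ r in (0 : ℝ)..s,
          (cross P (v r) (V r) + cross P (V r) (v r)) from cross_integral_self hv hs.1,
        ← intervalIntegral.integral_add (hi1.mono_set hss)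
        (hi23.intervalIntegrable 0 s)]
      refine intervalIntegral.integral_congr fun r hr => ?_
      rw [Set.uIcc_of_le hs.1] at hr
      exact hsum r hr.1
    rw [h1, hq s hs.1]
    abel

end LinearMoments

/-! ### Itô integrals of deterministic smooth integrands, by parts -/

section ByParts

variable {p q : ℕ}

/-- The pathwise integral `∫₀ᵗ K dz`, defined by integration by parts, when `K` has derivative
`K'`. -/
def byParts (K K' : ℝ → Matrix (Fin p) (Fin q) ℝ) (z : ℝ → EuclideanSpace ℝ (Fin q)) (t : ℝ) :
    EuclideanSpace ℝ (Fin p) :=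
  clm (K t) (z t) - clm (K 0) (z 0) - ∫ s in (0 : ℝ)..t, clm (K' s) (z s)

variable {K K' : ℝ → Matrix (Fin p) (Fin q) ℝ}

lemma continuous_clm_path {M : ℝ → Matrix (Fin p) (Fin q) ℝ} {z : ℝ → EuclideanSpace ℝ (Fin q)}
    (hM : Continuous M) (hz : Continuous z) : Continuous fun t => clm (M t) (z t) :=
  (continuous_clm.comp hM).clm_apply hz

lemma continuous_byParts (hK : Continuous K) (hK' : Continuous K')
    {z : ℝ → EuclideanSpace ℝ (Fin q)} (hz : Continuous z) : Continuous (byParts K K' z) :=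
  ((continuous_clm_path hK hz).sub continuous_const).sub (intervalIntegral.continuous_primitive
    (fun _ _ => (continuous_clm_path hK' hz).intervalIntegrable _ _) 0)

lemma byParts_congr {z z' : ℝ → EuclideanSpace ℝ (Fin q)} {t : ℝ} (ht : 0 ≤ t)
    (h : ∀ s ∈ Set.Icc 0 t, z s = z' s) : byParts K K' z t = byParts K K' z' t := by
  rw [byParts, byParts, h t ⟨ht, le_rfl⟩, h 0 ⟨le_rfl, ht⟩]
  congr 1
  refine intervalIntegral.integral_congr fun s hs => ?_
  rw [Set.uIcc_of_le ht] at hs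
  simp only [h s hs]

lemma byParts_add (hK' : Continuous K') {z z' : ℝ → EuclideanSpace ℝ (Fin q)} (hz : Continuous z)
    (hz' : Continuous z') (t : ℝ) :
    byParts K K' (fun s => z s + z' s) t = byParts K K' z t + byParts K K' z' t := by
  simp only [byParts, map_add]
  rw [intervalIntegral.integral_add ((continuous_clm_path hK' hz).intervalIntegrable _ _)
    ((continuous_clm_path hK' hz').intervalIntegrable _ _)]
  abel

/-- Consistency of the definition by parts with ordinary integration; it applies to the drift part
of the observations. -/
lemma byParts_integral (hK' : Continuous K')
    (hK : ∀ t, 0 ≤ t → K t = K 0 + ∫ s in (0 : ℝ)..t, K' s) {y : ℝ → EuclideanSpace ℝ (Fin q)}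
    (hy : Continuous y) {t : ℝ} (ht : 0 ≤ t) :
    byParts K K' (fun t => ∫ s in (0 : ℝ)..t, y s) t = ∫ s in (0 : ℝ)..t, clm (K s) (y s) := by
  set K₁ : ℝ → Matrix (Fin p) (Fin q) ℝ := fun t => K 0 + ∫ s in (0 : ℝ)..t, K' s with hK₁
  have hd : ∀ s, HasDerivAt K₁ (K' s) s := fun s =>
    (hasDerivAt_integral_of_continuous hK' s).const_add _
  have hK₁c : Continuous K₁ := continuous_iff_continuousAt.2 fun s => (hd s).continuousAt
  have hx : ∀ s, HasDerivAt (fun t => ∫ s in (0 : ℝ)..t, y s) (y s) s := fun s =>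
    hasDerivAt_integral_of_continuous hy s
  have hxc : Continuous fun t => ∫ s in (0 : ℝ)..t, y s :=
    continuous_iff_continuousAt.2 fun s => (hx s).continuousAt
  have hprod : ∀ s, HasDerivAt (fun t => clm (K₁ t) (∫ s in (0 : ℝ)..t, y s))
      (clm (K' s) (∫ r in (0 : ℝ)..s, y r) + clm (K₁ s) (y s)) s := fun s =>
    ((clmL.hasFDerivAt.comp_hasDerivAt s (hd s))).clm_apply (hx s)
  have hint := intervalIntegral.integral_eq_sub_of_hasDerivAt (a := 0) (b := t)
    (fun s _ => hprod s) (((continuous_clm_path hK' hxc).add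
      (continuous_clm_path hK₁c hy)).intervalIntegrable _ _)
  rw [intervalIntegral.integral_add ((continuous_clm_path hK' hxc).intervalIntegrable _ _)
    ((continuous_clm_path hK₁c hy).intervalIntegrable _ _)] at hint
  have h1 : ∫ s in (0 : ℝ)..t, clm (K s) (y s) = ∫ s in (0 : ℝ)..t, clm (K₁ s) (y s) := by
    refine intervalIntegral.integral_congr fun s hs => ?_
    rw [Set.uIcc_of_le ht] at hs
    simp only [hK₁, hK s hs.1]
  rw [h1, byParts, hK t ht, intervalIntegral.integral_same, map_zero, sub_zero]
  rw [intervalIntegral.integral_same, map_zero, sub_zero] at hint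
  rw [sub_eq_iff_eq_add, ← hint]
  abel

lemma byParts_sub_coeff {K₁ K₁' : ℝ → Matrix (Fin p) (Fin q) ℝ} (hK' : Continuous K')
    (hK₁' : Continuous K₁') {z : ℝ → EuclideanSpace ℝ (Fin q)} (hz : Continuous z) (t : ℝ) :
    byParts (fun s => K s - K₁ s) (fun s => K' s - K₁' s) z t =
      byParts K K' z t - byParts K₁ K₁' z t := by
  simp only [byParts, clm_sub, sub_apply]
  rw [intervalIntegral.integral_sub ((continuous_clm_path hK' hz).intervalIntegrable _ _)
    ((continuous_clm_path hK₁' hz).intervalIntegrable _ _)]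
  abel

lemma sum_mul_sub_byParts (k : ℕ → Matrix (Fin p) (Fin q) ℝ) (z : ℕ → EuclideanSpace ℝ (Fin q))
    (n : ℕ) : ∑ i ∈ Finset.range n, clm (k i) (z (i + 1) - z i) =
      clm (k n) (z n) - clm (k 0) (z 0) -
        ∑ i ∈ Finset.range n, clm (k (i + 1) - k i) (z (i + 1)) := by
  induction n with
  | zero => simp
  | succ n ih =>
    rw [Finset.sum_range_succ, ih, Finset.sum_range_succ, clm_sub, sub_apply,
      map_sub]
    abel

/-- Summation by parts moves the increments onto `K`, which has a continuous derivative on `[0, ∞)`.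
The sums then converge along every continuous path `z`, whatever its variation. -/
lemma tendsto_riemann_byParts (hK' : Continuous K')
    (hK : ∀ t, 0 ≤ t → K t = K 0 + ∫ s in (0 : ℝ)..t, K' s) {z : ℝ → EuclideanSpace ℝ (Fin q)}
    (hz : Continuous z) {t : ℝ} (ht : 0 ≤ t) :
    Tendsto (fun n : ℕ => ∑ k ∈ Finset.range n, clm (K ((k : ℝ) / n * t))
      (z (((k : ℝ) + 1) / n * t) - z ((k : ℝ) / n * t))) atTop (𝓝 (byParts K K' z t)) := by
  obtain ⟨C, hC0, hC⟩ := exists_norm_le_Icc hK' t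
  rw [Metric.tendsto_atTop]
  intro ε hε
  have hu : UniformContinuousOn z (Set.Icc 0 t) :=
    isCompact_Icc.uniformContinuousOn_of_continuous hz.continuousOn
  rw [Metric.uniformContinuousOn_iff] at hu
  -- `C t + 1` in place of `C t`, which may be zero; the total error will be `ε C t / (C t + 1) <
  -- ε`.
  obtain ⟨δ, hδ, hu⟩ := hu (ε / (C * t + 1)) (by positivity)
  obtain ⟨N, hN⟩ := exists_nat_gt (t / δ)
  refine ⟨N + 1, fun n hn => ?_⟩
  have hn0 : (0 : ℝ) < n := by exact_mod_cast (Nat.succ_pos N).trans_le hn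
  have hnN : t / δ < n := hN.trans_le (by exact_mod_cast (Nat.le_succ N).trans hn)
  have hmesh : t / n < δ := by
    rw [div_lt_iff₀ hδ] at hnN
    rw [div_lt_iff₀ hn0]; linarith
  set τ : ℕ → ℝ := fun k => (k : ℝ) / n * t with hτ
  have hτ0 : τ 0 = 0 := by simp [hτ]
  have hτn : τ n = t := by simp [hτ, hn0.ne']
  have hτs : ∀ k, τ (k + 1) - τ k = t / n := fun k => by
    simp only [hτ, Nat.cast_add, Nat.cast_one]; field_simp; ring
  have hτle : ∀ k, τ k ≤ τ (k + 1) := fun k => by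
    have : 0 ≤ t / n := by positivity
    linarith [hτs k]
  have hτnn : ∀ k, 0 ≤ τ k := fun k => by simp only [hτ]; positivity
  have hτt : ∀ k, k < n → τ (k + 1) ≤ t := fun k hk => by
    simp only [hτ]
    refine mul_le_of_le_one_left ht ?_
    rw [div_le_one hn0]
    exact_mod_cast hk
  have hKd : ∀ k, K (τ (k + 1)) - K (τ k) = ∫ s in (τ k)..(τ (k + 1)), K' s := fun k => by
    rw [hK _ (hτnn _), hK _ (hτnn _), add_sub_add_left_eq_sub,
      intervalIntegral.integral_interval_sub_left (hK'.intervalIntegrable _ _)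
        (hK'.intervalIntegrable _ _)]
  have hsum : ∑ k ∈ Finset.range n, clm (K ((k : ℝ) / n * t))
      (z (((k : ℝ) + 1) / n * t) - z ((k : ℝ) / n * t)) = clm (K t) (z t) - clm (K 0) (z 0) -
        ∑ i ∈ Finset.range n, clm (K (τ (i + 1)) - K (τ i)) (z (τ (i + 1))) := by
    have := sum_mul_sub_byParts (fun k => K (τ k)) (fun k => z (τ k)) n
    rw [hτn, hτ0] at this
    rw [← this]
    refine Finset.sum_congr rfl fun k _ => ?_
    simp only [hτ, Nat.cast_add, Nat.cast_one]
  have hint : ∀ k, IntervalIntegrable (fun s => clm (K' s) (z s)) volume (τ k) (τ (k + 1)) :=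
    fun k => (continuous_clm_path hK' hz).intervalIntegrable _ _
  have hint' : ∀ k, IntervalIntegrable (fun s => clm (K' s) (z (τ (k + 1)))) volume
      (τ k) (τ (k + 1)) := fun k => (continuous_clm_path hK' continuous_const).intervalIntegrable _ _
  have hI : ∫ s in (0 : ℝ)..t, clm (K' s) (z s) =
      ∑ k ∈ Finset.range n, ∫ s in (τ k)..(τ (k + 1)), clm (K' s) (z s) := by
    rw [intervalIntegral.sum_integral_adjacent_intervals fun k _ => hint k, hτ0, hτn]
  have hterm : ∀ k ∈ Finset.range n,
      ‖clm (K (τ (k + 1)) - K (τ k)) (z (τ (k + 1))) -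
        ∫ s in (τ k)..(τ (k + 1)), clm (K' s) (z s)‖ ≤ C * (ε / (C * t + 1)) * (t / n) := by
    intro k hk
    have hkn := Finset.mem_range.1 hk
    have h1 : clm (K (τ (k + 1)) - K (τ k)) (z (τ (k + 1))) =
        ∫ s in (τ k)..(τ (k + 1)), clm (K' s) (z (τ (k + 1))) := by
      rw [hKd, ← clmL_apply, ← ContinuousLinearMap.intervalIntegral_comp_comm _
        (hK'.intervalIntegrable _ _)]
      exact ContinuousLinearMap.intervalIntegral_apply
        ((continuous_clm.comp hK').intervalIntegrable _ _) _
    rw [h1, ← intervalIntegral.integral_sub (hint' k) (hint k)]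
    refine (intervalIntegral.norm_integral_le_of_norm_le_const
      (C := C * (ε / (C * t + 1))) fun s hs => ?_).trans (le_of_eq ?_)
    · rw [Set.uIoc_of_le (hτle k)] at hs
      have hs0 : 0 ≤ s := (hτnn k).trans hs.1.le
      have hst : s ≤ t := hs.2.trans (hτt k hkn)
      rw [← map_sub]
      refine (norm_clm_le _ _).trans (mul_le_mul (hC s ⟨hs0, hst⟩) ?_ (norm_nonneg _) hC0)
      rw [← dist_eq_norm]
      refine (hu _ ⟨hτnn _, hτt k hkn⟩ _ ⟨hs0, hst⟩ ?_).le
      rw [Real.dist_eq, abs_of_nonneg (by linarith [hs.2])]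
      linarith [hτs k, hs.1]
    · rw [hτs, abs_of_nonneg (by positivity)]
  rw [hsum, byParts, dist_eq_norm, hI]
  have heq : clm (K t) (z t) - clm (K 0) (z 0) -
        ∑ i ∈ Finset.range n, clm (K (τ (i + 1)) - K (τ i)) (z (τ (i + 1))) -
      (clm (K t) (z t) - clm (K 0) (z 0) -
        ∑ k ∈ Finset.range n, ∫ s in (τ k)..(τ (k + 1)), clm (K' s) (z s)) =
      -∑ k ∈ Finset.range n, (clm (K (τ (k + 1)) - K (τ k)) (z (τ (k + 1))) -
        ∫ s in (τ k)..(τ (k + 1)), clm (K' s) (z s)) := by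
    rw [Finset.sum_sub_distrib]; abel
  rw [heq, norm_neg]
  calc _ ≤ ∑ _k ∈ Finset.range n, C * (ε / (C * t + 1)) * (t / n) :=
        (norm_sum_le _ _).trans (Finset.sum_le_sum hterm)
    _ = ε * (C * t / (C * t + 1)) := by
        rw [Finset.sum_const, Finset.card_range, nsmul_eq_mul]
        field_simp
    _ < ε := by
        refine mul_lt_of_lt_one_right hε ?_
        rw [div_lt_one (by positivity)]
        linarith

variable {Ω : Type*} {mΩ : MeasurableSpace Ω} {P : Measure Ω} [IsFiniteMeasure P]

/-- Riemann sums converge pathwise, and limits in probability are unique; rational times and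
continuity then give one null set for all times. Itô integrals are evaluated only in this case of a
deterministic differentiable integrand. -/
lemma IsItoIntegral.ae_eq_byParts {Z : ℝ≥0 → Ω → EuclideanSpace ℝ (Fin q)}
    {I : ℝ≥0 → Ω → EuclideanSpace ℝ (Fin p)} (hKc : Continuous K) (hK' : Continuous K')
    (hK : ∀ t, 0 ≤ t → K t = K 0 + ∫ s in (0 : ℝ)..t, K' s)
    (hZm : ∀ t, Measurable (Z t)) {z : ℝ → Ω → EuclideanSpace ℝ (Fin q)}
    (hz : ∀ ω, Continuous fun t => z t ω) (hzZ : ∀ᵐ ω ∂P, ∀ t : ℝ, z t ω = Z t.toNNReal ω)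
    (hI : IsItoIntegral P (fun t _ => K t) Z I) :
    ∀ᵐ ω ∂P, ∀ t : ℝ≥0, I t ω = byParts K K' (fun s => z s ω) t := by
  have h1 : ∀ t : ℝ≥0, ∀ᵐ ω ∂P, I t ω = byParts K K' (fun s => z s ω) t := by
    intro t
    refine tendstoInMeasure_ae_unique (hI.2 t) (tendstoInMeasure_of_tendsto_ae (fun n => ?_) ?_)
    · refine (Measurable.aestronglyMeasurable ?_)
      refine Finset.measurable_fun_sum _ fun k _ => ?_
      exact (clm (K ((k : ℝ≥0) / n * t : ℝ≥0))).measurable.comp ((hZm _).sub (hZm _))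
    · filter_upwards [hzZ] with ω hω
      have := tendsto_riemann_byParts hK' hK (hz ω) t.2
      refine this.congr fun n => Finset.sum_congr rfl fun k _ => ?_
      have h2 : ∀ r : ℝ≥0, Z r ω = z r ω := fun r => by rw [hω, Real.toNNReal_coe]
      rw [h2, h2]
      push_cast
      rfl
  have hq : ∀ᵐ ω ∂P, ∀ t : ℚ, I (t : ℝ).toNNReal ω =
      byParts K K' (fun s => z s ω) (t : ℝ).toNNReal := ae_all_iff.2 fun t => h1 _
  filter_upwards [hq, hI.1] with ω hω hc t
  have hd : DenseRange ((↑) : ℚ → ℝ) := Rat.denseRange_cast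
  have h2 : (fun t : ℝ => I t.toNNReal ω) =
      fun t : ℝ => byParts K K' (fun s => z s ω) t.toNNReal := by
    refine hd.equalizer (hc.comp continuous_real_toNNReal)
      ((continuous_byParts hKc hK' (hz ω)).comp (by fun_prop)) (funext fun t => hω t)
  have := congrFun h2 t
  simpa using this

end ByParts

/-! ### Wiener processes -/

section Wiener

set_option linter.unusedSectionVars false

variable {Ω : Type*} [mΩ : MeasurableSpace Ω] {P : Measure Ω} {d k p q : ℕ}

lemma integral_inner_eq_trace_cross {u v : Ω → EuclideanSpace ℝ (Fin d)} (hu : MemLp u 2 P)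
    (hv : MemLp v 2 P) : ∫ ω, inner ℝ (u ω) (v ω) ∂P = (cross P u v).trace := by
  rw [Matrix.trace]
  simp only [Matrix.diag_apply, cross_apply hu hv, PiLp.inner_apply]
  rw [integral_finsetSum _ fun i _ => ?_]
  · refine Finset.sum_congr rfl fun i _ => integral_congr_ae (ae_of_all _ fun ω => ?_)
    simp [mul_comm]
  · simpa [mul_comm, Pi.mul_def] using (hu.eval_piLp i).integrable_mul (hv.eval_piLp i)

lemma eLpNorm_two_eq_ofReal {F : Type*} [NormedAddCommGroup F] {u : Ω → F} (hu : MemLp u 2 P) :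
    eLpNorm u 2 P = ENNReal.ofReal √(∫ ω, ‖u ω‖ ^ 2 ∂P) := by
  rw [hu.eLpNorm_eq_integral_rpow_norm two_ne_zero ENNReal.ofNat_ne_top, Real.sqrt_eq_rpow]
  simp

lemma eLpNorm_two_eq_sqrt_trace {u : Ω → EuclideanSpace ℝ (Fin d)} (hu : MemLp u 2 P) :
    eLpNorm u 2 P = ENNReal.ofReal √((cross P u u).trace) := by
  rw [eLpNorm_two_eq_ofReal hu, trace_cross_self hu]

lemma cross_of_indep {u : Ω → EuclideanSpace ℝ (Fin p)} {v : Ω → EuclideanSpace ℝ (Fin q)}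
    [IsFiniteMeasure P] (hu : MemLp u 2 P) (hv : MemLp v 2 P) (h : IndepFun u v P) :
    cross P u v = outer (∫ ω, u ω ∂P) (∫ ω, v ω ∂P) := by
  ext i j
  have hi := (EuclideanSpace.proj (𝕜 := ℝ) i).integral_comp_comm (hu.integrable one_le_two)
  have hj := (EuclideanSpace.proj (𝕜 := ℝ) j).integral_comp_comm (hv.integrable one_le_two)
  simp only [PiLp.proj_apply] at hi hj
  rw [cross_apply hu hv, outer_apply, ← hi, ← hj]
  exact (h.comp (EuclideanSpace.proj (𝕜 := ℝ) i).measurable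
    (EuclideanSpace.proj (𝕜 := ℝ) j).measurable).integral_fun_mul_eq_mul_integral
    (hu.eval_piLp i).1 (hv.eval_piLp j).1

lemma cross_congr {u u' : Ω → EuclideanSpace ℝ (Fin p)} {v v' : Ω → EuclideanSpace ℝ (Fin q)}
    (hu : u =ᵐ[P] u') (hv : v =ᵐ[P] v') : cross P u v = cross P u' v' := by
  refine integral_congr_ae ?_
  filter_upwards [hu, hv] with ω h1 h2
  simp only [h1, h2]

namespace IsWiener

variable {B : ℝ≥0 → Ω → EuclideanSpace ℝ (Fin k)}

lemma ae_continuous (hB : IsWiener P B) : ∀ᵐ ω ∂P, Continuous fun t => B t ω := by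
  filter_upwards [ae_all_iff.2 fun i => (hB.brownian i).cont] with ω h
  exact (PiLp.continuous_toLp 2 _).comp (continuous_pi h)

lemma ae_zero (hB : IsWiener P B) : ∀ᵐ ω ∂P, B 0 ω = 0 := by
  filter_upwards [ae_all_iff.2 fun i => (hB.brownian i).eval_zero_ae_eq_zero] with ω h
  ext i; exact h i

lemma memLp (hB : IsWiener P B) (t : ℝ≥0) : MemLp (B t) 2 P :=
  MemLp.of_eval_piLp fun i =>
    ((hB.brownian i).hasLaw_eval t).hasGaussianLaw.memLp_two

variable [IsProbabilityMeasure P]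

lemma integral_eq_zero (hB : IsWiener P B) (t : ℝ≥0) : ∫ ω, B t ω ∂P = 0 := by
  ext i
  have hi := (EuclideanSpace.proj (𝕜 := ℝ) i).integral_comp_comm ((hB.memLp t).integrable one_le_two)
  simp only [PiLp.proj_apply] at hi
  rw [← hi]
  exact (hB.brownian i).integral_eval t

lemma cross_eq (hB : IsWiener P B) (s t : ℝ≥0) :
    cross P (B s) (B t) = (min s t : ℝ) • (1 : Matrix (Fin k) (Fin k) ℝ) := by
  ext i j
  rw [cross_apply (hB.memLp s) (hB.memLp t), Matrix.smul_apply, smul_eq_mul]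
  by_cases hij : i = j
  · subst hij
    have := (hB.brownian i).covariance_fun_eval s t
    rw [covariance_eq_sub ((hB.memLp s).eval_piLp i) ((hB.memLp t).eval_piLp i)] at this
    have h0 : ∫ ω, B s ω i ∂P = 0 := (hB.brownian i).integral_eval s
    rw [h0, zero_mul, sub_zero] at this
    rw [Matrix.one_apply_eq, mul_one]
    exact_mod_cast this
  · rw [Matrix.one_apply_ne hij, mul_zero]
    have h := (hB.indep.indepFun hij).comp (measurable_pi_apply s) (measurable_pi_apply t)
    have h2 := h.integral_fun_mul_eq_mul_integral ((hB.memLp s).eval_piLp i).1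
      ((hB.memLp t).eval_piLp j).1
    have h0 : ∫ ω, B s ω i ∂P = 0 := (hB.brownian i).integral_eval s
    simp only [Function.comp_apply] at h2
    rw [h2, h0, zero_mul]

lemma eLpNorm_eq (hB : IsWiener P B) (t : ℝ≥0) :
    eLpNorm (B t) 2 P = ENNReal.ofReal √(t * k) := by
  rw [eLpNorm_two_eq_sqrt_trace (hB.memLp t), hB.cross_eq, min_self]
  simp

lemma eLpNorm_sub_eq (hB : IsWiener P B) {s t : ℝ≥0} (hst : s ≤ t) :
    eLpNorm (fun ω => B t ω - B s ω) 2 P = ENNReal.ofReal √((t - s) * k) := by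
  have hm := (hB.memLp t).sub (hB.memLp s)
  have e : ∀ s t : ℝ≥0, Integrable (fun ω => inner ℝ (B s ω) (B t ω)) P := fun s t =>
    ((hB.memLp s).norm.integrable_mul (hB.memLp t).norm).mono'
      ((hB.memLp s).1.inner (hB.memLp t).1) (ae_of_all _ fun ω => norm_inner_le_norm _ _)
  have h := fun s t : ℝ≥0 => integral_inner_eq_trace_cross (hB.memLp s) (hB.memLp t)
  simp only [hB.cross_eq, Matrix.trace_smul, Matrix.trace_one, Fintype.card_fin, smul_eq_mul] at h
  have h1 : ∫ ω, ‖B t ω - B s ω‖ ^ 2 ∂P = (t - s) * k := by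
    have h2 : ∀ ω, ‖B t ω - B s ω‖ ^ 2 =
        inner ℝ (B t ω) (B t ω) - 2 * inner ℝ (B t ω) (B s ω) + inner ℝ (B s ω) (B s ω) := by
      intro ω
      rw [norm_sub_sq_real, real_inner_self_eq_norm_sq, real_inner_self_eq_norm_sq]
    rw [integral_congr_ae (ae_of_all _ h2), integral_add (show Integrable
        (fun ω => inner ℝ (B t ω) (B t ω) - 2 * inner ℝ (B t ω) (B s ω)) P from
          (e t t).sub ((e t s).const_mul 2)) (e s s),
      integral_sub (e t t) ((e t s).const_mul 2), integral_const_mul, h, h, h]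
    simp only [min_self]
    rw [min_eq_right (NNReal.coe_le_coe.2 hst)]
    ring
  have := eLpNorm_two_eq_ofReal hm
  simp only [Pi.sub_apply, h1] at this
  exact this

lemma measurable_coord (hB : IsWiener P B) (i : Fin k) : Measurable fun ω (t : ℝ≥0) => B t ω i :=
  measurable_pi_lambda _ fun t => (EuclideanSpace.proj (𝕜 := ℝ) i).measurable.comp
    (hB.measurable t)

lemma isProjectiveLimit_coord (hB : IsWiener P B) (i : Fin k) :
    IsProjectiveLimit (P.map fun ω t => B t ω i) BrownianReal.projectiveFamily := fun I => by
  rw [Measure.map_map (Finset.measurable_restrict I) (hB.measurable_coord i)]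
  exact ((hB.brownian i).hasLaw I).map_eq

/-- Independence of the coordinates reduces the law of the path to the laws of its coordinates,
which are projective limits of the Brownian finite-dimensional laws. -/
lemma map_path_eq_map_pi (hB : IsWiener P B) :
    P.map (fun ω t => B t ω) = (Measure.pi fun i => P.map fun ω t => B t ω i).map
      (fun f t => WithLp.toLp 2 fun i => f i t) := by
  rw [← (iIndepFun_iff_map_fun_eq_pi_map fun i => (hB.measurable_coord i).aemeasurable).1 hB.indep,
    Measure.map_map _ (measurable_pi_lambda _ hB.measurable_coord)]
  · rfl
  · exact measurable_pi_lambda _ fun t => (WithLp.measurable_toLp 2 _).comp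
      (measurable_pi_lambda _ fun i => (measurable_pi_apply t).comp (measurable_pi_apply i))

/-- The law of a Wiener path does not depend on the realization. -/
lemma map_path_eq {Ω' : Type*} [MeasurableSpace Ω'] {P' : Measure Ω'} [IsProbabilityMeasure P']
    {B' : ℝ≥0 → Ω' → EuclideanSpace ℝ (Fin k)} (hB : IsWiener P B) (hB' : IsWiener P' B') :
    P.map (fun ω t => B t ω) = P'.map (fun ω t => B' t ω) := by
  rw [hB.map_path_eq_map_pi, hB'.map_path_eq_map_pi]
  congr 2
  funext i
  exact (hB.isProjectiveLimit_coord i).unique (hB'.isProjectiveLimit_coord i)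

end IsWiener

end Wiener

/-! ### The Kalman-Bucy filter as a functional of the observation path -/

section Kalman

set_option linter.unusedSectionVars false

variable {Ω : Type*} [mΩ : MeasurableSpace Ω] {P : Measure Ω} {d m b : ℕ}
  {A : Matrix (Fin d) (Fin d) ℝ} {H : Matrix (Fin m) (Fin d) ℝ} {σB : Matrix (Fin d) (Fin b) ℝ}

/-- `norm_le_of_dissipative` along each path, followed by Minkowski's inequality for the time
integral. It serves for the estimation error, for the difference of two filters and for the
difference of two fluctuations. -/
lemma eLpNorm_le_of_stable [NeZero d] [SFinite P] {Q F₀ : Matrix (Fin d) (Fin d) ℝ}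
    (hσB : (σB * σBᵀ).PosDef) (hQ : Q.PosDef)
    (hF₀ : (-(F₀ * Q + Q * F₀ᵀ) - σB * σBᵀ).PosSemidef)
    {c lam : ℝ} (hc : 0 ≤ c) (hlam : 0 < lam) {p : ℝ → Matrix (Fin d) (Fin d) ℝ} {T : ℝ}
    (hT : 0 ≤ T) (hp : Continuous p) (hpc : ∀ t ∈ Set.Icc 0 T, ‖p t‖ ≤ c * Real.exp (-2 * lam * t))
    {u g : ℝ → Ω → EuclideanSpace ℝ (Fin d)} (hu : ∀ ω, Continuous fun t => u t ω)
    (hum : ∀ t, StronglyMeasurable (u t)) (hg : ∀ ω, Continuous fun t => g t ω)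
    (hgm : ∀ t, StronglyMeasurable (g t))
    (h : ∀ᵐ ω ∂P, ∀ t ∈ Set.Icc 0 T, u t ω = u 0 ω +
      ∫ s in (0 : ℝ)..t, (clm (F₀ + p s) (u s ω) + g s ω))
    {φ : ℝ → ℝ} (hφ : Continuous φ) (hφ0 : ∀ t ∈ Set.Icc 0 T, 0 ≤ φ t)
    (hgφ : ∀ t ∈ Set.Icc 0 T, eLpNorm (g t) 2 P ≤ ENNReal.ofReal (φ t)) :
    eLpNorm (u T) 2 P ≤ ENNReal.ofReal (Real.exp (-rateβ σB Q * T)) *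
      (ENNReal.ofReal (Real.exp (√(condNum Q) * c / (2 * lam)) * √(condNum Q)) *
        (eLpNorm (u 0) 2 P +
          ENNReal.ofReal (∫ s in (0 : ℝ)..T, Real.exp (rateβ σB Q * s) * φ s))) := by
  obtain ⟨N, k₁, k₂, hk₁, hk₂, hk, hN₁, hN₂, hN⟩ := exists_lyapunov_coordinates hσB hQ
  set β := rateβ σB Q with hβ
  have hβ0 : 0 < β := rateβ_pos hσB hQ
  set C := Real.exp (√(condNum Q) * c / (2 * lam)) * √(condNum Q) with hC
  have hC0 : 0 ≤ C := by positivity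
  set v : ℝ → Ω → ℝ := fun s ω => Real.exp (β * s) * ‖g s ω‖ with hv
  have hvc : ∀ ω, Continuous fun s => v s ω := fun ω => by
    have := (hg ω).norm
    exact (by fun_prop : Continuous fun s : ℝ => Real.exp (β * s)).mul this
  have hvm : ∀ s, StronglyMeasurable (v s) := fun s => (hgm s).norm.const_mul _
  have hvu : StronglyMeasurable (Function.uncurry v) :=
    stronglyMeasurable_uncurry_of_continuous_of_stronglyMeasurable hvc hvm
  have hvI : StronglyMeasurable fun ω => ∫ s in (0 : ℝ)..T, v s ω := by
    simp only [intervalIntegral]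
    exact (StronglyMeasurable.integral_prod_left hvu).sub
      (StronglyMeasurable.integral_prod_left hvu)
  have h1 : ∀ᵐ ω ∂P, ‖u T ω‖ ≤
      ‖(Real.exp (-β * T) * C) • (‖u 0 ω‖ + ∫ s in (0 : ℝ)..T, v s ω)‖ := by
    filter_upwards [h] with ω hω
    have := norm_le_of_dissipative hk₁ hk₂ hβ0.le hc hlam hN₁ hN₂ (F₀ := clm F₀)
      (p := fun t => clm (p t)) (g := fun t => g t ω) (u := fun t => u t ω) (hN F₀ hF₀)
      (continuous_clm.comp hp) (hg ω) (hu ω) hT (fun t ht => by rw [norm_clm]; exact hpc t ht)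
      (fun t ht => by
        rw [hω t ht]
        refine congrArg _ (intervalIntegral.integral_congr fun s _ => ?_)
        simp only [clm_add, add_apply])
    rw [hk, ← hC, ← mul_assoc] at this
    exact this.trans (le_abs_self _)
  refine (eLpNorm_mono_ae h1).trans ?_
  have h2 := eLpNorm_const_smul (Real.exp (-β * T) * C)
    (fun ω => ‖u 0 ω‖ + ∫ s in (0 : ℝ)..T, v s ω) 2 P
  refine h2.trans_le ?_
  rw [Real.enorm_eq_ofReal (by positivity), ENNReal.ofReal_mul (Real.exp_pos _).le, mul_assoc]
  gcongr
  refine (eLpNorm_add_le (hum 0).norm.aestronglyMeasurable hvI.aestronglyMeasurable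
    one_le_two).trans ?_
  rw [eLpNorm_norm]
  gcongr
  refine eLpNorm_integral_le_ofReal hvu hT
    ((by fun_prop : Continuous fun s : ℝ => Real.exp (β * s)).mul hφ)
    (fun s hs => mul_nonneg (Real.exp_pos _).le (hφ0 s hs)) fun s hs => ?_
  have h3 := eLpNorm_const_smul (Real.exp (β * s)) (fun ω => ‖g s ω‖) 2 P
  refine h3.trans_le ?_
  rw [Real.enorm_eq_ofReal (Real.exp_pos _).le, ENNReal.ofReal_mul (Real.exp_pos _).le, eLpNorm_norm]
  gcongr
  exact hgφ s hs

/-- Everywhere continuous versions of the signal and of the noises. -/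
lemma exists_model_versions {m₀ : EuclideanSpace ℝ (Fin d)} {S₀ : Matrix (Fin d) (Fin d) ℝ}
    {X : ℝ≥0 → Ω → EuclideanSpace ℝ (Fin d)} {Z : ℝ≥0 → Ω → EuclideanSpace ℝ (Fin m)}
    {B : ℝ≥0 → Ω → EuclideanSpace ℝ (Fin b)} {W : ℝ≥0 → Ω → EuclideanSpace ℝ (Fin m)}
    (hmod : IsFilteringModel A H σB m₀ S₀ P X Z B W) :
    ∃ (x : ℝ → Ω → EuclideanSpace ℝ (Fin d)) (bb : ℝ → Ω → EuclideanSpace ℝ (Fin b))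
      (w : ℝ → Ω → EuclideanSpace ℝ (Fin m)),
      (∀ ω, Continuous fun t => x t ω) ∧ (∀ ω, Continuous fun t => bb t ω) ∧
      (∀ ω, Continuous fun t => w t ω) ∧ (∀ t, StronglyMeasurable (x t)) ∧
      (∀ t, StronglyMeasurable (bb t)) ∧ (∀ t, StronglyMeasurable (w t)) ∧
      ∀ᵐ ω ∂P, (∀ t : ℝ, x t ω = X t.toNNReal ω) ∧ (∀ t : ℝ, bb t ω = B t.toNNReal ω) ∧
        (∀ t : ℝ, w t ω = W t.toNNReal ω) ∧ w 0 ω = 0 ∧ bb 0 ω = 0 ∧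
        (∀ t : ℝ, 0 ≤ t → x t ω = x 0 ω + (∫ s in (0 : ℝ)..t, clm A (x s ω)) + clm σB (bb t ω)) ∧
        (∀ t : ℝ, 0 ≤ t → Z t.toNNReal ω = (∫ s in (0 : ℝ)..t, clm H (x s ω)) + w t ω) := by
  have hv : ∀ {k : ℕ} {f : ℝ≥0 → Ω → EuclideanSpace ℝ (Fin k)}, (∀ t, Measurable (f t)) →
      (∀ᵐ ω ∂P, Continuous fun t => f t ω) → ∃ f' : ℝ → Ω → EuclideanSpace ℝ (Fin k),
        (∀ ω, Continuous fun t => f' t ω) ∧ (∀ t, StronglyMeasurable (f' t)) ∧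
        ∀ᵐ ω ∂P, ∀ t : ℝ, f' t ω = f t.toNNReal ω := by
    intro k f hf hc
    obtain ⟨f', h1, h2, h3⟩ := exists_adapted_version (P := P) (m := fun _ => mΩ) (f := f)
      monotone_const (fun t => ⟨f t, (hf t).stronglyMeasurable.mono (le_nullAug le_rfl),
        ae_eq_refl _⟩) hc
    exact ⟨f', h1, fun t => (h2 t).mono (nullAug_le _), h3⟩
  obtain ⟨x, hxc, hxm, hx⟩ := hv hmod.measurable_X hmod.continuous_X
  obtain ⟨bb, hbc, hbm, hb⟩ := hv hmod.wiener_B.measurable hmod.wiener_B.ae_continuous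
  obtain ⟨w, hwc, hwm, hw⟩ := hv hmod.wiener_W.measurable hmod.wiener_W.ae_continuous
  refine ⟨x, bb, w, hxc, hbc, hwc, hxm, hbm, hwm, ?_⟩
  filter_upwards [hx, hb, hw, hmod.wiener_W.ae_zero, hmod.wiener_B.ae_zero, hmod.sde_X, hmod.sde_Z]
    with ω hx hb hw hW0 hB0 hX hZ
  refine ⟨hx, hb, hw, ?_, ?_, fun t ht => ?_, fun t ht => ?_⟩
  · rw [hw, Real.toNNReal_zero, hW0]
  · rw [hb, Real.toNNReal_zero, hB0]
  · have := hX t.toNNReal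
    simp only [← hx, ← hb, Real.coe_toNNReal t ht] at this
    have h0 : X 0 ω = x 0 ω := by rw [hx, Real.toNNReal_zero]
    rw [h0] at this
    exact this
  · have := hZ t.toNNReal
    simp only [← hx, ← hw, Real.coe_toNNReal t ht] at this
    exact this

/-- The noise term `∫ S Hᵀ dz` of the Kalman-Bucy equation, by parts. -/
def kalmanInt (A : Matrix (Fin d) (Fin d) ℝ) (H : Matrix (Fin m) (Fin d) ℝ)
    (σB : Matrix (Fin d) (Fin b) ℝ) (S : ℝ → Matrix (Fin d) (Fin d) ℝ)
    (z : ℝ → EuclideanSpace ℝ (Fin m)) : ℝ → EuclideanSpace ℝ (Fin d) :=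
  byParts (fun s => S (max s 0) * Hᵀ) (fun s => ricc A H σB (S (max s 0)) * Hᵀ) z

/-- The solution of the Kalman-Bucy equation driven by the path `z`. -/
def kalmanSol (A : Matrix (Fin d) (Fin d) ℝ) (H : Matrix (Fin m) (Fin d) ℝ)
    (σB : Matrix (Fin d) (Fin b) ℝ) (S : ℝ → Matrix (Fin d) (Fin d) ℝ)
    (m₀ : EuclideanSpace ℝ (Fin d)) (z : ℝ → EuclideanSpace ℝ (Fin m)) :
    ℝ → EuclideanSpace ℝ (Fin d) :=
  linSol (fun s => clm (A - S (max s 0) * Hᵀ * H)) (fun t => m₀ + kalmanInt A H σB S z t)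

variable {S : ℝ → Matrix (Fin d) (Fin d) ℝ} {S₀ : Matrix (Fin d) (Fin d) ℝ}

lemma IsDRESolution.continuous_gain (hS : IsDRESolution A H σB S₀ S) :
    Continuous fun s => S (max s 0) * Hᵀ := hS.continuous_max.matrix_mul continuous_const

lemma IsDRESolution.continuous_gain_deriv (hS : IsDRESolution A H σB S₀ S) :
    Continuous fun s => ricc A H σB (S (max s 0)) * Hᵀ :=
  (continuous_ricc.comp hS.continuous_max).matrix_mul continuous_const

lemma IsDRESolution.gain_eq (hS : IsDRESolution A H σB S₀ S) {t : ℝ} (ht : 0 ≤ t) :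
    S (max t 0) * Hᵀ = S (max 0 0) * Hᵀ +
      ∫ s in (0 : ℝ)..t, ricc A H σB (S (max s 0)) * Hᵀ := by
  have h1 := hS.eq_integral ht
  have h2 := (LinearMap.toContinuousLinearMap
    (mulRightLinearMap (Fin d) ℝ Hᵀ)).intervalIntegral_comp_comm (μ := volume) (a := 0)
      (b := t) (f := fun s => ricc A H σB (S (max s 0)))
      ((continuous_ricc.comp hS.continuous_max).intervalIntegrable _ _)
  change ∫ s in (0 : ℝ)..t, ricc A H σB (S (max s 0)) * Hᵀ =
    (∫ s in (0 : ℝ)..t, ricc A H σB (S (max s 0))) * Hᵀ at h2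
  rw [h2, h1, max_self, hS.1, Matrix.add_mul]

lemma IsDRESolution.continuous_drift (hS : IsDRESolution A H σB S₀ S) :
    Continuous fun s => A - S (max s 0) * Hᵀ * H :=
  continuous_const.sub (hS.continuous_gain.matrix_mul continuous_const)

lemma IsDRESolution.continuous_kalmanInt (hS : IsDRESolution A H σB S₀ S)
    {z : ℝ → EuclideanSpace ℝ (Fin m)} (hz : Continuous z) : Continuous (kalmanInt A H σB S z) :=
  continuous_byParts hS.continuous_gain hS.continuous_gain_deriv hz

lemma IsDRESolution.continuous_kalmanSol (hS : IsDRESolution A H σB S₀ S)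
    {z : ℝ → EuclideanSpace ℝ (Fin m)} (hz : Continuous z) (m₀ : EuclideanSpace ℝ (Fin d)) :
    Continuous (kalmanSol A H σB S m₀ z) :=
  continuous_linSol (continuous_clm.comp hS.continuous_drift)
    (continuous_const.add (hS.continuous_kalmanInt hz))

lemma IsDRESolution.kalmanSol_eq (hS : IsDRESolution A H σB S₀ S)
    {z : ℝ → EuclideanSpace ℝ (Fin m)} (hz : Continuous z) (m₀ : EuclideanSpace ℝ (Fin d)) {t : ℝ}
    (ht : 0 ≤ t) : kalmanSol A H σB S m₀ z t = m₀ + kalmanInt A H σB S z t +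
      ∫ s in (0 : ℝ)..t, clm (A - S (max s 0) * Hᵀ * H) (kalmanSol A H σB S m₀ z s) :=
  linSol_eq (continuous_clm.comp hS.continuous_drift)
    (continuous_const.add (hS.continuous_kalmanInt hz)) ht

/-- The gain is deterministic with a continuous derivative, so the filter is an explicit functional
of the observation path. Two filters, or a filter and a conditional mean, can then be compared path
by path. -/
lemma IsKalmanFilter.ae_eq_kalmanSol [IsFiniteMeasure P] {m₀ : EuclideanSpace ℝ (Fin d)}
    {Z : ℝ≥0 → Ω → EuclideanSpace ℝ (Fin m)} {M : ℝ≥0 → Ω → EuclideanSpace ℝ (Fin d)}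
    (hM : IsKalmanFilter A H σB m₀ S₀ P Z M S) (hZ : ∀ t, Measurable (Z t))
    {z : ℝ → Ω → EuclideanSpace ℝ (Fin m)} (hz : ∀ ω, Continuous fun t => z t ω)
    (hzZ : ∀ᵐ ω ∂P, ∀ t : ℝ, z t ω = Z t.toNNReal ω) :
    ∀ᵐ ω ∂P, ∀ t : ℝ≥0, M t ω = kalmanSol A H σB S m₀ (fun s => z s ω) t := by
  have hS := hM.dre
  obtain ⟨I, hI, hsde⟩ := hM.sde
  have hI' : IsItoIntegral P (fun (t : ℝ≥0) _ => S (max (t : ℝ) 0) * Hᵀ) Z I := by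
    have : (fun (t : ℝ≥0) (_ : Ω) => S (max (t : ℝ) 0) * Hᵀ) =
        fun (t : ℝ≥0) _ => S t * Hᵀ := by
      funext t _; rw [max_eq_left t.coe_nonneg]
    rw [this]; exact hI
  filter_upwards [hM.continuous, hI'.ae_eq_byParts (K := fun s => S (max s 0) * Hᵀ)
    hS.continuous_gain hS.continuous_gain_deriv
    (fun t ht => hS.gain_eq ht) hZ hz hzZ, hsde] with ω hMc hIb hMe t
  have hac : Continuous fun s => clm (A - S (max s 0) * Hᵀ * H) :=
    continuous_clm.comp hS.continuous_drift
  have huc : Continuous fun s : ℝ => M s.toNNReal ω := hMc.comp continuous_real_toNNReal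
  have := eq_linSol (u := fun s : ℝ => M s.toNNReal ω) (T := t)
    (n := fun t => m₀ + kalmanInt A H σB S (fun s => z s ω) t)
    (n' := fun t => m₀ + kalmanInt A H σB S (fun s => z s ω) t) hac
    (continuous_const.add (hS.continuous_kalmanInt (hz ω))) huc
    (fun _ _ => rfl) (fun _ _ => rfl) (fun s hs => ?_) t ⟨t.2, le_rfl⟩
  · simp only [Real.toNNReal_coe] at this
    exact this
  · have h1 := hMe s.toNNReal
    rw [hIb, Real.coe_toNNReal s hs.1] at h1
    rw [h1, add_sub_right_comm, add_sub_assoc, add_right_comm]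
    congr 1
    have hgc : Continuous fun s : ℝ => clm (S (max s 0) * Hᵀ) (clm H (M s.toNNReal ω)) :=
      continuous_clm_path hS.continuous_gain ((clm H).continuous.comp huc)
    have h2 : ∫ r in (0 : ℝ)..s, (S r * Hᵀ).toEuclideanLin (H.toEuclideanLin (M r.toNNReal ω)) =
        ∫ r in (0 : ℝ)..s, clm (S (max r 0) * Hᵀ) (clm H (M r.toNNReal ω)) := by
      refine intervalIntegral.integral_congr fun r hr => ?_
      rw [Set.uIcc_of_le hs.1] at hr
      simp only [max_eq_left hr.1]
      rfl
    have h3 : ∫ r in (0 : ℝ)..s, A.toEuclideanLin (M r.toNNReal ω) =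
        ∫ r in (0 : ℝ)..s, clm A (M r.toNNReal ω) := rfl
    have hAc : Continuous fun r : ℝ => clm A (M r.toNNReal ω) := (clm A).continuous.comp huc
    rw [h2, h3, ← intervalIntegral.integral_sub
      (hAc.intervalIntegrable _ _) (hgc.intervalIntegrable _ _)]
    refine intervalIntegral.integral_congr fun r _ => ?_
    simp only [clm_sub, sub_apply, clm_mul]

end Kalman

/-! ### Exponential stability of the Kalman-Bucy mean -/

section MeanStability

set_option linter.unusedSectionVars false

universe u

/-- The growth `√t` of Wiener increments is absorbed into an exponential of arbitrarily small rate,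
so the estimates below involve exponentials only. -/
lemma sqrt_le_exp {γ x : ℝ} (hγ : 0 < γ) (hx : 0 ≤ x) : √x ≤ (1 + 1 / γ) * Real.exp (γ * x) := by
  have h1 : √x ≤ 1 + x := by
    rw [Real.sqrt_le_left (by positivity)]; nlinarith
  have h2 := Real.add_one_le_exp (γ * x)
  have h3 : 1 ≤ Real.exp (γ * x) := Real.one_le_exp (by positivity)
  have h4 : x ≤ 1 / γ * Real.exp (γ * x) := by
    rw [one_div, ← div_eq_inv_mul, le_div_iff₀ hγ]; linarith
  linarith

lemma integral_exp_mul {a T : ℝ} (ha : a ≠ 0) :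
    ∫ s in (0 : ℝ)..T, Real.exp (a * s) = (Real.exp (a * T) - 1) / a := by
  rw [intervalIntegral.integral_comp_mul_left (fun s => Real.exp s) ha, integral_exp]
  simp [div_eq_inv_mul]

lemma integral_exp_mul_le {a T : ℝ} (ha : 0 < a) :
    ∫ s in (0 : ℝ)..T, Real.exp (a * s) ≤ Real.exp (a * T) / a := by
  rw [integral_exp_mul ha.ne']
  gcongr
  linarith

lemma integral_exp_neg_mul_le {a T : ℝ} (ha : 0 < a) :
    ∫ s in (0 : ℝ)..T, Real.exp (-a * s) ≤ 1 / a := by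
  rw [integral_exp_mul (neg_ne_zero.2 ha.ne'), div_neg, ← neg_div]
  gcongr
  linarith [Real.exp_pos (-a * T)]

variable {Ω : Type*} [mΩ : MeasurableSpace Ω] {P : Measure Ω} {d m b p q : ℕ}
  {A : Matrix (Fin d) (Fin d) ℝ} {H : Matrix (Fin m) (Fin d) ℝ} {σB : Matrix (Fin d) (Fin b) ℝ}

lemma eLpNorm_clm_le (M : Matrix (Fin p) (Fin q) ℝ) (u : Ω → EuclideanSpace ℝ (Fin q)) {c φ : ℝ}
    (hM : ‖M‖ ≤ c) (hu : eLpNorm u 2 P ≤ ENNReal.ofReal φ) :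
    eLpNorm (fun ω => clm M (u ω)) 2 P ≤ ENNReal.ofReal (c * φ) := by
  have hc : 0 ≤ c := (norm_nonneg _).trans hM
  have := eLpNorm_le_mul_eLpNorm_of_ae_le_mul (f := fun ω => clm M (u ω)) (g := u) (c := c) (μ := P)
    (ae_of_all _ fun ω => (norm_clm_le M (u ω)).trans
      (mul_le_mul_of_nonneg_right hM (norm_nonneg _))) 2
  refine this.trans ?_
  rw [ENNReal.ofReal_mul hc]
  gcongr

lemma eLpNorm_add_le_ofReal {F : Type*} [NormedAddCommGroup F] {u v : Ω → F} {φ ψ : ℝ}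
    (hum : StronglyMeasurable u) (hvm : StronglyMeasurable v) (hφ : 0 ≤ φ) (hψ : 0 ≤ ψ)
    (hu : eLpNorm u 2 P ≤ ENNReal.ofReal φ) (hv : eLpNorm v 2 P ≤ ENNReal.ofReal ψ) :
    eLpNorm (fun ω => u ω + v ω) 2 P ≤ ENNReal.ofReal (φ + ψ) := by
  rw [ENNReal.ofReal_add hφ hψ]
  exact (eLpNorm_add_le hum.aestronglyMeasurable hvm.aestronglyMeasurable one_le_two).trans
    (add_le_add hu hv)

lemma eLpNorm_sub_le_ofReal {F : Type*} [NormedAddCommGroup F] {u v : Ω → F} {φ ψ : ℝ}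
    (hum : StronglyMeasurable u) (hvm : StronglyMeasurable v) (hφ : 0 ≤ φ) (hψ : 0 ≤ ψ)
    (hu : eLpNorm u 2 P ≤ ENNReal.ofReal φ) (hv : eLpNorm v 2 P ≤ ENNReal.ofReal ψ) :
    eLpNorm (fun ω => u ω - v ω) 2 P ≤ ENNReal.ofReal (φ + ψ) := by
  rw [ENNReal.ofReal_add hφ hψ]
  exact (eLpNorm_sub_le hum.aestronglyMeasurable hvm.aestronglyMeasurable one_le_two).trans
    (add_le_add hu hv)

lemma stronglyMeasurable_intervalIntegral {F : Type*} [NormedAddCommGroup F] [NormedSpace ℝ F]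
    {u : ℝ → Ω → F} (hc : ∀ ω, Continuous fun t => u t ω) (hm : ∀ t, StronglyMeasurable (u t))
    (s t : ℝ) : StronglyMeasurable fun ω => ∫ r in s..t, u r ω := by
  have hu : StronglyMeasurable (Function.uncurry u) :=
    stronglyMeasurable_uncurry_of_continuous_of_stronglyMeasurable hc hm
  simp only [intervalIntegral]
  exact (StronglyMeasurable.integral_prod_left hu).sub (StronglyMeasurable.integral_prod_left hu)

lemma stronglyMeasurable_byParts {K K' : ℝ → Matrix (Fin p) (Fin q) ℝ} (hK' : Continuous K')
    {z : ℝ → Ω → EuclideanSpace ℝ (Fin q)} (hz : ∀ ω, Continuous fun t => z t ω)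
    (hm : ∀ t, StronglyMeasurable (z t)) (t : ℝ) :
    StronglyMeasurable fun ω => byParts K K' (fun s => z s ω) t := by
  have h : ∀ (M : Matrix (Fin p) (Fin q) ℝ) s, StronglyMeasurable fun ω => clm M (z s ω) :=
    fun M s => (clm M).continuous.comp_stronglyMeasurable (hm s)
  exact ((h _ _).sub (h _ _)).sub (stronglyMeasurable_intervalIntegral
    (fun ω => continuous_clm_path hK' (hz ω)) (fun s => h _ s) 0 t)

lemma IsDRESolution.stronglyMeasurable_kalmanSol {S : ℝ → Matrix (Fin d) (Fin d) ℝ}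
    {S₀ : Matrix (Fin d) (Fin d) ℝ} (hS : IsDRESolution A H σB S₀ S)
    {z : ℝ → Ω → EuclideanSpace ℝ (Fin m)} (hz : ∀ ω, Continuous fun t => z t ω)
    (hm : ∀ t, StronglyMeasurable (z t)) (m₀ : EuclideanSpace ℝ (Fin d)) (t : ℝ) :
    StronglyMeasurable fun ω => kalmanSol A H σB S m₀ (fun s => z s ω) t :=
  stronglyMeasurable_linSol (fun _ => continuous_clm.comp hS.continuous_drift)
    (fun ω => continuous_const.add (hS.continuous_kalmanInt (hz ω)))
    (fun _ => stronglyMeasurable_const)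
    (fun t => stronglyMeasurable_const.add
      (stronglyMeasurable_byParts hS.continuous_gain_deriv hz hm t)) t

/-- The increment over `[s, T]` involves only `z - z s` and the values of `K`, `K'` after time `s`,
so decay of the gain makes late increments small. -/
lemma byParts_sub_eq {K K' : ℝ → Matrix (Fin p) (Fin q) ℝ} (hK' : Continuous K')
    (hK : ∀ t, 0 ≤ t → K t = K 0 + ∫ s in (0 : ℝ)..t, K' s) {z : ℝ → EuclideanSpace ℝ (Fin q)}
    (hz : Continuous z) {s T : ℝ} (hs : 0 ≤ s) (hT : 0 ≤ T) :
    byParts K K' z T - byParts K K' z s =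
      clm (K T) (z T - z s) - ∫ r in (0 : ℝ)..(T - s), clm (K' (s + r)) (z (s + r) - z s) := by
  have h1 : ∫ r in (0 : ℝ)..(T - s), clm (K' (s + r)) (z (s + r) - z s) =
      ∫ r in s..T, clm (K' r) (z r - z s) := by
    rw [intervalIntegral.integral_comp_add_left (fun r => clm (K' r) (z r - z s)) s]
    simp
  have hi := fun y : ℝ → EuclideanSpace ℝ (Fin q) => fun (hy : Continuous y) (a b : ℝ) =>
    (continuous_clm_path hK' hy).intervalIntegrable (μ := volume) a b
  have h2 : ∫ r in s..T, clm (K' r) (z s) = clm (K T - K s) (z s) := by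
    rw [hK T hT, hK s hs, add_sub_add_left_eq_sub,
      intervalIntegral.integral_interval_sub_left (hK'.intervalIntegrable _ _)
        (hK'.intervalIntegrable _ _), ← clmL_apply,
      ← ContinuousLinearMap.intervalIntegral_comp_comm _ (hK'.intervalIntegrable _ _)]
    exact (ContinuousLinearMap.intervalIntegral_apply
      ((continuous_clm.comp hK').intervalIntegrable _ _) _).symm
  have h3 := intervalIntegral.integral_interval_sub_left (hi z hz 0 T) (hi z hz 0 s)
  rw [h1]
  simp only [map_sub]
  rw [intervalIntegral.integral_sub (hi z hz s T) (hi _ continuous_const s T), h2, ← h3, byParts,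
    byParts, clm_sub, sub_apply]
  abel

/-- The increments of a by-parts integral against a Wiener process. -/
lemma eLpNorm_byParts_sub_le [IsProbabilityMeasure P] {W : ℝ≥0 → Ω → EuclideanSpace ℝ (Fin q)}
    (hW : IsWiener P W) {w : ℝ → Ω → EuclideanSpace ℝ (Fin q)}
    (hwc : ∀ ω, Continuous fun t => w t ω) (hwm : ∀ t, StronglyMeasurable (w t))
    (hw : ∀ᵐ ω ∂P, ∀ t : ℝ, w t ω = W t.toNNReal ω)
    {K K' : ℝ → Matrix (Fin p) (Fin q) ℝ} (hK' : Continuous K')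
    (hK : ∀ t, 0 ≤ t → K t = K 0 + ∫ s in (0 : ℝ)..t, K' s) {c γ μ : ℝ} (hc : 0 ≤ c) (hγ : 0 < γ)
    (hKc : ∀ t, 0 ≤ t → ‖K t‖ ≤ c * Real.exp (-μ * t))
    (hKc' : ∀ t, 0 ≤ t → ‖K' t‖ ≤ c * Real.exp (-μ * t)) {s T : ℝ} (hs : 0 ≤ s) (hsT : s ≤ T) :
    eLpNorm (fun ω => byParts K K' (fun r => w r ω) T - byParts K K' (fun r => w r ω) s) 2 P ≤
      ENNReal.ofReal (c * (√q * (1 + 1 / γ)) * Real.exp (-μ * s) * (Real.exp ((γ - μ) * (T - s)) +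
        ∫ r in (0 : ℝ)..(T - s), Real.exp ((γ - μ) * r))) := by
  set cw : ℝ := √q * (1 + 1 / γ) with hcw
  have hcw0 : 0 ≤ cw := by positivity
  have hinc : ∀ r, s ≤ r → eLpNorm (fun ω => w r ω - w s ω) 2 P ≤
      ENNReal.ofReal (cw * Real.exp (γ * (r - s))) := by
    intro r hr
    have h1 : (fun ω => w r ω - w s ω) =ᵐ[P] fun ω => W r.toNNReal ω - W s.toNNReal ω := by
      filter_upwards [hw] with ω hω
      rw [hω, hω]
    rw [eLpNorm_congr_ae h1, hW.eLpNorm_sub_eq (Real.toNNReal_le_toNNReal hr),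
      Real.coe_toNNReal r (hs.trans hr), Real.coe_toNNReal s hs]
    refine ENNReal.ofReal_le_ofReal ?_
    rw [mul_comm, Real.sqrt_mul (by positivity), hcw, mul_assoc]
    exact mul_le_mul_of_nonneg_left (sqrt_le_exp hγ (by linarith)) (by positivity)
  have hexp : ∀ r, c * Real.exp (-μ * (s + r)) * (cw * Real.exp (γ * r)) =
      c * cw * Real.exp (-μ * s) * Real.exp ((γ - μ) * r) := by
    intro r
    have : Real.exp (-μ * (s + r)) * Real.exp (γ * r) =
        Real.exp (-μ * s) * Real.exp ((γ - μ) * r) := by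
      rw [← Real.exp_add, ← Real.exp_add]; congr 1; ring
    linear_combination c * cw * this
  have hT : 0 ≤ T := hs.trans hsT
  have hTs : 0 ≤ T - s := by linarith
  have hvc : ∀ ω, Continuous fun r => clm (K' (s + r)) (w (s + r) ω - w s ω) := fun ω =>
    continuous_clm_path (hK'.comp (by fun_prop))
      (((hwc ω).comp (by fun_prop : Continuous fun r : ℝ => s + r)).sub continuous_const)
  have hvm : ∀ r, StronglyMeasurable fun ω => clm (K' (s + r)) (w (s + r) ω - w s ω) := fun r =>
    (clm _).continuous.comp_stronglyMeasurable ((hwm _).sub (hwm _))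
  have heq : (fun ω => byParts K K' (fun r => w r ω) T - byParts K K' (fun r => w r ω) s) =
      fun ω => clm (K T) (w T ω - w s ω) -
        ∫ r in (0 : ℝ)..(T - s), clm (K' (s + r)) (w (s + r) ω - w s ω) :=
    funext fun ω => byParts_sub_eq hK' hK (hwc ω) hs hT
  rw [heq, mul_add, ← intervalIntegral.integral_const_mul]
  refine eLpNorm_sub_le_ofReal ((clm _).continuous.comp_stronglyMeasurable ((hwm _).sub (hwm _)))
    (stronglyMeasurable_intervalIntegral hvc hvm _ _) (by positivity)
    (intervalIntegral.integral_nonneg hTs fun r _ => by positivity) ?_ ?_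
  · rw [← hexp]
    have := eLpNorm_clm_le (P := P) (K T) (fun ω => w T ω - w s ω) (hKc T hT) (hinc T hsT)
    rwa [add_sub_cancel]
  · refine eLpNorm_integral_le_ofReal
      (stronglyMeasurable_uncurry_of_continuous_of_stronglyMeasurable hvc hvm) hTs (by fun_prop)
      (fun r _ => by positivity) fun r hr => ?_
    rw [← hexp]
    have h2 := hinc (s + r) (by linarith [hr.1])
    rw [add_sub_cancel_left] at h2
    exact eLpNorm_clm_le (P := P) _ _ (hKc' (s + r) (by linarith [hr.1])) h2

/-- `ricc Q = 0` and `ricc` is quadratic, so the time derivative of the covariance inherits the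
decay of `S - Q`. It occurs as the derivative of the gain in the integrals by parts. -/
lemma exists_ricc_bound {Q : Matrix (Fin d) (Fin d) ℝ} (hQ : ricc A H σB Q = 0)
    {S : ℝ → Matrix (Fin d) (Fin d) ℝ} {C μ : ℝ} (hC : 0 ≤ C) (hμ : 0 ≤ μ)
    (hS : ∀ t, 0 ≤ t → ‖S t - Q‖ ≤ C * Real.exp (-μ * t)) :
    ∃ C', 0 ≤ C' ∧ ∀ t, 0 ≤ t → ‖ricc A H σB (S t)‖ ≤ C' * Real.exp (-μ * t) := by
  refine ⟨(2 * ‖A‖ + ‖Hᵀ * H‖ * (2 * ‖Q‖ + C)) * C, by positivity, fun t ht => ?_⟩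
  have h1 : ricc A H σB (S t) = A * (S t - Q) + (S t - Q) * Aᵀ -
      ((S t - Q) * (Hᵀ * H) * S t + Q * (Hᵀ * H) * (S t - Q)) := by
    rw [← sub_zero (ricc A H σB (S t)), ← hQ, ricc, ricc]
    simp only [Matrix.mul_sub, Matrix.sub_mul, Matrix.mul_assoc]
    abel
  have hD := hS t ht
  have hSn : ‖S t‖ ≤ ‖Q‖ + C := by
    have := norm_le_norm_add_norm_sub Q (S t)
    rw [norm_sub_rev] at this
    have h2 : C * Real.exp (-μ * t) ≤ C :=
      mul_le_of_le_one_right hC (Real.exp_le_one_iff.2 (by nlinarith))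
    linarith
  have e1 : ‖A * (S t - Q)‖ ≤ ‖A‖ * ‖S t - Q‖ := Matrix.l2_opNorm_mul _ _
  have e2 : ‖(S t - Q) * Aᵀ‖ ≤ ‖S t - Q‖ * ‖A‖ := by
    rw [← norm_transpose A]; exact Matrix.l2_opNorm_mul _ _
  have e3 : ‖(S t - Q) * (Hᵀ * H) * S t‖ ≤ ‖S t - Q‖ * ‖Hᵀ * H‖ * ‖S t‖ :=
    (Matrix.l2_opNorm_mul _ _).trans
      (mul_le_mul_of_nonneg_right (Matrix.l2_opNorm_mul _ _) (norm_nonneg _))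
  have e4 : ‖Q * (Hᵀ * H) * (S t - Q)‖ ≤ ‖Q‖ * ‖Hᵀ * H‖ * ‖S t - Q‖ :=
    (Matrix.l2_opNorm_mul _ _).trans
      (mul_le_mul_of_nonneg_right (Matrix.l2_opNorm_mul _ _) (norm_nonneg _))
  have e5 : ‖S t - Q‖ * ‖Hᵀ * H‖ * ‖S t‖ ≤ ‖S t - Q‖ * ‖Hᵀ * H‖ * (‖Q‖ + C) := by gcongr
  calc ‖ricc A H σB (S t)‖ ≤ ‖A‖ * ‖S t - Q‖ + ‖S t - Q‖ * ‖A‖ +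
        (‖S t - Q‖ * ‖Hᵀ * H‖ * (‖Q‖ + C) + ‖Q‖ * ‖Hᵀ * H‖ * ‖S t - Q‖) := by
        rw [h1]
        exact (norm_sub_le _ _).trans (add_le_add ((norm_add_le _ _).trans (add_le_add e1 e2))
          ((norm_add_le _ _).trans (add_le_add (e3.trans e5) e4)))
    _ = (2 * ‖A‖ + ‖Hᵀ * H‖ * (2 * ‖Q‖ + C)) * ‖S t - Q‖ := by ring
    _ ≤ (2 * ‖A‖ + ‖Hᵀ * H‖ * (2 * ‖Q‖ + C)) * (C * Real.exp (-μ * t)) := by gcongr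
    _ = _ := by ring

end MeanStability

/-! ### The estimation error of the Kalman–Bucy filter -/

section MeanStability

set_option linter.unusedSectionVars false

universe u

variable {Ω : Type*} [mΩ : MeasurableSpace Ω] {P : Measure Ω} {d m b : ℕ}
  {A : Matrix (Fin d) (Fin d) ℝ} {H : Matrix (Fin m) (Fin d) ℝ} {σB : Matrix (Fin d) (Fin b) ℝ}

/-- `x`, `bb`, `w` are everywhere continuous versions of the signal and of its noises. -/
structure IsSignalVersion {Ω : Type*} [MeasurableSpace Ω] (P : Measure Ω)
    (A : Matrix (Fin d) (Fin d) ℝ) (σB : Matrix (Fin d) (Fin b) ℝ)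
    (B : ℝ≥0 → Ω → EuclideanSpace ℝ (Fin b)) (W : ℝ≥0 → Ω → EuclideanSpace ℝ (Fin m))
    (x : ℝ → Ω → EuclideanSpace ℝ (Fin d)) (bb : ℝ → Ω → EuclideanSpace ℝ (Fin b))
    (w : ℝ → Ω → EuclideanSpace ℝ (Fin m)) : Prop where
  wiener_B : IsWiener P B
  wiener_W : IsWiener P W
  continuous_x : ∀ ω, Continuous fun t => x t ω
  continuous_b : ∀ ω, Continuous fun t => bb t ω
  continuous_w : ∀ ω, Continuous fun t => w t ω
  measurable_x : ∀ t, StronglyMeasurable (x t)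
  measurable_b : ∀ t, StronglyMeasurable (bb t)
  measurable_w : ∀ t, StronglyMeasurable (w t)
  eq_b : ∀ᵐ ω ∂P, ∀ t : ℝ, bb t ω = B t.toNNReal ω
  eq_w : ∀ᵐ ω ∂P, ∀ t : ℝ, w t ω = W t.toNNReal ω
  eq_x : ∀ᵐ ω ∂P, ∀ t : ℝ, 0 ≤ t →
    x t ω = x 0 ω + (∫ s in (0 : ℝ)..t, clm A (x s ω)) + clm σB (bb t ω)

/-- The observation path. -/
def obsPath (H : Matrix (Fin m) (Fin d) ℝ) (x : ℝ → Ω → EuclideanSpace ℝ (Fin d))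
    (w : ℝ → Ω → EuclideanSpace ℝ (Fin m)) (t : ℝ) (ω : Ω) : EuclideanSpace ℝ (Fin m) :=
  (∫ s in (0 : ℝ)..t, clm H (x s ω)) + w t ω

variable {B : ℝ≥0 → Ω → EuclideanSpace ℝ (Fin b)} {W : ℝ≥0 → Ω → EuclideanSpace ℝ (Fin m)}
  {x : ℝ → Ω → EuclideanSpace ℝ (Fin d)} {bb : ℝ → Ω → EuclideanSpace ℝ (Fin b)}
  {w : ℝ → Ω → EuclideanSpace ℝ (Fin m)}
  {S S' : ℝ → Matrix (Fin d) (Fin d) ℝ} {S₀ S₀' : Matrix (Fin d) (Fin d) ℝ}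

namespace IsSignalVersion

lemma continuous_Hx (h : IsSignalVersion P A σB B W x bb w) (H : Matrix (Fin m) (Fin d) ℝ) (ω : Ω) :
    Continuous fun t => clm H (x t ω) := (clm H).continuous.comp (h.continuous_x ω)

lemma continuous_obs (h : IsSignalVersion P A σB B W x bb w) (H : Matrix (Fin m) (Fin d) ℝ) (ω : Ω) :
    Continuous fun t => obsPath H x w t ω :=
  (intervalIntegral.continuous_primitive
    (fun _ _ => (h.continuous_Hx H ω).intervalIntegrable _ _) 0).add (h.continuous_w ω)

lemma measurable_obs (h : IsSignalVersion P A σB B W x bb w) (H : Matrix (Fin m) (Fin d) ℝ) (t : ℝ) :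
    StronglyMeasurable (obsPath H x w t) :=
  (stronglyMeasurable_intervalIntegral (h.continuous_Hx H)
    (fun s => (clm H).continuous.comp_stronglyMeasurable (h.measurable_x s)) 0 t).add
      (h.measurable_w t)

/-- The drift of the observation contributes an ordinary integral, and the remaining noise integral
is against `W` alone. -/
lemma kalmanInt_obs (h : IsSignalVersion P A σB B W x bb w) (hS : IsDRESolution A H σB S₀ S)
    (ω : Ω) {t : ℝ} (ht : 0 ≤ t) : kalmanInt A H σB S (fun s => obsPath H x w s ω) t =
      (∫ s in (0 : ℝ)..t, clm (S (max s 0) * Hᵀ) (clm H (x s ω))) +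
        kalmanInt A H σB S (fun s => w s ω) t := by
  rw [kalmanInt, kalmanInt, ← byParts_integral hS.continuous_gain_deriv
    (fun t ht => hS.gain_eq ht) (h.continuous_Hx H ω) ht]
  exact byParts_add hS.continuous_gain_deriv (intervalIntegral.continuous_primitive
    (fun _ _ => (h.continuous_Hx H ω).intervalIntegrable _ _) 0) (h.continuous_w ω) t

/-- The linear equation of the estimation error. -/
lemma error_eq (h : IsSignalVersion P A σB B W x bb w) (hS : IsDRESolution A H σB S₀ S)
    (m₀ : EuclideanSpace ℝ (Fin d)) : ∀ᵐ ω ∂P, ∀ t : ℝ, 0 ≤ t →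
      x t ω - kalmanSol A H σB S m₀ (fun s => obsPath H x w s ω) t =
        (x 0 ω - m₀) + (clm σB (bb t ω) - kalmanInt A H σB S (fun s => w s ω) t) +
          ∫ s in (0 : ℝ)..t, clm (A - S (max s 0) * Hᵀ * H)
            (x s ω - kalmanSol A H σB S m₀ (fun s => obsPath H x w s ω) s) := by
  filter_upwards [h.eq_x] with ω hx t ht
  have hzc := h.continuous_obs H ω
  have hμc := hS.continuous_kalmanSol hzc m₀
  set μ := kalmanSol A H σB S m₀ (fun s => obsPath H x w s ω) with hμ
  have hμe : μ t = _ := hS.kalmanSol_eq hzc m₀ ht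
  rw [h.kalmanInt_obs hS ω ht, ← hμ] at hμe
  have hxc := h.continuous_x ω
  have c1 : Continuous fun s => clm A (x s ω) := (clm A).continuous.comp hxc
  have c2 : Continuous fun s => clm (S (max s 0) * Hᵀ) (clm H (x s ω)) :=
    continuous_clm_path hS.continuous_gain ((clm H).continuous.comp hxc)
  have c12 : Continuous fun s => clm A (x s ω) - clm (S (max s 0) * Hᵀ) (clm H (x s ω)) := c1.sub c2
  have c3 : Continuous fun s => clm (A - S (max s 0) * Hᵀ * H) (μ s) :=
    continuous_clm_path hS.continuous_drift hμc
  have hint : ∫ s in (0 : ℝ)..t, clm (A - S (max s 0) * Hᵀ * H) (x s ω - μ s) =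
      (∫ s in (0 : ℝ)..t, clm A (x s ω)) -
        (∫ s in (0 : ℝ)..t, clm (S (max s 0) * Hᵀ) (clm H (x s ω))) -
        ∫ s in (0 : ℝ)..t, clm (A - S (max s 0) * Hᵀ * H) (μ s) := by
    rw [← intervalIntegral.integral_sub (c1.intervalIntegrable _ _) (c2.intervalIntegrable _ _),
      ← intervalIntegral.integral_sub (c12.intervalIntegrable _ _)
        (c3.intervalIntegrable _ _)]
    refine intervalIntegral.integral_congr fun s _ => ?_
    simp only [map_sub, clm_sub, sub_apply, clm_mul]
  rw [hint, hμe, hx t ht]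
  abel

end IsSignalVersion

/-- The Riccati equation leaves the slack `Q Hᵀ (Q Hᵀ)ᵀ ⪰ 0`, so the limiting filter drift contracts
at rate `β` too. -/
lemma posSemidef_filter_drift {Q : Matrix (Fin d) (Fin d) ℝ} (hQ : IsARESolution A H σB Q) :
    (-((A - Q * Hᵀ * H) * Q + Q * (A - Q * Hᵀ * H)ᵀ) - σB * σBᵀ).PosSemidef := by
  have hT := (posDef_real_iff.1 hQ.1).1
  have h : -((A - Q * Hᵀ * H) * Q + Q * (A - Q * Hᵀ * H)ᵀ) - σB * σBᵀ =
      Q * Hᵀ * (Q * Hᵀ)ᵀ - ricc A H σB Q := by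
    simp only [ricc, Matrix.transpose_sub, Matrix.transpose_mul, Matrix.transpose_transpose, hT,
      Matrix.sub_mul, Matrix.mul_sub, Matrix.mul_assoc]
    abel
  rw [h, hQ.2, sub_zero]
  exact posSemidef_mul_transpose _

lemma norm_gain_sub_le {Q : Matrix (Fin d) (Fin d) ℝ} {C μ : ℝ}
    (hS : ∀ t, 0 ≤ t → ‖S t - Q‖ ≤ C * Real.exp (-μ * t)) {t : ℝ} (ht : 0 ≤ t) :
    ‖(Q - S (max t 0)) * Hᵀ * H‖ ≤ C * ‖Hᵀ * H‖ * Real.exp (-μ * t) := by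
  rw [Matrix.mul_assoc]
  refine (Matrix.l2_opNorm_mul _ _).trans ?_
  rw [norm_sub_rev, max_eq_left ht, mul_right_comm]
  exact mul_le_mul_of_nonneg_right (hS t ht) (norm_nonneg _)

/-- Growth like `exp (β t / 2)` is harmless, since the error will be multiplied by gain differences
of order `exp (-2 β t)`. The constant is quantified before the probability space, so that it depends
on the data only. -/
lemma exists_error_bound [NeZero d] {Q : Matrix (Fin d) (Fin d) ℝ} (hσB : (σB * σBᵀ).PosDef)
    (hQ : IsARESolution A H σB Q) (hS₀ : S₀.PosSemidef) (hS : IsDRESolution A H σB S₀ S)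
    (m₀ : EuclideanSpace ℝ (Fin d)) {E₀ : ℝ} (hE₀ : 0 ≤ E₀) :
    ∃ C, 0 ≤ C ∧ ∀ (Ω : Type u) [MeasurableSpace Ω] (P : Measure Ω) [IsProbabilityMeasure P]
      (B : ℝ≥0 → Ω → EuclideanSpace ℝ (Fin b)) (W : ℝ≥0 → Ω → EuclideanSpace ℝ (Fin m))
      (x : ℝ → Ω → EuclideanSpace ℝ (Fin d)) (bb : ℝ → Ω → EuclideanSpace ℝ (Fin b))
      (w : ℝ → Ω → EuclideanSpace ℝ (Fin m)), IsSignalVersion P A σB B W x bb w →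
      eLpNorm (fun ω => x 0 ω - m₀) 2 P ≤ ENNReal.ofReal E₀ → ∀ t : ℝ, 0 ≤ t →
      eLpNorm (fun ω => x t ω - kalmanSol A H σB S m₀ (fun s => obsPath H x w s ω) t) 2 P ≤
        ENNReal.ofReal (C * Real.exp (rateβ σB Q / 2 * t)) := by
  obtain ⟨C₁, hC₁, hd₁⟩ := exists_dre_decay hσB hQ hS₀ hS
  set β := rateβ σB Q with hβ
  have hβ0 : 0 < β := rateβ_pos hσB hQ.1
  rw [neg_mul] at hd₁
  obtain ⟨C₂, hC₂, hd₂⟩ := exists_ricc_bound hQ.2 hC₁.le (μ := 2 * β) (by positivity) hd₁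
  set γ := β / 2 with hγ
  have hγ0 : 0 < γ := by positivity
  set F₀ := A - Q * Hᵀ * H with hF₀
  set c := C₁ * ‖Hᵀ * H‖ with hc
  have hc0 : 0 ≤ c := by positivity
  have hexp1 : ∀ t : ℝ, 0 ≤ t → Real.exp (-(2 * β) * t) ≤ 1 := fun t ht =>
    Real.exp_le_one_iff.2 (by nlinarith)
  -- constants for the noise
  set cK := (‖Q‖ + C₁ + C₂) * ‖Hᵀ‖ with hcK
  have hcK0 : 0 ≤ cK := by positivity
  set cN := ‖σB‖ * (√b * (1 + 1 / γ)) + cK * (√m * (1 + 1 / γ)) * (1 + 1 / γ) with hcN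
  have hcN0 : 0 ≤ cN := by positivity
  set cF := ‖F₀‖ + c with hcF
  have hcF0 : 0 ≤ cF := by positivity
  set κ := Real.exp (√(condNum Q) * c / (2 * β)) * √(condNum Q) with hκ
  have hκ0 : 0 ≤ κ := by positivity
  refine ⟨κ * (E₀ + cF * cN / (β + γ)) + cN, by positivity, ?_⟩
  intro Ω _ P _ B W x bb w h hx0 T hT
  set μ : ℝ → Ω → EuclideanSpace ℝ (Fin d) :=
    fun t ω => kalmanSol A H σB S m₀ (fun s => obsPath H x w s ω) t with hμ
  set N : ℝ → Ω → EuclideanSpace ℝ (Fin d) :=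
    fun t ω => clm σB (bb t ω) - kalmanInt A H σB S (fun s => w s ω) t with hN
  have hNm : ∀ t, StronglyMeasurable (N t) := fun t =>
    ((clm σB).continuous.comp_stronglyMeasurable (h.measurable_b t)).sub
      (stronglyMeasurable_byParts hS.continuous_gain_deriv h.continuous_w h.measurable_w t)
  have hNc : ∀ ω, Continuous fun t => N t ω := fun ω =>
    ((clm σB).continuous.comp (h.continuous_b ω)).sub (hS.continuous_kalmanInt (h.continuous_w ω))
  have hμm : ∀ t, StronglyMeasurable (μ t) := fun t =>
    hS.stronglyMeasurable_kalmanSol (h.continuous_obs H) (h.measurable_obs H) m₀ t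
  have hμc : ∀ ω, Continuous fun t => μ t ω := fun ω =>
    hS.continuous_kalmanSol (h.continuous_obs H ω) m₀
  have hNb : ∀ t, 0 ≤ t → eLpNorm (N t) 2 P ≤ ENNReal.ofReal (cN * Real.exp (γ * t)) := by
    intro t ht
    have hb : eLpNorm (bb t) 2 P ≤ ENNReal.ofReal (√b * (1 + 1 / γ) * Real.exp (γ * t)) := by
      have h1 : bb t =ᵐ[P] B t.toNNReal := by filter_upwards [h.eq_b] with ω hω using hω t
      rw [eLpNorm_congr_ae h1, h.wiener_B.eLpNorm_eq, Real.coe_toNNReal t ht, mul_comm,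
        Real.sqrt_mul (by positivity), mul_assoc]
      exact ENNReal.ofReal_le_ofReal (mul_le_mul_of_nonneg_left (sqrt_le_exp hγ0 ht) (by positivity))
    have hk := eLpNorm_byParts_sub_le (P := P) h.wiener_W h.continuous_w h.measurable_w h.eq_w
      (K := fun s => S (max s 0) * Hᵀ) (K' := fun s => ricc A H σB (S (max s 0)) * Hᵀ)
      hS.continuous_gain_deriv (fun t ht => hS.gain_eq ht) (c := cK) (γ := γ) (μ := 0) hcK0 hγ0
      (fun t ht => ?_) (fun t ht => ?_)
      (le_refl (0 : ℝ)) ht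
    · have h0 : ∀ ω, byParts (fun s => S (max s 0) * Hᵀ) (fun s => ricc A H σB (S (max s 0)) * Hᵀ)
          (fun r => w r ω) 0 = 0 := fun ω => by simp [byParts]
      simp only [h0, sub_zero, neg_zero, zero_mul, Real.exp_zero, mul_one] at hk
      rw [hcN, add_mul]
      refine eLpNorm_sub_le_ofReal
        ((clm σB).continuous.comp_stronglyMeasurable (h.measurable_b t))
        (stronglyMeasurable_byParts hS.continuous_gain_deriv h.continuous_w h.measurable_w t)
        (by positivity) (by positivity) ?_ (hk.trans (ENNReal.ofReal_le_ofReal ?_))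
      · rw [mul_assoc]
        exact eLpNorm_clm_le (P := P) σB (bb t) le_rfl hb
      · rw [mul_assoc _ (1 + 1 / γ) (Real.exp _)]
        refine mul_le_mul_of_nonneg_left ?_ (by positivity)
        have := integral_exp_mul_le (T := t) hγ0
        rw [add_mul, one_mul, one_div, ← div_eq_inv_mul]
        linarith
    · rw [neg_zero, zero_mul, Real.exp_zero, mul_one, max_eq_left ht]
      refine (Matrix.l2_opNorm_mul _ _).trans (mul_le_mul_of_nonneg_right ?_ (norm_nonneg _))
      have h1 := norm_le_norm_add_norm_sub Q (S t)
      rw [norm_sub_rev] at h1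
      have h2 := mul_le_of_le_one_right hC₁.le (hexp1 t ht)
      linarith [hd₁ t ht]
    · rw [neg_zero, zero_mul, Real.exp_zero, mul_one, max_eq_left ht]
      refine (Matrix.l2_opNorm_mul _ _).trans (mul_le_mul_of_nonneg_right ?_ (norm_nonneg _))
      have h2 := mul_le_of_le_one_right hC₂ (hexp1 t ht)
      linarith [hd₂ t ht, norm_nonneg Q]
  set F : ℝ → Matrix (Fin d) (Fin d) ℝ := fun s => A - S (max s 0) * Hᵀ * H with hF
  set p : ℝ → Matrix (Fin d) (Fin d) ℝ := fun s => (Q - S (max s 0)) * Hᵀ * H with hp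
  have hFp : ∀ s, F s = F₀ + p s := fun s => by
    simp only [hF, hp, hF₀, Matrix.sub_mul]; abel
  have hpc : Continuous p :=
    ((continuous_const.sub hS.continuous_max).matrix_mul continuous_const).matrix_mul
      continuous_const
  have hpb : ∀ t, 0 ≤ t → ‖p t‖ ≤ c * Real.exp (-(2 * β) * t) := fun t ht => norm_gain_sub_le hd₁ ht
  have hFb : ∀ t, 0 ≤ t → ‖F t‖ ≤ cF := fun t ht => by
    rw [hFp]
    refine (norm_add_le _ _).trans (add_le_add_right ((hpb t ht).trans ?_) _)
    exact mul_le_of_le_one_right hc0 (hexp1 t ht)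
  have hFc : Continuous F := hS.continuous_drift
  -- After subtraction of the noise `N`, the remainder satisfies an integral equation with forcing
  -- `F N`, to which the pathwise contraction bound applies.
  set r : ℝ → Ω → EuclideanSpace ℝ (Fin d) := fun t ω => x t ω - μ t ω - N t ω with hr
  have hrc : ∀ ω, Continuous fun t => r t ω := fun ω =>
    ((h.continuous_x ω).sub (hμc ω)).sub (hNc ω)
  have hrm : ∀ t, StronglyMeasurable (r t) := fun t =>
    ((h.measurable_x t).sub (hμm t)).sub (hNm t)
  have hreq : ∀ᵐ ω ∂P, ∀ t : ℝ, 0 ≤ t → r t ω = (x 0 ω - m₀) +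
      ∫ s in (0 : ℝ)..t, (clm (F s) (r s ω) + clm (F s) (N s ω)) := by
    filter_upwards [h.error_eq hS m₀] with ω hω t ht
    have h1 : ∫ s in (0 : ℝ)..t, (clm (F s) (r s ω) + clm (F s) (N s ω)) =
        ∫ s in (0 : ℝ)..t, clm (F s) (x s ω - μ s ω) := by
      refine intervalIntegral.integral_congr fun s _ => ?_
      simp only [hr, ← map_add]
      congr 1
      abel
    rw [h1]
    simp only [hr]
    rw [show x t ω - μ t ω = _ from hω t ht]
    simp only [hN, hF, hμ]
    abel
  have hr0 : r 0 =ᵐ[P] fun ω => x 0 ω - m₀ := by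
    filter_upwards [hreq] with ω hω
    simpa using hω 0 le_rfl
  have key := eLpNorm_le_of_stable (P := P) (F₀ := F₀) (p := p) (u := r) (g := fun t ω => clm (F t) (N t ω))
    (c := c) (lam := β) hσB hQ.1 (posSemidef_filter_drift hQ) hc0 hβ0 hT hpc
    (fun t ht => by have := hpb t ht.1; rwa [← neg_mul] at this) hrc hrm
    (fun ω => continuous_clm_path hFc (hNc ω))
    (fun t => (clm _).continuous.comp_stronglyMeasurable (hNm t)) ?_
    (φ := fun t => cF * (cN * Real.exp (γ * t))) (by fun_prop) (fun t _ => by positivity)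
    (fun t ht => eLpNorm_clm_le (P := P) _ _ (hFb t ht.1) (hNb t ht.1))
  · rw [eLpNorm_congr_ae hr0, ← hβ, ← hκ] at key
    have hI : ∫ s in (0 : ℝ)..T, Real.exp (β * s) * (cF * (cN * Real.exp (γ * s))) ≤
        cF * cN / (β + γ) * Real.exp ((β + γ) * T) := by
      have h1 : ∀ s, Real.exp (β * s) * (cF * (cN * Real.exp (γ * s))) =
          cF * cN * Real.exp ((β + γ) * s) := fun s => by
        rw [show (β + γ) * s = β * s + γ * s by ring, Real.exp_add]; ring
      simp only [h1]
      rw [intervalIntegral.integral_const_mul, div_mul_eq_mul_div, ← mul_div_assoc']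
      exact mul_le_mul_of_nonneg_left (integral_exp_mul_le (by positivity)) (by positivity)
    have hrT : eLpNorm (r T) 2 P ≤
        ENNReal.ofReal (κ * (E₀ + cF * cN / (β + γ)) * Real.exp (γ * T)) := by
      refine key.trans ?_
      have hI0 : 0 ≤ ∫ s in (0 : ℝ)..T, Real.exp (β * s) * (cF * (cN * Real.exp (γ * s))) :=
        intervalIntegral.integral_nonneg hT fun s _ => by positivity
      calc _ ≤ ENNReal.ofReal (Real.exp (-β * T)) * (ENNReal.ofReal κ * (ENNReal.ofReal E₀ +
            ENNReal.ofReal (cF * cN / (β + γ) * Real.exp ((β + γ) * T)))) := by gcongr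
        _ = ENNReal.ofReal (Real.exp (-β * T) *
            (κ * (E₀ + cF * cN / (β + γ) * Real.exp ((β + γ) * T)))) := by
            rw [← ENNReal.ofReal_add hE₀ (by positivity), ← ENNReal.ofReal_mul hκ0,
              ← ENNReal.ofReal_mul (Real.exp_pos _).le]
        _ ≤ _ := by
            refine ENNReal.ofReal_le_ofReal ?_
            have e1 : Real.exp (-β * T) * Real.exp ((β + γ) * T) = Real.exp (γ * T) := by
              rw [← Real.exp_add]; congr 1; ring
            have e2 : Real.exp (-β * T) ≤ Real.exp (γ * T) := Real.exp_le_exp.2 (by nlinarith)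
            calc _ = κ * (E₀ * Real.exp (-β * T) + cF * cN / (β + γ) *
                  (Real.exp (-β * T) * Real.exp ((β + γ) * T))) := by ring
              _ ≤ κ * (E₀ * Real.exp (γ * T) + cF * cN / (β + γ) * Real.exp (γ * T)) := by
                  rw [e1]; gcongr
              _ = _ := by ring
    have hsum := eLpNorm_add_le_ofReal (P := P) (hrm T) (hNm T) (by positivity) (by positivity) hrT
      (hNb T hT)
    rw [add_mul]
    have hfin : (fun ω => x T ω - μ T ω) = fun ω => r T ω + N T ω := by
      funext ω; simp only [hr]; abel
    rw [hfin]
    exact hsum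
  · filter_upwards [hreq, hr0] with ω hω h0 t ht
    rw [hω t ht.1, h0]
    simp only [hFp]

end MeanStability

/-! ### The difference of two filters, and existence of the stability constants -/

section MeanStability

set_option linter.unusedSectionVars false

universe u

variable {Ω : Type*} [mΩ : MeasurableSpace Ω] {P : Measure Ω} {d m b : ℕ}
  {A : Matrix (Fin d) (Fin d) ℝ} {H : Matrix (Fin m) (Fin d) ℝ} {σB : Matrix (Fin d) (Fin b) ℝ}
  {B : ℝ≥0 → Ω → EuclideanSpace ℝ (Fin b)} {W : ℝ≥0 → Ω → EuclideanSpace ℝ (Fin m)}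
  {x : ℝ → Ω → EuclideanSpace ℝ (Fin d)} {bb : ℝ → Ω → EuclideanSpace ℝ (Fin b)}
  {w : ℝ → Ω → EuclideanSpace ℝ (Fin m)}
  {S S' : ℝ → Matrix (Fin d) (Fin d) ℝ} {S₀ S₀' : Matrix (Fin d) (Fin d) ℝ}

/-- The linear equation of the difference of two filters. -/
lemma IsSignalVersion.filter_diff_eq (h : IsSignalVersion P A σB B W x bb w)
    (hS : IsDRESolution A H σB S₀ S) (hS' : IsDRESolution A H σB S₀' S')
    (m₀ m₀' : EuclideanSpace ℝ (Fin d)) : ∀ᵐ ω ∂P, ∀ t : ℝ, 0 ≤ t →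
      kalmanSol A H σB S' m₀' (fun s => obsPath H x w s ω) t -
        kalmanSol A H σB S m₀ (fun s => obsPath H x w s ω) t =
        (m₀' - m₀) + (kalmanInt A H σB S' (fun s => w s ω) t -
          kalmanInt A H σB S (fun s => w s ω) t) +
          ∫ s in (0 : ℝ)..t, (clm (A - S' (max s 0) * Hᵀ * H)
            (kalmanSol A H σB S' m₀' (fun s => obsPath H x w s ω) s -
              kalmanSol A H σB S m₀ (fun s => obsPath H x w s ω) s) +
            clm ((S' (max s 0) - S (max s 0)) * Hᵀ * H)
              (x s ω - kalmanSol A H σB S m₀ (fun s => obsPath H x w s ω) s)) := by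
  filter_upwards [h.error_eq hS m₀, h.error_eq hS' m₀'] with ω h1 h2 t ht
  have e1 := h1 t ht
  have e2 := h2 t ht
  set μ := kalmanSol A H σB S m₀ (fun s => obsPath H x w s ω) with hμ
  set μ' := kalmanSol A H σB S' m₀' (fun s => obsPath H x w s ω) with hμ'
  have hμc : Continuous μ := hS.continuous_kalmanSol (h.continuous_obs H ω) m₀
  have hμc' : Continuous μ' := hS'.continuous_kalmanSol (h.continuous_obs H ω) m₀'
  have hxc := h.continuous_x ω
  have c1 : Continuous fun s => clm (A - S (max s 0) * Hᵀ * H) (x s ω - μ s) :=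
    continuous_clm_path hS.continuous_drift (hxc.sub hμc)
  have c2 : Continuous fun s => clm (A - S' (max s 0) * Hᵀ * H) (x s ω - μ' s) :=
    continuous_clm_path hS'.continuous_drift (hxc.sub hμc')
  have hint : ∫ s in (0 : ℝ)..t, (clm (A - S' (max s 0) * Hᵀ * H) (μ' s - μ s) +
      clm ((S' (max s 0) - S (max s 0)) * Hᵀ * H) (x s ω - μ s)) =
      (∫ s in (0 : ℝ)..t, clm (A - S (max s 0) * Hᵀ * H) (x s ω - μ s)) -
        ∫ s in (0 : ℝ)..t, clm (A - S' (max s 0) * Hᵀ * H) (x s ω - μ' s) := by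
    rw [← intervalIntegral.integral_sub (c1.intervalIntegrable _ _) (c2.intervalIntegrable _ _)]
    refine intervalIntegral.integral_congr fun s _ => ?_
    simp only [Matrix.sub_mul, clm_sub, map_sub, sub_apply]
    abel
  rw [hint]
  have e3 : μ' t - μ t = (x t ω - μ t) - (x t ω - μ' t) := by abel
  rw [e3, e1, e2]
  abel

-- The difference contracts with the drift of the second filter and is forced by the gain
-- difference, acting on `W` and on the estimation error. The gain difference is of order `exp (-2 β
-- t)`, the error of order `exp (β t / 2)`, so the forcing decays faster than `exp (-β t)` and the
-- rate `β` survives.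
set_option maxHeartbeats 1000000 in
lemma exists_filter_diff_bound [NeZero d] {Q : Matrix (Fin d) (Fin d) ℝ}
    (hσB : (σB * σBᵀ).PosDef) (hQ : IsARESolution A H σB Q) (hS₀ : S₀.PosSemidef)
    (hS₀' : S₀'.PosSemidef) (hS : IsDRESolution A H σB S₀ S) (hS' : IsDRESolution A H σB S₀' S')
    (m₀ m₀' : EuclideanSpace ℝ (Fin d)) {E₀ : ℝ} (hE₀ : 0 ≤ E₀) :
    ∃ C, 0 ≤ C ∧ ∀ (Ω : Type u) [MeasurableSpace Ω] (P : Measure Ω) [IsProbabilityMeasure P]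
      (B : ℝ≥0 → Ω → EuclideanSpace ℝ (Fin b)) (W : ℝ≥0 → Ω → EuclideanSpace ℝ (Fin m))
      (x : ℝ → Ω → EuclideanSpace ℝ (Fin d)) (bb : ℝ → Ω → EuclideanSpace ℝ (Fin b))
      (w : ℝ → Ω → EuclideanSpace ℝ (Fin m)), IsSignalVersion P A σB B W x bb w →
      eLpNorm (fun ω => x 0 ω - m₀) 2 P ≤ ENNReal.ofReal E₀ → ∀ t : ℝ, 0 ≤ t →
      eLpNorm (fun ω => kalmanSol A H σB S' m₀' (fun s => obsPath H x w s ω) t -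
        kalmanSol A H σB S m₀ (fun s => obsPath H x w s ω) t) 2 P ≤
        ENNReal.ofReal (C * Real.exp (-rateβ σB Q * t)) := by
  obtain ⟨Ce, hCe, hbd⟩ := exists_error_bound.{u} hσB hQ hS₀ hS m₀ hE₀
  obtain ⟨C₁, hC₁, hd₁⟩ := exists_dre_decay hσB hQ hS₀ hS
  obtain ⟨C₁', hC₁', hd₁'⟩ := exists_dre_decay hσB hQ hS₀' hS'
  set β := rateβ σB Q with hβ
  have hβ0 : 0 < β := rateβ_pos hσB hQ.1
  rw [neg_mul] at hd₁ hd₁'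
  obtain ⟨C₂, hC₂, hd₂⟩ := exists_ricc_bound hQ.2 hC₁.le (μ := 2 * β) (by positivity) hd₁
  obtain ⟨C₂', hC₂', hd₂'⟩ := exists_ricc_bound hQ.2 hC₁'.le (μ := 2 * β) (by positivity) hd₁'
  set F₀ := A - Q * Hᵀ * H with hF₀
  set c := C₁' * ‖Hᵀ * H‖ with hc
  have hc0 : 0 ≤ c := by positivity
  have hexp1 : ∀ t : ℝ, 0 ≤ t → Real.exp (-(2 * β) * t) ≤ 1 := fun t ht =>
    Real.exp_le_one_iff.2 (by nlinarith)
  set cK := (C₁ + C₁' + C₂ + C₂') * ‖Hᵀ‖ with hcK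
  have hcK0 : 0 ≤ cK := by positivity
  set c₃ := cK * (√m * (1 + 1 / β)) * (1 + 1 / β) with hc₃
  have hc₃0 : 0 ≤ c₃ := by positivity
  set cF := ‖F₀‖ + c with hcF
  have hcF0 : 0 ≤ cF := by positivity
  set c₄ := cF * c₃ + (C₁ + C₁') * ‖Hᵀ * H‖ * Ce with hc₄
  have hc₄0 : 0 ≤ c₄ := by positivity
  set κ := Real.exp (√(condNum Q) * c / (2 * β)) * √(condNum Q) with hκ
  have hκ0 : 0 ≤ κ := by positivity
  refine ⟨κ * (‖m₀' - m₀‖ + c₃ + c₄ * (1 / (β / 2))), by positivity, ?_⟩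
  intro Ω _ P _ B W x bb w h hx0 T hT
  have hbd' := hbd Ω P B W x bb w h hx0
  set μ : ℝ → Ω → EuclideanSpace ℝ (Fin d) :=
    fun t ω => kalmanSol A H σB S m₀ (fun s => obsPath H x w s ω) t with hμ
  set μ' : ℝ → Ω → EuclideanSpace ℝ (Fin d) :=
    fun t ω => kalmanSol A H σB S' m₀' (fun s => obsPath H x w s ω) t with hμ'
  have hμm : ∀ t, StronglyMeasurable (μ t) := fun t =>
    hS.stronglyMeasurable_kalmanSol (h.continuous_obs H) (h.measurable_obs H) m₀ t
  have hμc : ∀ ω, Continuous fun t => μ t ω := fun ω =>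
    hS.continuous_kalmanSol (h.continuous_obs H ω) m₀
  have hμm' : ∀ t, StronglyMeasurable (μ' t) := fun t =>
    hS'.stronglyMeasurable_kalmanSol (h.continuous_obs H) (h.measurable_obs H) m₀' t
  have hμc' : ∀ ω, Continuous fun t => μ' t ω := fun ω =>
    hS'.continuous_kalmanSol (h.continuous_obs H ω) m₀'
  set K : ℝ → Matrix (Fin d) (Fin m) ℝ := fun s => S' (max s 0) * Hᵀ - S (max s 0) * Hᵀ with hK
  set K' : ℝ → Matrix (Fin d) (Fin m) ℝ := fun s =>
    ricc A H σB (S' (max s 0)) * Hᵀ - ricc A H σB (S (max s 0)) * Hᵀ with hK'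
  have hKc : Continuous K := hS'.continuous_gain.sub hS.continuous_gain
  have hKc' : Continuous K' := hS'.continuous_gain_deriv.sub hS.continuous_gain_deriv
  have hKeq : ∀ t, 0 ≤ t → K t = K 0 + ∫ s in (0 : ℝ)..t, K' s := fun t ht => by
    simp only [hK, hK']
    rw [intervalIntegral.integral_sub (hS'.continuous_gain_deriv.intervalIntegrable _ _)
      (hS.continuous_gain_deriv.intervalIntegrable _ _), hS'.gain_eq ht, hS.gain_eq ht]
    abel
  have hKb : ∀ t, 0 ≤ t → ‖K t‖ ≤ cK * Real.exp (-(2 * β) * t) := fun t ht => by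
    have e : K t = ((S' t - Q) - (S t - Q)) * Hᵀ := by
      simp only [hK, max_eq_left ht, ← Matrix.sub_mul]; congr 1; abel
    rw [e, hcK, mul_right_comm]
    refine (Matrix.l2_opNorm_mul _ _).trans (mul_le_mul_of_nonneg_right ?_ (norm_nonneg _))
    refine (norm_sub_le _ _).trans ((add_le_add (hd₁' t ht) (hd₁ t ht)).trans ?_)
    rw [← add_mul]
    exact mul_le_mul_of_nonneg_right (by linarith) (Real.exp_pos _).le
  have hKb' : ∀ t, 0 ≤ t → ‖K' t‖ ≤ cK * Real.exp (-(2 * β) * t) := fun t ht => by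
    have e : K' t = (ricc A H σB (S' t) - ricc A H σB (S t)) * Hᵀ := by
      simp only [hK', max_eq_left ht, ← Matrix.sub_mul]
    rw [e, hcK, mul_right_comm]
    refine (Matrix.l2_opNorm_mul _ _).trans (mul_le_mul_of_nonneg_right ?_ (norm_nonneg _))
    refine (norm_sub_le _ _).trans ((add_le_add (hd₂' t ht) (hd₂ t ht)).trans ?_)
    rw [← add_mul]
    exact mul_le_mul_of_nonneg_right (by linarith) (Real.exp_pos _).le
  set k : ℝ → Ω → EuclideanSpace ℝ (Fin d) := fun t ω => byParts K K' (fun s => w s ω) t with hk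
  have hkm : ∀ t, StronglyMeasurable (k t) := stronglyMeasurable_byParts hKc' h.continuous_w h.measurable_w
  have hkc : ∀ ω, Continuous fun t => k t ω := fun ω => continuous_byParts hKc hKc' (h.continuous_w ω)
  have hk0 : ∀ ω, k 0 ω = 0 := fun ω => by simp [hk, byParts]
  have hkb : ∀ s ∈ Set.Icc 0 T, eLpNorm (fun ω => k T ω - k s ω) 2 P ≤
      ENNReal.ofReal (c₃ * Real.exp (-(2 * β) * s)) := fun s hs => by
    refine (eLpNorm_byParts_sub_le (P := P) h.wiener_W h.continuous_w h.measurable_w h.eq_w hKc'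
      hKeq (c := cK) (γ := β) (μ := 2 * β) hcK0 hβ0 hKb hKb' hs.1 hs.2).trans
      (ENNReal.ofReal_le_ofReal ?_)
    have e1 : β - 2 * β = -β := by ring
    have e2 : Real.exp (-β * (T - s)) ≤ 1 := Real.exp_le_one_iff.2 (by nlinarith [hs.2])
    have e3 := integral_exp_neg_mul_le (T := T - s) hβ0
    rw [e1]
    calc _ ≤ cK * (√m * (1 + 1 / β)) * Real.exp (-(2 * β) * s) * (1 + 1 / β) :=
          mul_le_mul_of_nonneg_left (add_le_add e2 e3) (by positivity)
      _ = _ := by rw [hc₃]; ring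
  set F : ℝ → Matrix (Fin d) (Fin d) ℝ := fun s => A - S' (max s 0) * Hᵀ * H with hF
  set p : ℝ → Matrix (Fin d) (Fin d) ℝ := fun s => (Q - S' (max s 0)) * Hᵀ * H with hp
  have hFp : ∀ s, F s = F₀ + p s := fun s => by
    simp only [hF, hp, hF₀, Matrix.sub_mul]; abel
  have hpc : Continuous p :=
    ((continuous_const.sub hS'.continuous_max).matrix_mul continuous_const).matrix_mul
      continuous_const
  have hpb : ∀ t, 0 ≤ t → ‖p t‖ ≤ c * Real.exp (-(2 * β) * t) := fun t ht => norm_gain_sub_le hd₁' ht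
  have hFb : ∀ t, 0 ≤ t → ‖F t‖ ≤ cF := fun t ht => by
    rw [hFp]
    refine (norm_add_le _ _).trans (add_le_add_right ((hpb t ht).trans ?_) _)
    exact mul_le_of_le_one_right hc0 (hexp1 t ht)
  have hFc : Continuous F := hS'.continuous_drift
  set D : ℝ → Matrix (Fin d) (Fin d) ℝ := fun s => (S' (max s 0) - S (max s 0)) * Hᵀ * H with hD
  have hDc : Continuous D :=
    ((hS'.continuous_max.sub hS.continuous_max).matrix_mul continuous_const).matrix_mul
      continuous_const
  have hDb : ∀ t, 0 ≤ t → ‖D t‖ ≤ (C₁ + C₁') * ‖Hᵀ * H‖ * Real.exp (-(2 * β) * t) := fun t ht => by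
    have e : D t = ((S' t - Q) - (S t - Q)) * (Hᵀ * H) := by
      simp only [hD, max_eq_left ht, Matrix.mul_assoc]; congr 1; abel
    rw [e, mul_right_comm]
    refine (Matrix.l2_opNorm_mul _ _).trans (mul_le_mul_of_nonneg_right ?_ (norm_nonneg _))
    refine (norm_sub_le _ _).trans ((add_le_add (hd₁' t ht) (hd₁ t ht)).trans ?_)
    rw [← add_mul, add_comm C₁']
  -- The noise is removed by adding its future increment `k T - k t`, which is of order `exp (-2 β
  -- t)` and vanishes at `t = T`. Subtracting `k t` instead would leave a term that need not decay.
  set r : ℝ → Ω → EuclideanSpace ℝ (Fin d) := fun t ω => μ' t ω - μ t ω + (k T ω - k t ω) with hr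
  have hrc : ∀ ω, Continuous fun t => r t ω := fun ω =>
    ((hμc' ω).sub (hμc ω)).add (continuous_const.sub (hkc ω))
  have hrm : ∀ t, StronglyMeasurable (r t) := fun t =>
    ((hμm' t).sub (hμm t)).add ((hkm T).sub (hkm t))
  set g : ℝ → Ω → EuclideanSpace ℝ (Fin d) := fun t ω =>
    clm (D t) (x t ω - μ t ω) - clm (F t) (k T ω - k t ω) with hg
  have hreq : ∀ᵐ ω ∂P, ∀ t : ℝ, 0 ≤ t → r t ω = ((m₀' - m₀) + k T ω) +
      ∫ s in (0 : ℝ)..t, (clm (F s) (r s ω) + g s ω) := by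
    filter_upwards [h.filter_diff_eq hS hS' m₀ m₀'] with ω hω t ht
    have h1 : ∫ s in (0 : ℝ)..t, (clm (F s) (r s ω) + g s ω) =
        ∫ s in (0 : ℝ)..t, (clm (F s) (μ' s ω - μ s ω) + clm (D s) (x s ω - μ s ω)) := by
      refine intervalIntegral.integral_congr fun s _ => ?_
      simp only [hr, hg, map_add]
      abel
    have h2 : k t ω = kalmanInt A H σB S' (fun s => w s ω) t - kalmanInt A H σB S (fun s => w s ω) t :=
      byParts_sub_coeff hS'.continuous_gain_deriv hS.continuous_gain_deriv (h.continuous_w ω) t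
    have h3 : μ' t ω - μ t ω = _ := hω t ht
    rw [← h2] at h3
    rw [h1]
    simp only [hr]
    rw [h3]
    simp only [hF, hμ, hμ', hD]
    abel
  have hr0 : r 0 =ᵐ[P] fun ω => (m₀' - m₀) + k T ω := by
    filter_upwards [hreq] with ω hω
    simpa using hω 0 le_rfl
  have key := eLpNorm_le_of_stable (P := P) (F₀ := F₀) (p := p) (u := r) (g := g)
    (c := c) (lam := β) hσB hQ.1 (posSemidef_filter_drift hQ) hc0 hβ0 hT hpc
    (fun t ht => by have := hpb t ht.1; rwa [← neg_mul] at this) hrc hrm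
    (fun ω => (continuous_clm_path hDc ((h.continuous_x ω).sub (hμc ω))).sub
      (continuous_clm_path hFc (continuous_const.sub (hkc ω))))
    (fun t => ((clm _).continuous.comp_stronglyMeasurable ((h.measurable_x t).sub (hμm t))).sub
      ((clm _).continuous.comp_stronglyMeasurable ((hkm T).sub (hkm t)))) ?_
    -- `3 / 2 β = 2 β - β / 2`: decay of the gain difference against growth of the error bound.
    (φ := fun t => c₄ * Real.exp (-(3 / 2 * β) * t)) (by fun_prop) (fun t _ => by positivity)
    (fun t ht => ?_)
  · rw [eLpNorm_congr_ae hr0, ← hβ, ← hκ] at key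
    have hI : ∫ s in (0 : ℝ)..T, Real.exp (β * s) * (c₄ * Real.exp (-(3 / 2 * β) * s)) ≤
        c₄ * (1 / (β / 2)) := by
      have h1 : ∀ s, Real.exp (β * s) * (c₄ * Real.exp (-(3 / 2 * β) * s)) =
          c₄ * Real.exp (-(β / 2) * s) := fun s => by
        rw [mul_left_comm, ← Real.exp_add]; congr 2; ring
      simp only [h1]
      rw [intervalIntegral.integral_const_mul]
      exact mul_le_mul_of_nonneg_left (integral_exp_neg_mul_le (by positivity)) hc₄0
    have hrT : r T = fun ω => μ' T ω - μ T ω := by funext ω; simp [hr]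
    have h0 : eLpNorm (fun ω => (m₀' - m₀) + k T ω) 2 P ≤ ENNReal.ofReal (‖m₀' - m₀‖ + c₃) := by
      refine eLpNorm_add_le_ofReal stronglyMeasurable_const (hkm T) (norm_nonneg _) hc₃0 ?_ ?_
      · rw [eLpNorm_const _ two_ne_zero (IsProbabilityMeasure.ne_zero P)]
        simp
      · have := hkb 0 ⟨le_rfl, hT⟩
        simpa [hk0] using this
    rw [hrT] at key
    refine key.trans ?_
    calc _ ≤ ENNReal.ofReal (Real.exp (-β * T)) * (ENNReal.ofReal κ *
          (ENNReal.ofReal (‖m₀' - m₀‖ + c₃) + ENNReal.ofReal (c₄ * (1 / (β / 2))))) := by gcongr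
      _ = _ := by
        rw [← ENNReal.ofReal_add (by positivity) (by positivity), ← ENNReal.ofReal_mul hκ0,
          ← ENNReal.ofReal_mul (Real.exp_pos _).le, mul_comm]
  · filter_upwards [hreq, hr0] with ω hω h0 t ht
    rw [hω t ht.1, h0]
    simp only [hFp]
  · have e1 := eLpNorm_clm_le (P := P) _ _ (hDb t ht.1) (hbd' t ht.1)
    have e2 := eLpNorm_clm_le (P := P) _ _ (hFb t ht.1) (hkb t ht)
    refine (eLpNorm_sub_le_ofReal
      ((clm _).continuous.comp_stronglyMeasurable ((h.measurable_x t).sub (hμm t)))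
      ((clm _).continuous.comp_stronglyMeasurable ((hkm T).sub (hkm t))) (by positivity)
      (by positivity) e1 e2).trans (ENNReal.ofReal_le_ofReal ?_)
    have e3 : Real.exp (-(2 * β) * t) * Real.exp (β / 2 * t) = Real.exp (-(3 / 2 * β) * t) := by
      rw [← Real.exp_add]; congr 1; ring
    have e4 : Real.exp (-(2 * β) * t) ≤ Real.exp (-(3 / 2 * β) * t) :=
      Real.exp_le_exp.2 (by nlinarith [ht.1])
    calc _ = (C₁ + C₁') * ‖Hᵀ * H‖ * Ce * (Real.exp (-(2 * β) * t) * Real.exp (β / 2 * t)) +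
          cF * c₃ * Real.exp (-(2 * β) * t) := by ring
      _ ≤ (C₁ + C₁') * ‖Hᵀ * H‖ * Ce * Real.exp (-(3 / 2 * β) * t) +
          cF * c₃ * Real.exp (-(3 / 2 * β) * t) := by rw [e3]; gcongr
      _ = _ := by rw [hc₄]; ring

lemma kalmanInt_congr_path {z z' : ℝ → EuclideanSpace ℝ (Fin m)} {t : ℝ} (ht : 0 ≤ t)
    (h : ∀ s ∈ Set.Icc 0 t, z' s = z s) : kalmanInt A H σB S z' t = kalmanInt A H σB S z t :=
  byParts_congr ht h

lemma IsDRESolution.kalmanSol_congr (hS : IsDRESolution A H σB S₀ S) (m₀ : EuclideanSpace ℝ (Fin d))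
    {z z' : ℝ → EuclideanSpace ℝ (Fin m)} (hz : Continuous z) (hz' : Continuous z') {t : ℝ}
    (h : ∀ s ∈ Set.Icc 0 t, z' s = z s) (ht : 0 ≤ t) :
    kalmanSol A H σB S m₀ z' t = kalmanSol A H σB S m₀ z t :=
  linSol_congr (continuous_clm.comp hS.continuous_drift) (continuous_clm.comp hS.continuous_drift)
    (continuous_const.add (hS.continuous_kalmanInt hz))
    (continuous_const.add (hS.continuous_kalmanInt hz')) (fun _ _ => rfl)
    (fun _ hs => congrArg (m₀ + ·) (kalmanInt_congr_path hs.1 fun r hr => h r ⟨hr.1, hr.2.trans hs.2⟩)) t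
    ⟨ht, le_rfl⟩

lemma IsDRESolution.kalmanSol_eq_of_eq (hS' : IsDRESolution A H σB S₀ S')
    (hS : IsDRESolution A H σB S₀ S) (m₀ : EuclideanSpace ℝ (Fin d)) :
    kalmanSol A H σB S' m₀ = kalmanSol A H σB S m₀ := by
  have h : (fun s : ℝ => S' (max s 0)) = fun s => S (max s 0) :=
    funext fun s => hS'.unique hS (le_max_right _ _)
  have h1 : ∀ s : ℝ, S' (max s 0) = S (max s 0) := congrFun h
  funext z
  simp only [kalmanSol, kalmanInt, h1]

lemma IsFilteringModel.exists_signalVersion {m₀ : EuclideanSpace ℝ (Fin d)}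
    {X : ℝ≥0 → Ω → EuclideanSpace ℝ (Fin d)} {Z : ℝ≥0 → Ω → EuclideanSpace ℝ (Fin m)}
    (hmod : IsFilteringModel A H σB m₀ S₀ P X Z B W) :
    ∃ x bb w, IsSignalVersion P A σB B W x bb w ∧ (x 0 =ᵐ[P] X 0) ∧
      ∀ᵐ ω ∂P, ∀ t : ℝ, 0 ≤ t → obsPath H x w t ω = Z t.toNNReal ω := by
  obtain ⟨x, bb, w, h1, h2, h3, h4, h5, h6, h7⟩ := exists_model_versions hmod
  refine ⟨x, bb, w, ⟨hmod.wiener_B, hmod.wiener_W, h1, h2, h3, h4, h5, h6, ?_, ?_, ?_⟩, ?_, ?_⟩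
  · filter_upwards [h7] with ω h using h.2.1
  · filter_upwards [h7] with ω h using h.2.2.1
  · filter_upwards [h7] with ω h using h.2.2.2.2.2.1
  · filter_upwards [h7] with ω h
    rw [h.1, Real.toNNReal_zero]
  · filter_upwards [h7] with ω h t ht using (h.2.2.2.2.2.2 t ht).symm

theorem exists_kalman_constants {Q : Matrix (Fin d) (Fin d) ℝ} (hσB : (σB * σBᵀ).PosDef)
    (hQ : IsARESolution A H σB Q) (m₀ m₀' : EuclideanSpace ℝ (Fin d)) (hS₀ : S₀.PosSemidef)
    (hS₀' : S₀'.PosSemidef) :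
    ∃ M₁ M₂ : ℝ, ∀ (Ω : Type u) [MeasurableSpace Ω] (P : Measure Ω) [IsProbabilityMeasure P]
      (X : ℝ≥0 → Ω → EuclideanSpace ℝ (Fin d)) (Z : ℝ≥0 → Ω → EuclideanSpace ℝ (Fin m))
      (B : ℝ≥0 → Ω → EuclideanSpace ℝ (Fin b)) (W : ℝ≥0 → Ω → EuclideanSpace ℝ (Fin m))
      (M M' : ℝ≥0 → Ω → EuclideanSpace ℝ (Fin d)) (S S' : ℝ → Matrix (Fin d) (Fin d) ℝ),
      IsFilteringModel A H σB m₀ S₀ P X Z B W →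
      IsKalmanFilter A H σB m₀ S₀ P Z M S → IsKalmanFilter A H σB m₀' S₀' P Z M' S' →
      IsKalmanConst P Q M S M' S' (rateβ σB Q) M₁ M₂ := by
  -- In dimension zero all differences vanish, and any positive constants do.
  rcases Nat.eq_zero_or_pos d with rfl | hd
  · refine ⟨1, 1, fun Ω _ P _ X Z B W M M' S S' _ _ _ => ⟨one_pos, one_pos, fun t _ => ?_,
      fun t _ => ?_, fun t => ?_⟩⟩
    · rw [Subsingleton.elim (S t - Q) 0, norm_zero]; positivity
    · rw [Subsingleton.elim (S' t - Q) 0, norm_zero]; positivity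
    · have : ∀ ω, ‖M' t ω - M t ω‖ₑ ^ 2 = 0 := fun ω => by
        rw [Subsingleton.elim (M' t ω - M t ω) 0]; simp
      simp [this]
  have : NeZero d := ⟨hd.ne'⟩
  -- The constants are read off one pair of Riccati flows, with which every other pair agrees by
  -- uniqueness. If there is no such pair, there are no filters and the claim is vacuous.
  by_cases hex : (∃ S, IsDRESolution A H σB S₀ S) ∧ ∃ S', IsDRESolution A H σB S₀' S'
  swap
  · refine ⟨0, 0, fun Ω _ P _ X Z B W M M' S S' _ hM hM' => (hex ⟨⟨S, hM.dre⟩, S', hM'.dre⟩).elim⟩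
  obtain ⟨⟨S, hS⟩, S', hS'⟩ := hex
  obtain ⟨C₁, hC₁, hd₁⟩ := exists_dre_decay hσB hQ hS₀ hS
  obtain ⟨C₁', hC₁', hd₁'⟩ := exists_dre_decay hσB hQ hS₀' hS'
  -- The law of `X 0` is prescribed, so the initial error is the same on every probability space.
  set E₀ := (eLpNorm (fun x => x - m₀) 2 (multivariateGaussian m₀ S₀)).toReal with hE₀
  obtain ⟨C, hC, hb⟩ := exists_filter_diff_bound.{u} hσB hQ hS₀ hS₀' hS hS' m₀ m₀' (E₀ := E₀)
    ENNReal.toReal_nonneg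
  -- `C + 1`, since `C` may be zero and `M₂` has to be positive.
  refine ⟨C₁ + C₁', (C + 1) ^ 2, fun Ω _ P _ X Z B W M M' T T' hmod hM hM' => ?_⟩
  have hT : ∀ t, 0 ≤ t → T t = S t := fun t ht => hM.dre.unique hS ht
  have hT' : ∀ t, 0 ≤ t → T' t = S' t := fun t ht => hM'.dre.unique hS' ht
  refine ⟨by positivity, by positivity, fun t ht => ?_, fun t ht => ?_, fun t => ?_⟩
  · rw [hT t ht]
    exact (hd₁ t ht).trans (mul_le_mul_of_nonneg_right (by linarith) (Real.exp_pos _).le)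
  · rw [hT' t ht]
    exact (hd₁' t ht).trans (mul_le_mul_of_nonneg_right (by linarith) (Real.exp_pos _).le)
  · obtain ⟨x, bb, w, hv, hx0, hz⟩ := hmod.exists_signalVersion
    have hx0' : eLpNorm (fun ω => x 0 ω - m₀) 2 P ≤ ENNReal.ofReal E₀ := by
      have e1 : (fun ω => x 0 ω - m₀) =ᵐ[P] (fun x => x - m₀) ∘ X 0 := by
        filter_upwards [hx0] with ω hω
        simp [hω]
      rw [eLpNorm_congr_ae e1, ← eLpNorm_map_measure (by fun_prop) hmod.law_zero.aemeasurable,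
        hmod.law_zero.map_eq, hE₀, ENNReal.ofReal_toReal]
      exact ((IsGaussian.memLp_two_id (μ := multivariateGaussian m₀ S₀)).sub
        (memLp_const m₀)).eLpNorm_ne_top
    have hb' := hb Ω P B W x bb w hv hx0' t t.2
    have hz' : ∀ᵐ ω ∂P, ∀ t : ℝ, obsPath H x w (max t 0) ω = Z t.toNNReal ω := by
      filter_upwards [hz] with ω hω t
      rw [hω _ (le_max_right _ _), show (max t 0).toNNReal = t.toNNReal by
        rcases le_total t 0 with h | h <;> simp [h, Real.toNNReal_of_nonpos]]
    have hzc : ∀ ω, Continuous fun t => obsPath H x w (max t 0) ω := fun ω =>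
      (hv.continuous_obs H ω).comp (by fun_prop : Continuous fun t : ℝ => max t 0)
    have hsol : ∀ {S S₀} (m₀ : EuclideanSpace ℝ (Fin d)), IsDRESolution A H σB S₀ S → ∀ ω,
        kalmanSol A H σB S m₀ (fun s => obsPath H x w (max s 0) ω) t =
          kalmanSol A H σB S m₀ (fun s => obsPath H x w s ω) t := fun m₀ hS ω =>
      hS.kalmanSol_congr m₀ (hv.continuous_obs H ω) (hzc ω)
        (fun s hs => by rw [max_eq_left hs.1]) t.2
    have e1 : M' t - M t =ᵐ[P] fun ω => kalmanSol A H σB S' m₀' (fun s => obsPath H x w s ω) t -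
        kalmanSol A H σB S m₀ (fun s => obsPath H x w s ω) t := by
      filter_upwards [hM.ae_eq_kalmanSol hmod.measurable_Z hzc hz',
        hM'.ae_eq_kalmanSol hmod.measurable_Z hzc hz'] with ω h1 h2
      rw [Pi.sub_apply, h1, h2, hsol _ hM.dre, hsol _ hM'.dre, hM.dre.kalmanSol_eq_of_eq hS,
        hM'.dre.kalmanSol_eq_of_eq hS']
    have e2 := lintegral_enorm_sq (P := P) (M' t - M t)
    refine e2.trans_le ?_
    rw [eLpNorm_congr_ae e1]
    calc _ ≤ ENNReal.ofReal (C * Real.exp (-rateβ σB Q * t)) ^ 2 := by gcongr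
      _ = ENNReal.ofReal ((C * Real.exp (-rateβ σB Q * t)) ^ 2) :=
        (ENNReal.ofReal_pow (by positivity) 2).symm
      _ ≤ _ := by
        refine ENNReal.ofReal_le_ofReal ?_
        rw [mul_pow, ← Real.exp_nat_mul]
        have e3 : ((2 : ℕ) : ℝ) * (-rateβ σB Q * t) = -2 * rateβ σB Q * t := by push_cast; ring
        rw [e3]
        gcongr
        linarith

end MeanStability

/-! ### Conditional moments of linear equations with observable coefficients -/

section Conditioning

set_option linter.unusedSectionVars false

lemma ae_forall_eq_of_continuous {Ω F : Type*} [MeasurableSpace Ω] {P : Measure Ω}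
    [TopologicalSpace F] [T2Space F] {f g : ℝ → Ω → F} (hf : ∀ ω, Continuous fun t => f t ω)
    (hg : ∀ ω, Continuous fun t => g t ω) (h : ∀ t, 0 ≤ t → f t =ᵐ[P] g t) :
    ∀ᵐ ω ∂P, ∀ t, 0 ≤ t → f t ω = g t ω := by
  have h1 : ∀ᵐ ω ∂P, ∀ q : ℚ, f (max (q : ℝ) 0) ω = g (max (q : ℝ) 0) ω :=
    ae_all_iff.2 fun q => h _ (le_max_right _ _)
  filter_upwards [h1] with ω hω t ht
  have hm : Continuous fun t : ℝ => max t 0 := by fun_prop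
  have := (Rat.denseRange_cast (𝕜 := ℝ)).equalizer ((hf ω).comp hm) ((hg ω).comp hm) (funext hω)
  simpa [max_eq_left ht] using congrFun this t

variable {Ω : Type*} {𝒢 ℋ : MeasurableSpace Ω} [mΩ : MeasurableSpace Ω] {P : Measure Ω} {d m b : ℕ}

/-- Coefficients and noise are evaluated at two separate points of `Ω`, with respect to two
sub-σ-algebras; freezing requires this joint measurability. -/
lemma stronglyMeasurable_linSol_prod {a : ℝ → Ω → Matrix (Fin d) (Fin d) ℝ}
    {r ν : ℝ → Ω → EuclideanSpace ℝ (Fin d)} (ha : ∀ ω, Continuous fun t => a t ω)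
    (hr : ∀ ω, Continuous fun t => r t ω) (hν : ∀ ω, Continuous fun t => ν t ω)
    (ham : ∀ t, StronglyMeasurable[𝒢] (a t)) (hrm : ∀ t, StronglyMeasurable[𝒢] (r t))
    (hνm : ∀ t, StronglyMeasurable[ℋ] (ν t)) (t : ℝ) :
    StronglyMeasurable[𝒢.prod ℋ] fun z : Ω × Ω =>
      linSol (fun s => clm (a s z.1)) (fun s => r s z.1 + ν s z.2) t := by
  refine @stronglyMeasurable_linSol _ _ _ _ _ (𝒢.prod ℋ) _ _
    (fun z => continuous_clm.comp (ha z.1)) (fun z => (hr z.1).add (hν z.2)) (fun s => ?_)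
    (fun s => ?_) t
  · exact (continuous_clm.comp_stronglyMeasurable (ham s)).comp_measurable
      (@measurable_fst Ω Ω 𝒢 ℋ)
  · exact ((hrm s).comp_measurable (@measurable_fst Ω Ω 𝒢 ℋ)).add
      ((hνm s).comp_measurable (@measurable_snd Ω Ω 𝒢 ℋ))

variable [IsProbabilityMeasure P]

/-- Conditional mean of the solution of a linear equation with `𝒢`-measurable coefficients and
independent centred noise. -/
theorem condExp_linSol (h𝒢 : 𝒢 ≤ mΩ) (hℋ : ℋ ≤ mΩ) (hind : Indep 𝒢 ℋ P)
    {a : ℝ → Ω → Matrix (Fin d) (Fin d) ℝ}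
    {r ν : ℝ → Ω → EuclideanSpace ℝ (Fin d)} (ha : ∀ ω, Continuous fun t => a t ω)
    (hr : ∀ ω, Continuous fun t => r t ω)
    (ham : ∀ t, StronglyMeasurable[𝒢] (a t)) (hrm : ∀ t, StronglyMeasurable[𝒢] (r t))
    (hν : IsLpProcess 2 P ν) (hνm : ∀ t, StronglyMeasurable[ℋ] (ν t))
    (hν0 : ∀ t, 0 ≤ t → ∫ ω, ν t ω ∂P = 0) {t : ℝ} (ht : 0 ≤ t)
    {Y : Ω → EuclideanSpace ℝ (Fin d)} (hY : MemLp Y 2 P)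
    (hYeq : ∀ᵐ ω ∂P, Y ω = linSol (fun s => clm (a s ω)) (fun s => r s ω + ν s ω) t) :
    P[Y | 𝒢] =ᵐ[P] fun ω => linSol (fun s => clm (a s ω)) (fun s => r s ω) t := by
  set f : Ω → Ω → EuclideanSpace ℝ (Fin d) := fun ω ω' =>
    linSol (fun s => clm (a s ω)) (fun s => r s ω + ν s ω') t with hf
  have hYf : Y =ᵐ[P] fun ω => f ω ω := hYeq
  have h1 := (condExp_of_indep (f := f) h𝒢 hℋ hind
    (stronglyMeasurable_linSol_prod ha hr hν.continuous ham hrm hνm t)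
    ((hY.integrable one_le_two).congr hYf)).1
  refine (condExp_congr_ae hYf).trans (h1.trans (ae_of_all _ fun ω => ?_))
  have hac : Continuous fun s => clm (a s ω) := continuous_clm.comp (ha ω)
  -- Superposition: with frozen coefficients the noise contributes additively, and its contribution
  -- has mean zero.
  have h2 : ∀ ω', f ω ω' = linSol (fun s => clm (a s ω)) (fun s => r s ω) t +
      linSol (fun s => clm (a s ω)) (fun s => ν s ω') t := fun ω' =>
    linSol_add hac (hr ω) (hν.continuous ω') ht
  simp only [h2]
  rw [integral_add (integrable_const _) (((hν.linSol hac).memLp ht).integrable one_le_two),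
    integral_linSol (ha ω) hν hν0 ht]
  simp

/-- Conditional covariance of the solution of a linear equation with `𝒢`-measurable coefficients and
independent centred noise. -/
theorem condExp_linSol_mul (h𝒢 : 𝒢 ≤ mΩ) (hℋ : ℋ ≤ mΩ) (hind : Indep 𝒢 ℋ P)
    {a : ℝ → Ω → Matrix (Fin d) (Fin d) ℝ}
    {ν : ℝ → Ω → EuclideanSpace ℝ (Fin d)} (ha : ∀ ω, Continuous fun t => a t ω)
    (ham : ∀ t, StronglyMeasurable[𝒢] (a t))
    (hν : IsLpProcess 2 P ν) (hνm : ∀ t, StronglyMeasurable[ℋ] (ν t))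
    {Γ Θ : Matrix (Fin d) (Fin d) ℝ}
    (hΓ : ∀ s t, 0 ≤ s → s ≤ t → cross P (ν s) (ν t) = Γ + s • Θ) {t : ℝ} (ht : 0 ≤ t)
    {U : Ω → EuclideanSpace ℝ (Fin d)} (hU : MemLp U 2 P)
    (hUeq : ∀ᵐ ω ∂P, U ω = linSol (fun s => clm (a s ω)) (fun s => ν s ω) t) (i j : Fin d) :
    P[fun ω => U ω i * U ω j | 𝒢] =ᵐ[P] fun ω => lyapSol (fun s => a s ω) Γ Θ t i j := by
  set f : Ω → Ω → EuclideanSpace ℝ (Fin d) := fun ω ω' =>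
    linSol (fun s => clm (a s ω)) (fun s => ν s ω') t with hf
  have hUf : (fun ω => U ω i * U ω j) =ᵐ[P] fun ω => f ω ω i * f ω ω j := by
    filter_upwards [hUeq] with ω h
    rw [h]
  have hfm : StronglyMeasurable[𝒢.prod ℋ] fun z : Ω × Ω => f z.1 z.2 := by
    have := stronglyMeasurable_linSol_prod (r := fun _ _ => (0 : EuclideanSpace ℝ (Fin d))) ha
      (fun _ => continuous_const) hν.continuous ham (fun _ => stronglyMeasurable_const) hνm t
    simpa only [zero_add] using this
  have hfi : ∀ i, StronglyMeasurable[𝒢.prod ℋ] fun z : Ω × Ω => f z.1 z.2 i := fun i =>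
    (EuclideanSpace.proj (𝕜 := ℝ) i).continuous.comp_stronglyMeasurable hfm
  have h1 := (condExp_of_indep (f := fun ω ω' => f ω ω' i * f ω ω' j) h𝒢 hℋ hind
    ((hfi i).mul (hfi j)) (((hU.eval_piLp i).integrable_mul (hU.eval_piLp j)).congr hUf)).1
  refine (condExp_congr_ae hUf).trans (h1.trans (ae_of_all _ fun ω => ?_))
  have hac : Continuous fun s => clm (a s ω) := continuous_clm.comp (ha ω)
  have hm := (hν.linSol hac).memLp ht
  beta_reduce
  -- With frozen coefficients the integral over the noise is an unconditional second moment.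
  rw [← cross_linSol_self (ha ω) hν hΓ ht, cross_apply hm hm]

end Conditioning

/-! ### The initial value and noise of a mean-field process -/

section Noise

set_option linter.unusedSectionVars false

variable {Ω : Type*} [mΩ : MeasurableSpace Ω] {P : Measure Ω} {d m b : ℕ}
  {A : Matrix (Fin d) (Fin d) ℝ} {H : Matrix (Fin m) (Fin d) ℝ} {σB : Matrix (Fin d) (Fin b) ℝ}

/-- The σ-algebra of the initial value and of the noise of a mean-field process. -/
abbrev noiseSigma (Y₀ : Ω → EuclideanSpace ℝ (Fin d)) (B : ℝ≥0 → Ω → EuclideanSpace ℝ (Fin b)) :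
    MeasurableSpace Ω :=
  MeasurableSpace.comap (fun ω => (Y₀ ω, fun t : ℝ≥0 => B t ω)) inferInstance

/-- `bt` is an everywhere continuous version of the noise `B` of a process started at `Y₀`. -/
structure IsNoiseVersion (P : Measure Ω) (Y₀ : Ω → EuclideanSpace ℝ (Fin d))
    (B : ℝ≥0 → Ω → EuclideanSpace ℝ (Fin b)) (bt : ℝ → Ω → EuclideanSpace ℝ (Fin b)) : Prop where
  wiener : IsWiener P B
  measurable_zero : Measurable Y₀
  memLp : MemLp Y₀ 2 P
  indep : IndepFun Y₀ (fun ω (t : ℝ≥0) => B t ω) P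
  continuous : ∀ ω, Continuous fun t => bt t ω
  measurable : ∀ t, StronglyMeasurable[nullAug P (noiseSigma Y₀ B)] (bt t)
  eq : ∀ᵐ ω ∂P, ∀ t : ℝ, bt t ω = B t.toNNReal ω

/-- The centred noise of a mean-field process. -/
def noise (P : Measure Ω) (σB : Matrix (Fin d) (Fin b) ℝ) (Y₀ : Ω → EuclideanSpace ℝ (Fin d))
    (bt : ℝ → Ω → EuclideanSpace ℝ (Fin b)) (t : ℝ) (ω : Ω) : EuclideanSpace ℝ (Fin d) :=
  (Y₀ ω - ∫ ω', Y₀ ω' ∂P) + clm σB (bt t ω)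

variable {Y₀ : Ω → EuclideanSpace ℝ (Fin d)} {B : ℝ≥0 → Ω → EuclideanSpace ℝ (Fin b)}
  {bt : ℝ → Ω → EuclideanSpace ℝ (Fin b)}

lemma exists_noiseVersion (hB : IsWiener P B) (hY : Measurable Y₀) (hY2 : MemLp Y₀ 2 P)
    (h : IndepFun Y₀ (fun ω (t : ℝ≥0) => B t ω) P) : ∃ bt, IsNoiseVersion P Y₀ B bt := by
  have hm : Measurable (fun ω => (Y₀ ω, fun t : ℝ≥0 => B t ω)) :=
    hY.prodMk (measurable_pi_lambda _ hB.measurable)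
  have hle : noiseSigma Y₀ B ≤ mΩ := hm.comap_le
  have hBm : ∀ t, Measurable[noiseSigma Y₀ B] (B t) := fun t =>
    ((measurable_pi_apply t).comp measurable_snd).comp
      (comap_measurable fun ω => (Y₀ ω, fun t : ℝ≥0 => B t ω))
  obtain ⟨bt, h1, h2, h3⟩ := exists_adapted_version (P := P) (m := fun _ => noiseSigma Y₀ B) (f := B)
    monotone_const (fun t => ⟨B t, (hBm t).stronglyMeasurable.mono (le_nullAug hle), ae_eq_refl _⟩)
    hB.ae_continuous
  exact ⟨bt, hB, hY, hY2, h, h1, h2, h3⟩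

namespace IsNoiseVersion

lemma noiseSigma_le (h : IsNoiseVersion P Y₀ B bt) : noiseSigma Y₀ B ≤ mΩ :=
  (h.measurable_zero.prodMk (measurable_pi_lambda _ h.wiener.measurable)).comap_le

lemma measurable_noise (h : IsNoiseVersion P Y₀ B bt) (t : ℝ) :
    StronglyMeasurable[nullAug P (noiseSigma Y₀ B)] (noise P σB Y₀ bt t) := by
  have hY : Measurable[noiseSigma Y₀ B] Y₀ := measurable_fst.comp
    (comap_measurable fun ω => (Y₀ ω, fun t : ℝ≥0 => B t ω))
  exact ((hY.stronglyMeasurable.mono (le_nullAug h.noiseSigma_le)).sub stronglyMeasurable_const).add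
    ((clm σB).continuous.comp_stronglyMeasurable (h.measurable t))

lemma continuous_noise (h : IsNoiseVersion P Y₀ B bt) (ω : Ω) :
    Continuous fun t => noise P σB Y₀ bt t ω :=
  continuous_const.add ((clm σB).continuous.comp (h.continuous ω))

lemma ae_eq (h : IsNoiseVersion P Y₀ B bt) (t : ℝ) : bt t =ᵐ[P] B t.toNNReal := by
  filter_upwards [h.eq] with ω hω using hω t

lemma memLp_bt (h : IsNoiseVersion P Y₀ B bt) (t : ℝ) : MemLp (bt t) 2 P :=
  (memLp_congr_ae (h.ae_eq t)).2 (h.wiener.memLp _)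

lemma indepFun_bt (h : IsNoiseVersion P Y₀ B bt) (t : ℝ) : IndepFun Y₀ (bt t) P := by
  have h1 : IndepFun Y₀ (B t.toNNReal) P :=
    h.indep.comp (φ := id) measurable_id (measurable_pi_apply t.toNNReal)
  exact h1.congr (ae_eq_refl _) (h.ae_eq t).symm

variable [IsProbabilityMeasure P]

lemma isLpProcess_noise (h : IsNoiseVersion P Y₀ B bt) : IsLpProcess 2 P (noise P σB Y₀ bt) := by
  have hb : IsLpProcess 2 P bt := by
    refine ⟨h.continuous, fun t => (h.measurable t).mono (nullAug_le _), fun T =>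
      ⟨(√(T * b)).toNNReal, fun t ht => ?_⟩⟩
    rw [eLpNorm_congr_ae (h.ae_eq t), h.wiener.eLpNorm_eq, Real.coe_toNNReal t ht.1]
    refine ENNReal.ofReal_le_ofReal (Real.sqrt_le_sqrt ?_)
    exact mul_le_mul_of_nonneg_right ht.2 (by positivity)
  have h0 : IsLpProcess 2 P fun (_ : ℝ) ω => Y₀ ω - ∫ ω', Y₀ ω' ∂P :=
    IsLpProcess.of_memLp (h.memLp.sub (memLp_const _))
      (h.measurable_zero.stronglyMeasurable.sub stronglyMeasurable_const)
  exact h0.add one_le_two (hb.clm_apply (a := fun _ => clm σB) continuous_const)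

lemma integral_bt (h : IsNoiseVersion P Y₀ B bt) (t : ℝ) : ∫ ω, bt t ω ∂P = 0 := by
  rw [integral_congr_ae (h.ae_eq t), h.wiener.integral_eq_zero]

lemma integral_centred (h : IsNoiseVersion P Y₀ B bt) : ∫ ω, (Y₀ ω - ∫ ω', Y₀ ω' ∂P) ∂P = 0 := by
  rw [integral_sub (h.memLp.integrable one_le_two) (integrable_const _)]
  simp

lemma integral_clm_bt (h : IsNoiseVersion P Y₀ B bt) (t : ℝ) : ∫ ω, clm σB (bt t ω) ∂P = 0 := by
  rw [ContinuousLinearMap.integral_comp_comm _ ((h.memLp_bt t).integrable one_le_two),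
    h.integral_bt, map_zero]

lemma integral_noise (h : IsNoiseVersion P Y₀ B bt) (t : ℝ) :
    ∫ ω, noise P σB Y₀ bt t ω ∂P = 0 := by
  simp only [noise]
  rw [integral_add, h.integral_centred, h.integral_clm_bt, add_zero]
  · exact (h.memLp.integrable one_le_two).sub (integrable_const _)
  · exact (clm σB).integrable_comp ((h.memLp_bt t).integrable one_le_two)

/-- The initial value and the Wiener process are independent and centred, so the mixed terms vanish;
what remains has the form `Γ + s Θ` on which `cross_linSol_self` relies. -/
lemma cross_noise (h : IsNoiseVersion P Y₀ B bt) {s t : ℝ} (hs : 0 ≤ s) (hst : s ≤ t) :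
    cross P (noise P σB Y₀ bt s) (noise P σB Y₀ bt t) =
      cross P (fun ω => Y₀ ω - ∫ ω', Y₀ ω' ∂P) (fun ω => Y₀ ω - ∫ ω', Y₀ ω' ∂P) +
        s • (σB * σBᵀ) := by
  set ξ : Ω → EuclideanSpace ℝ (Fin d) := fun ω => Y₀ ω - ∫ ω', Y₀ ω' ∂P with hξ
  have hξ2 : MemLp ξ 2 P := h.memLp.sub (memLp_const _)
  have hb := h.memLp_bt
  have hc : ∀ t, MemLp (fun ω => clm σB (bt t ω)) 2 P := fun t => (clm σB).comp_memLp' (hb t)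
  have hi : ∀ t, IndepFun ξ (fun ω => clm σB (bt t ω)) P := fun t =>
    (h.indepFun_bt t).comp (φ := fun y => y - ∫ ω', Y₀ ω' ∂P) (by fun_prop)
      (clm σB).continuous.measurable
  have e0 : ∀ {p q : ℕ} (y : EuclideanSpace ℝ (Fin q)), outer (0 : EuclideanSpace ℝ (Fin p)) y = 0 :=
    fun y => by ext i j; simp [outer_apply]
  have e1 : cross P ξ (fun ω => clm σB (bt t ω)) = 0 := by
    rw [cross_of_indep hξ2 (hc t) (hi t), show ∫ ω, ξ ω ∂P = 0 from h.integral_centred, e0]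
  have e2 : cross P (fun ω => clm σB (bt s ω)) ξ = 0 := by
    rw [cross_of_indep (hc s) hξ2 (hi s).symm, h.integral_clm_bt, e0]
  have e3 : cross P (fun ω => clm σB (bt s ω)) (fun ω => clm σB (bt t ω)) = s • (σB * σBᵀ) := by
    rw [cross_clm_left (hb s) (hc t), ← cross_transpose (hc t) (hb s), cross_clm_left (hb t) (hb s),
      cross_congr (h.ae_eq t) (h.ae_eq s), h.wiener.cross_eq, Real.coe_toNNReal s hs,
      Real.coe_toNNReal t (hs.trans hst), min_eq_right hst]
    simp
  change cross P (fun ω => ξ ω + clm σB (bt s ω)) (fun ω => ξ ω + clm σB (bt t ω)) = _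
  have hadd : MemLp (fun ω => ξ ω + clm σB (bt t ω)) 2 P := hξ2.add (hc t)
  rw [cross_add_left hξ2 (hc s) hadd, cross_add_right hξ2 hξ2 (hc t),
    cross_add_right (hc s) hξ2 (hc t), e1, e2, e3, add_zero, zero_add]

end IsNoiseVersion

lemma cross_centred_eq_covMat {π₀ : Measure (EuclideanSpace ℝ (Fin d))} [IsProbabilityMeasure P]
    (hY : HasLaw Y₀ π₀ P) (hm : MemLp Y₀ 2 P) :
    cross P (fun ω => Y₀ ω - ∫ ω', Y₀ ω' ∂P) (fun ω => Y₀ ω - ∫ ω', Y₀ ω' ∂P) = covMat π₀ := by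
  ext i j
  have hc : MemLp (fun ω => Y₀ ω - ∫ ω', Y₀ ω' ∂P) 2 P := hm.sub (memLp_const _)
  have e : ∀ i, (∫ ω', Y₀ ω' ∂P) i = ∫ x : EuclideanSpace ℝ (Fin d), x i ∂π₀ := fun i => by
    have hi := (EuclideanSpace.proj (𝕜 := ℝ) i).integral_comp_comm (hm.integrable one_le_two)
    simp only [PiLp.proj_apply] at hi
    rw [← hi, ← hY.map_eq, integral_map hY.aemeasurable]
    exact (EuclideanSpace.proj (𝕜 := ℝ) i).continuous.aestronglyMeasurable
  rw [cross_apply hc hc, covMat, Matrix.of_apply, covariance, ← e i, ← e j, ← hY.map_eq,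
    integral_map hY.aemeasurable]
  · rfl
  · exact Continuous.aestronglyMeasurable (by fun_prop)

lemma covMat_multivariateGaussian (m₀ : EuclideanSpace ℝ (Fin d)) {S₀ : Matrix (Fin d) (Fin d) ℝ}
    (hS₀ : S₀.PosSemidef) : covMat (multivariateGaussian m₀ S₀) = S₀ := by
  ext i j
  exact covariance_eval_multivariateGaussian hS₀ i j

end Noise

/-! ### Independence from the observations, and adapted versions of the McKean–Vlasov data -/

section MeanField

set_option linter.unusedSectionVars false

variable {Ω : Type*} [mΩ : MeasurableSpace Ω] {P : Measure Ω} {d m b : ℕ}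
  {A : Matrix (Fin d) (Fin d) ℝ} {H : Matrix (Fin m) (Fin d) ℝ} {σB : Matrix (Fin d) (Fin b) ℝ}
  {m₀ : EuclideanSpace ℝ (Fin d)} {S₀ : Matrix (Fin d) (Fin d) ℝ}
  {X : ℝ≥0 → Ω → EuclideanSpace ℝ (Fin d)} {Z : ℝ≥0 → Ω → EuclideanSpace ℝ (Fin m)}
  {B : ℝ≥0 → Ω → EuclideanSpace ℝ (Fin b)} {W : ℝ≥0 → Ω → EuclideanSpace ℝ (Fin m)}

lemma obsSigma_le (hZ : ∀ t, Measurable (Z t)) (t : ℝ≥0) : obsSigma Z t ≤ mΩ :=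
  (measurable_pi_lambda _ fun s : Set.Iic t => hZ s).comap_le

lemma measurable_obsSigma {s t : ℝ≥0} (h : s ≤ t) : Measurable[obsSigma Z t] (Z s) :=
  (measurable_pi_apply (⟨s, h⟩ : Set.Iic t)).comp (comap_measurable (pathUpTo Z t))

lemma obsSigma_mono : Monotone (obsSigma Z) := fun s t h => by
  rw [obsSigma, MeasurableSpace.comap_le_iff_le_map]
  have : Measurable[obsSigma Z t] (pathUpTo Z s) :=
    @measurable_pi_lambda _ _ _ (obsSigma Z t) _ _ fun r => measurable_obsSigma (r.2.trans h)
  exact this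

/-- The σ-algebra of the signal and observation noises. -/
abbrev signalSigma (X₀ : Ω → EuclideanSpace ℝ (Fin d)) (B : ℝ≥0 → Ω → EuclideanSpace ℝ (Fin b))
    (W : ℝ≥0 → Ω → EuclideanSpace ℝ (Fin m)) : MeasurableSpace Ω :=
  MeasurableSpace.comap (fun ω => (X₀ ω, (fun t : ℝ≥0 => B t ω), (fun t : ℝ≥0 => W t ω)))
    inferInstance

/-- The signal equation is linear, so up to null sets `X`, and with it `Z`, is an explicit
functional of `(X 0, B, W)`. Observations thus carry no information on the noise of a mean-field
process. -/
lemma IsFilteringModel.obsSigma_le_nullAug (hmod : IsFilteringModel A H σB m₀ S₀ P X Z B W)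
    (t : ℝ≥0) : obsSigma Z t ≤ nullAug P (signalSigma (X 0) B W) := by
  have hcm : Measurable[signalSigma (X 0) B W] (fun ω => (X 0 ω, (fun t : ℝ≥0 => B t ω), (fun t : ℝ≥0 => W t ω))) :=
    comap_measurable _
  have hle : signalSigma (X 0) B W ≤ mΩ := ((hmod.measurable_X 0).prodMk
    ((measurable_pi_lambda _ hmod.wiener_B.measurable).prodMk
      (measurable_pi_lambda _ hmod.wiener_W.measurable))).comap_le
  have hX0 : Measurable[signalSigma (X 0) B W] (X 0) := measurable_fst.comp hcm
  have hB : ∀ t, Measurable[signalSigma (X 0) B W] (B t) := fun t =>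
    (measurable_pi_apply t).comp ((measurable_fst.comp measurable_snd).comp hcm)
  have hW : ∀ t, Measurable[signalSigma (X 0) B W] (W t) := fun t =>
    (measurable_pi_apply t).comp ((measurable_snd.comp measurable_snd).comp hcm)
  obtain ⟨bt, hbc, hbm, hb⟩ := exists_adapted_version (P := P) (m := fun _ => signalSigma (X 0) B W) (f := B)
    monotone_const (fun t => ⟨B t, (hB t).stronglyMeasurable.mono (le_nullAug hle), ae_eq_refl _⟩)
    hmod.wiener_B.ae_continuous
  obtain ⟨w, hwc, hwm, hw⟩ := exists_adapted_version (P := P) (m := fun _ => signalSigma (X 0) B W) (f := W)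
    monotone_const (fun t => ⟨W t, (hW t).stronglyMeasurable.mono (le_nullAug hle), ae_eq_refl _⟩)
    hmod.wiener_W.ae_continuous
  set n : ℝ → Ω → EuclideanSpace ℝ (Fin d) := fun t ω => X 0 ω + clm σB (bt t ω) with hn
  have hnc : ∀ ω, Continuous fun t => n t ω := fun ω =>
    continuous_const.add ((clm σB).continuous.comp (hbc ω))
  set x : ℝ → Ω → EuclideanSpace ℝ (Fin d) := fun t ω => linSol (fun _ => clm A) (fun s => n s ω) t
    with hx
  have hxc : ∀ ω, Continuous fun t => x t ω := fun ω => continuous_linSol continuous_const (hnc ω)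
  have hxm : ∀ t, StronglyMeasurable[nullAug P (signalSigma (X 0) B W)] (x t) := fun t =>
    @stronglyMeasurable_linSol _ _ _ _ _ (nullAug P (signalSigma (X 0) B W)) _ _ (fun _ => continuous_const) hnc
      (fun _ => stronglyMeasurable_const)
      (fun t => (hX0.stronglyMeasurable.mono (le_nullAug hle)).add
        ((clm σB).continuous.comp_stronglyMeasurable (hbm t))) t
  have hzm : ∀ t : ℝ, StronglyMeasurable[nullAug P (signalSigma (X 0) B W)]
      fun ω => (∫ s in (0 : ℝ)..t, clm H (x s ω)) + w t ω := fun t =>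
    (@stronglyMeasurable_intervalIntegral _ (nullAug P (signalSigma (X 0) B W)) _ _ _ _
      (fun ω => (clm H).continuous.comp (hxc ω))
      (fun s => (clm H).continuous.comp_stronglyMeasurable (hxm s)) 0 t).add (hwm t)
  have hz : ∀ s : ℝ≥0, Z s =ᵐ[P] fun ω => (∫ r in (0 : ℝ)..s, clm H (x r ω)) + w s ω := by
    intro s
    filter_upwards [hb, hw, hmod.sde_X, hmod.sde_Z, hmod.continuous_X] with ω hb hw hX hZ hXc
    have h1 : ∀ r ∈ Set.Icc (0 : ℝ) s, X r.toNNReal ω = x r ω := by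
      refine eq_linSol (u := fun r : ℝ => X r.toNNReal ω) (n' := fun r => n r ω) continuous_const
        (hnc ω) (hXc.comp continuous_real_toNNReal) (fun _ _ => rfl) (fun _ _ => rfl) fun r hr => ?_
      have := hX r.toNNReal
      rw [Real.coe_toNNReal r hr.1] at this
      rw [this, hn]
      simp only [hb r]
      exact add_right_comm _ _ _
    rw [hZ s, hw s, Real.toNNReal_coe]
    congr 1
    refine intervalIntegral.integral_congr fun r hr => ?_
    rw [Set.uIcc_of_le s.coe_nonneg] at hr
    change clm H (X r.toNNReal ω) = clm H (x r ω)
    rw [h1 r hr]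
  rw [obsSigma, MeasurableSpace.comap_le_iff_le_map]
  have : Measurable[nullAug P (signalSigma (X 0) B W)] (pathUpTo Z t) :=
    @measurable_pi_lambda _ _ _ (nullAug P (signalSigma (X 0) B W)) _ _ fun s =>
      measurable_nullAug_congr (hmod.measurable_Z s) (hzm s).measurable (hz s)
  exact this

lemma IsFilteringModel.indep_nullAug [IsProbabilityMeasure P]
    (hmod : IsFilteringModel A H σB m₀ S₀ P X Z B W)
    {Y₀ : Ω → EuclideanSpace ℝ (Fin d)} {Bbar : ℝ≥0 → Ω → EuclideanSpace ℝ (Fin b)}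
    (hcopy : IsIndependentCopy P (X 0) B W Y₀ Bbar) (hY₀ : Measurable Y₀) (t : ℝ≥0) :
    Indep (nullAug P (obsSigma Z t)) (nullAug P (noiseSigma Y₀ Bbar)) P := by
  have h1 : Indep (signalSigma (X 0) B W) (noiseSigma Y₀ Bbar) P :=
    (IndepFun_iff_Indep _ _ _).1 hcopy.indep_signal.symm
  -- Augmented twice: `obsSigma` lies in an augmented σ-algebra and is then augmented itself.
  have h2 := nullAug_indep (nullAug_indep h1)
  have hle := (hY₀.prodMk (measurable_pi_lambda _ hcopy.wiener.measurable)).comap_le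
  exact indep_of_indep_of_le_left (indep_of_indep_of_le_right h2
    (le_nullAug (nullAug_le _))) (nullAug_mono (hmod.obsSigma_le_nullAug t))

lemma IsFilteringModel.ae_continuous_obs (hmod : IsFilteringModel A H σB m₀ S₀ P X Z B W) :
    ∀ᵐ ω ∂P, Continuous fun t => Z t ω := by
  filter_upwards [hmod.continuous_X, hmod.wiener_W.ae_continuous, hmod.sde_Z] with ω hX hW hZ
  have h1 : Continuous fun s : ℝ => clm H (X s.toNNReal ω) :=
    (clm H).continuous.comp (hX.comp continuous_real_toNNReal)
  have h2 := intervalIntegral.continuous_primitive (μ := volume)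
    (fun a b => h1.intervalIntegrable a b) 0
  have h3 : (fun t => Z t ω) = fun t : ℝ≥0 => (∫ s in (0 : ℝ)..t, clm H (X s.toNNReal ω)) + W t ω :=
    funext fun t => hZ t
  rw [h3]
  exact (h2.comp NNReal.continuous_coe).add hW

/-- Adapted, everywhere continuous versions of the processes in the McKean-Vlasov equation. -/
structure IsMeanFieldVersion (P : Measure Ω)
    (A : Matrix (Fin d) (Fin d) ℝ) (H : Matrix (Fin m) (Fin d) ℝ) (σB : Matrix (Fin d) (Fin b) ℝ)
    (Z : ℝ≥0 → Ω → EuclideanSpace ℝ (Fin m))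
    (Y : ℝ≥0 → Ω → EuclideanSpace ℝ (Fin d)) (bt : ℝ → Ω → EuclideanSpace ℝ (Fin b))
    (mb : ℝ → Ω → EuclideanSpace ℝ (Fin d)) (sb : ℝ → Ω → Matrix (Fin d) (Fin d) ℝ)
    (I : ℝ → Ω → EuclideanSpace ℝ (Fin d)) : Prop where
  continuous_mb : ∀ ω, Continuous fun t => mb t ω
  continuous_sb : ∀ ω, Continuous fun t => sb t ω
  continuous_I : ∀ ω, Continuous fun t => I t ω
  measurable_mb : ∀ t : ℝ, StronglyMeasurable[nullAug P (obsSigma Z t.toNNReal)] (mb t)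
  measurable_sb : ∀ t : ℝ, StronglyMeasurable[nullAug P (obsSigma Z t.toNNReal)] (sb t)
  measurable_I : ∀ t : ℝ, StronglyMeasurable[nullAug P (obsSigma Z t.toNNReal)] (I t)
  mean : ∀ t : ℝ≥0, mb t =ᵐ[P] P[Y t | obsSigma Z t]
  cov : ∀ (t : ℝ≥0) i j, (fun ω => sb t ω i j) =ᵐ[P]
    P[fun ω => (Y t ω i - mb t ω i) * (Y t ω j - mb t ω j) | obsSigma Z t]
  ito : IsItoIntegral P (fun (t : ℝ≥0) ω => sb t ω * Hᵀ) Z fun t => I t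
  eq : ∀ᵐ ω ∂P, (Continuous fun t => Y t ω) ∧ ∀ t : ℝ, 0 ≤ t →
    Y t.toNNReal ω = Y 0 ω + (∫ s in (0 : ℝ)..t, clm A (Y s.toNNReal ω)) + clm σB (bt t ω) + I t ω -
      ∫ s in (0 : ℝ)..t, clm (sb s ω * Hᵀ)
        ((1 / 2 : ℝ) • (clm H (Y s.toNNReal ω) + clm H (mb s ω)))

lemma stronglyMeasurable_matrix {α : Type*} [MeasurableSpace α] {p q : ℕ}
    {f : α → Matrix (Fin p) (Fin q) ℝ} (h : ∀ i j, StronglyMeasurable fun x => f x i j) :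
    StronglyMeasurable f := by
  have : f = fun x => ∑ i, ∑ j, f x i j • Matrix.single i j (1 : ℝ) := by
    funext x
    conv_lhs => rw [Matrix.matrix_eq_sum_single (f x)]
    simp
  rw [this]
  refine Finset.stronglyMeasurable_fun_sum _ fun i _ => Finset.stronglyMeasurable_fun_sum _ fun j _ => ?_
  exact (h i j).smul_const _

lemma stronglyMeasurable_clm_apply {α : Type*} [MeasurableSpace α] {p q : ℕ}
    {f : α → Matrix (Fin p) (Fin q) ℝ} {g : α → EuclideanSpace ℝ (Fin q)}
    (hf : StronglyMeasurable f) (hg : StronglyMeasurable g) :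
    StronglyMeasurable fun x => clm (f x) (g x) := by
  have h1 := continuous_clm.comp_stronglyMeasurable hf
  exact isBoundedBilinearMap_apply.continuous.comp_stronglyMeasurable (h1.prodMk hg)

lemma IsItoIntegral.congr {p q : ℕ} {K K' : ℝ≥0 → Ω → Matrix (Fin p) (Fin q) ℝ}
    {Z : ℝ≥0 → Ω → EuclideanSpace ℝ (Fin q)} {I I' : ℝ≥0 → Ω → EuclideanSpace ℝ (Fin p)}
    (h : IsItoIntegral P K Z I) (hK : ∀ᵐ ω ∂P, ∀ t, K t ω = K' t ω)
    (hI : ∀ᵐ ω ∂P, ∀ t, I t ω = I' t ω) : IsItoIntegral P K' Z I' := by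
  refine ⟨?_, fun t => (h.2 t).congr (fun n => ?_) ?_⟩
  · filter_upwards [h.1, hI] with ω h1 h2
    have : (fun t => I' t ω) = fun t => I t ω := funext fun t => (h2 t).symm
    rwa [this]
  · filter_upwards [hK] with ω hω
    simp only [hω]
  · filter_upwards [hI] with ω hω using hω t

/-- Mean and covariance are adapted as conditional expectations, and the Itô integral as a limit of
Riemann sums whose nodes do not exceed `t`. -/
lemma IsMeanFieldSolution.exists_version [IsProbabilityMeasure P]
    (hmod : IsFilteringModel A H σB m₀ S₀ P X Z B W)
    {π₀ : Measure (EuclideanSpace ℝ (Fin d))} {Bbar : ℝ≥0 → Ω → EuclideanSpace ℝ (Fin b)}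
    {Y : ℝ≥0 → Ω → EuclideanSpace ℝ (Fin d)} (hY : IsMeanFieldSolution A H σB π₀ P Z Bbar Y)
    {bt : ℝ → Ω → EuclideanSpace ℝ (Fin b)} (hbt : IsNoiseVersion P (Y 0) Bbar bt) :
    ∃ mb sb I, IsMeanFieldVersion P A H σB Z Y bt mb sb I := by
  obtain ⟨mbar, Sbar, I, hmc, hSc, hm, hS, hI, hsde⟩ := hY.sde
  have hle := obsSigma_le hmod.measurable_Z
  obtain ⟨mb, hmbc, hmbm, hmb⟩ := exists_adapted_version (P := P) (m := obsSigma Z) (f := mbar)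
    obsSigma_mono (fun t => ⟨_, stronglyMeasurable_condExp.mono (le_nullAug (hle t)), hm t⟩) hmc
  obtain ⟨sb, hsbc, hsbm, hsb⟩ := exists_adapted_version (P := P) (m := obsSigma Z) (f := Sbar)
    obsSigma_mono (fun t => ⟨fun ω => Matrix.of fun i j =>
      (P[fun ω => (Y t ω i - mbar t ω i) * (Y t ω j - mbar t ω j) | obsSigma Z t]) ω,
      @stronglyMeasurable_matrix _ (nullAug P (obsSigma Z t)) _ _ _ fun i j =>
        stronglyMeasurable_condExp.mono (le_nullAug (hle t)), by
        have : ∀ᵐ ω ∂P, ∀ i j, Sbar t ω i j = _ :=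
          ae_all_iff.2 fun i => ae_all_iff.2 fun j => hS t i j
        filter_upwards [this] with ω hω
        ext i j
        exact hω i j⟩) hSc
  have hmb' : ∀ᵐ ω ∂P, ∀ t : ℝ≥0, mb t ω = mbar t ω := by
    filter_upwards [hmb] with ω hω t
    rw [hω, Real.toNNReal_coe]
  have hsb' : ∀ᵐ ω ∂P, ∀ t : ℝ≥0, sb t ω = Sbar t ω := by
    filter_upwards [hsb] with ω hω t
    rw [hω, Real.toNNReal_coe]
  have hI' : IsItoIntegral P (fun (t : ℝ≥0) ω => sb t ω * Hᵀ) Z I :=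
    hI.congr (by filter_upwards [hsb'] with ω hω t; rw [hω t]) (ae_of_all _ fun _ _ => rfl)
  obtain ⟨Iv, hIc, hIm, hIe⟩ := exists_adapted_version (P := P) (m := obsSigma Z) (f := I)
    obsSigma_mono (fun t => by
      refine exists_ae_eq_of_tendstoInMeasure (m := nullAug P (obsSigma Z t)) (fun n => ?_) (hI'.2 t)
      refine Finset.stronglyMeasurable_fun_sum _ fun k hk => ?_
      have hk' : (k : ℝ≥0) + 1 ≤ n := by exact_mod_cast Finset.mem_range.1 hk
      have hn : (0 : ℝ≥0) < n := lt_of_lt_of_le (by positivity) hk'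
      have h1 : ((k : ℝ≥0) + 1) / n * t ≤ t :=
        mul_le_of_le_one_left zero_le ((div_le_one hn).2 hk')
      have h2 : (k : ℝ≥0) / n * t ≤ t :=
        mul_le_of_le_one_left zero_le ((div_le_one hn).2 (le_trans (by simp) hk'))
      have hz : ∀ s ≤ t, StronglyMeasurable[nullAug P (obsSigma Z t)] (Z s) := fun s hs =>
        (measurable_obsSigma hs).stronglyMeasurable.mono (le_nullAug (hle t))
      have hs : StronglyMeasurable[nullAug P (obsSigma Z t)] (sb ((k : ℝ≥0) / n * t : ℝ≥0)) :=
        (hsbm _).mono (nullAug_mono (obsSigma_mono (by rwa [Real.toNNReal_coe])))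
      exact @stronglyMeasurable_clm_apply _ (nullAug P (obsSigma Z t)) _ _ _ _
        (((continuous_id.matrix_mul continuous_const).comp_stronglyMeasurable hs))
        ((hz _ h1).sub (hz _ h2))) hI.1
  have hIe' : ∀ᵐ ω ∂P, ∀ t : ℝ≥0, Iv t ω = I t ω := by
    filter_upwards [hIe] with ω hω t
    rw [hω, Real.toNNReal_coe]
  refine ⟨mb, sb, Iv, hmbc, hsbc, hIc, hmbm, hsbm, hIm, fun t => ?_, fun t i j => ?_, ?_, ?_⟩
  · refine EventuallyEq.trans ?_ (hm t)
    filter_upwards [hmb'] with ω hω using hω t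
  · have h1 : (fun ω => (Y t ω i - mb t ω i) * (Y t ω j - mb t ω j)) =ᵐ[P]
        fun ω => (Y t ω i - mbar t ω i) * (Y t ω j - mbar t ω j) := by
      filter_upwards [hmb'] with ω hω
      rw [hω t]
    refine EventuallyEq.trans ?_ ((hS t i j).trans (condExp_congr_ae h1).symm)
    filter_upwards [hsb'] with ω hω
    rw [hω t]
  · exact hI'.congr (ae_of_all _ fun _ _ => rfl)
      (by filter_upwards [hIe'] with ω hω t using (hω t).symm)
  · filter_upwards [hY.continuous, hsde, hmb, hsb, hIe, hbt.eq] with ω hYc he h1 h2 h3 h4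
    refine ⟨hYc, fun t ht => ?_⟩
    have := he t.toNNReal
    rw [Real.coe_toNNReal t ht] at this
    rw [this, h3, h4]
    simp only [h1, h2]
    rfl

end MeanField

/-! ### Identification of the conditional mean and covariance with the Kalman–Bucy filter -/

section Identification

set_option linter.unusedSectionVars false

variable {Ω : Type*} [mΩ : MeasurableSpace Ω] {P : Measure Ω} {d m b : ℕ}
  {A : Matrix (Fin d) (Fin d) ℝ} {H : Matrix (Fin m) (Fin d) ℝ} {σB : Matrix (Fin d) (Fin b) ℝ}
  {m₀ : EuclideanSpace ℝ (Fin d)} {S₀ : Matrix (Fin d) (Fin d) ℝ}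
  {X : ℝ≥0 → Ω → EuclideanSpace ℝ (Fin d)} {Z : ℝ≥0 → Ω → EuclideanSpace ℝ (Fin m)}
  {B : ℝ≥0 → Ω → EuclideanSpace ℝ (Fin b)} {W : ℝ≥0 → Ω → EuclideanSpace ℝ (Fin m)}

lemma continuous_lyapSol {a : ℝ → Matrix (Fin d) (Fin d) ℝ} (ha : Continuous a)
    (Γ Θ : Matrix (Fin d) (Fin d) ℝ) : Continuous (lyapSol a Γ Θ) :=
  continuous_linSol (continuous_sylv ha ha.matrix_transpose) (by fun_prop)

lemma lyapSol_eq {a : ℝ → Matrix (Fin d) (Fin d) ℝ} (ha : Continuous a)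
    (Γ Θ : Matrix (Fin d) (Fin d) ℝ) {t : ℝ} (ht : 0 ≤ t) : lyapSol a Γ Θ t = Γ + t • Θ +
      ∫ s in (0 : ℝ)..t, (a s * lyapSol a Γ Θ s + lyapSol a Γ Θ s * (a s)ᵀ) :=
  linSol_eq (continuous_sylv ha ha.matrix_transpose)
    (by fun_prop : Continuous fun s : ℝ => Γ + s • Θ) ht

lemma lyapSol_congr {a a' : ℝ → Matrix (Fin d) (Fin d) ℝ} (ha : Continuous a)
    (ha' : Continuous a') (Γ Θ : Matrix (Fin d) (Fin d) ℝ) {t : ℝ} (ht : 0 ≤ t)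
    (h : ∀ s ∈ Set.Icc 0 t, a' s = a s) : lyapSol a' Γ Θ t = lyapSol a Γ Θ t :=
  linSol_congr (continuous_sylv ha ha.matrix_transpose)
    (continuous_sylv ha' ha'.matrix_transpose) (by fun_prop) (by fun_prop)
    (fun s hs => by rw [h s hs]) (fun _ _ => rfl) t ⟨ht, le_rfl⟩

/-- The covariance of a mean-field process started from `S₀` is the solution of the Riccati
equation. -/
lemma IsDRESolution.lyapSol_eq {S : ℝ → Matrix (Fin d) (Fin d) ℝ} (hS : IsDRESolution A H σB S₀ S)
    (hS₀ : S₀ᵀ = S₀) {t : ℝ} (ht : 0 ≤ t) :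
    lyapSol (fun s => halfDrift A H (S (max s 0))) S₀ (σB * σBᵀ) t = S t := by
  have hc := hS.continuous_max
  have hac : Continuous fun s => halfDrift A H (S (max s 0)) := (continuous_halfDrift A H).comp hc
  have h := eq_linSol (u := fun s => S (max s 0)) (T := t) (n' := fun s => S₀ + s • (σB * σBᵀ))
    (continuous_sylv hac hac.matrix_transpose) (by fun_prop) hc
    (fun _ _ => rfl) (fun _ _ => rfl) (fun s hs => ?_) t ⟨ht, le_rfl⟩
  · rw [lyapSol, ← h, max_eq_left ht]
  · have h2 : ∫ r in (0 : ℝ)..s, ricc A H σB (S (max r 0)) =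
        ∫ r in (0 : ℝ)..s, (sylv (halfDrift A H (S (max r 0))) (halfDrift A H (S (max r 0)))ᵀ
          (S (max r 0)) + σB * σBᵀ) := by
      refine intervalIntegral.integral_congr fun r _ => ?_
      rw [ricc_eq_halfDrift (hS.transpose_eq hS₀ (le_max_right _ _)), sylv_apply]
    have h1 : Continuous fun r => sylv (halfDrift A H (S (max r 0)))
        (halfDrift A H (S (max r 0)))ᵀ (S (max r 0)) :=
      (continuous_sylv hac hac.matrix_transpose).clm_apply hc
    rw [hS.eq_integral hs.1, h2, intervalIntegral.integral_add (h1.intervalIntegrable _ _)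
      (by simp), intervalIntegral.integral_const, sub_zero]
    abel

/-- The coefficient of the Lyapunov equation is built from its own solution; for symmetric `L` this
fixed-point relation is the Riccati equation. -/
lemma isDRESolution_of_eq_lyapSol {Γ : Matrix (Fin d) (Fin d) ℝ}
    {L : ℝ → Matrix (Fin d) (Fin d) ℝ} (hL : Continuous L)
    (h : ∀ t, 0 ≤ t → L t = lyapSol (fun s => halfDrift A H (L s)) Γ (σB * σBᵀ) t)
    (hT : ∀ t, 0 ≤ t → (L t)ᵀ = L t) : IsDRESolution A H σB Γ L := by
  have hac : Continuous fun s => halfDrift A H (L s) := (continuous_halfDrift A H).comp hL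
  have hLc := continuous_lyapSol hac Γ (σB * σBᵀ)
  set l := lyapSol (fun s => halfDrift A H (L s)) Γ (σB * σBᵀ) with hl
  have hgc : Continuous fun s => halfDrift A H (L s) * l s + l s * (halfDrift A H (L s))ᵀ :=
    (hac.matrix_mul hLc).add (hLc.matrix_mul hac.matrix_transpose)
  refine ⟨?_, fun t ht => ?_⟩
  · rw [h 0 le_rfl, hl, LinearFPF.lyapSol_eq hac _ _ le_rfl]; simp
  · have h1 : HasDerivAt (fun t : ℝ => Γ + t • (σB * σBᵀ) +
        ∫ s in (0 : ℝ)..t, (halfDrift A H (L s) * l s + l s * (halfDrift A H (L s))ᵀ))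
        (ricc A H σB (L t)) t := by
      rw [ricc_eq_halfDrift (hT t ht), add_comm]
      have := (((hasDerivAt_id t).smul_const (σB * σBᵀ)).const_add Γ).add
        (hasDerivAt_integral_of_continuous hgc t)
      rw [one_smul, ← h t ht] at this
      exact this
    refine h1.hasDerivWithinAt.congr (fun s hs => ?_) ?_
    · exact (h s hs).trans (LinearFPF.lyapSol_eq hac _ _ hs)
    · exact (h t ht).trans (LinearFPF.lyapSol_eq hac _ _ ht)

variable [IsProbabilityMeasure P] {Y : ℝ≥0 → Ω → EuclideanSpace ℝ (Fin d)}
  {Bbar : ℝ≥0 → Ω → EuclideanSpace ℝ (Fin b)}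
  {bt : ℝ → Ω → EuclideanSpace ℝ (Fin b)} {mb : ℝ → Ω → EuclideanSpace ℝ (Fin d)}
  {sb : ℝ → Ω → Matrix (Fin d) (Fin d) ℝ} {I : ℝ → Ω → EuclideanSpace ℝ (Fin d)}

/-- The part of a mean-field equation that depends on the observations only. -/
def obsForcing (H : Matrix (Fin m) (Fin d) ℝ) (e : EuclideanSpace ℝ (Fin d))
    (mb : ℝ → Ω → EuclideanSpace ℝ (Fin d)) (sb : ℝ → Ω → Matrix (Fin d) (Fin d) ℝ)
    (I : ℝ → Ω → EuclideanSpace ℝ (Fin d)) (t : ℝ) (ω : Ω) : EuclideanSpace ℝ (Fin d) :=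
  e + (I t ω - ∫ s in (0 : ℝ)..t, clm ((1 / 2 : ℝ) • (sb s ω * Hᵀ * H)) (mb s ω))

namespace IsMeanFieldVersion

lemma continuous_drift (hv : IsMeanFieldVersion P A H σB Z Y bt mb sb I) (ω : Ω) :
    Continuous fun t => halfDrift A H (sb t ω) := (continuous_halfDrift A H).comp (hv.continuous_sb ω)

lemma continuous_clm_drift (hv : IsMeanFieldVersion P A H σB Z Y bt mb sb I) (ω : Ω) :
    Continuous fun t => clm (halfDrift A H (sb t ω)) := continuous_clm.comp (hv.continuous_drift ω)

lemma continuous_correction (hv : IsMeanFieldVersion P A H σB Z Y bt mb sb I) (ω : Ω) :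
    Continuous fun s => clm ((1 / 2 : ℝ) • (sb s ω * Hᵀ * H)) (mb s ω) :=
  continuous_clm_path ((((hv.continuous_sb ω).matrix_mul continuous_const).matrix_mul
    continuous_const).const_smul (1 / 2 : ℝ)) (hv.continuous_mb ω)

lemma continuous_forcing (hv : IsMeanFieldVersion P A H σB Z Y bt mb sb I)
    (e : EuclideanSpace ℝ (Fin d)) (ω : Ω) : Continuous fun t => obsForcing H e mb sb I t ω :=
  continuous_const.add ((hv.continuous_I ω).sub (intervalIntegral.continuous_primitive
    (fun _ _ => (hv.continuous_correction ω).intervalIntegrable _ _) 0))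

/-- Of the correction `(H Y + H m̄) / 2`, the part with `Y` joins the drift, which becomes
`halfDrift`, and the part with `m̄` joins the Itô integral in `obsForcing`. Apart from the
independent noise, all coefficients are now observable. -/
lemma eq_linSol (hv : IsMeanFieldVersion P A H σB Z Y bt mb sb I)
    (hbt : IsNoiseVersion P (Y 0) Bbar bt) : ∀ᵐ ω ∂P, ∀ t : ℝ, 0 ≤ t → Y t.toNNReal ω =
      linSol (fun s => clm (halfDrift A H (sb s ω)))
        (fun s => obsForcing H (∫ ω', Y 0 ω' ∂P) mb sb I s ω + noise P σB (Y 0) bt s ω) t := by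
  filter_upwards [hv.eq] with ω ⟨hYc, h⟩ t ht
  have huc : Continuous fun s : ℝ => Y s.toNNReal ω := hYc.comp continuous_real_toNNReal
  refine LinearFPF.eq_linSol (u := fun s : ℝ => Y s.toNNReal ω) (T := t)
    (n' := fun s => obsForcing H (∫ ω', Y 0 ω' ∂P) mb sb I s ω + noise P σB (Y 0) bt s ω)
    (hv.continuous_clm_drift ω)
    ((hv.continuous_forcing _ ω).add (hbt.continuous_noise ω)) huc (fun _ _ => rfl)
    (fun _ _ => rfl) (fun s hs => ?_) t ⟨ht, le_rfl⟩
  have hc1 := hv.continuous_correction ω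
  have hcs : Continuous fun s => (1 / 2 : ℝ) • (sb s ω * Hᵀ * H) :=
    (((hv.continuous_sb ω).matrix_mul continuous_const).matrix_mul
      continuous_const).const_smul (1 / 2 : ℝ)
  have hc2 : Continuous fun s : ℝ => clm ((1 / 2 : ℝ) • (sb s ω * Hᵀ * H)) (Y s.toNNReal ω) :=
    continuous_clm_path hcs huc
  have hc3 : Continuous fun s : ℝ => clm A (Y s.toNNReal ω) := (clm A).continuous.comp huc
  have e1 : ∫ r in (0 : ℝ)..s, clm (sb r ω * Hᵀ)
      ((1 / 2 : ℝ) • (clm H (Y r.toNNReal ω) + clm H (mb r ω))) =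
      (∫ r in (0 : ℝ)..s, clm ((1 / 2 : ℝ) • (sb r ω * Hᵀ * H)) (Y r.toNNReal ω)) +
        ∫ r in (0 : ℝ)..s, clm ((1 / 2 : ℝ) • (sb r ω * Hᵀ * H)) (mb r ω) := by
    rw [← intervalIntegral.integral_add (hc2.intervalIntegrable _ _) (hc1.intervalIntegrable _ _)]
    refine intervalIntegral.integral_congr fun r _ => ?_
    simp only [clm_smul, clm_mul, map_smul, map_add, smul_add, smul_apply]
  have e2 : ∫ r in (0 : ℝ)..s, clm (halfDrift A H (sb r ω)) (Y r.toNNReal ω) =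
      (∫ r in (0 : ℝ)..s, clm A (Y r.toNNReal ω)) -
        ∫ r in (0 : ℝ)..s, clm ((1 / 2 : ℝ) • (sb r ω * Hᵀ * H)) (Y r.toNNReal ω) := by
    rw [← intervalIntegral.integral_sub (hc3.intervalIntegrable _ _) (hc2.intervalIntegrable _ _)]
    refine intervalIntegral.integral_congr fun r _ => ?_
    simp only [halfDrift, clm_sub, sub_apply]
  beta_reduce
  rw [h s hs.1, e1, e2]
  simp only [obsForcing, noise]
  abel

/-- The processes stopped at time `t` are measurable with respect to the observations up to `t`. -/
lemma stopped_measurable (hv : IsMeanFieldVersion P A H σB Z Y bt mb sb I) (t : ℝ≥0) (s : ℝ) :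
    StronglyMeasurable[nullAug P (obsSigma Z t)] (mb (min s t)) ∧
    StronglyMeasurable[nullAug P (obsSigma Z t)] (sb (min s t)) ∧
    StronglyMeasurable[nullAug P (obsSigma Z t)] (I (min s t)) := by
  have h : nullAug P (obsSigma Z (min s t).toNNReal) ≤ nullAug P (obsSigma Z t) :=
    nullAug_mono (obsSigma_mono (Real.toNNReal_le_iff_le_coe.2 (min_le_right _ _)))
  exact ⟨(hv.measurable_mb _).mono h, (hv.measurable_sb _).mono h, (hv.measurable_I _).mono h⟩

lemma stopped_continuous {F : Type*} [TopologicalSpace F] {f : ℝ → Ω → F}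
    (hf : ∀ ω, Continuous fun t => f t ω) (t : ℝ≥0) (ω : Ω) :
    Continuous fun s => f (min s t) ω :=
  (hf ω).comp (by fun_prop : Continuous fun s : ℝ => min s (t : ℝ))

lemma measurable_stopped_drift (hv : IsMeanFieldVersion P A H σB Z Y bt mb sb I) (t : ℝ≥0) (s : ℝ) :
    StronglyMeasurable[nullAug P (obsSigma Z t)] fun ω => halfDrift A H (sb (min s t) ω) :=
  (continuous_halfDrift A H).comp_stronglyMeasurable (hv.stopped_measurable t s).2.1

lemma measurable_stopped_forcing (hv : IsMeanFieldVersion P A H σB Z Y bt mb sb I)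
    (e : EuclideanSpace ℝ (Fin d)) (t : ℝ≥0) (s : ℝ) :
    StronglyMeasurable[nullAug P (obsSigma Z t)] (obsForcing H e (fun s => mb (min s t))
      (fun s => sb (min s t)) (fun s => I (min s t)) s) := by
  have hc : Continuous fun Q : Matrix (Fin d) (Fin d) ℝ => (1 / 2 : ℝ) • (Q * Hᵀ * H) := by fun_prop
  refine stronglyMeasurable_const.add ((hv.stopped_measurable t s).2.2.sub
    (@stronglyMeasurable_intervalIntegral _ (nullAug P (obsSigma Z t)) _ _ _ _
      (fun ω => stopped_continuous hv.continuous_correction t ω) (fun r => ?_) 0 s))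
  exact @stronglyMeasurable_clm_apply _ (nullAug P (obsSigma Z t)) _ _ _ _
    (hc.comp_stronglyMeasurable (hv.stopped_measurable t r).2.1) (hv.stopped_measurable t r).1

lemma stopped_forcing_eq (e : EuclideanSpace ℝ (Fin d)) {t : ℝ≥0} {s : ℝ}
    (hs : s ∈ Set.Icc (0 : ℝ) t) (ω : Ω) : obsForcing H e (fun s => mb (min s t))
      (fun s => sb (min s t)) (fun s => I (min s t)) s ω = obsForcing H e mb sb I s ω := by
  simp only [obsForcing, min_eq_left hs.2]
  congr 2
  refine intervalIntegral.integral_congr fun r hr => ?_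
  rw [Set.uIcc_of_le hs.1] at hr
  simp only [min_eq_left (hr.2.trans hs.2)]

lemma continuous_stopped_forcing (hv : IsMeanFieldVersion P A H σB Z Y bt mb sb I)
    (e : EuclideanSpace ℝ (Fin d)) (t : ℝ≥0) (ω : Ω) :
    Continuous fun s => obsForcing H e (fun s => mb (min s t))
      (fun s => sb (min s t)) (fun s => I (min s t)) s ω :=
  continuous_const.add ((stopped_continuous hv.continuous_I t ω).sub
    (intervalIntegral.continuous_primitive
      (fun _ _ => (stopped_continuous hv.continuous_correction t ω).intervalIntegrable _ _) 0))

/-- Conditioning at time `t` needs coefficients measurable for a single σ-algebra at all times.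
Stopping them at `t` achieves this, and the solution at `t` does not change. -/
lemma linSol_stopped (hv : IsMeanFieldVersion P A H σB Z Y bt mb sb I) (t : ℝ≥0) (ω : Ω)
    {n n' : ℝ → EuclideanSpace ℝ (Fin d)} (hn : Continuous n) (hn' : Continuous n')
    (h : ∀ s ∈ Set.Icc (0 : ℝ) t, n' s = n s) :
    linSol (fun s => clm (halfDrift A H (sb (min s t) ω))) n' t =
      linSol (fun s => clm (halfDrift A H (sb s ω))) n t :=
  linSol_congr (hv.continuous_clm_drift ω)
    (stopped_continuous hv.continuous_clm_drift t ω) hn hn'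
    (fun s hs => by simp only [min_eq_left hs.2]) h t ⟨t.2, le_rfl⟩

variable (hmod : IsFilteringModel A H σB m₀ S₀ P X Z B W)
  (hcopy : IsIndependentCopy P (X 0) B W (Y 0) Bbar)
  (hbt : IsNoiseVersion P (Y 0) Bbar bt) (hY2 : ∀ t, MemLp (Y t) 2 P)
include hmod hcopy hbt hY2

/-- The noise averages out. The equation is not yet closed: `mb` and `sb` still occur in the drift
and in the forcing. -/
lemma ae_eq_mean (hv : IsMeanFieldVersion P A H σB Z Y bt mb sb I) (t : ℝ≥0) :
    ∀ᵐ ω ∂P, mb t ω = linSol (fun s => clm (halfDrift A H (sb s ω)))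
      (fun s => obsForcing H (∫ ω', Y 0 ω' ∂P) mb sb I s ω) t := by
  set e := ∫ ω', Y 0 ω' ∂P with he
  have hle := obsSigma_le hmod.measurable_Z t
  have h := condExp_linSol (P := P) (nullAug_le (obsSigma Z t)) (nullAug_le _)
    (hmod.indep_nullAug hcopy hbt.measurable_zero t)
    (a := fun s ω => halfDrift A H (sb (min s t) ω))
    (r := obsForcing H e (fun s => mb (min s t)) (fun s => sb (min s t)) (fun s => I (min s t)))
    (fun ω => stopped_continuous hv.continuous_drift t ω) (hv.continuous_stopped_forcing e t)
    (hv.measurable_stopped_drift t) (hv.measurable_stopped_forcing e t)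
    (hbt.isLpProcess_noise (σB := σB)) hbt.measurable_noise (fun s _ => hbt.integral_noise s)
    t.2 (hY2 t) (by
      filter_upwards [hv.eq_linSol hbt] with ω hω
      have h1 := hω t t.2
      rw [Real.toNNReal_coe] at h1
      rw [h1]
      exact (hv.linSol_stopped t ω ((hv.continuous_forcing _ ω).add (hbt.continuous_noise ω))
        ((hv.continuous_stopped_forcing e t ω).add (hbt.continuous_noise ω))
        fun s hs => congrArg (· + noise P σB (Y 0) bt s ω) (stopped_forcing_eq e hs ω)).symm)
  filter_upwards [hv.mean t, h, condExp_nullAug hle (Y t) ((hY2 t).integrable one_le_two)]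
    with ω h1 h2 h3
  rw [h1, ← h3, h2]
  exact hv.linSol_stopped t ω (hv.continuous_forcing _ ω) (hv.continuous_stopped_forcing e t ω)
    fun s hs => stopped_forcing_eq e hs ω

lemma ae_eq_centred (hv : IsMeanFieldVersion P A H σB Z Y bt mb sb I) (t : ℝ≥0) :
    ∀ᵐ ω ∂P, Y t ω - mb t ω = linSol (fun s => clm (halfDrift A H (sb s ω)))
      (fun s => noise P σB (Y 0) bt s ω) t := by
  filter_upwards [hv.ae_eq_mean hmod hcopy hbt hY2 t, hv.eq_linSol hbt] with ω h1 h2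
  have h3 := h2 t t.2
  rw [Real.toNNReal_coe] at h3
  rw [h3, h1, linSol_add (hv.continuous_clm_drift ω) (hv.continuous_forcing _ ω)
    (hbt.continuous_noise ω) t.coe_nonneg, add_sub_cancel_left]

/-- The relation is self-referential, as `sb` enters the drift of the equation whose covariance it
is. Both sides have continuous paths, so one null set serves all times. -/
lemma ae_eq_cov (hv : IsMeanFieldVersion P A H σB Z Y bt mb sb I) {Γ : Matrix (Fin d) (Fin d) ℝ}
    (hΓ : cross P (fun ω => Y 0 ω - ∫ ω', Y 0 ω' ∂P) (fun ω => Y 0 ω - ∫ ω', Y 0 ω' ∂P) = Γ) :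
    ∀ᵐ ω ∂P, ∀ t : ℝ, 0 ≤ t →
      sb t ω = lyapSol (fun s => halfDrift A H (sb s ω)) Γ (σB * σBᵀ) t := by
  refine ae_forall_eq_of_continuous hv.continuous_sb
    (fun ω => continuous_lyapSol (hv.continuous_drift ω) _ _) fun t' ht' => ?_
  lift t' to ℝ≥0 using ht' with t
  have hle := obsSigma_le hmod.measurable_Z t
  set U : Ω → EuclideanSpace ℝ (Fin d) := fun ω => Y t ω - mb t ω with hU
  have hU2 : MemLp U 2 P := (hY2 t).sub ((memLp_congr_ae (hv.mean t)).2 ((hY2 t).condExp one_le_two))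
  have h : ∀ i j, P[fun ω => U ω i * U ω j | nullAug P (obsSigma Z t)] =ᵐ[P]
      fun ω => lyapSol (fun s => halfDrift A H (sb (min s t) ω)) Γ (σB * σBᵀ) t i j := fun i j =>
    condExp_linSol_mul (P := P) (nullAug_le (obsSigma Z t)) (nullAug_le _)
      (hmod.indep_nullAug hcopy hbt.measurable_zero t)
      (a := fun s ω => halfDrift A H (sb (min s t) ω))
      (fun ω => stopped_continuous hv.continuous_drift t ω) (hv.measurable_stopped_drift t)
      (hbt.isLpProcess_noise (σB := σB)) hbt.measurable_noise
      (fun s r hs hsr => by rw [hbt.cross_noise hs hsr, hΓ])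
      t.2 hU2 (by
        filter_upwards [hv.ae_eq_centred hmod hcopy hbt hY2 t] with ω hω
        rw [show U ω = _ from hω]
        exact (hv.linSol_stopped t ω (hbt.continuous_noise ω) (hbt.continuous_noise ω)
          fun s hs => rfl).symm) i j
  have hae : ∀ᵐ ω ∂P, ∀ i j, sb t ω i j =
      lyapSol (fun s => halfDrift A H (sb (min s t) ω)) Γ (σB * σBᵀ) t i j := by
    refine ae_all_iff.2 fun i => ae_all_iff.2 fun j => ?_
    filter_upwards [hv.cov t i j, h i j, condExp_nullAug hle (fun ω => U ω i * U ω j)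
      ((hU2.eval_piLp i).integrable_mul (hU2.eval_piLp j))] with ω h1 h2 h3
    rw [h1, ← h2, h3]
    rfl
  filter_upwards [hae] with ω hω
  rw [← lyapSol_congr (hv.continuous_drift ω) (stopped_continuous hv.continuous_drift t ω) Γ _ t.coe_nonneg
    fun s hs => by rw [min_eq_left hs.2]]
  ext i j
  exact hω i j

/-- Almost every path of `sb` solves the Riccati equation from the deterministic value `Γ`, so
uniqueness makes `sb` deterministic. Its symmetry comes from being a matrix of second moments of the
frozen equation. -/
lemma ae_eq_riccati (hv : IsMeanFieldVersion P A H σB Z Y bt mb sb I)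
    {Γ : Matrix (Fin d) (Fin d) ℝ}
    (hΓ : cross P (fun ω => Y 0 ω - ∫ ω', Y 0 ω' ∂P) (fun ω => Y 0 ω - ∫ ω', Y 0 ω' ∂P) = Γ)
    {S : ℝ → Matrix (Fin d) (Fin d) ℝ} (hS : IsDRESolution A H σB Γ S) :
    ∀ᵐ ω ∂P, ∀ t : ℝ, 0 ≤ t → sb t ω = S t := by
  filter_upwards [hv.ae_eq_cov hmod hcopy hbt hY2 hΓ] with ω hω t ht
  refine (isDRESolution_of_eq_lyapSol (hv.continuous_sb ω) hω fun s hs => ?_).unique hS ht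
  have hac := hv.continuous_drift ω
  have hU := (hbt.isLpProcess_noise (σB := σB)).linSol (continuous_clm.comp hac)
  have hΓ' : ∀ s r, 0 ≤ s → s ≤ r → cross P (noise P σB (Y 0) bt s) (noise P σB (Y 0) bt r) =
      Γ + s • (σB * σBᵀ) := fun s r hs hsr => by rw [hbt.cross_noise hs hsr, hΓ]
  rw [hω s hs, ← cross_linSol_self hac hbt.isLpProcess_noise hΓ' hs]
  exact cross_transpose (hU.memLp hs) (hU.memLp hs)

/-- With a deterministic gain the Itô integral is the one by parts. The two halves of the correction
recombine: `A - S Hᵀ H / 2` applied to the mean, minus the half kept in the forcing, is the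
Kalman–Bucy drift `A - S Hᵀ H`. -/
lemma ae_eq_kalmanSol (hv : IsMeanFieldVersion P A H σB Z Y bt mb sb I)
    {Γ : Matrix (Fin d) (Fin d) ℝ}
    (hΓ : cross P (fun ω => Y 0 ω - ∫ ω', Y 0 ω' ∂P) (fun ω => Y 0 ω - ∫ ω', Y 0 ω' ∂P) = Γ)
    {S : ℝ → Matrix (Fin d) (Fin d) ℝ} (hS : IsDRESolution A H σB Γ S)
    {z : ℝ → Ω → EuclideanSpace ℝ (Fin m)} (hz : ∀ ω, Continuous fun t => z t ω)
    (hzZ : ∀ᵐ ω ∂P, ∀ t : ℝ, z t ω = Z t.toNNReal ω) :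
    ∀ᵐ ω ∂P, ∀ t : ℝ≥0, mb t ω =
      kalmanSol A H σB S (∫ ω', Y 0 ω' ∂P) (fun s => z s ω) t := by
  have hsb := hv.ae_eq_riccati hmod hcopy hbt hY2 hΓ hS
  have hmean : ∀ᵐ ω ∂P, ∀ t : ℝ, 0 ≤ t → mb t ω =
      linSol (fun s => clm (halfDrift A H (sb s ω)))
        (fun s => obsForcing H (∫ ω', Y 0 ω' ∂P) mb sb I s ω) t :=
    ae_forall_eq_of_continuous hv.continuous_mb
      (fun ω => continuous_linSol (hv.continuous_clm_drift ω)
        (hv.continuous_forcing _ ω)) fun t ht => hv.ae_eq_mean hmod hcopy hbt hY2 ⟨t, ht⟩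
  have hito : IsItoIntegral P (fun (t : ℝ≥0) _ => S (max (t : ℝ) 0) * Hᵀ) Z fun t => I t :=
    hv.ito.congr (by
      filter_upwards [hsb] with ω hω t
      rw [hω t t.2, max_eq_left t.coe_nonneg]) (ae_of_all _ fun _ _ => rfl)
  have hdc : Continuous fun s => clm (A - S (max s 0) * Hᵀ * H) :=
    continuous_clm.comp hS.continuous_drift
  filter_upwards [hsb, hmean, hito.ae_eq_byParts (K := fun s => S (max s 0) * Hᵀ) hS.continuous_gain
    hS.continuous_gain_deriv (fun t ht => hS.gain_eq ht) hmod.measurable_Z hz hzZ]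
    with ω hs hm hI t
  refine LinearFPF.eq_linSol (u := fun s => mb s ω) (T := t)
    (n' := fun s => (∫ ω', Y 0 ω' ∂P) + kalmanInt A H σB S (fun r => z r ω) s)
    hdc (continuous_const.add (hS.continuous_kalmanInt (hz ω))) (hv.continuous_mb ω) (fun _ _ => rfl)
    (fun _ _ => rfl) (fun s hst => ?_) t ⟨t.2, le_rfl⟩
  have hIs : I s ω = kalmanInt A H σB S (fun r => z r ω) s := hI ⟨s, hst.1⟩
  have h1 := linSol_eq (hv.continuous_clm_drift ω)
    (hv.continuous_forcing (∫ ω', Y 0 ω' ∂P) ω) hst.1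
  have hmc := hv.continuous_mb ω
  have c1 := hv.continuous_correction ω
  have c2 : Continuous fun r => clm (halfDrift A H (sb r ω)) (mb r ω) :=
    continuous_clm_path (hv.continuous_drift ω) hmc
  have e1 : ∫ r in (0 : ℝ)..s, clm (A - S (max r 0) * Hᵀ * H) (mb r ω) =
      (∫ r in (0 : ℝ)..s, clm (halfDrift A H (sb r ω)) (mb r ω)) -
        ∫ r in (0 : ℝ)..s, clm ((1 / 2 : ℝ) • (sb r ω * Hᵀ * H)) (mb r ω) := by
    rw [← intervalIntegral.integral_sub (c2.intervalIntegrable _ _) (c1.intervalIntegrable _ _)]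
    refine intervalIntegral.integral_congr fun r hr => ?_
    rw [Set.uIcc_of_le hst.1] at hr
    beta_reduce
    rw [← sub_apply, ← clm_sub, hs r hr.1, max_eq_left hr.1, halfDrift, sub_sub, ← add_smul]
    norm_num
  have e2 : ∫ r in (0 : ℝ)..s, clm (halfDrift A H (sb r ω)) (mb r ω) =
      ∫ r in (0 : ℝ)..s, clm (halfDrift A H (sb r ω)) (linSol
        (fun s => clm (halfDrift A H (sb s ω)))
        (fun s => obsForcing H (∫ ω', Y 0 ω' ∂P) mb sb I s ω) r) := by
    refine intervalIntegral.integral_congr fun r hr => ?_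
    rw [Set.uIcc_of_le hst.1] at hr
    beta_reduce
    rw [← hm r hr.1]
  beta_reduce
  rw [e1, e2, hm s hst.1, h1, ← hIs]
  simp only [obsForcing]
  abel

end IsMeanFieldVersion

/-- A mean-field process is the Kalman-Bucy mean plus an independent Gaussian-type fluctuation. -/
theorem IsMeanFieldSolution.ae_eq {π₀ : Measure (EuclideanSpace ℝ (Fin d))}
    (hmod : IsFilteringModel A H σB m₀ S₀ P X Z B W)
    (hcopy : IsIndependentCopy P (X 0) B W (Y 0) Bbar)
    (hY : IsMeanFieldSolution A H σB π₀ P Z Bbar Y)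
    {M : ℝ≥0 → Ω → EuclideanSpace ℝ (Fin d)} {S : ℝ → Matrix (Fin d) (Fin d) ℝ}
    (hM : IsKalmanFilter A H σB (∫ x, x ∂π₀) (covMat π₀) P Z M S)
    (hbt : IsNoiseVersion P (Y 0) Bbar bt) (t : ℝ≥0) :
    (∀ᵐ ω ∂P, Y t ω = M t ω + linSol (fun s => clm (halfDrift A H (S (max s 0))))
      (fun s => noise P σB (Y 0) bt s ω) t) ∧
    M t =ᵐ[P] P[Y t | obsSigma Z t] := by
  obtain ⟨mb, sb, I, hv⟩ := hY.exists_version hmod hbt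
  obtain ⟨z, hzc, -, hzZ⟩ := exists_adapted_version (P := P) (m := obsSigma Z) (f := Z)
    obsSigma_mono (fun t => ⟨Z t, (measurable_obsSigma le_rfl).stronglyMeasurable.mono
      (le_nullAug (obsSigma_le hmod.measurable_Z t)), ae_eq_refl _⟩) hmod.ae_continuous_obs
  have hΓ := cross_centred_eq_covMat hY.law_zero (hY.memLp 0)
  have hE : ∫ ω', Y 0 ω' ∂P = ∫ x, x ∂π₀ := by
    rw [← hY.law_zero.map_eq, integral_map hY.law_zero.aemeasurable]
    exact continuous_id.aestronglyMeasurable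
  have hMm : M t =ᵐ[P] mb t := by
    filter_upwards [hv.ae_eq_kalmanSol hmod hcopy hbt hY.memLp hΓ hM.dre hzc hzZ,
      hM.ae_eq_kalmanSol hmod.measurable_Z hzc hzZ] with ω h1 h2
    rw [h1, h2, hE]
  refine ⟨?_, hMm.trans (hv.mean t)⟩
  · filter_upwards [hMm, hv.ae_eq_centred hmod hcopy hbt hY.memLp t,
      hv.ae_eq_riccati hmod hcopy hbt hY.memLp hΓ hM.dre] with ω h1 h2 h3
    rw [h1, ← sub_eq_iff_eq_add', h2]
    have hdc : Continuous fun s => clm (halfDrift A H (S (max s 0))) :=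
      continuous_clm.comp ((continuous_halfDrift A H).comp hM.dre.continuous_max)
    exact linSol_congr hdc
      (hv.continuous_clm_drift ω) (hbt.continuous_noise ω)
      (hbt.continuous_noise ω) (fun s hs => by rw [h3 s hs.1, max_eq_left hs.1])
      (fun _ _ => rfl) t ⟨t.2, le_rfl⟩

end Identification

/-! ### Conditional laws as translates of the law of the fluctuation -/

section ConditionalLaw

set_option linter.unusedSectionVars false

variable {Ω : Type*} {ℋ : MeasurableSpace Ω} [mΩ : MeasurableSpace Ω] {P : Measure Ω} {d m b : ℕ}
  {A : Matrix (Fin d) (Fin d) ℝ} {H : Matrix (Fin m) (Fin d) ℝ} {σB : Matrix (Fin d) (Fin b) ℝ}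

/-- The conditional law of an observable quantity plus an independent fluctuation. -/
lemma condLaw_ae_eq_map [IsProbabilityMeasure P] {Z : ℝ≥0 → Ω → EuclideanSpace ℝ (Fin m)}
    (hZ : ∀ t, Measurable (Z t)) {t : ℝ≥0} {Y M U : Ω → EuclideanSpace ℝ (Fin d)}
    (hY : Measurable Y) (hYU : ∀ᵐ ω ∂P, Y ω = M ω + U ω) {g : Ω → EuclideanSpace ℝ (Fin d)}
    (hg : StronglyMeasurable[obsSigma Z t] g) (hM : M =ᵐ[P] g) (hℋ : ℋ ≤ mΩ)
    (hU : Measurable[ℋ] U) (hind : Indep (obsSigma Z t) ℋ P) :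
    ∀ᵐ ω ∂P, condLaw P Z t Y ω = (P.map U).map fun u => M ω + u := by
  obtain ⟨h, hh, rfl⟩ := hg.measurable.exists_eq_measurable_comp
  have hp : Measurable (pathUpTo Z t) := measurable_pi_lambda _ fun s : Set.Iic t => hZ s
  have hUm : Measurable U := hU.mono hℋ le_rfl
  set ν := P.map U with hν
  have : IsProbabilityMeasure ν := Measure.isProbabilityMeasure_map hUm.aemeasurable
  have hind' : IndepFun (pathUpTo Z t) U P :=
    (IndepFun_iff_Indep _ _ _).2 (indep_of_indep_of_le_right hind hU.comap_le)
  have hf : Measurable fun q : (Set.Iic t → EuclideanSpace ℝ (Fin m)) × EuclideanSpace ℝ (Fin d) =>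
      h q.1 + q.2 := (hh.comp measurable_fst).add measurable_snd
  -- Candidate for the conditional law: `κ x` is the law of `h x + U`. By independence the joint law
  -- of observation path and `Y` disintegrates along `κ`, and conditional distributions are almost
  -- everywhere unique.
  set κ : Kernel (Set.Iic t → EuclideanSpace ℝ (Fin m)) (EuclideanSpace ℝ (Fin d)) :=
    ((Kernel.id ×ₖ Kernel.const _ ν).map fun q => h q.1 + q.2) with hκ
  have hκm : IsMarkovKernel κ := Kernel.IsMarkovKernel.map _ hf
  have hκx : ∀ x, κ x = ν.map fun u => h x + u := fun x => by
    rw [hκ, Kernel.map_apply _ hf, Kernel.prod_apply, Kernel.id_apply, Kernel.const_apply,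
      Measure.dirac_prod, Measure.map_map hf measurable_prodMk_left]
    rfl
  have hF : Measurable fun q : (Set.Iic t → EuclideanSpace ℝ (Fin m)) × EuclideanSpace ℝ (Fin d) =>
      (q.1, h q.1 + q.2) := measurable_fst.prodMk hf
  have key : P.map (fun ω => (pathUpTo Z t ω, Y ω)) = P.map (pathUpTo Z t) ⊗ₘ κ := by
    have h1 : P.map (fun ω => (pathUpTo Z t ω, Y ω)) =
        ((P.map (pathUpTo Z t)).prod ν).map fun q => (q.1, h q.1 + q.2) := by
      rw [hν, ← (indepFun_iff_map_prod_eq_prod_map_map hp.aemeasurable hUm.aemeasurable).1 hind',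
        Measure.map_map hF (hp.prodMk hUm)]
      refine Measure.map_congr ?_
      filter_upwards [hYU, hM] with ω h1 h2
      simp only [Function.comp_apply, h1, h2]
    rw [h1]
    ext s hs
    rw [Measure.map_apply hF hs, Measure.prod_apply (hF hs), Measure.compProd_apply hs]
    refine lintegral_congr fun x => ?_
    have hx : Measurable fun u => h x + u := measurable_const_add (h x)
    rw [hκx, Measure.map_apply hx (measurable_prodMk_left hs)]
    rfl
  have h2 := ae_of_ae_map hp.aemeasurable
    (condDistrib_ae_eq_of_measure_eq_compProd (μ := P) (pathUpTo Z t) hY.aemeasurable key)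
  filter_upwards [h2, hM] with ω h3 h4
  rw [condLaw, h3, hκx, h4]
  rfl

/-- Continuous paths. -/
abbrev PathSpace (b : ℕ) : Type := {f : ℝ → EuclideanSpace ℝ (Fin b) // Continuous f}

/-- Measurable sets of continuous paths are traces of measurable sets of the product space. Laws can
thus be compared there, although the set of continuous paths itself need not be measurable. -/
lemma PathSpace.measure_ext {μ ν : Measure (PathSpace b)}
    (h : μ.map Subtype.val = ν.map Subtype.val) : μ = ν := by
  ext s hs
  obtain ⟨s', hs', rfl⟩ := hs
  rw [← Measure.map_apply measurable_subtype_coe hs', h, Measure.map_apply measurable_subtype_coe hs']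

/-- The fluctuation of a mean-field process as a functional of its initial value and noise. -/
def fluctuation (A : Matrix (Fin d) (Fin d) ℝ) (H : Matrix (Fin m) (Fin d) ℝ)
    (σB : Matrix (Fin d) (Fin b) ℝ) (S : ℝ → Matrix (Fin d) (Fin d) ℝ)
    (e : EuclideanSpace ℝ (Fin d)) (t : ℝ) (q : EuclideanSpace ℝ (Fin d) × PathSpace b) :
    EuclideanSpace ℝ (Fin d) :=
  linSol (fun s => clm (halfDrift A H (S (max s 0)))) (fun s => (q.1 - e) + clm σB (q.2.1 s)) t

section Fluctuation

variable {S₀ : Matrix (Fin d) (Fin d) ℝ} {S : ℝ → Matrix (Fin d) (Fin d) ℝ}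

lemma IsDRESolution.continuous_clm_halfDrift (hS : IsDRESolution A H σB S₀ S) :
    Continuous fun s => clm (halfDrift A H (S (max s 0))) :=
  continuous_clm.comp ((continuous_halfDrift A H).comp hS.continuous_max)

lemma continuous_fluctuation_noise (e : EuclideanSpace ℝ (Fin d))
    (q : EuclideanSpace ℝ (Fin d) × PathSpace b) :
    Continuous fun s => (q.1 - e) + clm σB (q.2.1 s) :=
  continuous_const.add ((clm σB).continuous.comp q.2.2)

lemma IsDRESolution.continuous_fluctuation (hS : IsDRESolution A H σB S₀ S)
    (e : EuclideanSpace ℝ (Fin d)) (q : EuclideanSpace ℝ (Fin d) × PathSpace b) :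
    Continuous fun t => fluctuation A H σB S e t q :=
  continuous_linSol hS.continuous_clm_halfDrift (continuous_fluctuation_noise e q)

lemma IsDRESolution.stronglyMeasurable_fluctuation (hS : IsDRESolution A H σB S₀ S)
    (e : EuclideanSpace ℝ (Fin d)) (t : ℝ) :
    StronglyMeasurable (fluctuation A H σB S e t) :=
  stronglyMeasurable_linSol (fun _ => hS.continuous_clm_halfDrift)
    (fun q => continuous_fluctuation_noise e q) (fun _ => stronglyMeasurable_const)
    (fun s => by
      have h1 : Measurable fun q : EuclideanSpace ℝ (Fin d) × PathSpace b => q.2.1 s :=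
        (measurable_pi_apply s).comp (measurable_subtype_coe.comp measurable_snd)
      exact ((measurable_fst.sub_const e).add
        ((clm σB).continuous.measurable.comp h1)).stronglyMeasurable) t

lemma IsDRESolution.fluctuation_eq (hS : IsDRESolution A H σB S₀ S)
    (e : EuclideanSpace ℝ (Fin d)) (q : EuclideanSpace ℝ (Fin d) × PathSpace b) {t : ℝ}
    (ht : 0 ≤ t) : fluctuation A H σB S e t q = (q.1 - e) + clm σB (q.2.1 t) +
      ∫ s in (0 : ℝ)..t, clm (halfDrift A H (S (max s 0))) (fluctuation A H σB S e s q) :=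
  linSol_eq hS.continuous_clm_halfDrift (continuous_fluctuation_noise e q) ht

end Fluctuation

namespace IsNoiseVersion

variable {Y₀ : Ω → EuclideanSpace ℝ (Fin d)} {B : ℝ≥0 → Ω → EuclideanSpace ℝ (Fin b)}
  {bt : ℝ → Ω → EuclideanSpace ℝ (Fin b)}

/-- The continuous path of the noise. -/
def path (h : IsNoiseVersion P Y₀ B bt) (ω : Ω) : PathSpace b := ⟨fun t => bt t ω, h.continuous ω⟩

lemma measurable_path (h : IsNoiseVersion P Y₀ B bt) : Measurable h.path :=
  Measurable.subtype_mk (measurable_pi_lambda _ fun t =>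
    ((h.measurable t).mono (nullAug_le _)).measurable)

lemma ae_path_eq (h : IsNoiseVersion P Y₀ B bt) :
    (fun ω (t : ℝ) => bt t ω) =ᵐ[P] fun ω (t : ℝ) => B t.toNNReal ω := by
  filter_upwards [h.eq] with ω hω
  exact funext hω

lemma measurable_reindex {k : ℕ} :
    Measurable fun (f : ℝ≥0 → EuclideanSpace ℝ (Fin k)) (t : ℝ) => f t.toNNReal :=
  measurable_pi_lambda _ fun t => measurable_pi_apply t.toNNReal

lemma indepFun_path (h : IsNoiseVersion P Y₀ B bt) : IndepFun Y₀ h.path P := by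
  have h1 : IndepFun Y₀ (fun ω (t : ℝ) => bt t ω) P :=
    (h.indep.comp (φ := id) measurable_id measurable_reindex).congr (ae_eq_refl _) h.ae_path_eq.symm
  rw [IndepFun_iff_Indep] at h1 ⊢
  refine indep_of_indep_of_le_right h1 (le_of_eq ?_)
  exact MeasurableSpace.comap_comp

/-- The two mean-field processes may have different noises, but all Wiener paths have one law; hence
their conditional laws can be realized with a common noise path. -/
lemma map_path_eq [IsProbabilityMeasure P] {Ω' : Type*} [MeasurableSpace Ω'] {P' : Measure Ω'}
    [IsProbabilityMeasure P'] {Y₀' : Ω' → EuclideanSpace ℝ (Fin d)}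
    {B' : ℝ≥0 → Ω' → EuclideanSpace ℝ (Fin b)} {bt' : ℝ → Ω' → EuclideanSpace ℝ (Fin b)}
    (h : IsNoiseVersion P Y₀ B bt) (h' : IsNoiseVersion P' Y₀' B' bt') :
    P.map h.path = P'.map h'.path := by
  refine PathSpace.measure_ext ?_
  rw [Measure.map_map measurable_subtype_coe h.measurable_path,
    Measure.map_map measurable_subtype_coe h'.measurable_path]
  have e1 := Measure.map_congr (mβ := MeasurableSpace.pi) h.ae_path_eq
  have e2 := Measure.map_congr (mβ := MeasurableSpace.pi) h'.ae_path_eq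
  have e3 := congrArg (Measure.map fun (f : ℝ≥0 → EuclideanSpace ℝ (Fin b)) (t : ℝ) => f t.toNNReal)
    (h.wiener.map_path_eq h'.wiener)
  rw [Measure.map_map measurable_reindex (measurable_pi_lambda _ h.wiener.measurable),
    Measure.map_map measurable_reindex (measurable_pi_lambda _ h'.wiener.measurable)] at e3
  exact e1.trans (e3.trans e2.symm)

/-- The law of the fluctuation of a mean-field process. -/
lemma map_linSol_noise [IsProbabilityMeasure P] (h : IsNoiseVersion P Y₀ B bt)
    {S₀ : Matrix (Fin d) (Fin d) ℝ} {S : ℝ → Matrix (Fin d) (Fin d) ℝ}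
    (hS : IsDRESolution A H σB S₀ S) (t : ℝ) :
    P.map (fun ω => linSol (fun s => clm (halfDrift A H (S (max s 0))))
      (fun s => noise P σB Y₀ bt s ω) t) =
      ((P.map Y₀).prod (P.map h.path)).map (fluctuation A H σB S (∫ ω, Y₀ ω ∂P) t) := by
  rw [← (indepFun_iff_map_prod_eq_prod_map_map h.measurable_zero.aemeasurable
    h.measurable_path.aemeasurable).1 h.indepFun_path,
    Measure.map_map (hS.stronglyMeasurable_fluctuation _ t).measurable
      (h.measurable_zero.prodMk h.measurable_path)]
  rfl

/-- The covariance of the fluctuation is the Riccati solution. This is the origin of `√tr Σ_s` in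
the final estimate. -/
lemma eLpNorm_linSol_noise [IsProbabilityMeasure P] (h : IsNoiseVersion P Y₀ B bt)
    {S₀ : Matrix (Fin d) (Fin d) ℝ} {S : ℝ → Matrix (Fin d) (Fin d) ℝ}
    (hS : IsDRESolution A H σB S₀ S)
    (hΓ : cross P (fun ω => Y₀ ω - ∫ ω', Y₀ ω' ∂P) (fun ω => Y₀ ω - ∫ ω', Y₀ ω' ∂P) = S₀)
    {t : ℝ} (ht : 0 ≤ t) :
    eLpNorm (fun ω => linSol (fun s => clm (halfDrift A H (S (max s 0))))
      (fun s => noise P σB Y₀ bt s ω) t) 2 P = ENNReal.ofReal √((S t).trace) := by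
  have hac : Continuous fun s => halfDrift A H (S (max s 0)) :=
    (continuous_halfDrift A H).comp hS.continuous_max
  have hn := h.isLpProcess_noise (σB := σB)
  have hc : MemLp (fun ω => Y₀ ω - ∫ ω', Y₀ ω' ∂P) 2 P := h.memLp.sub (memLp_const _)
  have hT : S₀ᵀ = S₀ := by rw [← hΓ, cross_transpose hc hc]
  have hΓ' : ∀ s r, 0 ≤ s → s ≤ r → cross P (noise P σB Y₀ bt s) (noise P σB Y₀ bt r) =
      S₀ + s • (σB * σBᵀ) := fun s r hs hsr => by rw [h.cross_noise hs hsr, hΓ]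
  rw [eLpNorm_two_eq_sqrt_trace ((hn.linSol hS.continuous_clm_halfDrift).memLp ht),
    cross_linSol_self hac hn hΓ' ht, hS.lyapSol_eq hT ht]

end IsNoiseVersion

end ConditionalLaw

/-! ### Synchronous coupling of two fluctuations -/

section Coupling

set_option linter.unusedSectionVars false

variable {Ω : Type*} [mΩ : MeasurableSpace Ω] {P : Measure Ω} {d m b : ℕ}
  {A : Matrix (Fin d) (Fin d) ℝ} {H : Matrix (Fin m) (Fin d) ℝ} {σB : Matrix (Fin d) (Fin b) ℝ}

/-- Fluctuations start from centred values; centring is an orthogonal projection in `L²`, so it does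
not increase the initial distance. -/
lemma eLpNorm_sub_integral_le [IsProbabilityMeasure P] {v : Ω → EuclideanSpace ℝ (Fin d)}
    (hv : MemLp v 2 P) : eLpNorm (fun ω => v ω - ∫ ω', v ω' ∂P) 2 P ≤ eLpNorm v 2 P := by
  set e := ∫ ω', v ω' ∂P with he
  have hc : MemLp (fun ω => v ω - e) 2 P := hv.sub (memLp_const _)
  rw [eLpNorm_two_eq_ofReal hc, eLpNorm_two_eq_ofReal hv]
  refine ENNReal.ofReal_le_ofReal (Real.sqrt_le_sqrt ?_)
  have hi : Integrable (fun ω => ‖v ω‖ ^ 2) P := hv.integrable_norm_pow two_ne_zero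
  have hi2 : Integrable (fun ω => 2 * inner ℝ e (v ω)) P :=
    ((hv.integrable one_le_two).const_inner e).const_mul 2
  have h1 : ∀ ω, ‖v ω - e‖ ^ 2 = ‖v ω‖ ^ 2 - 2 * inner ℝ e (v ω) + ‖e‖ ^ 2 := fun ω => by
    rw [norm_sub_sq_real, real_inner_comm]
  have h2 : ∫ ω, 2 * inner ℝ e (v ω) ∂P = 2 * ‖e‖ ^ 2 := by
    rw [integral_const_mul, integral_inner (hv.integrable one_le_two), ← he,
      real_inner_self_eq_norm_sq]
  have hi3 : Integrable (fun ω => ‖v ω‖ ^ 2 - 2 * inner ℝ e (v ω)) P := hi.sub hi2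
  simp only [h1]
  rw [integral_add hi3 (integrable_const _), integral_sub hi hi2, h2, integral_const]
  simp only [probReal_univ, one_smul]
  nlinarith [sq_nonneg ‖e‖]

/-- For the half drift the algebraic Riccati equation is a Lyapunov equation with no slack, whence
the contraction rate `β`. -/
lemma neg_halfDrift_lyapunov {Q : Matrix (Fin d) (Fin d) ℝ} (hQ : IsARESolution A H σB Q) :
    (-(halfDrift A H Q * Q + Q * (halfDrift A H Q)ᵀ) - σB * σBᵀ).PosSemidef := by
  have h := ricc_eq_halfDrift (A := A) (H := H) (σB := σB) (posDef_real_iff.1 hQ.1).1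
  rw [hQ.2] at h
  have : -(halfDrift A H Q * Q + Q * (halfDrift A H Q)ᵀ) - σB * σBᵀ = 0 := by
    rw [← neg_add', ← h, neg_zero]
  rw [this]
  exact Matrix.PosSemidef.zero

lemma norm_half_smul_mul_le (D : Matrix (Fin d) (Fin d) ℝ) (H : Matrix (Fin m) (Fin d) ℝ) :
    ‖(1 / 2 : ℝ) • (D * Hᵀ * H)‖ ≤ 1 / 2 * (‖D‖ * ‖Hᵀ * H‖) := by
  rw [norm_smul, Matrix.mul_assoc]
  simp only [one_div, norm_inv, Real.norm_ofNat]
  gcongr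
  exact Matrix.l2_opNorm_mul _ _

variable {S S' : ℝ → Matrix (Fin d) (Fin d) ℝ} {S₀ S₀' : Matrix (Fin d) (Fin d) ℝ}

/-- The equation of the difference of two fluctuations with common noise. -/
lemma fluctuation_sub_eq (hS : IsDRESolution A H σB S₀ S) (hS' : IsDRESolution A H σB S₀' S')
    (e e' x x' : EuclideanSpace ℝ (Fin d)) (f : PathSpace b) {t : ℝ} (ht : 0 ≤ t) :
    fluctuation A H σB S' e' t (x', f) - fluctuation A H σB S e t (x, f) =
      ((x' - x) - (e' - e)) + ∫ s in (0 : ℝ)..t, (clm (halfDrift A H (S' (max s 0)))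
        (fluctuation A H σB S' e' s (x', f) - fluctuation A H σB S e s (x, f)) +
        clm (halfDrift A H (S' (max s 0)) - halfDrift A H (S (max s 0)))
          (fluctuation A H σB S e s (x, f))) := by
  have c1 : Continuous fun s => clm (halfDrift A H (S' (max s 0)))
      (fluctuation A H σB S' e' s (x', f)) :=
    hS'.continuous_clm_halfDrift.clm_apply (hS'.continuous_fluctuation e' (x', f))
  have c2 : Continuous fun s => clm (halfDrift A H (S (max s 0)))
      (fluctuation A H σB S e s (x, f)) :=
    hS.continuous_clm_halfDrift.clm_apply (hS.continuous_fluctuation e (x, f))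
  have hint : ∫ s in (0 : ℝ)..t, (clm (halfDrift A H (S' (max s 0)))
        (fluctuation A H σB S' e' s (x', f) - fluctuation A H σB S e s (x, f)) +
        clm (halfDrift A H (S' (max s 0)) - halfDrift A H (S (max s 0)))
          (fluctuation A H σB S e s (x, f))) =
      (∫ s in (0 : ℝ)..t, clm (halfDrift A H (S' (max s 0)))
        (fluctuation A H σB S' e' s (x', f))) -
      ∫ s in (0 : ℝ)..t, clm (halfDrift A H (S (max s 0))) (fluctuation A H σB S e s (x, f)) := by
    rw [← intervalIntegral.integral_sub (c1.intervalIntegrable _ _) (c2.intervalIntegrable _ _)]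
    refine intervalIntegral.integral_congr fun s _ => ?_
    simp only [map_sub, clm_sub, sub_apply]
    abel
  rw [hint, hS.fluctuation_eq e _ ht, hS'.fluctuation_eq e' _ ht]
  abel

/-- Two fluctuations driven by the same noise contract. -/
theorem eLpNorm_fluctuation_sub_le [NeZero d] {Q : Matrix (Fin d) (Fin d) ℝ}
    (hσB : (σB * σBᵀ).PosDef) (hQ : IsARESolution A H σB Q)
    (hS : IsDRESolution A H σB S₀ S) (hS' : IsDRESolution A H σB S₀' S')
    {lam M₁ : ℝ} (hlam : rateβ σB Q ≤ lam) (hM₁ : 0 < M₁)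
    (hd : ∀ t : ℝ, 0 ≤ t → ‖S t - Q‖ ≤ M₁ * Real.exp (-2 * lam * t))
    (hd' : ∀ t : ℝ, 0 ≤ t → ‖S' t - Q‖ ≤ M₁ * Real.exp (-2 * lam * t))
    {γ : Measure (EuclideanSpace ℝ (Fin d) × EuclideanSpace ℝ (Fin d))} [IsProbabilityMeasure γ]
    {ν : Measure (PathSpace b)} [IsProbabilityMeasure ν]
    (hγ : MemLp (fun q : EuclideanSpace ℝ (Fin d) × EuclideanSpace ℝ (Fin d) => q.1) 2 γ)
    (hγ' : MemLp (fun q : EuclideanSpace ℝ (Fin d) × EuclideanSpace ℝ (Fin d) => q.2) 2 γ)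
    (hU : ∀ s : ℝ, 0 ≤ s → eLpNorm (fun q : (EuclideanSpace ℝ (Fin d) × EuclideanSpace ℝ (Fin d)) ×
      PathSpace b => fluctuation A H σB S (∫ q, q.1 ∂γ) s (q.1.1, q.2)) 2 (γ.prod ν) ≤
        ENNReal.ofReal √((S s).trace)) {t : ℝ} (ht : 0 ≤ t) :
    eLpNorm (fun q : (EuclideanSpace ℝ (Fin d) × EuclideanSpace ℝ (Fin d)) × PathSpace b =>
      fluctuation A H σB S' (∫ q, q.2 ∂γ) t (q.1.2, q.2) -
        fluctuation A H σB S (∫ q, q.1 ∂γ) t (q.1.1, q.2)) 2 (γ.prod ν) ≤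
      ENNReal.ofReal (Real.exp (-rateβ σB Q * t)) * (ENNReal.ofReal (constα H σB Q M₁) *
        (eLpNorm (fun q : EuclideanSpace ℝ (Fin d) × EuclideanSpace ℝ (Fin d) => q.2 - q.1) 2 γ +
          ENNReal.ofReal (M₁ * ‖Hᵀ * H‖ * ∫ s in (0 : ℝ)..t, √((S s).trace)))) := by
  set β := rateβ σB Q with hβ
  have hβ0 : 0 < β := rateβ_pos hσB hQ.1
  have hlam0 : 0 < lam := hβ0.trans_le hlam
  set e := ∫ q, q.1 ∂γ with he
  set e' := ∫ q, q.2 ∂γ with he'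
  set h2 := ‖Hᵀ * H‖ with hh2
  have hh0 : 0 ≤ h2 := norm_nonneg _
  have hm1 : Measurable fun q : (EuclideanSpace ℝ (Fin d) × EuclideanSpace ℝ (Fin d)) ×
      PathSpace b => (q.1.1, q.2) := (measurable_fst.comp measurable_fst).prodMk measurable_snd
  have hm2 : Measurable fun q : (EuclideanSpace ℝ (Fin d) × EuclideanSpace ℝ (Fin d)) ×
      PathSpace b => (q.1.2, q.2) := (measurable_snd.comp measurable_fst).prodMk measurable_snd
  set U : ℝ → (EuclideanSpace ℝ (Fin d) × EuclideanSpace ℝ (Fin d)) × PathSpace b →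
    EuclideanSpace ℝ (Fin d) := fun s q => fluctuation A H σB S e s (q.1.1, q.2) with hUdef
  set V : ℝ → (EuclideanSpace ℝ (Fin d) × EuclideanSpace ℝ (Fin d)) × PathSpace b →
    EuclideanSpace ℝ (Fin d) := fun s q => fluctuation A H σB S' e' s (q.1.2, q.2) with hVdef
  have hUm : ∀ s, StronglyMeasurable (U s) := fun s =>
    (hS.stronglyMeasurable_fluctuation e s).comp_measurable hm1
  have hVm : ∀ s, StronglyMeasurable (V s) := fun s =>
    (hS'.stronglyMeasurable_fluctuation e' s).comp_measurable hm2
  have hUc : ∀ q, Continuous fun s => U s q := fun q => hS.continuous_fluctuation e _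
  have hVc : ∀ q, Continuous fun s => V s q := fun q => hS'.continuous_fluctuation e' _
  set F₀ := halfDrift A H Q with hF₀
  set p : ℝ → Matrix (Fin d) (Fin d) ℝ := fun s => (1 / 2 : ℝ) • ((Q - S' (max s 0)) * Hᵀ * H) with hp
  have hFp : ∀ s, halfDrift A H (S' (max s 0)) = F₀ + p s := fun s => by
    simp only [hF₀, hp, halfDrift, Matrix.sub_mul, smul_sub]; abel
  have hpc : Continuous p := by
    have := hS'.continuous_max
    have h : Continuous fun s => Q - S' (max s 0) := continuous_const.sub this
    exact ((h.matrix_mul continuous_const).matrix_mul continuous_const).const_smul (1 / 2 : ℝ)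
  have hpb : ∀ s ∈ Set.Icc 0 t, ‖p s‖ ≤ 1 / 2 * (M₁ * h2) * Real.exp (-2 * lam * s) := fun s hs => by
    refine (norm_half_smul_mul_le _ _).trans ?_
    rw [norm_sub_rev, max_eq_left hs.1]
    have := mul_le_mul_of_nonneg_right (hd' s hs.1) hh0
    linarith
  set D : ℝ → Matrix (Fin d) (Fin d) ℝ := fun s =>
    halfDrift A H (S' (max s 0)) - halfDrift A H (S (max s 0)) with hD
  have hDc : Continuous D := ((continuous_halfDrift A H).comp hS'.continuous_max).sub
    ((continuous_halfDrift A H).comp hS.continuous_max)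
  -- The factor `1 / 2` of the half drift offsets the factor `2` of the triangle inequality through
  -- `Q`.
  have hDb : ∀ s, 0 ≤ s → ‖D s‖ ≤ M₁ * h2 * Real.exp (-2 * lam * s) := fun s hs => by
    have e1 : D s = (1 / 2 : ℝ) • ((S s - S' s) * Hᵀ * H) := by
      simp only [hD, halfDrift, max_eq_left hs, Matrix.sub_mul, smul_sub]; abel
    rw [e1]
    refine (norm_half_smul_mul_le _ _).trans ?_
    have e2 : ‖S s - S' s‖ ≤ 2 * (M₁ * Real.exp (-2 * lam * s)) := by
      have := norm_sub_le (S s - Q) (S' s - Q)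
      rw [sub_sub_sub_cancel_right] at this
      linarith [hd s hs, hd' s hs]
    have := mul_le_mul_of_nonneg_right e2 hh0
    linarith
  have hU' : ∀ s ∈ Set.Icc 0 t, eLpNorm (U s) 2 (γ.prod ν) ≤
      ENNReal.ofReal √((S (max s 0)).trace) := fun s hs => by
    rw [max_eq_left hs.1]; exact hU s hs.1
  have htc : Continuous fun s => √((S (max s 0)).trace) :=
    Real.continuous_sqrt.comp hS.continuous_max.matrix_trace
  have hδ : ∀ q, ∀ s, 0 ≤ s → V s q - U s q = ((q.1.2 - q.1.1) - (e' - e)) +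
      ∫ r in (0 : ℝ)..s, (clm (F₀ + p r) (V r q - U r q) + clm (D r) (U r q)) := fun q s hs => by
    have := fluctuation_sub_eq hS hS' e e' q.1.1 q.1.2 q.2 hs
    simp only [hFp] at this
    refine this.trans ?_
    simp only [hUdef, hVdef, hD, hFp]
  have hδ0 : ∀ q, V 0 q - U 0 q = (q.1.2 - q.1.1) - (e' - e) := fun q => by
    simpa using hδ q 0 le_rfl
  have key := eLpNorm_le_of_stable (P := γ.prod ν) (F₀ := F₀) (p := p)
    (u := fun s q => V s q - U s q)
    (g := fun s q => clm (D s) (U s q)) (c := 1 / 2 * (M₁ * h2)) (lam := lam) hσB hQ.1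
    (neg_halfDrift_lyapunov hQ) (by positivity) hlam0 ht hpc hpb
    (fun q => (hVc q).sub (hUc q)) (fun s => (hVm s).sub (hUm s))
    (fun q => continuous_clm_path hDc (hUc q))
    (fun s => (clm _).continuous.comp_stronglyMeasurable (hUm s))
    (ae_of_all _ fun q s hs => by rw [hδ q s hs.1, hδ0])
    (φ := fun s => M₁ * h2 * Real.exp (-2 * lam * s) * √((S (max s 0)).trace))
    ((by fun_prop : Continuous fun s : ℝ => M₁ * h2 * Real.exp (-2 * lam * s)).mul htc)
    (fun s _ => by positivity)
    (fun s hs => eLpNorm_clm_le (P := γ.prod ν) _ _ (hDb s hs.1) (hU' s hs))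
  refine key.trans ?_
  rw [← hβ]
  -- The estimate gives half the perturbation and the rate `lam ≥ β` in the exponent; `constα` gives
  -- up both gains.
  have hα : Real.exp (√(condNum Q) * (1 / 2 * (M₁ * h2)) / (2 * lam)) * √(condNum Q) ≤
      constα H σB Q M₁ := by
    rw [constα, ← hβ]
    refine mul_le_mul_of_nonneg_right (Real.exp_le_exp.2 ?_) (Real.sqrt_nonneg _)
    have hx : 0 ≤ √(condNum Q) * M₁ * h2 := by positivity
    calc √(condNum Q) * (1 / 2 * (M₁ * h2)) / (2 * lam)
        ≤ √(condNum Q) * M₁ * h2 / (2 * lam) := by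
          have h : √(condNum Q) * (1 / 2 * (M₁ * h2)) = 1 / 2 * (√(condNum Q) * M₁ * h2) := by ring
          exact div_le_div_of_nonneg_right (by rw [h]; linarith) (by positivity)
      _ ≤ √(condNum Q) * M₁ * h2 / (2 * β) := by gcongr
  have h0 : eLpNorm (fun q => V 0 q - U 0 q) 2 (γ.prod ν) ≤
      eLpNorm (fun q : EuclideanSpace ℝ (Fin d) × EuclideanSpace ℝ (Fin d) => q.2 - q.1) 2 γ := by
    have hv : MemLp (fun q : EuclideanSpace ℝ (Fin d) × EuclideanSpace ℝ (Fin d) => q.2 - q.1) 2 γ :=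
      hγ'.sub hγ
    have h1 := eLpNorm_sub_integral_le hv
    rw [integral_sub (hγ'.integrable one_le_two) (hγ.integrable one_le_two)] at h1
    refine le_trans (le_of_eq ?_) h1
    simp only [hδ0]
    exact eLpNorm_comp_measurePreserving (μ := γ.prod ν) (ν := γ)
      (g := fun q : EuclideanSpace ℝ (Fin d) × EuclideanSpace ℝ (Fin d) => q.2 - q.1 - (e' - e))
      (by fun_prop) measurePreserving_fst
  -- Since `β ≤ lam`, the weight `exp (β s)` is absorbed by `exp (-2 lam s)`; the surplus decay is
  -- given up.
  have hI : ∫ s in (0 : ℝ)..t, Real.exp (β * s) *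
      (M₁ * h2 * Real.exp (-2 * lam * s) * √((S (max s 0)).trace)) ≤
      M₁ * h2 * ∫ s in (0 : ℝ)..t, √((S s).trace) := by
    have e1 : ∫ s in (0 : ℝ)..t, √((S s).trace) = ∫ s in (0 : ℝ)..t, √((S (max s 0)).trace) := by
      refine intervalIntegral.integral_congr fun s hs => ?_
      rw [Set.uIcc_of_le ht] at hs
      simp only [max_eq_left hs.1]
    rw [e1, ← intervalIntegral.integral_const_mul]
    refine intervalIntegral.integral_mono_on ht (Continuous.intervalIntegrable ?_ _ _)
      (Continuous.intervalIntegrable (continuous_const.mul htc) _ _) fun s hs => ?_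
    · exact (by fun_prop : Continuous fun s : ℝ => Real.exp (β * s)).mul
        ((by fun_prop : Continuous fun s : ℝ => M₁ * h2 * Real.exp (-2 * lam * s)).mul htc)
    · have e2 : Real.exp (β * s) * Real.exp (-2 * lam * s) ≤ 1 := by
        rw [← Real.exp_add]
        exact Real.exp_le_one_iff.2 (by nlinarith [hs.1])
      calc _ = Real.exp (β * s) * Real.exp (-2 * lam * s) * (M₁ * h2 * √((S (max s 0)).trace)) := by
            ring
        _ ≤ _ := mul_le_of_le_one_left (by positivity) e2
  gcongr

end Coupling

/-! ### Couplings and the Wasserstein distance -/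

section Wasserstein

lemma lintegral_enorm_sq_rpow {α F : Type*} [MeasurableSpace α] [NormedAddCommGroup F]
    (μ : Measure α) (f : α → F) :
    (∫⁻ x, ‖f x‖ₑ ^ 2 ∂μ) ^ (1 / 2 : ℝ) = eLpNorm f 2 μ := by
  rw [eLpNorm_eq_lintegral_rpow_enorm_toReal two_ne_zero ENNReal.ofNat_ne_top]
  norm_num

/-- A bound that holds for all couplings holds for the Wasserstein distance. -/
lemma le_of_forall_coupling {E : Type*} [MeasurableSpace E] [EDist E] {μ ν : Measure E}
    [IsProbabilityMeasure μ] [IsProbabilityMeasure ν] {L : ℝ≥0∞} {Φ : ℝ≥0∞ → ℝ≥0∞}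
    (hΦ : Continuous Φ)
    (h : ∀ γ : Measure (E × E), γ.map Prod.fst = μ → γ.map Prod.snd = ν →
      L ≤ Φ ((∫⁻ p, edist p.1 p.2 ^ 2 ∂γ) ^ (1 / 2 : ℝ))) : L ≤ Φ (W2 μ ν) := by
  set s : Set ℝ≥0∞ := {x | ∃ γ : Measure (E × E), γ.map Prod.fst = μ ∧ γ.map Prod.snd = ν ∧
    ∫⁻ p, edist p.1 p.2 ^ 2 ∂γ = x} with hs
  have hW : W2 μ ν = (sInf s) ^ (1 / 2 : ℝ) := by
    rw [W2]
    congr 1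
    refine le_antisymm (le_sInf ?_) (le_iInf fun γ => le_iInf fun h1 => le_iInf fun h2 =>
      sInf_le ⟨γ, h1, h2, rfl⟩)
    rintro _ ⟨γ, h1, h2, rfl⟩
    exact iInf_le_of_le γ (iInf_le_of_le h1 (iInf_le_of_le h2 le_rfl))
  have hne : s.Nonempty := ⟨_, μ.prod ν, by simp, by simp, rfl⟩
  have hcl : IsClosed {x : ℝ≥0∞ | L ≤ Φ (x ^ (1 / 2 : ℝ))} :=
    isClosed_le continuous_const (hΦ.comp (ENNReal.continuous_rpow_const))
  have hsub : s ⊆ {x : ℝ≥0∞ | L ≤ Φ (x ^ (1 / 2 : ℝ))} := by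
    rintro _ ⟨γ, h1, h2, rfl⟩
    exact h γ h1 h2
  rw [hW]
  -- No optimal coupling is needed: the infimum lies in the closure of the set of costs, and `Φ` is
  -- continuous.
  exact hcl.closure_subset_iff.2 hsub (csInf_mem_closure hne (OrderBot.bddBelow s))

/-- Pushing one measure `ρ` forward by the pair of maps is a coupling of the two translated laws. -/
lemma W2_map_add_le {T : Type*} [MeasurableSpace T] {d : ℕ} {ρ : Measure T} [IsProbabilityMeasure ρ]
    {U V : T → EuclideanSpace ℝ (Fin d)} (hU : Measurable U) (hV : Measurable V)
    (a c : EuclideanSpace ℝ (Fin d)) :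
    W2 ((ρ.map U).map fun u => a + u) ((ρ.map V).map fun u => c + u) ≤
      ‖c - a‖ₑ + eLpNorm (fun q => V q - U q) 2 ρ := by
  have hUa : Measurable fun q => a + U q := measurable_const.add hU
  have hVc : Measurable fun q => c + V q := measurable_const.add hV
  have hp := hUa.prodMk hVc
  have h1 : W2 ((ρ.map U).map fun u => a + u) ((ρ.map V).map fun u => c + u) ≤
      (∫⁻ p, edist p.1 p.2 ^ 2 ∂(ρ.map fun q => (a + U q, c + V q))) ^ (1 / 2 : ℝ) := by
    refine ENNReal.rpow_le_rpow ?_ (by norm_num)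
    refine iInf_le_of_le _ (iInf_le_of_le ?_ (iInf_le_of_le ?_ le_rfl))
    · rw [Measure.map_map measurable_fst hp, Measure.map_map (measurable_const_add a) hU]
      rfl
    · rw [Measure.map_map measurable_snd hp, Measure.map_map (measurable_const_add c) hV]
      rfl
  refine h1.trans ?_
  have h2 : ∀ q, edist (a + U q) (c + V q) = ‖(c - a) + (V q - U q)‖ₑ := fun q => by
    rw [edist_comm, edist_eq_enorm_sub]
    congr 1
    abel
  rw [lintegral_map (measurable_edist.pow_const 2) hp]
  simp only [h2]
  rw [lintegral_enorm_sq_rpow]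
  refine (eLpNorm_add_le (f := fun _ => c - a) aestronglyMeasurable_const
    (hV.sub hU).aestronglyMeasurable one_le_two).trans (add_le_add_left (le_of_eq ?_) _)
  rw [eLpNorm_const _ two_ne_zero (IsProbabilityMeasure.ne_zero ρ)]
  simp

lemma W2_eq_zero_of_subsingleton {E : Type*} [MeasurableSpace E] [PseudoEMetricSpace E]
    [Subsingleton E] (μ ν : Measure E) [IsProbabilityMeasure μ] [IsProbabilityMeasure ν] :
    W2 μ ν = 0 := by
  have h : ∀ p : E × E, edist p.1 p.2 = 0 := fun p => by rw [Subsingleton.elim p.1 p.2, edist_self]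
  have h0 : W2 μ ν ≤ (∫⁻ p, edist p.1 p.2 ^ 2 ∂(μ.prod ν)) ^ (1 / 2 : ℝ) :=
    ENNReal.rpow_le_rpow (iInf_le_of_le _ (iInf_le_of_le (by simp) (iInf_le_of_le (by simp) le_rfl)))
      (by norm_num)
  simpa [h] using h0

end Wasserstein

/-! ### The stability estimate -/

section Stability

set_option linter.unusedSectionVars false

variable {Ω : Type*} [mΩ : MeasurableSpace Ω] {P : Measure Ω} {d m b : ℕ}
  {A : Matrix (Fin d) (Fin d) ℝ} {H : Matrix (Fin m) (Fin d) ℝ} {σB : Matrix (Fin d) (Fin b) ℝ}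
  {m₀ : EuclideanSpace ℝ (Fin d)} {S₀ : Matrix (Fin d) (Fin d) ℝ}
  {X : ℝ≥0 → Ω → EuclideanSpace ℝ (Fin d)} {Z : ℝ≥0 → Ω → EuclideanSpace ℝ (Fin m)}
  {B : ℝ≥0 → Ω → EuclideanSpace ℝ (Fin b)} {W : ℝ≥0 → Ω → EuclideanSpace ℝ (Fin m)}

instance isProbabilityMeasure_condLaw (Z : ℝ≥0 → Ω → EuclideanSpace ℝ (Fin m)) (t : ℝ≥0)
    (Y : Ω → EuclideanSpace ℝ (Fin d)) [IsFiniteMeasure P] (ω : Ω) :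
    IsProbabilityMeasure (condLaw P Z t Y ω) := by
  unfold condLaw
  infer_instance

/-- Used to lift a coupling of the initial values to a coupling of the fluctuations with a common
noise path, with the right marginals. -/
lemma map_prod_comp {T F G : Type*} [MeasurableSpace T] [MeasurableSpace F] [MeasurableSpace G]
    {K : Type*} [MeasurableSpace K] (γ : Measure T) [SFinite γ] (ν : Measure F) [SFinite ν]
    {f : T → G} (hf : Measurable f) {Φ : G × F → K} (hΦ : Measurable Φ) :
    (γ.prod ν).map (fun q => Φ (f q.1, q.2)) = ((γ.map f).prod ν).map Φ := by
  have h := Measure.map_prod_map γ ν hf (measurable_id (α := F))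
  rw [Measure.map_id] at h
  rw [h, Measure.map_map hΦ (hf.prodMap measurable_id)]
  rfl

lemma IsMeanFieldSolution.integral_zero {π₀ : Measure (EuclideanSpace ℝ (Fin d))}
    {Bbar : ℝ≥0 → Ω → EuclideanSpace ℝ (Fin b)} {Y : ℝ≥0 → Ω → EuclideanSpace ℝ (Fin d)}
    (hY : IsMeanFieldSolution A H σB π₀ P Z Bbar Y) : ∫ ω, Y 0 ω ∂P = ∫ x, x ∂π₀ := by
  rw [← hY.law_zero.map_eq, integral_map (hY.measurable 0).aemeasurable (by fun_prop)]

/-- The conditional law of a mean-field process. -/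
lemma IsMeanFieldSolution.condLaw_ae_eq [IsProbabilityMeasure P]
    (hmod : IsFilteringModel A H σB m₀ S₀ P X Z B W)
    {π₀ : Measure (EuclideanSpace ℝ (Fin d))}
    {Y : ℝ≥0 → Ω → EuclideanSpace ℝ (Fin d)} {Bbar : ℝ≥0 → Ω → EuclideanSpace ℝ (Fin b)}
    (hcopy : IsIndependentCopy P (X 0) B W (Y 0) Bbar)
    (hY : IsMeanFieldSolution A H σB π₀ P Z Bbar Y)
    {M : ℝ≥0 → Ω → EuclideanSpace ℝ (Fin d)} {S : ℝ → Matrix (Fin d) (Fin d) ℝ}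
    (hM : IsKalmanFilter A H σB (∫ x, x ∂π₀) (covMat π₀) P Z M S)
    {bt : ℝ → Ω → EuclideanSpace ℝ (Fin b)} (hbt : IsNoiseVersion P (Y 0) Bbar bt) (t : ℝ≥0) :
    ∀ᵐ ω ∂P, condLaw P Z t (Y t) ω =
      ((π₀.prod (P.map hbt.path)).map (fluctuation A H σB S (∫ x, x ∂π₀) t)).map
        fun u => M t ω + u := by
  obtain ⟨h1, h2⟩ := hY.ae_eq hmod hcopy hM hbt t
  have hU : StronglyMeasurable[nullAug P (noiseSigma (Y 0) Bbar)] fun ω =>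
      linSol (fun s => clm (halfDrift A H (S (max s 0))))
        (fun s => noise P σB (Y 0) bt s ω) (t : ℝ) :=
    @stronglyMeasurable_linSol _ _ _ _ _ (nullAug P (noiseSigma (Y 0) Bbar)) _ _
      (fun _ => hM.dre.continuous_clm_halfDrift) hbt.continuous_noise
      (fun _ => stronglyMeasurable_const) (fun s => hbt.measurable_noise s) t
  have h3 := condLaw_ae_eq_map hmod.measurable_Z (hY.measurable t) h1 stronglyMeasurable_condExp h2
    (nullAug_le _) hU.measurable
    (indep_of_indep_of_le_left (hmod.indep_nullAug hcopy (hY.measurable 0) t)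
      (le_nullAug (obsSigma_le hmod.measurable_Z t)))
  rwa [hbt.map_linSol_noise hM.dre, hY.law_zero.map_eq, hY.integral_zero] at h3

lemma IsMeanFieldSolution.eLpNorm_fluctuation [IsProbabilityMeasure P]
    {π₀ : Measure (EuclideanSpace ℝ (Fin d))}
    {Y : ℝ≥0 → Ω → EuclideanSpace ℝ (Fin d)} {Bbar : ℝ≥0 → Ω → EuclideanSpace ℝ (Fin b)}
    (hY : IsMeanFieldSolution A H σB π₀ P Z Bbar Y)
    {S : ℝ → Matrix (Fin d) (Fin d) ℝ} (hS : IsDRESolution A H σB (covMat π₀) S)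
    {bt : ℝ → Ω → EuclideanSpace ℝ (Fin b)} (hbt : IsNoiseVersion P (Y 0) Bbar bt)
    {t : ℝ} (ht : 0 ≤ t) :
    eLpNorm (fluctuation A H σB S (∫ x, x ∂π₀) t) 2 (π₀.prod (P.map hbt.path)) =
      ENNReal.ofReal √((S t).trace) := by
  rw [← hbt.eLpNorm_linSol_noise hS (cross_centred_eq_covMat hY.law_zero (hY.memLp 0)) ht]
  have h := hbt.map_linSol_noise (A := A) (H := H) (σB := σB) hS t
  rw [hY.law_zero.map_eq, hY.integral_zero] at h
  have hm := (hS.stronglyMeasurable_fluctuation (∫ x, x ∂π₀) t).measurable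
  have hU : Measurable fun ω => linSol (fun s => clm (halfDrift A H (S (max s 0))))
        (fun s => noise P σB (Y 0) bt s ω) t :=
    (stronglyMeasurable_linSol (fun _ => hS.continuous_clm_halfDrift) hbt.continuous_noise
      (fun _ => stronglyMeasurable_const)
      (fun s => (hbt.measurable_noise s).mono (nullAug_le _)) t).measurable
  have e1 := eLpNorm_map_measure (p := 2) (μ := π₀.prod (P.map hbt.path))
    (g := (id : EuclideanSpace ℝ (Fin d) → EuclideanSpace ℝ (Fin d)))
    aestronglyMeasurable_id hm.aemeasurable
  have e2 := eLpNorm_map_measure (p := 2) (μ := P)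
    (g := (id : EuclideanSpace ℝ (Fin d) → EuclideanSpace ℝ (Fin d)))
    aestronglyMeasurable_id hU.aemeasurable
  rw [h] at e2
  exact e1.symm.trans e2

/-- The stability estimate for one coupling of the initial laws. -/
lemma lintegral_W2_condLaw_le [NeZero d] [IsProbabilityMeasure P] {Q : Matrix (Fin d) (Fin d) ℝ}
    (hσB : (σB * σBᵀ).PosDef) (hQ : IsARESolution A H σB Q)
    (hmod : IsFilteringModel A H σB m₀ S₀ P X Z B W)
    {π₀ π₀' : Measure (EuclideanSpace ℝ (Fin d))} [IsProbabilityMeasure π₀]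
    [IsProbabilityMeasure π₀'] (hπ : MemLp id 2 π₀) (hπ' : MemLp id 2 π₀')
    {Y Y' : ℝ≥0 → Ω → EuclideanSpace ℝ (Fin d)} {Bbar Btil : ℝ≥0 → Ω → EuclideanSpace ℝ (Fin b)}
    (hcopy : IsIndependentCopy P (X 0) B W (Y 0) Bbar)
    (hY : IsMeanFieldSolution A H σB π₀ P Z Bbar Y)
    (hcopy' : IsIndependentCopy P (X 0) B W (Y' 0) Btil)
    (hY' : IsMeanFieldSolution A H σB π₀' P Z Btil Y')
    {M M' : ℝ≥0 → Ω → EuclideanSpace ℝ (Fin d)} {S S' : ℝ → Matrix (Fin d) (Fin d) ℝ}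
    (hM : IsKalmanFilter A H σB (∫ x, x ∂π₀) (covMat π₀) P Z M S)
    (hM' : IsKalmanFilter A H σB (∫ x, x ∂π₀') (covMat π₀') P Z M' S')
    {lam M₁ M₂ : ℝ} (hlam : rateβ σB Q ≤ lam) (hK : IsKalmanConst P Q M S M' S' lam M₁ M₂)
    (t : ℝ≥0) {γ : Measure (EuclideanSpace ℝ (Fin d) × EuclideanSpace ℝ (Fin d))}
    (h₁ : γ.map Prod.fst = π₀) (h₂ : γ.map Prod.snd = π₀') :
    (∫⁻ ω, W2 (condLaw P Z t (Y t) ω) (condLaw P Z t (Y' t) ω) ^ 2 ∂P) ^ (1 / 2 : ℝ) ≤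
      ENNReal.ofReal (Real.exp (-rateβ σB Q * t)) * (ENNReal.ofReal (constα H σB Q M₁) *
        (∫⁻ p, edist p.1 p.2 ^ 2 ∂γ) ^ (1 / 2 : ℝ) + ENNReal.ofReal √M₂ +
          ENNReal.ofReal (constα H σB Q M₁ * M₁ * ‖Hᵀ * H‖ *
            ∫ s in (0 : ℝ)..t, √((S s).trace))) := by
  obtain ⟨bt, hbt⟩ := exists_noiseVersion hcopy.wiener (hY.measurable 0) (hY.memLp 0)
    hcopy.indep_zero
  obtain ⟨bt', hbt'⟩ := exists_noiseVersion hcopy'.wiener (hY'.measurable 0) (hY'.memLp 0)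
    hcopy'.indep_zero
  have hγ : IsProbabilityMeasure γ := by
    have : IsProbabilityMeasure (γ.map Prod.fst) := by rw [h₁]; infer_instance
    exact Measure.isProbabilityMeasure_of_map Prod.fst
  have hν : IsProbabilityMeasure (P.map hbt.path) :=
    Measure.isProbabilityMeasure_map hbt.measurable_path.aemeasurable
  have hg1 : MemLp (fun q : EuclideanSpace ℝ (Fin d) × EuclideanSpace ℝ (Fin d) => q.1) 2 γ := by
    rw [← h₁] at hπ
    exact hπ.comp_of_map measurable_fst.aemeasurable
  have hg2 : MemLp (fun q : EuclideanSpace ℝ (Fin d) × EuclideanSpace ℝ (Fin d) => q.2) 2 γ := by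
    rw [← h₂] at hπ'
    exact hπ'.comp_of_map measurable_snd.aemeasurable
  have he1 : ∫ q, q.1 ∂γ = ∫ x, x ∂π₀ := by
    rw [← h₁, integral_map measurable_fst.aemeasurable (by fun_prop)]
  have he2 : ∫ q, q.2 ∂γ = ∫ x, x ∂π₀' := by
    rw [← h₂, integral_map measurable_snd.aemeasurable (by fun_prop)]
  have hm1 : Measurable fun q : (EuclideanSpace ℝ (Fin d) × EuclideanSpace ℝ (Fin d)) ×
      PathSpace b => (q.1.1, q.2) := (measurable_fst.comp measurable_fst).prodMk measurable_snd
  have hm2 : Measurable fun q : (EuclideanSpace ℝ (Fin d) × EuclideanSpace ℝ (Fin d)) ×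
      PathSpace b => (q.1.2, q.2) := (measurable_snd.comp measurable_fst).prodMk measurable_snd
  have hf1 := fun s => (hM.dre.stronglyMeasurable_fluctuation (∫ x, x ∂π₀) s).measurable
  have hf2 := fun s => (hM'.dre.stronglyMeasurable_fluctuation (∫ x, x ∂π₀') s).measurable
  have hU : ∀ s : ℝ, 0 ≤ s → eLpNorm (fun q : (EuclideanSpace ℝ (Fin d) ×
      EuclideanSpace ℝ (Fin d)) × PathSpace b => fluctuation A H σB S (∫ q, q.1 ∂γ) s (q.1.1, q.2))
      2 (γ.prod (P.map hbt.path)) ≤ ENNReal.ofReal √((S s).trace) := fun s hs => by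
    rw [← hY.eLpNorm_fluctuation hM.dre hbt hs, he1]
    have h := map_prod_comp γ (P.map hbt.path) measurable_fst
      (Φ := (id : EuclideanSpace ℝ (Fin d) × PathSpace b → _)) measurable_id
    rw [Measure.map_id, h₁] at h
    have hf := eLpNorm_map_measure (p := 2) (μ := γ.prod (P.map hbt.path))
      (hf1 s).aestronglyMeasurable hm1.aemeasurable
    rw [← h]
    exact hf.ge
  have key := eLpNorm_fluctuation_sub_le hσB hQ hM.dre hM'.dre hlam hK.pos₁ hK.cov hK.cov'
    hg1 hg2 hU t.coe_nonneg
  rw [he1, he2] at key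
  set K := ENNReal.ofReal (Real.exp (-rateβ σB Q * t)) * (ENNReal.ofReal (constα H σB Q M₁) *
        (eLpNorm (fun q : EuclideanSpace ℝ (Fin d) × EuclideanSpace ℝ (Fin d) => q.2 - q.1) 2 γ +
          ENNReal.ofReal (M₁ * ‖Hᵀ * H‖ * ∫ s in (0 : ℝ)..t, √((S s).trace)))) with hKdef
  have hpt : ∀ᵐ ω ∂P, W2 (condLaw P Z t (Y t) ω) (condLaw P Z t (Y' t) ω) ≤
      ‖M' t ω - M t ω‖ₑ + K := by
    filter_upwards [hY.condLaw_ae_eq hmod hcopy hM hbt t,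
      hY'.condLaw_ae_eq hmod hcopy' hM' hbt' t] with ω h3 h4
    -- Both fluctuation laws become images of the one measure `γ.prod (P.map hbt.path)`: coupled
    -- initial values, common noise path.
    rw [hbt'.map_path_eq hbt] at h4
    rw [h3, h4, ← h₁, ← h₂, ← map_prod_comp γ (P.map hbt.path) measurable_fst (h₁ ▸ hf1 t),
      ← map_prod_comp γ (P.map hbt.path) measurable_snd (h₂ ▸ hf2 t), h₁, h₂]
    exact (W2_map_add_le ((hf1 t).comp hm1) ((hf2 t).comp hm2) _ _).trans
      (add_le_add_right key _)
  have hMm : AEMeasurable (fun ω => M' t ω - M t ω) P := (hM'.aemeasurable t).sub (hM.aemeasurable t)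
  have hβ0 : 0 < rateβ σB Q := rateβ_pos hσB hQ.1
  -- The square root halves the exponent `-2 lam t`, and `lam ≥ β`.
  have hmean : (∫⁻ ω, ‖M' t ω - M t ω‖ₑ ^ 2 ∂P) ^ (1 / 2 : ℝ) ≤
      ENNReal.ofReal (Real.exp (-rateβ σB Q * t)) * ENNReal.ofReal √M₂ := by
    refine (ENNReal.rpow_le_rpow (hK.mean t) (by norm_num)).trans ?_
    rw [ENNReal.ofReal_rpow_of_nonneg (by have := hK.pos₂; positivity) (by norm_num),
      ← Real.sqrt_eq_rpow, ← ENNReal.ofReal_mul (Real.exp_nonneg _), Real.sqrt_mul hK.pos₂.le,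
      mul_comm]
    refine ENNReal.ofReal_le_ofReal (mul_le_mul_of_nonneg_right ?_ (Real.sqrt_nonneg _))
    refine Real.sqrt_le_iff.2 ⟨Real.exp_nonneg _, ?_⟩
    rw [← Real.exp_nat_mul]
    refine Real.exp_le_exp.2 ?_
    have := mul_le_mul_of_nonneg_right hlam t.coe_nonneg
    push_cast
    linarith
  calc (∫⁻ ω, W2 (condLaw P Z t (Y t) ω) (condLaw P Z t (Y' t) ω) ^ 2 ∂P) ^ (1 / 2 : ℝ)
      ≤ (∫⁻ ω, (‖M' t ω - M t ω‖ₑ + K) ^ (2 : ℝ) ∂P) ^ (1 / 2 : ℝ) := by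
        refine ENNReal.rpow_le_rpow (lintegral_mono_ae ?_) (by norm_num)
        filter_upwards [hpt] with ω hω
        rw [ENNReal.rpow_ofNat]
        exact pow_le_pow_left' hω 2
    -- Minkowski's inequality is applied to the measurable majorant, so measurability of the
    -- Wasserstein distance in `ω` plays no role.
    _ ≤ (∫⁻ ω, ‖M' t ω - M t ω‖ₑ ^ (2 : ℝ) ∂P) ^ (1 / 2 : ℝ) +
          (∫⁻ _, K ^ (2 : ℝ) ∂P) ^ (1 / 2 : ℝ) :=
        ENNReal.lintegral_Lp_add_le hMm.enorm aemeasurable_const one_le_two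
    _ ≤ ENNReal.ofReal (Real.exp (-rateβ σB Q * t)) * ENNReal.ofReal √M₂ + K := by
        refine add_le_add ?_ (le_of_eq ?_)
        · simpa only [ENNReal.rpow_ofNat] using hmean
        · rw [lintegral_const, measure_univ, mul_one, ← ENNReal.rpow_mul]
          norm_num
    _ = _ := by
        have e1 : eLpNorm (fun q : EuclideanSpace ℝ (Fin d) × EuclideanSpace ℝ (Fin d) =>
            q.2 - q.1) 2 γ = (∫⁻ p, edist p.1 p.2 ^ 2 ∂γ) ^ (1 / 2 : ℝ) := by
          rw [← lintegral_enorm_sq_rpow]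
          simp only [edist_comm _ (Prod.snd _), edist_eq_enorm_sub]
        have e2 : ENNReal.ofReal (constα H σB Q M₁ * M₁ * ‖Hᵀ * H‖ *
            ∫ s in (0 : ℝ)..t, √((S s).trace)) = ENNReal.ofReal (constα H σB Q M₁) *
              ENNReal.ofReal (M₁ * ‖Hᵀ * H‖ * ∫ s in (0 : ℝ)..t, √((S s).trace)) := by
          rw [← ENNReal.ofReal_mul (by unfold constα; positivity)]
          congr 1
          ring
        rw [hKdef, e1, e2]
        ring

/-- Stability of the mean-field process. -/
theorem mean_field_stability [IsProbabilityMeasure P] {Q : Matrix (Fin d) (Fin d) ℝ}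
    (hσB : (σB * σBᵀ).PosDef) (hQ : IsARESolution A H σB Q) (hS₀ : S₀.PosSemidef)
    (hmod : IsFilteringModel A H σB m₀ S₀ P X Z B W)
    {π₀' : Measure (EuclideanSpace ℝ (Fin d))} [IsProbabilityMeasure π₀'] (hπ' : MemLp id 2 π₀')
    {Y Y' : ℝ≥0 → Ω → EuclideanSpace ℝ (Fin d)} {Bbar Btil : ℝ≥0 → Ω → EuclideanSpace ℝ (Fin b)}
    (hcopy : IsIndependentCopy P (X 0) B W (Y 0) Bbar)
    (hY : IsMeanFieldSolution A H σB (multivariateGaussian m₀ S₀) P Z Bbar Y)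
    (hcopy' : IsIndependentCopy P (X 0) B W (Y' 0) Btil)
    (hY' : IsMeanFieldSolution A H σB π₀' P Z Btil Y')
    {M M' : ℝ≥0 → Ω → EuclideanSpace ℝ (Fin d)} {S S' : ℝ → Matrix (Fin d) (Fin d) ℝ}
    (hM : IsKalmanFilter A H σB m₀ S₀ P Z M S)
    (hM' : IsKalmanFilter A H σB (∫ x, x ∂π₀') (covMat π₀') P Z M' S')
    {lam M₁ M₂ : ℝ} (hlam : rateβ σB Q ≤ lam) (hK : IsKalmanConst P Q M S M' S' lam M₁ M₂)
    (t : ℝ≥0) :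
    (∫⁻ ω, W2 (condLaw P Z t (Y t) ω) (condLaw P Z t (Y' t) ω) ^ 2 ∂P) ^ (1 / 2 : ℝ) ≤
      ENNReal.ofReal (Real.exp (-rateβ σB Q * t)) * (ENNReal.ofReal (constα H σB Q M₁) *
        W2 (multivariateGaussian m₀ S₀) π₀' + ENNReal.ofReal √M₂ +
          ENNReal.ofReal (constα H σB Q M₁ * M₁ * ‖Hᵀ * H‖ *
            ∫ s in (0 : ℝ)..t, √((S s).trace))) := by
  -- In dimension zero the eigenvalues behind `rateβ` and `constα` take default values, but every
  -- Wasserstein distance vanishes.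
  rcases Nat.eq_zero_or_pos d with rfl | hd
  · simp only [W2_eq_zero_of_subsingleton]
    simp
  · have : NeZero d := ⟨hd.ne'⟩
    refine le_of_forall_coupling (Φ := fun x => ENNReal.ofReal (Real.exp (-rateβ σB Q * t)) *
      (ENNReal.ofReal (constα H σB Q M₁) * x + ENNReal.ofReal √M₂ +
          ENNReal.ofReal (constα H σB Q M₁ * M₁ * ‖Hᵀ * H‖ *
            ∫ s in (0 : ℝ)..t, √((S s).trace)))) ?_ fun γ h₁ h₂ => ?_
    · refine (ENNReal.continuous_const_mul ENNReal.ofReal_ne_top).comp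
        (((ENNReal.continuous_const_mul ENNReal.ofReal_ne_top).add continuous_const).add
          continuous_const)
    · have hM0 : IsKalmanFilter A H σB (∫ x, x ∂(multivariateGaussian m₀ S₀))
          (covMat (multivariateGaussian m₀ S₀)) P Z M S := by
        rw [integral_id_multivariateGaussian, covMat_multivariateGaussian m₀ hS₀]
        exact hM
      exact lintegral_W2_condLaw_le hσB hQ hmod IsGaussian.memLp_two_id hπ' hcopy hY hcopy' hY'
        hM0 hM' hlam hK t h₁ h₂

end Stability

end

end LinearFPF

/-! ### Assembly of the theorem -/

theorem mainTheorem2 {d m b : ℕ} (A : Matrix (Fin d) (Fin d) ℝ) (H : Matrix (Fin m) (Fin d) ℝ)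
    (σB : Matrix (Fin d) (Fin b) ℝ)
    (hAH : LinearFPF.IsDetectable A H) (hAσ : LinearFPF.IsStabilizable A σB)
    (hσB : (σB * σBᵀ).PosDef)
    (m₀ : EuclideanSpace ℝ (Fin d)) (S₀ : Matrix (Fin d) (Fin d) ℝ) (hS₀ : S₀.PosSemidef) :
    ∃ Sinf : Matrix (Fin d) (Fin d) ℝ,
      LinearFPF.IsARESolution A H σB Sinf ∧
      (∀ Q, LinearFPF.IsARESolution A H σB Q → Q = Sinf) ∧
      -- existence of the constants, depending only on the model and the initial means, covariances
      (∀ (m₀' : EuclideanSpace ℝ (Fin d)) (S₀' : Matrix (Fin d) (Fin d) ℝ), S₀'.PosSemidef →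
        ∃ M₁ M₂ : ℝ, ∀ (Ω : Type*) [MeasurableSpace Ω] (P : Measure Ω) [IsProbabilityMeasure P]
          (X : ℝ≥0 → Ω → EuclideanSpace ℝ (Fin d)) (Z : ℝ≥0 → Ω → EuclideanSpace ℝ (Fin m))
          (B : ℝ≥0 → Ω → EuclideanSpace ℝ (Fin b)) (W : ℝ≥0 → Ω → EuclideanSpace ℝ (Fin m))
          (M M' : ℝ≥0 → Ω → EuclideanSpace ℝ (Fin d)) (S S' : ℝ → Matrix (Fin d) (Fin d) ℝ),
          LinearFPF.IsFilteringModel A H σB m₀ S₀ P X Z B W →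
          LinearFPF.IsKalmanFilter A H σB m₀ S₀ P Z M S →
          LinearFPF.IsKalmanFilter A H σB m₀' S₀' P Z M' S' →
          LinearFPF.IsKalmanConst P Sinf M S M' S' (LinearFPF.rateβ σB Sinf) M₁ M₂) ∧
      -- the stability estimate, for all such constants
      (∀ (Ω : Type*) [MeasurableSpace Ω] (P : Measure Ω) [IsProbabilityMeasure P]
        (X : ℝ≥0 → Ω → EuclideanSpace ℝ (Fin d)) (Z : ℝ≥0 → Ω → EuclideanSpace ℝ (Fin m))
        (B : ℝ≥0 → Ω → EuclideanSpace ℝ (Fin b)) (W : ℝ≥0 → Ω → EuclideanSpace ℝ (Fin m))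
        (π₀' : Measure (EuclideanSpace ℝ (Fin d))) [IsProbabilityMeasure π₀']
        (Xbar Xtil : ℝ≥0 → Ω → EuclideanSpace ℝ (Fin d))
        (Bbar Btil : ℝ≥0 → Ω → EuclideanSpace ℝ (Fin b))
        (M M' : ℝ≥0 → Ω → EuclideanSpace ℝ (Fin d)) (S S' : ℝ → Matrix (Fin d) (Fin d) ℝ)
        (lam M₁ M₂ : ℝ),
        LinearFPF.IsFilteringModel A H σB m₀ S₀ P X Z B W →
        MemLp id 2 π₀' →
        LinearFPF.IsIndependentCopy P (X 0) B W (Xbar 0) Bbar →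
        LinearFPF.IsMeanFieldSolution A H σB (multivariateGaussian m₀ S₀) P Z Bbar Xbar →
        LinearFPF.IsIndependentCopy P (X 0) B W (Xtil 0) Btil →
        LinearFPF.IsMeanFieldSolution A H σB π₀' P Z Btil Xtil →
        LinearFPF.IsKalmanFilter A H σB m₀ S₀ P Z M S →
        LinearFPF.IsKalmanFilter A H σB (∫ x, x ∂π₀') (LinearFPF.covMat π₀') P Z M' S' →
        LinearFPF.rateβ σB Sinf ≤ lam →
        LinearFPF.IsKalmanConst P Sinf M S M' S' lam M₁ M₂ →
        ∀ t : ℝ≥0, 0 < t →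
          (∫⁻ ω, LinearFPF.W2 (LinearFPF.condLaw P Z t (Xbar t) ω)
              (LinearFPF.condLaw P Z t (Xtil t) ω) ^ 2 ∂P) ^ (1 / 2 : ℝ) ≤
            ENNReal.ofReal (Real.exp (-LinearFPF.rateβ σB Sinf * t)) *
              (ENNReal.ofReal (LinearFPF.constα H σB Sinf M₁) *
                  LinearFPF.W2 (multivariateGaussian m₀ S₀) π₀' +
                ENNReal.ofReal (√M₂) +
                ENNReal.ofReal (LinearFPF.constα H σB Sinf M₁ * M₁ * ‖Hᵀ * H‖ *
                  ∫ s in (0 : ℝ)..t, √((S s).trace)))) := by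
  obtain ⟨L, hL⟩ := hAH
  -- Detectability enters through the observer gain `L` only: the Lyapunov matrix of `A - L H`
  -- yields the first supersolution of the Riccati equation.
  obtain ⟨R, hR, hLR⟩ := LinearFPF.exists_lyapunov_of_isHurwitz hL
  obtain ⟨Q, hQ⟩ := LinearFPF.exists_isARESolution hσB hR hLR
  refine ⟨Q, hQ, fun Q' hQ' => LinearFPF.isARESolution_unique hσB hQ' hQ, fun m₀' S₀' hS₀' => ?_, ?_⟩
  · exact LinearFPF.exists_kalman_constants hσB hQ m₀ m₀' hS₀ hS₀'
  · intro Ω _ P _ X Z B W π₀' _ Xbar Xtil Bbar Btil M M' S S' lam M₁ M₂ hmod hπ' hcX hX hcX' hX' hM hM'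
      hlam hK t _
    exact LinearFPF.mean_field_stability hσB hQ hS₀ hmod hπ' hcX hX hcX' hX' hM hM' hlam hK t
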